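/- **Setting.** Let $B$ be a commutative unital $C^*$-algebra and let $\Gamma$ be a group acting on $B$ by $*$-automorphisms; the unit of $\Gamma$ is $e$. All algebras are complex and unital, and so are all homomorphisms. $B\rtimes\Gamma$ denotes the algebraic crossed product (finite sums $\sum_\gamma b_\gamma\gamma$ with $\gamma b=\gamma(b)\gamma$, $\gamma^*=\gamma^{-1}$), and $\hat\otimes$ the maximal tensor product of $C^*$-algebras. A $*$-algebra $A$ *has an enveloping $C^*$-algebra* if $|a|:=\sup_\pi\|\pi(a)\|<\infty$ for all $a\in A$, where $\pi$ runs over all $*$-homomorphisms into $C^*$-algebras; then $C^*(A)$ is the separated completion of $(A,|\cdot|)$. Put $B\hat\rtimes\Gamma=C^*(B\rtimes\Gamma)$ and $C^*(\Gamma)=C^*(\mathbb C\Gamma)$. *$(B,\Gamma)$-algebras.* A $(B,\Gamma)$-algebra is a $\Gamma\times\Gamma$-graded algebra $A=\bigoplus A_{\gamma,\gamma'}$ with homomorphisms $r,s\colon B\to A_{e,e}$ with commuting images such that $a\,r(b)=r(\gamma(b))a$ and $a\,s(b)=s(\gamma'(b))a$ for $a\in A_{\gamma,\gamma'}$. It is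 a $(B,\Gamma)$-$*$-algebra if $A$ is a $*$-algebra, $r,s$ are $*$-homomorphisms and $(A_{\gamma,\gamma'})^*\subseteq A_{\gamma^{-1},\gamma'^{-1}}$. Morphisms preserve the grading, $r$ and $s$. $B\rtimes\Gamma$ is a $(B,\Gamma)$-$*$-algebra with $(B\rtimes\Gamma)_{\gamma,\gamma}=B\gamma$, $(B\rtimes\Gamma)_{\gamma,\gamma'}=0$ for $\gamma\ne\gamma'$, $r=s=$ inclusion. The fibre product $A\tilde\otimes C$ is the quotient of $\sum A_{\gamma,\gamma'}\otimes C_{\gamma',\gamma''}\subseteq A\otimes C$ by the ideal generated by all $s(b)\otimes1-1\otimes r(b)$, with $A_{\gamma,\gamma'}\tilde\otimes C_{\gamma',\gamma''}$ in degree $(\gamma,\gamma'')$, $r(b)=r(b)\tilde\otimes1$ and $s(b)=1\tilde\otimes s(b)$. *$(B,\Gamma)$-Hopf $*$-algebroids.* Such an object is a $(B,\Gamma)$-$*$-algebra $A$ with morphisms $\Delta\colon A\to A\tilde\otimes A$ and $\epsilon\colon A\to B\rtimes\Gamma$ satisfying coassociativity and the counit axiom (with respect to the canonical isomorphisms $(A\tilde\otimes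 A)\tilde\otimes A\cong A\tilde\otimes (A\tilde\otimes A)$ and $A\cong(B\rtimes\Gamma)\tilde\otimes A\cong A\tilde\otimes(B\rtimes\Gamma)$, $a\mapsto\gamma\tilde\otimes a$, $a\mapsto a\tilde\otimes\gamma'$ for $a\in A_{\gamma,\gamma'}$) and a unital linear antihomomorphism $S\colon A\to A$ with $S(A_{\gamma,\gamma'})\subseteq A_{\gamma'^{-1},\gamma^{-1}}$, $S\circ r=s$, $S\circ s=r$ such that, whenever $\Delta(a)=\sum_i x_i\tilde\otimes y_i$ with $x_i,y_i$ homogeneous of matching degrees, $\sum_iS(x_i)y_i=\check s(\epsilon(a))$ and $\sum_i x_iS(y_i)=\hat r(\epsilon(a))$, where $\check s(\gamma b)=s(b)$ and $\hat r(b\gamma)=r(b)$. *$(B,\Gamma)$-$C^*$-algebras.* Such an object is a $C^*$-algebra $A$ with injective, commuting coactions $\delta\colon A\to C^*(\Gamma)\hat\otimes A$ and $\bar\delta\colon A\to A\hat\otimes C^*(\Gamma)$ of $C^*(\Gamma)$ (with comultiplication $\gamma\mapsto\gamma\otimes\gamma$) and $*$-homomorphisms $r,s\colon B\to A_{e,e}$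 such that $\sum A_{\gamma,\gamma'}$ is a $(B,\Gamma)$-$*$-algebra, where $A_{\gamma,\gamma'}=\{a:\delta(a)=\gamma\otimes a,\ \bar\delta(a)=a\otimes\gamma'\}$. Morphisms are the $*$-homomorphisms compatible with $\delta,\bar\delta,r,s$. The product $A\boxtimes C$ of two such objects is the quotient of the $C^*$-algebra $\{x\in A\hat\otimes C:(\bar\delta\otimes\mathrm{id})(x)=(\mathrm{id}\otimes\delta)(x)\}$ by the closed ideal generated by all $s(b)\otimes1-1\otimes r(b)$, with the structure induced by $\delta\otimes\mathrm{id}$, $\mathrm{id}\otimes\bar\delta$, $r(b)\otimes1$, $1\otimes s(b)$. If a $(B,\Gamma)$-$*$-algebra $A$ has an enveloping $C^*$-algebra, then $C^*(A)$ is a $(B,\Gamma)$-$C^*$-algebra with $\delta(a)=\gamma\otimes a$, $\bar\delta(a)=a\otimes\gamma'$ for $a\in A_{\gamma,\gamma'}$. *Compact $(B,\Gamma)$-Hopf $C^*$-algebroids.* Such an object is a $(B,\Gamma)$-$C^*$-algebra $A$ with a morphism $\Delta\colon A\to A\boxtimes A$ that is coassociative, $(\Delta\boxtimes\mathrm{id})\Delta=(\mathrm{id}\boxtimes\Delta)\Delta$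 (up to the canonical isomorphism $(A\boxtimes A)\boxtimes A\cong A\boxtimes(A\boxtimes A)$), and has cancellation: the products $\Delta(a)(1\otimes c)$ with $a\in A$, $c\in\bigcup_\gamma A_{e,\gamma}$ span a dense subspace of $A\boxtimes A$, and so do the products $(c\otimes1)\Delta(a)$ with $a\in A$, $c\in\bigcup_\gamma A_{\gamma,e}$. A counit is a morphism $\epsilon\colon A\to B\hat\rtimes\Gamma$ with $(\epsilon\boxtimes\mathrm{id})\Delta=L_A$ and $(\mathrm{id}\boxtimes\epsilon)\Delta=R_A$, where $L_A\colon A\to(B\hat\rtimes\Gamma)\boxtimes A$ and $R_A\colon A\to A\boxtimes(B\hat\rtimes\Gamma)$ are the canonical isomorphisms, induced by $\delta$, $\bar\delta$ and the natural map $C^*(\Gamma)\to B\hat\rtimes\Gamma$. **Theorem.** **(1)** Let $(A,\Delta,\epsilon,S)$ be a $(B,\Gamma)$-Hopf $*$-algebroid such that $A$ has an enveloping $C^*$-algebra. Then $\Delta$ extends to a morphism $\Delta_{C^*(A)}\colon C^*(A)\to C^*(A)\boxtimes C^*(A)$ (that is, the composition of $A\to C^*(A)$ with $\Delta_{C^*(A)}$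 equals the composition of $\Delta$ with the canonical map $A\tilde\otimes A\to C^*(A)\boxtimes C^*(A)$) such that $(C^*(A),\Delta_{C^*(A)})$ is a compact $(B,\Gamma)$-Hopf $C^*$-algebroid with counit $C^*(\epsilon)\colon C^*(A)\to B\hat\rtimes\Gamma$. Now let $\gamma_1,\dots,\gamma_n\in\Gamma$ and $\nabla=\mathrm{diag}(\gamma_1,\dots,\gamma_n)\in M_n(B\rtimes\Gamma)$. A matrix $F\in M_n(B)$ is $\nabla$-even if $\nabla F\nabla^{-1}\in M_n(B)$, and $\nabla$-odd if $\nabla F\nabla\in M_n(B)$. For a matrix $v=(v_{ij})$, write $\bar v=(v_{ij}^*)$, $v^{-\top}=(v^{-1})^\top$, and $r_n,s_n$ for the entrywise application of $r,s$. **(2)** Let $F=F^*\in\mathrm{GL}_n(B)$ be $\nabla$-even. Let $A^B_{\mathrm u}(\nabla,F)$ be the universal $(B,\Gamma)$-$*$-algebra generated by the entries $v_{ij}\in A_{\gamma_i,\gamma_j}$ of a unitary matrix $v$ for which $\bar v$ is invertible and $r_n(\nabla F\nabla^{-1})\bar v^{-\top}=vs_n(F)$. This $*$-algebra exists, and it has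 an enveloping $C^*$-algebra. $C^*(A^B_{\mathrm u}(\nabla,F))$ is the universal $C^*$-algebra generated by the images of two $*$-homomorphisms $r,s$ of $B$ with commuting images and by the entries of a unitary $n\times n$-matrix $v$ subject to the relations (i) $v_{ij}r(b)=r(\gamma_i(b))v_{ij}$ and $v_{ij}s(b)=s(\gamma_j(b))v_{ij}$ for all $i,j$ and $b\in B$; (ii) $\bar v$ is invertible and $r_n(\nabla F\nabla^{-1})\bar v^{-\top}=vs_n(F)$. $A^B_{\mathrm u}(\nabla,F)$ has the structure of a $(B,\Gamma)$-Hopf $*$-algebroid with $\Delta(v_{ij})=\sum_kv_{ik}\tilde\otimes v_{kj}$, $\epsilon(v_{ij})=\delta_{i,j}\gamma_i$ and $(S(v_{ij}))_{ij}=v^{-1}$, and the extension of $\Delta$ as in (1) turns $C^*(A^B_{\mathrm u}(\nabla,F))$ into a compact $(B,\Gamma)$-Hopf $C^*$-algebroid with counit $C^*(\epsilon)$, where for all $i,j$ $$\delta(v_{ij})=\gamma_i\otimes v_{ij},\quad\bar\delta(v_{ij})=v_{ij}\otimes\gamma_j,\quad\Delta(v_{ij})=\sum_kv_{ik}\otimes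 v_{kj},\quad\epsilon(v_{ij})=\delta_{i,j}\gamma_i.\tag{$*$}$$ **(3)** Let $F,G\in\mathrm{GL}_n(B)$ be $\nabla$-odd with $GF^*=FG^*$, and assume that $G^{-1}F=\lambda\bar HH^\top$ for some $\lambda\in\mathbb C$ and some $\nabla$-even $H\in\mathrm{GL}_n(B)$. Put $Q=G(\nabla\bar G\nabla)$. Let $A^B_{\mathrm o}(\nabla,F,G)$ be the universal $(B,\Gamma)$-algebra generated by the entries $v_{ij}\in A_{\gamma_i,\gamma_j}$ of an invertible matrix $v$ such that $r_n(\nabla F\nabla)v^{-\top}=vs_n(F)$ and $r_n(\nabla Q\nabla^{-1})v=vs_n(Q)$, made into a $(B,\Gamma)$-$*$-algebra by the involution with $r_n(\nabla G\nabla)\bar v=vs_n(G)$. This $*$-algebra exists, and it has an enveloping $C^*$-algebra. $C^*(A^B_{\mathrm o}(\nabla,F,G))$ is the universal $C^*$-algebra generated by the images of two $*$-homomorphisms $r,s$ of $B$ with commuting images and by the entries of an invertible $n\times n$-matrix $v$ subject to the relations (i) $v_{ij}r(b)=r(\gamma_i(b))v_{ij}$ and $v_{ij}s(b)=s(\gamma_j(b))v_{ij}$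 for all $i,j$ and $b\in B$; (ii) $r_n(\nabla F\nabla)v^{-\top}=vs_n(F)$ and $r_n(\nabla G\nabla)\bar v=vs_n(G)$. $A^B_{\mathrm o}(\nabla,F,G)$ has the structure of a $(B,\Gamma)$-Hopf $*$-algebroid with $\Delta(v_{ij})=\sum_kv_{ik}\tilde\otimes v_{kj}$, $\epsilon(v_{ij})=\delta_{i,j}\gamma_i$ and $(S(v_{ij}))_{ij}=v^{-1}$, and the extension of $\Delta$ as in (1) turns $C^*(A^B_{\mathrm o}(\nabla,F,G))$ into a compact $(B,\Gamma)$-Hopf $C^*$-algebroid with counit $C^*(\epsilon)$ such that $(*)$ holds. -/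

import Mathlib

open scoped TensorProduct

universe u

set_option linter.unusedSectionVars false

noncomputable section

/-! ## Enveloping C⋆-algebras -/

section Envelope

variable (A : Type u) [Ring A] [StarRing A] [Algebra ℂ A]

/-- The norms `‖π a‖` of `a` under all unital `*`-homomorphisms `π` into C⋆-algebras. -/
def repNorms (a : A) : Set ℝ :=
  {x | ∃ (D : Type u) (_ : CStarAlgebra D) (π : A →⋆ₐ[ℂ] D), x = ‖π a‖}

/-- A `*`-algebra has an enveloping C⋆-algebra iff `|a| = sup ‖π a‖` is finite for all `a`. -/
class HasEnvelopingCStar : Prop where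
  bdd : ∀ a : A, BddAbove (repNorms A a)

variable {A}

/-- The largest C⋆-seminorm `|a| = sup ‖π a‖`. -/
def universalNorm (a : A) : ℝ := sSup (repNorms A a)

lemma repNorms_nonempty (a : A) : (repNorms A a).Nonempty := by
  let i0 : StarRing PUnit.{u+1} :=
    { star := id, star_involutive := fun _ => rfl, star_mul := fun _ _ => rfl,
      star_add := fun _ _ => rfl }
  let i1 : CStarAlgebra PUnit.{u+1} :=
    { (inferInstance : NormedRing PUnit.{u+1}), i0,
      (inferInstance : NormedAlgebra ℂ PUnit.{u+1}) with
      norm_mul_self_le := fun _ => by simp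
      complete := fun {f} hf => CompleteSpace.complete hf
      star_smul := fun _ _ => rfl }
  exact ⟨_, PUnit, i1, (⟨⟨⟨⟨⟨fun _ => 0, rfl⟩, fun _ _ => rfl⟩, rfl, fun _ _ => rfl⟩, fun _ => rfl⟩,
    fun _ => rfl⟩ : A →⋆ₐ[ℂ] PUnit.{u+1}), rfl⟩

lemma le_universalNorm [HasEnvelopingCStar A] {D : Type u} [CStarAlgebra D] (π : A →⋆ₐ[ℂ] D)
    (a : A) : ‖π a‖ ≤ universalNorm a :=
  le_csSup (HasEnvelopingCStar.bdd a) ⟨D, inferInstance, π, rfl⟩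

lemma universalNorm_le {a : A} {c : ℝ}
    (h : ∀ (D : Type u) [CStarAlgebra D] (π : A →⋆ₐ[ℂ] D), ‖π a‖ ≤ c) : universalNorm a ≤ c := by
  refine csSup_le (repNorms_nonempty a) ?_
  rintro _ ⟨D, _, π, rfl⟩
  exact h D π

lemma universalNorm_nonneg (a : A) : 0 ≤ universalNorm a := by
  refine Real.sSup_nonneg ?_
  rintro _ ⟨D, _, π, rfl⟩
  exact norm_nonneg _

lemma universalNorm_zero : universalNorm (0 : A) = 0 :=
  le_antisymm (universalNorm_le fun D _ π => by simp) (universalNorm_nonneg _)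

lemma universalNorm_neg (a : A) : universalNorm (-a) = universalNorm a := by
  simp only [universalNorm, repNorms, map_neg, norm_neg]

section

variable [HasEnvelopingCStar A]

lemma universalNorm_add (a b : A) :
    universalNorm (a + b) ≤ universalNorm a + universalNorm b := universalNorm_le fun D _ π => by
  rw [map_add]
  exact (norm_add_le _ _).trans (add_le_add (le_universalNorm π a) (le_universalNorm π b))

lemma universalNorm_mul (a b : A) :
    universalNorm (a * b) ≤ universalNorm a * universalNorm b := universalNorm_le fun D _ π => by
  rw [map_mul]
  exact (norm_mul_le _ _).trans (mul_le_mul (le_universalNorm π a) (le_universalNorm π b)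
    (norm_nonneg _) (universalNorm_nonneg _))

lemma universalNorm_smul (c : ℂ) (a : A) :
    universalNorm (c • a) ≤ ‖c‖ * universalNorm a := universalNorm_le fun D _ π => by
  rw [map_smul, norm_smul]
  exact mul_le_mul_of_nonneg_left (le_universalNorm π a) (norm_nonneg _)

lemma universalNorm_star (a : A) : universalNorm (star a) ≤ universalNorm a :=
  universalNorm_le fun D _ π => by
    rw [map_star, norm_star]
    exact le_universalNorm π a

lemma universalNorm_mul_self (a : A) :
    universalNorm a * universalNorm a ≤ universalNorm (star a * a) := by
  have h : universalNorm a ≤ Real.sqrt (universalNorm (star a * a)) :=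
    universalNorm_le fun D _ π => by
      refine Real.le_sqrt_of_sq_le ?_
      rw [sq, ← CStarRing.norm_star_mul_self, ← map_star, ← map_mul]
      exact le_universalNorm π _
  calc universalNorm a * universalNorm a
      ≤ Real.sqrt (universalNorm (star a * a)) * Real.sqrt (universalNorm (star a * a)) :=
        mul_self_le_mul_self (universalNorm_nonneg _) h
    _ = _ := Real.mul_self_sqrt (universalNorm_nonneg _)

end

lemma neg_add_neg_swap (a b : A) : -(-a + b) = -b + a := by abel

lemma neg_add_split (a b c : A) : -a + c = (-a + b) + (-b + c) := by abel

variable (A) in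
/-- The `*`-algebra `A`, regarded as a seminormed space with respect to `|·|`. -/
def PreEnvelope : Type u := A

instance : Ring (PreEnvelope A) := inferInstanceAs (Ring A)
instance : StarRing (PreEnvelope A) := inferInstanceAs (StarRing A)
instance : Algebra ℂ (PreEnvelope A) := inferInstanceAs (Algebra ℂ A)

variable [HasEnvelopingCStar A]

instance : SeminormedRing (PreEnvelope A) where
  norm a := universalNorm (A := A) a
  dist a b := universalNorm (A := A) (-a + b)
  dist_self a := (congrArg universalNorm (neg_add_cancel (G := A) a)).trans universalNorm_zero
  dist_comm a b := (universalNorm_neg (A := A) (-a + b)).symm.trans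
    (congrArg (universalNorm (A := A)) (neg_add_neg_swap (show A from a) b))
  dist_triangle a b c := (congrArg (universalNorm (A := A)) (neg_add_split (show A from a) b c)).trans_le
    (universalNorm_add (A := A) (-a + b) (-b + c))
  dist_eq _ _ := rfl
  norm_mul_le := universalNorm_mul (A := A)

instance : NormedSpace ℂ (PreEnvelope A) where
  norm_smul_le := universalNorm_smul (A := A)

instance : NormedStarGroup (PreEnvelope A) where
  norm_star_le := universalNorm_star (A := A)

variable (A) in
/-- The enveloping C⋆-algebra `C⋆(A)`: the separated completion of `A` with respect to `|·|`. -/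
def CStarEnv : Type u := UniformSpace.Completion (PreEnvelope A)

namespace CStarEnv

open UniformSpace

instance : NormedRing (CStarEnv A) := inferInstanceAs (NormedRing (Completion (PreEnvelope A)))
instance : NormedSpace ℂ (CStarEnv A) :=
  inferInstanceAs (NormedSpace ℂ (Completion (PreEnvelope A)))
instance : CompleteSpace (CStarEnv A) :=
  inferInstanceAs (CompleteSpace (Completion (PreEnvelope A)))

/-- The underlying function of the canonical map `A → C⋆(A)`. -/
def coe (a : A) : CStarEnv A := ((show PreEnvelope A from a : PreEnvelope A) : Completion _)

lemma coe_add (a b : A) : coe (a + b) = coe a + coe b := Completion.coe_add (α := PreEnvelope A) _ _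
lemma coe_mul (a b : A) : coe (a * b) = coe a * coe b := Completion.coe_mul (α := PreEnvelope A) _ _
lemma coe_one : coe (1 : A) = 1 := rfl
lemma coe_zero : coe (0 : A) = 0 := rfl
lemma coe_smul (c : ℂ) (a : A) : coe (c • a) = c • coe a := by
  have h := Completion.coe_smul (M := ℂ) c (show PreEnvelope A from a)
  exact h
lemma norm_coe (a : A) : ‖coe a‖ = universalNorm a := Completion.norm_coe (E := PreEnvelope A) a

lemma denseRange_coe : DenseRange (coe : A → CStarEnv A) :=
  Completion.denseRange_coe (α := PreEnvelope A)

lemma eq_on {Y : Type*} [TopologicalSpace Y] [T2Space Y] {f g : CStarEnv A → Y}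
    (hf : Continuous f) (hg : Continuous g) (h : ∀ a, f (coe a) = g (coe a)) (x : CStarEnv A) :
    f x = g x :=
  congrFun (denseRange_coe.equalizer hf hg (funext h)) x

lemma eq_on₂ {Y : Type*} [TopologicalSpace Y] [T2Space Y] {f g : CStarEnv A → CStarEnv A → Y}
    (hf : Continuous fun p : CStarEnv A × CStarEnv A => f p.1 p.2)
    (hg : Continuous fun p : CStarEnv A × CStarEnv A => g p.1 p.2)
    (h : ∀ a b, f (coe a) (coe b) = g (coe a) (coe b)) (x y : CStarEnv A) : f x y = g x y :=
  congrFun ((denseRange_coe.prodMap denseRange_coe).equalizer hf hg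
    (funext fun p => h p.1 p.2)) (x, y)

lemma continuous_const_smul' (c : ℂ) : Continuous fun x : CStarEnv A => c • x :=
  continuous_const_smul (T := Completion (PreEnvelope A)) c

instance : ContinuousConstSMul ℂ (CStarEnv A) := ⟨continuous_const_smul'⟩

lemma smul_mul_assoc' (c : ℂ) : ∀ x y : CStarEnv A, (c • x) * y = c • (x * y) :=
  eq_on₂ (((continuous_const_smul' c).comp continuous_fst).mul continuous_snd)
    ((continuous_const_smul' c).comp continuous_mul) fun a b => by
      rw [← coe_smul, ← coe_mul, ← coe_mul, ← coe_smul, smul_mul_assoc]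

lemma mul_smul_comm' (c : ℂ) : ∀ x y : CStarEnv A, x * (c • y) = c • (x * y) :=
  eq_on₂ (continuous_fst.mul ((continuous_const_smul' c).comp continuous_snd))
    ((continuous_const_smul' c).comp continuous_mul) fun a b => by
      rw [← coe_smul, ← coe_mul, ← coe_mul, ← coe_smul, mul_smul_comm]

instance : NormedAlgebra ℂ (CStarEnv A) :=
  { Algebra.ofModule
      smul_mul_assoc' mul_smul_comm' with
    norm_smul_le := norm_smul_le }

instance : Star (CStarEnv A) := ⟨Completion.map (star : PreEnvelope A → PreEnvelope A)⟩

lemma coe_star (a : A) : coe (star a) = star (coe a) :=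
  (Completion.map_coe (f := (star : PreEnvelope A → PreEnvelope A))
    star_isometry.uniformContinuous a).symm

lemma continuous_star' : Continuous (star : CStarEnv A → CStarEnv A) := Completion.continuous_map

instance : ContinuousStar (CStarEnv A) := ⟨continuous_star'⟩

instance : StarRing (CStarEnv A) where
  star_involutive := eq_on (by fun_prop) continuous_id fun a => by
    rw [← coe_star, ← coe_star, star_star]
  star_mul := eq_on₂ (by fun_prop) (by fun_prop) fun a b => by
    rw [← coe_mul, ← coe_star, ← coe_star, ← coe_star, ← coe_mul, star_mul]
  star_add := eq_on₂ (by fun_prop) (by fun_prop) fun a b => by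
    rw [← coe_add, ← coe_star, ← coe_star, ← coe_star, ← coe_add, star_add]

instance : CStarRing (CStarEnv A) where
  norm_mul_self_le x := by
    refine denseRange_coe.induction_on (p := fun x : CStarEnv A => ‖x‖ * ‖x‖ ≤ ‖star x * x‖) x
      (isClosed_le (by fun_prop) (by fun_prop)) fun a => ?_
    rw [← coe_star, ← coe_mul, norm_coe, norm_coe]
    exact universalNorm_mul_self a

variable [StarModule ℂ A]

instance : StarModule ℂ (CStarEnv A) where
  star_smul c := eq_on (continuous_star'.comp (continuous_const_smul' c))
      ((continuous_const_smul' _).comp continuous_star') fun a => by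
    rw [← coe_smul, ← coe_star, ← coe_star, ← coe_smul, star_smul]

instance : CStarAlgebra (CStarEnv A) where

/-- The canonical (universal) representation `A → C⋆(A)`. -/
def of : A →⋆ₐ[ℂ] CStarEnv A where
  toFun := coe
  map_one' := coe_one
  map_mul' := coe_mul
  map_zero' := coe_zero
  map_add' := coe_add
  commutes' c := by rw [Algebra.algebraMap_eq_smul_one, coe_smul, Algebra.algebraMap_eq_smul_one,
    coe_one]
  map_star' := coe_star

lemma denseRange_of : DenseRange (of : A → CStarEnv A) := denseRange_coe

lemma continuous_hom {X D : Type*} [CStarAlgebra X] [CStarAlgebra D] (f : X →⋆ₐ[ℂ] D) :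
    Continuous f :=
  AddMonoidHomClass.continuous_of_bound f 1 fun a => by
    simpa only [one_mul] using NonUnitalStarAlgHom.norm_apply_le f a

lemma hom_ext {D : Type*} [CStarAlgebra D] {f g : CStarEnv A →⋆ₐ[ℂ] D}
    (h : ∀ a, f (of a) = g (of a)) : f = g :=
  StarAlgHom.ext (eq_on (continuous_hom f) (continuous_hom g) h)

variable {D : Type u} [CStarAlgebra D]

lemma lift_exists (π : A →⋆ₐ[ℂ] D) : ∃ f : CStarEnv A →⋆ₐ[ℂ] D, ∀ a, f (of a) = π a := by
  let π' : PreEnvelope A →+ D := AddMonoidHomClass.toAddMonoidHom (M := A) π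
  have hπ : UniformContinuous π' := by
    refine (AddMonoidHomClass.lipschitz_of_bound π' 1 fun a => ?_).uniformContinuous
    rw [one_mul]
    exact le_universalNorm π a
  let F : CStarEnv A → D := Completion.extension π'
  have hF : Continuous F := Completion.continuous_extension
  have hFa : ∀ a : A, F (coe a) = π a := fun a => Completion.extension_coe hπ a
  refine ⟨⟨⟨⟨⟨⟨F, ?_⟩, ?_⟩, ?_, ?_⟩, ?_⟩, ?_⟩, hFa⟩
  · rw [← coe_one, hFa, map_one]
  · exact eq_on₂ (f := fun x y => F (x * y)) (g := fun x y => F x * F y)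
      (by fun_prop) (by fun_prop) fun a b => by
        rw [← coe_mul, hFa, hFa, hFa, map_mul]
  · show F 0 = 0
    rw [← coe_zero, hFa, map_zero]
  · exact eq_on₂ (f := fun x y => F (x + y)) (g := fun x y => F x + F y)
      (by fun_prop) (by fun_prop) fun a b => by
        rw [← coe_add, hFa, hFa, hFa, map_add]
  · intro c
    show F (algebraMap ℂ _ c) = _
    rw [Algebra.algebraMap_eq_smul_one, ← coe_one, ← coe_smul, hFa, map_smul, map_one,
      Algebra.algebraMap_eq_smul_one]
  · exact eq_on (f := fun x => F (star x)) (g := fun x => star (F x))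
      (by fun_prop) (by fun_prop) fun a => by rw [← coe_star, hFa, hFa, map_star]

/-- Every representation of `A` factorizes (uniquely) through `C⋆(A)`. -/
def lift (π : A →⋆ₐ[ℂ] D) : CStarEnv A →⋆ₐ[ℂ] D := (lift_exists π).choose

@[simp] lemma lift_of (π : A →⋆ₐ[ℂ] D) (a : A) : lift π (of a) = π a :=
  (lift_exists π).choose_spec a

/-- `C⋆(π) : C⋆(A) → C⋆(C)`. -/
def map {C : Type u} [Ring C] [StarRing C] [Algebra ℂ C] [StarModule ℂ C] [HasEnvelopingCStar C]
    (π : A →⋆ₐ[ℂ] C) : CStarEnv A →⋆ₐ[ℂ] CStarEnv C := lift (of.comp π)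

end CStarEnv

end Envelope

lemma HasEnvelopingCStar.of_span {A : Type u} [Ring A] [StarRing A] [Algebra ℂ A] (S : Set A)
    (hS : Submodule.span ℂ S = ⊤) (hb : ∀ a ∈ S, BddAbove (repNorms A a)) :
    HasEnvelopingCStar A := by
  refine ⟨fun a => ?_⟩
  have ha : a ∈ Submodule.span ℂ S := hS ▸ Submodule.mem_top
  induction ha using Submodule.span_induction with
  | mem x hx => exact hb x hx
  | zero =>
    refine ⟨0, ?_⟩
    rintro _ ⟨D, _, π, rfl⟩
    simp
  | add x y _ _ hx hy =>
    obtain ⟨c, hc⟩ := hx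
    obtain ⟨d, hd⟩ := hy
    refine ⟨c + d, ?_⟩
    rintro _ ⟨D, _, π, rfl⟩
    rw [map_add]
    exact (norm_add_le _ _).trans (add_le_add (hc ⟨D, _, π, rfl⟩) (hd ⟨D, _, π, rfl⟩))
  | smul z x _ hx =>
    obtain ⟨c, hc⟩ := hx
    refine ⟨‖z‖ * c, ?_⟩
    rintro _ ⟨D, _, π, rfl⟩
    rw [map_smul, norm_smul]
    exact mul_le_mul_of_nonneg_left (hc ⟨D, _, π, rfl⟩) (norm_nonneg _)

/-! ## The maximal tensor product -/

section MaxTensor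

/-- The inclusion of the first factor of an algebraic tensor product of `*`-algebras. -/
def inclLeft (A C : Type u) [CStarAlgebra A] [CStarAlgebra C] : A →⋆ₐ[ℂ] A ⊗[ℂ] C :=
  { (Algebra.TensorProduct.includeLeft : A →ₐ[ℂ] A ⊗[ℂ] C) with
    map_star' := fun a => by simp }

/-- The inclusion of the second factor of an algebraic tensor product of `*`-algebras. -/
def inclRight (A C : Type u) [CStarAlgebra A] [CStarAlgebra C] : C →⋆ₐ[ℂ] A ⊗[ℂ] C :=
  { (Algebra.TensorProduct.includeRight : C →ₐ[ℂ] A ⊗[ℂ] C) with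
    map_star' := fun a => by simp }

instance (A C : Type u) [CStarAlgebra A] [CStarAlgebra C] : HasEnvelopingCStar (A ⊗[ℂ] C) := by
  refine .of_span {t | ∃ a c, a ⊗ₜ[ℂ] c = t} (TensorProduct.span_tmul_eq_top ℂ A C) ?_
  rintro _ ⟨a, c, rfl⟩
  refine ⟨‖a‖ * ‖c‖, ?_⟩
  rintro _ ⟨D, _, π, rfl⟩
  have h : a ⊗ₜ[ℂ] c = inclLeft A C a * inclRight A C c := by
    show _ = (a ⊗ₜ[ℂ] (1 : C)) * ((1 : A) ⊗ₜ[ℂ] c)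
    simp
  rw [h, map_mul]
  refine (norm_mul_le _ _).trans (mul_le_mul ?_ ?_ (norm_nonneg _) (norm_nonneg _))
  · exact NonUnitalStarAlgHom.norm_apply_le (π.comp (inclLeft A C)) a
  · exact NonUnitalStarAlgHom.norm_apply_le (π.comp (inclRight A C)) c

/-- The maximal tensor product of two C⋆-algebras. -/
abbrev MaxTensor (A C : Type u) [CStarAlgebra A] [CStarAlgebra C] : Type u :=
  CStarEnv (A ⊗[ℂ] C)

infixl:100 " ⊗ᵐ " => MaxTensor

namespace MaxTensor

variable {A C D E F G : Type u} [CStarAlgebra A] [CStarAlgebra C] [CStarAlgebra D]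
  [CStarAlgebra E] [CStarAlgebra F] [CStarAlgebra G]

/-- The elementary tensor `a ⊗ c`. -/
def tmul (a : A) (c : C) : A ⊗ᵐ C := CStarEnv.of (a ⊗ₜ[ℂ] c)

lemma tmul_mul_tmul (a a' : A) (c c' : C) :
    tmul a c * tmul a' c' = tmul (a * a') (c * c') := by
  simp [tmul, ← map_mul]

lemma star_tmul (a : A) (c : C) : star (tmul a c) = tmul (star a) (star c) := by
  simp [tmul, ← map_star]

lemma one_def : (1 : A ⊗ᵐ C) = tmul 1 1 := by
  rw [tmul, ← Algebra.TensorProduct.one_def, map_one]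

lemma tmul_add (a : A) (c d : C) : tmul a (c + d) = tmul a c + tmul a d := by
  simp [tmul, TensorProduct.tmul_add]

lemma add_tmul (a b : A) (c : C) : tmul (a + b) c = tmul a c + tmul b c := by
  simp [tmul, TensorProduct.add_tmul]

lemma tmul_smul (z : ℂ) (a : A) (c : C) : tmul a (z • c) = z • tmul a c := by
  simp [tmul]

lemma smul_tmul (z : ℂ) (a : A) (c : C) : tmul (z • a) c = z • tmul a c := by
  rw [tmul, tmul, ← TensorProduct.smul_tmul', map_smul]

/-- `a ↦ a ⊗ 1`. -/
def inl : A →⋆ₐ[ℂ] A ⊗ᵐ C := CStarEnv.of.comp (inclLeft A C)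

/-- `c ↦ 1 ⊗ c`. -/
def inr : C →⋆ₐ[ℂ] A ⊗ᵐ C := CStarEnv.of.comp (inclRight A C)

lemma inl_apply (a : A) : (inl a : A ⊗ᵐ C) = tmul a 1 := rfl
lemma inr_apply (c : C) : (inr c : A ⊗ᵐ C) = tmul 1 c := rfl

lemma hom_ext {f g : A ⊗ᵐ C →⋆ₐ[ℂ] D} (h : ∀ a c, f (tmul a c) = g (tmul a c)) : f = g := by
  refine CStarEnv.hom_ext fun t => ?_
  induction t with
  | zero => simp
  | tmul a c => exact h a c
  | add x y hx hy => simp [hx, hy]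

/-- The `*`-homomorphism `a ⊗ c ↦ f a * g c` for commuting `f` and `g`. -/
def lift (f : A →⋆ₐ[ℂ] D) (g : C →⋆ₐ[ℂ] D) (h : ∀ a c, Commute (f a) (g c)) :
    A ⊗ᵐ C →⋆ₐ[ℂ] D :=
  CStarEnv.lift
    { Algebra.TensorProduct.lift (f : A →ₐ[ℂ] D) (g : C →ₐ[ℂ] D) h with
      map_star' := fun t => by
        show Algebra.TensorProduct.lift (f : A →ₐ[ℂ] D) (g : C →ₐ[ℂ] D) h (star t) =
          star (Algebra.TensorProduct.lift (f : A →ₐ[ℂ] D) (g : C →ₐ[ℂ] D) h t)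
        induction t with
        | zero => simp
        | tmul a c =>
          rw [TensorProduct.star_tmul, Algebra.TensorProduct.lift_tmul,
            Algebra.TensorProduct.lift_tmul, star_mul]
          show f (star a) * g (star c) = star (g c) * star (f a)
          rw [(h _ _).eq, map_star, map_star]
        | add x y hx hy => simp only [star_add, map_add, hx, hy] }

@[simp] lemma lift_tmul (f : A →⋆ₐ[ℂ] D) (g : C →⋆ₐ[ℂ] D) (h : ∀ a c, Commute (f a) (g c))
    (a : A) (c : C) : lift f g h (tmul a c) = f a * g c := by
  rw [lift, tmul, CStarEnv.lift_of]
  exact Algebra.TensorProduct.lift_tmul (f : A →ₐ[ℂ] D) (g : C →ₐ[ℂ] D) h a c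

/-- `f ⊗ g`. -/
def map (f : A →⋆ₐ[ℂ] D) (g : C →⋆ₐ[ℂ] E) : A ⊗ᵐ C →⋆ₐ[ℂ] D ⊗ᵐ E :=
  lift (inl.comp f) (inr.comp g) fun a c => by
    show inl (f a) * inr (g c) = inr (g c) * inl (f a)
    simp only [inl_apply, inr_apply, tmul_mul_tmul, one_mul, mul_one]

@[simp] lemma map_tmul (f : A →⋆ₐ[ℂ] D) (g : C →⋆ₐ[ℂ] E) (a : A) (c : C) :
    map f g (tmul a c) = tmul (f a) (g c) := by
  rw [map, lift_tmul]
  show inl (f a) * inr (g c) = _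
  simp only [inl_apply, inr_apply, tmul_mul_tmul, one_mul, mul_one]

lemma map_map (f : A →⋆ₐ[ℂ] D) (g : C →⋆ₐ[ℂ] E) (f' : D →⋆ₐ[ℂ] F) (g' : E →⋆ₐ[ℂ] G)
    (x : A ⊗ᵐ C) : map f' g' (map f g x) = map (f'.comp f) (g'.comp g) x :=
  DFunLike.congr_fun (hom_ext (f := (map f' g').comp (map f g))
    (g := map (f'.comp f) (g'.comp g)) fun a c => by simp) x

lemma map_id (x : A ⊗ᵐ C) : map (StarAlgHom.id ℂ A) (StarAlgHom.id ℂ C) x = x :=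
  DFunLike.congr_fun (hom_ext (f := map (StarAlgHom.id ℂ A) (StarAlgHom.id ℂ C))
    (g := StarAlgHom.id ℂ _) fun a c => by simp) x

lemma commute_assoc (x : A ⊗ᵐ C) (d : D) :
    Commute (map (StarAlgHom.id ℂ A) (inl : C →⋆ₐ[ℂ] C ⊗ᵐ D) x)
      (((inr : C ⊗ᵐ D →⋆ₐ[ℂ] A ⊗ᵐ (C ⊗ᵐ D)).comp inr) d) := by
  have h : ∀ x : A ⊗ᵐ C, map (StarAlgHom.id ℂ A) inl x * tmul 1 (tmul 1 d)
      = tmul 1 (tmul 1 d) * map (StarAlgHom.id ℂ A) (inl : C →⋆ₐ[ℂ] C ⊗ᵐ D) x := by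
    refine congrFun (CStarEnv.denseRange_of.equalizer
      ((CStarEnv.continuous_hom _).mul continuous_const)
      (continuous_const.mul (CStarEnv.continuous_hom _)) (funext fun t => ?_))
    show map (StarAlgHom.id ℂ A) inl (CStarEnv.of t) * _ =
      _ * map (StarAlgHom.id ℂ A) (inl : C →⋆ₐ[ℂ] C ⊗ᵐ D) (CStarEnv.of t)
    induction t with
    | zero => simp
    | tmul a c =>
      show map (StarAlgHom.id ℂ A) inl (tmul a c) * _ =
        _ * map (StarAlgHom.id ℂ A) (inl : C →⋆ₐ[ℂ] C ⊗ᵐ D) (tmul a c)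
      simp [inl_apply, tmul_mul_tmul]
    | add x y hx hy => simp only [map_add, add_mul, mul_add, hx, hy]
  exact h x

/-- The canonical map `(A ⊗ C) ⊗ D → A ⊗ (C ⊗ D)`. -/
def assocHom (A C D : Type u) [CStarAlgebra A] [CStarAlgebra C] [CStarAlgebra D] :
    (A ⊗ᵐ C) ⊗ᵐ D →⋆ₐ[ℂ] A ⊗ᵐ (C ⊗ᵐ D) :=
  lift (map (StarAlgHom.id ℂ A) inl) (inr.comp inr) commute_assoc

@[simp] lemma assocHom_tmul (a : A) (c : C) (d : D) :
    assocHom A C D (tmul (tmul a c) d) = tmul a (tmul c d) := by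
  rw [assocHom, lift_tmul, map_tmul]
  show tmul _ (inl c) * inr (inr d) = _
  simp [inl_apply, inr_apply, tmul_mul_tmul]

lemma hom_ext₃ {f g : (A ⊗ᵐ C) ⊗ᵐ D →⋆ₐ[ℂ] E}
    (h : ∀ a c d, f (tmul (tmul a c) d) = g (tmul (tmul a c) d)) : f = g := by
  refine hom_ext fun x d => ?_
  have h2 : f.comp inl = g.comp inl := hom_ext fun a c => h a c 1
  have h3 : f (inr d) = g (inr d) := by
    have := h 1 1 d
    rwa [← one_def] at this
  have hx : tmul x d = inl x * inr d := by simp [inl_apply, inr_apply, tmul_mul_tmul]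
  have h4 : f (inl x) = g (inl x) := DFunLike.congr_fun h2 x
  rw [hx, map_mul, map_mul, h3, h4]

lemma hom_ext₃' {f g : A ⊗ᵐ (C ⊗ᵐ D) →⋆ₐ[ℂ] E}
    (h : ∀ a c d, f (tmul a (tmul c d)) = g (tmul a (tmul c d))) : f = g := by
  refine hom_ext fun a x => ?_
  have h2 : f.comp inr = g.comp inr := hom_ext fun c d => h 1 c d
  have h3 : f (inl a) = g (inl a) := by
    have := h a 1 1
    rwa [← one_def] at this
  have hx : tmul a x = inl a * inr x := by simp [inl_apply, inr_apply, tmul_mul_tmul]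
  have h4 : f (inr x) = g (inr x) := DFunLike.congr_fun h2 x
  rw [hx, map_mul, map_mul, h3, h4]

lemma assocHom_map (f : A →⋆ₐ[ℂ] E) (g : C →⋆ₐ[ℂ] F) (h : D →⋆ₐ[ℂ] G) (x : (A ⊗ᵐ C) ⊗ᵐ D) :
    assocHom E F G (map (map f g) h x) = map f (map g h) (assocHom A C D x) :=
  DFunLike.congr_fun (hom_ext₃ (f := (assocHom E F G).comp (map (map f g) h))
    (g := (map f (map g h)).comp (assocHom A C D)) fun a c d => by simp) x

end MaxTensor

end MaxTensor

/-! ## The group C⋆-algebra -/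

section GroupAlgebra

variable {Γ : Type u} [Group Γ]

/-- The involution of the group algebra `ℂ Γ`, given by `(z γ)⋆ = z̄ γ⁻¹`. -/
def groupAlgebraStar : MonoidAlgebra ℂ Γ →+ MonoidAlgebra ℂ Γ :=
  (Finsupp.liftAddHom fun γ : Γ =>
    { toFun := fun z : ℂ => MonoidAlgebra.single γ⁻¹ (star z)
      map_zero' := by simp
      map_add' := fun x y => by rw [star_add, MonoidAlgebra.single_add] }).comp
    (MonoidAlgebra.coeffAddEquiv (R := ℂ) (M := Γ)).toAddMonoidHom

lemma groupAlgebraStar_single (γ : Γ) (z : ℂ) :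
    groupAlgebraStar (MonoidAlgebra.single γ z) = MonoidAlgebra.single γ⁻¹ (star z) := by
  simp [groupAlgebraStar]

instance : StarRing (MonoidAlgebra ℂ Γ) where
  star := groupAlgebraStar
  star_involutive x := by
    induction x using MonoidAlgebra.induction_linear with
    | zero => simp
    | add f g hf hg => rw [map_add, map_add, hf, hg]
    | single γ z => rw [groupAlgebraStar_single, groupAlgebraStar_single, inv_inv, star_star]
  star_mul x y := by
    induction x using MonoidAlgebra.induction_linear with
    | zero => simp
    | add f g hf hg => rw [add_mul, map_add, map_add, hf, hg, mul_add]
    | single γ z =>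
      induction y using MonoidAlgebra.induction_linear with
      | zero => simp
      | add f g hf hg => rw [mul_add, map_add, map_add, hf, hg, add_mul]
      | single γ' z' =>
        rw [MonoidAlgebra.single_mul_single, groupAlgebraStar_single, groupAlgebraStar_single,
          groupAlgebraStar_single, MonoidAlgebra.single_mul_single, mul_inv_rev, star_mul]
  star_add := map_add _

lemma star_single (γ : Γ) (z : ℂ) :
    star (MonoidAlgebra.single γ z) = MonoidAlgebra.single γ⁻¹ (star z) :=
  groupAlgebraStar_single γ z

instance : StarModule ℂ (MonoidAlgebra ℂ Γ) where
  star_smul c x := by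
    induction x using MonoidAlgebra.induction_linear with
    | zero => simp
    | add f g hf hg => rw [smul_add, star_add, star_add, hf, hg, smul_add]
    | single γ z => 
      rw [MonoidAlgebra.smul_single, star_single, star_single, MonoidAlgebra.smul_single,
        star_smul]

/-- The `*`-homomorphism of `ℂ Γ` given by a homomorphism of `Γ` into the unitaries. -/
def groupAlgebraLift {D : Type*} [Ring D] [StarRing D] [Algebra ℂ D] [StarModule ℂ D]
    (U : Γ →* D) (hU : ∀ γ, star (U γ) = U γ⁻¹) : MonoidAlgebra ℂ Γ →⋆ₐ[ℂ] D :=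
  { MonoidAlgebra.lift ℂ D Γ U with
    map_star' := fun x => by
      show MonoidAlgebra.lift ℂ D Γ U (star x) = star (MonoidAlgebra.lift ℂ D Γ U x)
      induction x using MonoidAlgebra.induction_linear with
      | zero => simp
      | add f g hf hg => rw [star_add, map_add, hf, hg, map_add, star_add]
      | single γ z =>
        rw [star_single, MonoidAlgebra.lift_single, MonoidAlgebra.lift_single, star_smul, hU] }

lemma groupAlgebraLift_single {D : Type*} [Ring D] [StarRing D] [Algebra ℂ D] [StarModule ℂ D]
    (U : Γ →* D) (hU : ∀ γ, star (U γ) = U γ⁻¹) (γ : Γ) (z : ℂ) :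
    groupAlgebraLift U hU (MonoidAlgebra.single γ z) = z • U γ :=
  MonoidAlgebra.lift_single U γ z

lemma norm_le_one_of_isometry {D : Type*} [CStarAlgebra D] {x : D} (h : star x * x = 1) :
    ‖x‖ ≤ 1 := by
  rcases subsingleton_or_nontrivial D with _ | _
  · rw [Subsingleton.elim x 0, norm_zero]
    exact zero_le_one
  · have h2 := CStarRing.norm_star_mul_self (x := x)
    rw [h, CStarRing.norm_one] at h2
    nlinarith [norm_nonneg x]

instance : HasEnvelopingCStar (MonoidAlgebra ℂ Γ) := by
  refine .of_span (Set.range fun p : Γ × ℂ => MonoidAlgebra.single p.1 p.2) ?_ ?_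
  · rw [eq_top_iff]
    intro x _
    induction x using MonoidAlgebra.induction_linear with
    | zero => exact Submodule.zero_mem _
    | add f g hf hg => exact Submodule.add_mem _ (hf trivial) (hg trivial)
    | single γ z => exact Submodule.subset_span ⟨(γ, z), rfl⟩
  · rintro _ ⟨⟨γ, z⟩, rfl⟩
    refine ⟨‖z‖, ?_⟩
    rintro _ ⟨D, _, π, rfl⟩
    have h : (MonoidAlgebra.single γ z : MonoidAlgebra ℂ Γ) = z • MonoidAlgebra.single γ 1 := by
      rw [MonoidAlgebra.smul_single, smul_eq_mul, mul_one]
    have h1 : ‖π (MonoidAlgebra.single γ 1)‖ ≤ 1 := by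
      refine norm_le_one_of_isometry ?_
      rw [← map_star, ← map_mul, star_single, MonoidAlgebra.single_mul_single, inv_mul_cancel,
        star_one, mul_one, ← MonoidAlgebra.one_def, map_one]
    dsimp only
    rw [h, map_smul, norm_smul]
    exact mul_le_of_le_one_right (norm_nonneg _) h1

variable (Γ) in
/-- The full group C⋆-algebra `C⋆(Γ)`. -/
abbrev GroupCStar : Type u := CStarEnv (MonoidAlgebra ℂ Γ)

namespace GroupCStar

/-- The canonical unitary of `C⋆(Γ)` associated to `γ ∈ Γ`. -/
def gen : Γ →* GroupCStar Γ where
  toFun γ := CStarEnv.of (MonoidAlgebra.single γ 1)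
  map_one' := by rw [← MonoidAlgebra.one_def, map_one]
  map_mul' γ γ' := by rw [← map_mul, MonoidAlgebra.single_mul_single, mul_one]

lemma star_gen (γ : Γ) : star (gen γ) = gen γ⁻¹ := by
  simp [gen, ← map_star, star_single]

/-- The `*`-homomorphism of `C⋆(Γ)` given by a homomorphism of `Γ` into the unitaries. -/
def lift {D : Type u} [CStarAlgebra D] (U : Γ →* D) (hU : ∀ γ, star (U γ) = U γ⁻¹) :
    GroupCStar Γ →⋆ₐ[ℂ] D := CStarEnv.lift (groupAlgebraLift U hU)

@[simp] lemma lift_gen {D : Type u} [CStarAlgebra D] (U : Γ →* D)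
    (hU : ∀ γ, star (U γ) = U γ⁻¹) (γ : Γ) : lift U hU (gen γ) = U γ := by
  show CStarEnv.lift _ (CStarEnv.of _) = _
  rw [CStarEnv.lift_of, groupAlgebraLift_single, one_smul]

lemma hom_ext {D : Type u} [CStarAlgebra D] {f g : GroupCStar Γ →⋆ₐ[ℂ] D}
    (h : ∀ γ, f (gen γ) = g (gen γ)) : f = g := by
  refine CStarEnv.hom_ext fun x => ?_
  induction x using MonoidAlgebra.induction_linear with
  | zero => simp
  | add x y hx hy => rw [map_add, map_add, map_add, hx, hy]
  | single γ z =>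
    have h1 : (MonoidAlgebra.single γ z : MonoidAlgebra ℂ Γ) = z • MonoidAlgebra.single γ 1 := by
      rw [MonoidAlgebra.smul_single, smul_eq_mul, mul_one]
    rw [h1, map_smul, map_smul, map_smul]
    exact congrArg _ (h γ)

/-- The comultiplication `γ ↦ γ ⊗ γ` of `C⋆(Γ)`. -/
def comul : GroupCStar Γ →⋆ₐ[ℂ] GroupCStar Γ ⊗ᵐ GroupCStar Γ :=
  lift
    { toFun := fun γ => MaxTensor.tmul (gen γ) (gen γ)
      map_one' := by rw [map_one, MaxTensor.one_def]
      map_mul' := fun γ γ' => by rw [MaxTensor.tmul_mul_tmul, map_mul] }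
    fun γ => by
      show star (MaxTensor.tmul (gen γ) (gen γ)) = MaxTensor.tmul (gen γ⁻¹) (gen γ⁻¹)
      rw [MaxTensor.star_tmul, star_gen]

@[simp] lemma comul_gen (γ : Γ) : comul (gen γ) = MaxTensor.tmul (gen γ) (gen γ) :=
  lift_gen _ _ γ

end GroupCStar

end GroupAlgebra

/-! ## Quotients of C⋆-algebras by closed ideals -/

section Quotients

variable {X : Type u} [CStarAlgebra X]

/-- `I` is a closed (automatically self-adjoint) two-sided ideal of a C⋆-algebra. -/
structure IsClosedStarIdeal (I : Ideal X) : Prop where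
  isTwoSided : I.IsTwoSided
  isClosed : IsClosed (I : Set X)
  star_mem : ∀ x ∈ I, star x ∈ I

/-- The closed two-sided ideal generated by a set. -/
def closedIdeal (T : Set X) : Ideal X := sInf {I | IsClosedStarIdeal I ∧ T ⊆ I}

lemma mem_closedIdeal {T : Set X} {x : X} :
    x ∈ closedIdeal T ↔ ∀ I : Ideal X, IsClosedStarIdeal I → T ⊆ I → x ∈ I := by
  simp [closedIdeal, Submodule.mem_sInf]

lemma subset_closedIdeal {T : Set X} {x : X} (hx : x ∈ T) : x ∈ closedIdeal T :=
  mem_closedIdeal.2 fun _ _ hT => hT hx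

lemma closedIdeal_isClosedStarIdeal (T : Set X) : IsClosedStarIdeal (closedIdeal T) where
  isTwoSided := ⟨fun b ha => mem_closedIdeal.2 fun I hI hT =>
    hI.isTwoSided.mul_mem_of_left b (mem_closedIdeal.1 ha I hI hT)⟩
  isClosed := by
    have : (closedIdeal T : Set X) = ⋂ I ∈ {I : Ideal X | IsClosedStarIdeal I ∧ T ⊆ I}, I := by
      simp [closedIdeal, Submodule.coe_sInf]
    rw [this]
    exact isClosed_biInter fun I hI => hI.1.isClosed
  star_mem x hx := mem_closedIdeal.2 fun I hI hT => hI.star_mem x (mem_closedIdeal.1 hx I hI hT)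

instance (T : Set X) : (closedIdeal T).IsTwoSided := (closedIdeal_isClosedStarIdeal T).isTwoSided
instance (T : Set X) : IsClosed (closedIdeal T : Set X) :=
  (closedIdeal_isClosedStarIdeal T).isClosed

lemma ker_isClosedStarIdeal {D : Type*} [CStarAlgebra D] (f : X →⋆ₐ[ℂ] D) :
    IsClosedStarIdeal (RingHom.ker (f : X →+* D)) where
  isTwoSided := inferInstance
  isClosed := isClosed_singleton.preimage (CStarEnv.continuous_hom f)
  star_mem x hx := by
    have h : f x = 0 := hx
    show f (star x) = 0
    rw [map_star, h, star_zero]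

/-- The quotient of a C⋆-algebra by the closed two-sided ideal generated by a set. -/
def CStarQuot (T : Set X) : Type u := X ⧸ closedIdeal T

namespace CStarQuot

variable (T : Set X)

instance : Ring (CStarQuot T) := inferInstanceAs (Ring (X ⧸ closedIdeal T))
instance : Algebra ℂ (CStarQuot T) := inferInstanceAs (Algebra ℂ (X ⧸ closedIdeal T))
instance : NormedAddCommGroup (CStarQuot T) :=
  Submodule.Quotient.normedAddCommGroup (closedIdeal T)
instance : CompleteSpace (CStarQuot T) := Submodule.Quotient.completeSpace (closedIdeal T)
instance : NormedSpace ℂ (CStarQuot T) := Submodule.Quotient.normedSpace (closedIdeal T) ℂ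

variable {T}

/-- The underlying function of the quotient map. -/
def mk (x : X) : CStarQuot T := Ideal.Quotient.mk (closedIdeal T) x

lemma mk_surjective : Function.Surjective (mk : X → CStarQuot T) := Ideal.Quotient.mk_surjective
lemma mk_mul (x y : X) : (mk (x * y) : CStarQuot T) = mk x * mk y := rfl
lemma mk_add (x y : X) : (mk (x + y) : CStarQuot T) = mk x + mk y := rfl
lemma mk_one : (mk 1 : CStarQuot T) = 1 := rfl
lemma mk_smul (c : ℂ) (x : X) : (mk (c • x) : CStarQuot T) = c • mk x := rfl
lemma mk_eq_mk {x y : X} : (mk x : CStarQuot T) = mk y ↔ x - y ∈ closedIdeal T :=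
  Ideal.Quotient.mk_eq_mk_iff_sub_mem x y
lemma norm_mk_le (x : X) : ‖(mk x : CStarQuot T)‖ ≤ ‖x‖ :=
  Submodule.Quotient.norm_mk_le (closedIdeal T) x
lemma norm_mk_lt (x : CStarQuot T) {ε : ℝ} (hε : 0 < ε) : ∃ y, mk y = x ∧ ‖y‖ < ‖x‖ + ε :=
  Submodule.Quotient.norm_mk_lt x hε

instance : NormedRing (CStarQuot T) where
  dist_eq := dist_eq_norm_neg_add
  norm_mul_le x y := by
    refine le_of_tendsto_of_tendsto (b := nhdsWithin (0 : ℝ) (Set.Ioi 0))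
      (f := fun _ => ‖x * y‖) (g := fun ε => (‖x‖ + ε) * (‖y‖ + ε)) tendsto_const_nhds ?_ ?_
    · have : Filter.Tendsto (fun ε : ℝ => (‖x‖ + ε) * (‖y‖ + ε)) (nhds 0)
          (nhds ((‖x‖ + 0) * (‖y‖ + 0))) := by
        apply Continuous.tendsto
        fun_prop
      rw [add_zero, add_zero] at this
      exact this.mono_left nhdsWithin_le_nhds
    · filter_upwards [self_mem_nhdsWithin] with ε hε
      obtain ⟨a, rfl, ha⟩ := norm_mk_lt x hε
      obtain ⟨b, rfl, hb⟩ := norm_mk_lt y hε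
      rw [← mk_mul]
      exact (norm_mk_le _).trans ((norm_mul_le a b).trans
        (mul_le_mul ha.le hb.le (norm_nonneg _) ((norm_nonneg _).trans ha.le)))

instance : NormedAlgebra ℂ (CStarQuot T) where
  norm_smul_le c x := (Submodule.Quotient.normedSpace (closedIdeal T) ℂ).norm_smul_le c x

instance : Star (CStarQuot T) where
  star := Quotient.map' star fun x y h => by
    rw [Submodule.quotientRel_def] at h ⊢
    rw [← star_sub]
    exact (closedIdeal_isClosedStarIdeal T).star_mem _ h

lemma mk_star (x : X) : (mk (star x) : CStarQuot T) = star (mk x) := rfl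

instance : StarRing (CStarQuot T) where
  star_involutive x := by
    obtain ⟨x, rfl⟩ := mk_surjective x
    rw [← mk_star, ← mk_star, star_star]
  star_mul x y := by
    obtain ⟨x, rfl⟩ := mk_surjective x
    obtain ⟨y, rfl⟩ := mk_surjective y
    rw [← mk_mul, ← mk_star, star_mul, mk_mul, mk_star, mk_star]
  star_add x y := by
    obtain ⟨x, rfl⟩ := mk_surjective x
    obtain ⟨y, rfl⟩ := mk_surjective y
    rw [← mk_add, ← mk_star, star_add, mk_add, mk_star, mk_star]

instance : StarModule ℂ (CStarQuot T) where
  star_smul c x := by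
    obtain ⟨x, rfl⟩ := mk_surjective x
    rw [← mk_smul, ← mk_star, star_smul, mk_smul, mk_star]

/-- A closed ideal contains approximate right units. -/
lemma exists_approx {I : Ideal X} (hI : IsClosedStarIdeal I) {y : X} (hy : y ∈ I) {ε : ℝ}
    (hε : 0 < ε) : ∃ e ∈ I, ‖1 - e‖ ≤ 1 ∧ ‖y - y * e‖ < ε := by
  let N : NonUnitalStarSubalgebra ℂ X :=
    { carrier := I
      add_mem' := I.add_mem
      zero_mem' := I.zero_mem
      mul_mem' := fun {a b} _ hb => I.mul_mem_left a hb
      smul_mem' := fun c x hx => by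
        have := I.mul_mem_left (algebraMap ℂ X c) hx
        rwa [← Algebra.smul_def] at this
      star_mem' := fun {x} hx => hI.star_mem x hx }
  have : IsClosed (N : Set X) := hI.isClosed
  let : NonUnitalCStarAlgebra N := NonUnitalStarSubalgebra.nonUnitalCStarAlgebra N
  let : PartialOrder N := CStarAlgebra.spectralOrder N
  have : StarOrderedRing N := CStarAlgebra.spectralOrderedRing N
  let : PartialOrder X := CStarAlgebra.spectralOrder X
  have : StarOrderedRing X := CStarAlgebra.spectralOrderedRing X
  have hl := CStarAlgebra.increasingApproximateUnit N
  have h1 := (hl.tendsto_mul_left ⟨y, hy⟩).eventually (Metric.ball_mem_nhds _ hε)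
  obtain ⟨e, ⟨he1, he2⟩, he3⟩ :=
    ((h1.and hl.eventually_nonneg).and hl.eventually_norm).exists
  refine ⟨e, e.2, ?_, ?_⟩
  · have hpos : (0 : X) ≤ (e : X) := by
      rw [StarOrderedRing.nonneg_iff] at he2 ⊢
      refine AddSubmonoid.closure_induction
        (motive := fun (x : N) _ => (x : X) ∈ AddSubmonoid.closure (Set.range fun s : X => star s * s))
        ?_ ?_ ?_ he2
      · rintro _ ⟨s, rfl⟩
        exact AddSubmonoid.subset_closure ⟨(s : X), rfl⟩
      · exact AddSubmonoid.zero_mem _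
      · intro a b _ _ ha hb
        exact AddSubmonoid.add_mem _ ha hb
    have hle : (e : X) ≤ 1 := (CStarAlgebra.norm_le_one_iff_of_nonneg (e : X) hpos).1 he3
    exact (CStarAlgebra.norm_le_one_iff_of_nonneg _ (sub_nonneg.2 hle)).2 (sub_le_self _ hpos)
  · rw [← norm_neg, neg_sub]
    have := mem_ball_iff_norm.1 he1
    exact this

instance : CStarRing (CStarQuot T) where
  norm_mul_self_le x := by
    refine le_of_forall_pos_le_add fun ε hε => ?_
    obtain ⟨x, rfl⟩ := mk_surjective x
    obtain ⟨z, hz, hz2⟩ := norm_mk_lt (star (mk x : CStarQuot T) * mk x) (half_pos hε)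
    rw [← mk_star, ← mk_mul] at hz hz2 ⊢
    obtain ⟨e, he, he1, he2⟩ := exists_approx (closedIdeal_isClosedStarIdeal T) (mk_eq_mk.1 hz)
      (half_pos hε)
    have h1 : (mk x : CStarQuot T) = mk (x * (1 - e)) := by
      rw [mk_eq_mk, mul_sub, mul_one, sub_sub_cancel]
      exact Ideal.mul_mem_left _ _ he
    have h2 : star (x * (1 - e)) * (x * (1 - e)) = star (1 - e) * z * (1 - e)
        - star (1 - e) * ((z - star x * x) - (z - star x * x) * e) := by
      rw [star_mul]
      noncomm_ring
    have h3 : ‖star (1 - e)‖ ≤ 1 := by rwa [norm_star]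
    calc ‖(mk x : CStarQuot T)‖ * ‖(mk x : CStarQuot T)‖
        ≤ ‖x * (1 - e)‖ * ‖x * (1 - e)‖ := by
          rw [h1]
          exact mul_self_le_mul_self (norm_nonneg _) (norm_mk_le _)
      _ = ‖star (1 - e) * z * (1 - e)
            - star (1 - e) * ((z - star x * x) - (z - star x * x) * e)‖ := by
          rw [← CStarRing.norm_star_mul_self, h2]
      _ ≤ ‖star (1 - e) * z * (1 - e)‖
            + ‖star (1 - e) * ((z - star x * x) - (z - star x * x) * e)‖ := norm_sub_le _ _
      _ ≤ ‖z‖ + ε / 2 := by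
          refine add_le_add ?_ ?_
          · refine (norm_mul_le _ _).trans ((mul_le_of_le_one_right (norm_nonneg _) he1).trans ?_)
            exact (norm_mul_le _ _).trans (mul_le_of_le_one_left (norm_nonneg _) h3)
          · exact (norm_mul_le _ _).trans
              ((mul_le_of_le_one_left (norm_nonneg _) h3).trans he2.le)
      _ ≤ _ := by linarith

instance : CStarAlgebra (CStarQuot T) where

variable (T) in
/-- The quotient map. -/
def proj : X →⋆ₐ[ℂ] CStarQuot T where
  toFun := mk
  map_one' := mk_one
  map_mul' := mk_mul
  map_zero' := rfl
  map_add' := mk_add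
  commutes' _ := rfl
  map_star' := mk_star

lemma proj_surjective : Function.Surjective (proj T) := mk_surjective

lemma proj_eq_zero {x : X} (hx : x ∈ T) : proj T x = 0 :=
  Ideal.Quotient.eq_zero_iff_mem.2 (subset_closedIdeal hx)

lemma hom_ext {D : Type*} [CStarAlgebra D] {f g : CStarQuot T →⋆ₐ[ℂ] D}
    (h : ∀ x, f (proj T x) = g (proj T x)) : f = g :=
  StarAlgHom.ext fun x => by
    obtain ⟨x, rfl⟩ := proj_surjective x
    exact h x

/-- The `*`-homomorphism on the quotient induced by one that vanishes on the relations. -/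
def lift {D : Type*} [CStarAlgebra D] (f : X →⋆ₐ[ℂ] D) (hf : ∀ x ∈ T, f x = 0) :
    CStarQuot T →⋆ₐ[ℂ] D :=
  { Ideal.Quotient.liftₐ (closedIdeal T) (f : X →ₐ[ℂ] D) (fun x hx =>
      mem_closedIdeal.1 hx _ (ker_isClosedStarIdeal f) hf) with
    map_star' := fun x => by
      obtain ⟨x, rfl⟩ := mk_surjective x
      exact map_star f x }

@[simp] lemma lift_proj {D : Type*} [CStarAlgebra D] (f : X →⋆ₐ[ℂ] D) (hf : ∀ x ∈ T, f x = 0)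
    (x : X) : lift f hf (proj T x) = f x := rfl

end CStarQuot

end Quotients

/-! ## The crossed product algebra -/

section CrossedProduct

variable {B Γ : Type u} [CommCStarAlgebra B] [Group Γ]

/-- The action of `Γ` on `B` given by a homomorphism into the automorphism group. -/
abbrev actionOf (α : Γ →* (B ≃⋆ₐ[ℂ] B)) : MulSemiringAction Γ B where
  smul γ b := α γ b
  one_smul b := by show α 1 b = b; rw [map_one]; rfl
  mul_smul γ γ' b := by show α (γ * γ') b = α γ (α γ' b); rw [map_mul]; rfl
  smul_zero γ := map_zero (α γ)
  smul_add γ := map_add (α γ)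
  smul_one γ := map_one (α γ)
  smul_mul γ := map_mul (α γ)

/-- The algebraic crossed product `B ⋊ Γ`, whose elements are the finite sums `∑ b_γ γ`, with
`(b γ) (b' γ') = b γ(b') γ γ'`. -/
def CrossedProduct (_ : Γ →* (B ≃⋆ₐ[ℂ] B)) : Type u := SkewMonoidAlgebra B Γ

namespace CrossedProduct

variable {α : Γ →* (B ≃⋆ₐ[ℂ] B)}

instance : Ring (CrossedProduct α) := @SkewMonoidAlgebra.instRing B Γ _ _ (actionOf α)

instance : Module ℂ (CrossedProduct α) := inferInstanceAs (Module ℂ (SkewMonoidAlgebra B Γ))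

/-- The element `b γ` of `B ⋊ Γ`. -/
def single (γ : Γ) (b : B) : CrossedProduct α := SkewMonoidAlgebra.single γ b

/-- The coefficient `b_γ` of `∑ b_γ γ`. -/
def coeff (γ : Γ) : CrossedProduct α →ₗ[ℂ] B where
  toFun x := SkewMonoidAlgebra.coeff (k := B) (G := Γ) x γ
  map_add' x y := DFunLike.congr_fun (SkewMonoidAlgebra.coeff_add (k := B) (G := Γ) x y) γ
  map_smul' z x := DFunLike.congr_fun (SkewMonoidAlgebra.coeff_smul (k := B) (G := Γ) z x) γ

lemma ext {x y : CrossedProduct α} (h : ∀ γ, coeff γ x = coeff γ y) : x = y :=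
  SkewMonoidAlgebra.ext (k := B) (G := Γ) h

lemma coeff_single_same (γ : Γ) (b : B) : coeff γ (single γ b : CrossedProduct α) = b := by
  show SkewMonoidAlgebra.coeff (SkewMonoidAlgebra.single γ b) γ = b
  rw [SkewMonoidAlgebra.coeff_single, Finsupp.single_eq_same]

lemma coeff_single_ne {γ δ : Γ} (h : δ ≠ γ) (b : B) :
    coeff δ (single γ b : CrossedProduct α) = 0 := by
  show SkewMonoidAlgebra.coeff (SkewMonoidAlgebra.single γ b) δ = 0
  rw [SkewMonoidAlgebra.coeff_single, Finsupp.single_eq_of_ne h]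

lemma single_add (γ : Γ) (b c : B) : (single γ (b + c) : CrossedProduct α) =
    single γ b + single γ c := SkewMonoidAlgebra.single_add γ b c

lemma single_zero (γ : Γ) : (single γ 0 : CrossedProduct α) = 0 :=
  SkewMonoidAlgebra.single_zero γ

lemma smul_single (z : ℂ) (γ : Γ) (b : B) : z • (single γ b : CrossedProduct α) =
    single γ (z • b) := SkewMonoidAlgebra.smul_single z γ b

lemma single_mul_single (γ γ' : Γ) (b b' : B) : (single γ b : CrossedProduct α) * single γ' b' =
    single (γ * γ') (b * α γ b') :=
  let _ := actionOf α
  SkewMonoidAlgebra.single_mul_single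

lemma one_def : (1 : CrossedProduct α) = single 1 1 :=
  let _ := actionOf α
  SkewMonoidAlgebra.one_def

@[elab_as_elim]
lemma induction {p : CrossedProduct α → Prop} (x : CrossedProduct α) (h0 : p 0)
    (h1 : ∀ γ b, p (single γ b)) (h2 : ∀ x y, p x → p y → p (x + y)) : p x :=
  SkewMonoidAlgebra.induction_on (k := B) (G := Γ) x h0 h1 h2

instance : Algebra ℂ (CrossedProduct α) :=
  Algebra.ofModule
    (fun z x y => by
      induction x using CrossedProduct.induction with
      | h0 => simp
      | h2 x x' hx hx' => rw [smul_add, add_mul, add_mul, hx, hx', smul_add]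
      | h1 γ b =>
        induction y using CrossedProduct.induction with
        | h0 => simp
        | h2 y y' hy hy' => rw [mul_add, mul_add, hy, hy', smul_add]
        | h1 γ' b' =>
          rw [smul_single, single_mul_single, single_mul_single, smul_single, smul_mul_assoc])
    (fun z x y => by
      induction x using CrossedProduct.induction with
      | h0 => simp
      | h2 x x' hx hx' => rw [add_mul, add_mul, hx, hx', smul_add]
      | h1 γ b =>
        induction y using CrossedProduct.induction with
        | h0 => simp
        | h2 y y' hy hy' => rw [smul_add, mul_add, mul_add, hy, hy', smul_add]
        | h1 γ' b' =>
          rw [smul_single, single_mul_single, single_mul_single, smul_single, map_smul,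
            mul_smul_comm])

/-- The involution `(b γ)⋆ = γ⁻¹ b⋆ = γ⁻¹(b⋆) γ⁻¹`. -/
def starHom : CrossedProduct α →+ CrossedProduct α :=
  (Finsupp.liftAddHom fun γ : Γ =>
    { toFun := fun b : B => (single γ⁻¹ (α γ⁻¹ (star b)) : CrossedProduct α)
      map_zero' := by rw [star_zero, map_zero, single_zero]
      map_add' := fun b c => by rw [star_add, map_add, single_add] }).comp
    (SkewMonoidAlgebra.coeffAddEquiv (k := B) (G := Γ)).toAddMonoidHom

lemma starHom_single (γ : Γ) (b : B) :
    starHom (single γ b : CrossedProduct α) = single γ⁻¹ (α γ⁻¹ (star b)) := by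
  show Finsupp.liftAddHom _ (Finsupp.single γ b) = _
  rw [Finsupp.liftAddHom_apply_single]
  rfl

lemma map_inv_map (γ : Γ) (b : B) : α γ⁻¹ (α γ b) = b := by
  have h : (α γ⁻¹ * α γ) b = b := by
    rw [← map_mul, inv_mul_cancel, map_one]
    rfl
  exact h

lemma map_map_inv (γ : Γ) (b : B) : α γ (α γ⁻¹ b) = b := by
  have := map_inv_map (α := α) γ⁻¹ b
  rwa [inv_inv] at this

instance : StarRing (CrossedProduct α) where
  star := starHom
  star_involutive x := by
    induction x using CrossedProduct.induction with
    | h0 => rw [map_zero, map_zero]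
    | h2 x y hx hy => rw [map_add, map_add, hx, hy]
    | h1 γ b =>
      rw [starHom_single, starHom_single, ← map_star, star_star, inv_inv, map_map_inv]
  star_mul x y := by
    induction x using CrossedProduct.induction with
    | h0 => rw [zero_mul, map_zero, mul_zero]
    | h2 x x' hx hx' => rw [add_mul, map_add, map_add, mul_add, hx, hx']
    | h1 γ b =>
      induction y using CrossedProduct.induction with
      | h0 => rw [mul_zero, map_zero, zero_mul]
      | h2 y y' hy hy' => rw [mul_add, map_add, map_add, add_mul, hy, hy']
      | h1 γ' b' =>
        rw [single_mul_single, starHom_single, starHom_single, starHom_single, single_mul_single,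
          mul_inv_rev, star_mul, map_mul (α (γ'⁻¹ * γ⁻¹)), map_mul α]
        congr 2
        show α γ'⁻¹ (α γ⁻¹ (star (α γ b'))) = _
        rw [← map_star, map_inv_map]
  star_add := map_add _

lemma star_single (γ : Γ) (b : B) :
    star (single γ b : CrossedProduct α) = single γ⁻¹ (α γ⁻¹ (star b)) := starHom_single γ b

instance : StarModule ℂ (CrossedProduct α) where
  star_smul c x := by
    induction x using CrossedProduct.induction with
    | h0 => simp
    | h2 x y hx hy => rw [smul_add, star_add, star_add, hx, hy, smul_add]
    | h1 γ b =>
      rw [smul_single, star_single, star_single, smul_single, star_smul, map_smul]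

/-- The inclusion `B → B ⋊ Γ`. -/
def incl : B →⋆ₐ[ℂ] CrossedProduct α where
  toFun b := single 1 b
  map_one' := one_def.symm
  map_mul' b c := by rw [single_mul_single, mul_one, map_one]; rfl
  map_zero' := single_zero 1
  map_add' := single_add 1
  commutes' z := by
    rw [Algebra.algebraMap_eq_smul_one, Algebra.algebraMap_eq_smul_one, ← smul_single, ← one_def]
  map_star' b := by rw [star_single, inv_one, map_one]; rfl

instance : HasEnvelopingCStar (CrossedProduct α) := by
  refine .of_span {x | ∃ γ b, single γ b = x} ?_ ?_
  · rw [eq_top_iff]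
    intro x _
    induction x using CrossedProduct.induction with
    | h0 => exact Submodule.zero_mem _
    | h2 x y hx hy => exact Submodule.add_mem _ (hx trivial) (hy trivial)
    | h1 γ b => exact Submodule.subset_span ⟨γ, b, rfl⟩
  · rintro _ ⟨γ, b, rfl⟩
    refine ⟨‖b‖, ?_⟩
    rintro _ ⟨D, _, π, rfl⟩
    have h : (single γ b : CrossedProduct α) = incl b * single γ 1 := by
      show _ = single 1 b * single γ 1
      rw [single_mul_single, one_mul, map_one, mul_one]
    have h1 : ‖π (single γ 1)‖ ≤ 1 := by
      refine norm_le_one_of_isometry ?_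
      rw [← map_star, ← map_mul, star_single, single_mul_single, inv_mul_cancel, star_one,
        map_one, one_mul, ← one_def, map_one]
    rw [h, map_mul]
    refine (norm_mul_le _ _).trans ((mul_le_of_le_one_right (norm_nonneg _) h1).trans ?_)
    exact NonUnitalStarAlgHom.norm_apply_le (π.comp incl) b

end CrossedProduct

end CrossedProduct

/-! ## Quotients of `*`-algebras -/

section StarQuotients

variable {X : Type u} [Ring X] [StarRing X] [Algebra ℂ X] [StarModule ℂ X]

/-- `I` is a self-adjoint two-sided ideal of a `*`-algebra. -/
structure IsStarIdeal (I : Ideal X) : Prop where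
  isTwoSided : I.IsTwoSided
  star_mem : ∀ x ∈ I, star x ∈ I

/-- The self-adjoint two-sided ideal generated by a set. If the set is self-adjoint, then this is
the two-sided ideal generated by it. -/
def starIdeal (T : Set X) : Ideal X := sInf {I | IsStarIdeal I ∧ T ⊆ I}

lemma mem_starIdeal {T : Set X} {x : X} :
    x ∈ starIdeal T ↔ ∀ I : Ideal X, IsStarIdeal I → T ⊆ I → x ∈ I := by
  simp [starIdeal, Submodule.mem_sInf]

lemma subset_starIdeal {T : Set X} {x : X} (hx : x ∈ T) : x ∈ starIdeal T :=
  mem_starIdeal.2 fun _ _ hT => hT hx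

lemma starIdeal_isStarIdeal (T : Set X) : IsStarIdeal (starIdeal T) where
  isTwoSided := ⟨fun b ha => mem_starIdeal.2 fun I hI hT =>
    hI.isTwoSided.mul_mem_of_left b (mem_starIdeal.1 ha I hI hT)⟩
  star_mem x hx := mem_starIdeal.2 fun I hI hT => hI.star_mem x (mem_starIdeal.1 hx I hI hT)

instance (T : Set X) : (starIdeal T).IsTwoSided := (starIdeal_isStarIdeal T).isTwoSided

/-- The quotient of a `*`-algebra by the self-adjoint two-sided ideal generated by a set. -/
def StarQuot (T : Set X) : Type u := X ⧸ starIdeal T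

namespace StarQuot

variable {T : Set X}

instance : Ring (StarQuot T) := inferInstanceAs (Ring (X ⧸ starIdeal T))
instance : Algebra ℂ (StarQuot T) := inferInstanceAs (Algebra ℂ (X ⧸ starIdeal T))

/-- The underlying function of the quotient map. -/
def mk (x : X) : StarQuot T := Ideal.Quotient.mk (starIdeal T) x

lemma mk_surjective : Function.Surjective (mk : X → StarQuot T) := Ideal.Quotient.mk_surjective
lemma mk_mul (x y : X) : (mk (x * y) : StarQuot T) = mk x * mk y := rfl
lemma mk_add (x y : X) : (mk (x + y) : StarQuot T) = mk x + mk y := rfl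
lemma mk_one : (mk 1 : StarQuot T) = 1 := rfl
lemma mk_smul (c : ℂ) (x : X) : (mk (c • x) : StarQuot T) = c • mk x := rfl

instance : Star (StarQuot T) where
  star := Quotient.map' star fun x y h => by
    rw [Submodule.quotientRel_def] at h ⊢
    rw [← star_sub]
    exact (starIdeal_isStarIdeal T).star_mem _ h

lemma mk_star (x : X) : (mk (star x) : StarQuot T) = star (mk x) := rfl

instance : StarRing (StarQuot T) where
  star_involutive x := by
    obtain ⟨x, rfl⟩ := mk_surjective x
    rw [← mk_star, ← mk_star, star_star]
  star_mul x y := by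
    obtain ⟨x, rfl⟩ := mk_surjective x
    obtain ⟨y, rfl⟩ := mk_surjective y
    rw [← mk_mul, ← mk_star, star_mul, mk_mul, mk_star, mk_star]
  star_add x y := by
    obtain ⟨x, rfl⟩ := mk_surjective x
    obtain ⟨y, rfl⟩ := mk_surjective y
    rw [← mk_add, ← mk_star, star_add, mk_add, mk_star, mk_star]

instance : StarModule ℂ (StarQuot T) where
  star_smul c x := by
    obtain ⟨x, rfl⟩ := mk_surjective x
    rw [← mk_smul, ← mk_star, star_smul, mk_smul, mk_star]

variable (T) in
/-- The quotient map. -/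
def proj : X →⋆ₐ[ℂ] StarQuot T where
  toFun := mk
  map_one' := mk_one
  map_mul' := mk_mul
  map_zero' := rfl
  map_add' := mk_add
  commutes' _ := rfl
  map_star' := mk_star

lemma proj_surjective : Function.Surjective (proj T) := mk_surjective

lemma proj_eq_zero {x : X} (hx : x ∈ T) : proj T x = 0 :=
  Ideal.Quotient.eq_zero_iff_mem.2 (subset_starIdeal hx)

lemma ker_isStarIdeal {D : Type*} [Ring D] [StarRing D] [Algebra ℂ D] (f : X →⋆ₐ[ℂ] D) :
    IsStarIdeal (RingHom.ker (f : X →+* D)) where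
  isTwoSided := inferInstance
  star_mem x hx := by
    have h : f x = 0 := hx
    show f (star x) = 0
    rw [map_star, h, star_zero]

/-- The `*`-homomorphism on the quotient induced by one that vanishes on the relations. -/
def lift {D : Type*} [Ring D] [StarRing D] [Algebra ℂ D] (f : X →⋆ₐ[ℂ] D)
    (hf : ∀ x ∈ T, f x = 0) : StarQuot T →⋆ₐ[ℂ] D :=
  { Ideal.Quotient.liftₐ (starIdeal T) (f : X →ₐ[ℂ] D) (fun x hx =>
      mem_starIdeal.1 hx _ (ker_isStarIdeal f) hf) with
    map_star' := fun x => by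
      obtain ⟨x, rfl⟩ := mk_surjective x
      exact map_star f x }

@[simp] lemma lift_proj {D : Type*} [Ring D] [StarRing D] [Algebra ℂ D] (f : X →⋆ₐ[ℂ] D)
    (hf : ∀ x ∈ T, f x = 0) (x : X) : lift f hf (proj T x) = f x := rfl

end StarQuot

end StarQuotients

/-! ## `(B, Γ)`-algebras -/

section BGAlgebras

variable {B Γ : Type u} [CommCStarAlgebra B] [Group Γ]

/-- The axioms of a `(B, Γ)`-algebra: `A` is the direct sum of the subspaces `A_{γ,γ'}`, these form
a `Γ × Γ`-grading, and `r`, `s` are homomorphisms from `B` to `A_{e,e}` with commuting images such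
that `a r(b) = r(γ(b)) a` and `a s(b) = s(γ'(b)) a` for `a ∈ A_{γ,γ'}`. -/
structure IsBGAlg (α : Γ →* (B ≃⋆ₐ[ℂ] B)) {A : Type u} [Ring A] [Algebra ℂ A]
    (gr : Γ → Γ → Submodule ℂ A) (r s : B →ₐ[ℂ] A) : Prop where
  indep : iSupIndep fun p : Γ × Γ => gr p.1 p.2
  iSup_eq_top : ⨆ p : Γ × Γ, gr p.1 p.2 = ⊤
  mul_mem : ∀ {γ γ' δ δ' : Γ} {a b : A}, a ∈ gr γ γ' → b ∈ gr δ δ' → a * b ∈ gr (γ * δ) (γ' * δ')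
  r_mem : ∀ b, r b ∈ gr 1 1
  s_mem : ∀ b, s b ∈ gr 1 1
  commute : ∀ b c, Commute (r b) (s c)
  mul_r : ∀ {γ γ' : Γ} {a : A} (b : B), a ∈ gr γ γ' → a * r b = r (α γ b) * a
  mul_s : ∀ {γ γ' : Γ} {a : A} (b : B), a ∈ gr γ γ' → a * s b = s (α γ' b) * a

/-- A `(B, Γ)`-algebra structure on the algebra `A`. -/
structure BGAlg (α : Γ →* (B ≃⋆ₐ[ℂ] B)) (A : Type u) [Ring A] [Algebra ℂ A] where
  gr : Γ → Γ → Submodule ℂ A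
  r : B →ₐ[ℂ] A
  s : B →ₐ[ℂ] A
  isBGAlg : IsBGAlg α gr r s

/-- Morphisms of `(B, Γ)`-algebras. -/
structure IsBGHom {α : Γ →* (B ≃⋆ₐ[ℂ] B)} {A C : Type u} [Ring A] [Algebra ℂ A] [Ring C]
    [Algebra ℂ C] (V : BGAlg α A) (W : BGAlg α C) (f : A →ₐ[ℂ] C) : Prop where
  map_gr : ∀ {γ γ' : Γ} {a : A}, a ∈ V.gr γ γ' → f a ∈ W.gr γ γ'
  map_r : ∀ b, f (V.r b) = W.r b
  map_s : ∀ b, f (V.s b) = W.s b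

variable (B Γ) in
/-- The data underlying a `(B, Γ)`-`*`-algebra: the subspaces `A_{γ,γ'}` and the `*`-homomorphisms
`r, s : B → A_{e,e}`. -/
structure BGStarData (A : Type u) [Ring A] [StarRing A] [Algebra ℂ A] where
  gr : Γ → Γ → Submodule ℂ A
  r : B →⋆ₐ[ℂ] A
  s : B →⋆ₐ[ℂ] A
  r_mem : ∀ b, r b ∈ gr 1 1
  s_mem : ∀ b, s b ∈ gr 1 1

/-- A `(B, Γ)`-`*`-algebra structure on the `*`-algebra `A`. -/
structure BGStarAlg (α : Γ →* (B ≃⋆ₐ[ℂ] B)) (A : Type u) [Ring A] [StarRing A] [Algebra ℂ A]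
    extends BGStarData B Γ A where
  isBGAlg : IsBGAlg α gr (r : B →ₐ[ℂ] A) (s : B →ₐ[ℂ] A)
  star_mem : ∀ {γ γ' : Γ} {a : A}, a ∈ gr γ γ' → star a ∈ gr γ⁻¹ γ'⁻¹

/-- The `(B, Γ)`-algebra underlying a `(B, Γ)`-`*`-algebra. -/
def BGStarAlg.toBGAlg {α : Γ →* (B ≃⋆ₐ[ℂ] B)} {A : Type u} [Ring A] [StarRing A] [Algebra ℂ A]
    (V : BGStarAlg α A) : BGAlg α A where
  gr := V.gr
  r := V.r
  s := V.s
  isBGAlg := V.isBGAlg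

variable {A C D A' C' : Type u} [Ring A] [StarRing A] [Algebra ℂ A] [StarModule ℂ A]
  [Ring C] [StarRing C] [Algebra ℂ C] [StarModule ℂ C]
  [Ring D] [StarRing D] [Algebra ℂ D] [StarModule ℂ D]
  [Ring A'] [StarRing A'] [Algebra ℂ A'] [StarModule ℂ A']
  [Ring C'] [StarRing C'] [Algebra ℂ C'] [StarModule ℂ C']

/-- The `*`-homomorphism `f` is compatible with the grading, with `r` and with `s`. -/
structure IsBGStarHom (V : BGStarData B Γ A) (W : BGStarData B Γ C) (f : A →⋆ₐ[ℂ] C) : Prop where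
  map_gr : ∀ {γ γ' : Γ} {a : A}, a ∈ V.gr γ γ' → f a ∈ W.gr γ γ'
  map_r : ∀ b, f (V.r b) = W.r b
  map_s : ∀ b, f (V.s b) = W.s b

lemma IsBGStarHom.id (V : BGStarData B Γ A) : IsBGStarHom V V (StarAlgHom.id ℂ A) :=
  ⟨fun h => h, fun _ => rfl, fun _ => rfl⟩

/-- The `(B, Γ)`-`*`-algebra `B ⋊ Γ`, where `(B ⋊ Γ)_{γ,γ} = B γ` and `(B ⋊ Γ)_{γ,γ'} = 0` if
`γ ≠ γ'`, and where `r` and `s` are the inclusion of `B`. -/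
def crossedData (α : Γ →* (B ≃⋆ₐ[ℂ] B)) : BGStarData B Γ (CrossedProduct α) where
  gr γ γ' :=
    { carrier := {x | ∃ b, x = CrossedProduct.single γ b ∧ (γ ≠ γ' → b = 0)}
      add_mem' := by
        rintro _ _ ⟨b, rfl, hb⟩ ⟨c, rfl, hc⟩
        exact ⟨b + c, (CrossedProduct.single_add γ b c).symm, fun h => by rw [hb h, hc h, add_zero]⟩
      zero_mem' := ⟨0, (CrossedProduct.single_zero γ).symm, fun _ => rfl⟩
      smul_mem' := by
        rintro z _ ⟨b, rfl, hb⟩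
        exact ⟨z • b, CrossedProduct.smul_single z γ b, fun h => by rw [hb h, smul_zero]⟩ }
  r := CrossedProduct.incl
  s := CrossedProduct.incl
  r_mem b := ⟨b, rfl, fun h => absurd rfl h⟩
  s_mem b := ⟨b, rfl, fun h => absurd rfl h⟩

lemma single_mem_crossedData (α : Γ →* (B ≃⋆ₐ[ℂ] B)) (γ : Γ) (b : B) :
    CrossedProduct.single γ b ∈ (crossedData α).gr γ γ := ⟨b, rfl, fun h => absurd rfl h⟩

lemma crossedData_eq_zero (α : Γ →* (B ≃⋆ₐ[ℂ] B)) {γ γ' : Γ} (h : γ ≠ γ') {x : CrossedProduct α}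
    (hx : x ∈ (crossedData α).gr γ γ') : x = 0 := by
  obtain ⟨b, rfl, hb⟩ := hx
  rw [hb h, CrossedProduct.single_zero]

/-- The crossed product `B ⋊ Γ` as a `(B, Γ)`-`*`-algebra. -/
def crossedAlg (α : Γ →* (B ≃⋆ₐ[ℂ] B)) : BGStarAlg α (CrossedProduct α) where
  toBGStarData := crossedData α
  isBGAlg :=
    { indep := by
        intro p
        rw [Submodule.disjoint_def]
        intro x hx hx2
        by_cases hp : p.1 = p.2
        · have h1 : (⨆ q, ⨆ (_ : q ≠ p), (crossedData α).gr q.1 q.2) ≤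
              LinearMap.ker (CrossedProduct.coeff (α := α) p.1) := by
            refine iSup₂_le fun q hq => ?_
            rintro _ ⟨b, rfl, hb⟩
            rw [LinearMap.mem_ker]
            by_cases hq2 : q.1 = q.2
            · refine CrossedProduct.coeff_single_ne (fun h => hq ?_) b
              exact Prod.ext h.symm (hq2.symm.trans (h.symm.trans hp))
            · rw [hb hq2, CrossedProduct.single_zero, map_zero]
          have h2 := h1 hx2
          obtain ⟨b, rfl, hb⟩ := hx
          rw [LinearMap.mem_ker, CrossedProduct.coeff_single_same] at h2
          rw [h2, CrossedProduct.single_zero]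
        · exact crossedData_eq_zero α hp hx
      iSup_eq_top := by
        rw [eq_top_iff]
        intro x _
        induction x using CrossedProduct.induction with
        | h0 => exact Submodule.zero_mem _
        | h2 x y hx hy => exact Submodule.add_mem _ (hx trivial) (hy trivial)
        | h1 γ b => exact Submodule.mem_iSup_of_mem (γ, γ) (single_mem_crossedData α γ b)
      mul_mem := by
        intro γ γ' δ δ' a b ha hb
        by_cases h : γ = γ'
        · by_cases h' : δ = δ'
          · obtain ⟨a, rfl, -⟩ := ha
            obtain ⟨b, rfl, -⟩ := hb
            subst h h'
            rw [CrossedProduct.single_mul_single]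
            exact single_mem_crossedData α _ _
          · rw [crossedData_eq_zero α h' hb, mul_zero]
            exact Submodule.zero_mem _
        · rw [crossedData_eq_zero α h ha, zero_mul]
          exact Submodule.zero_mem _
      r_mem := (crossedData α).r_mem
      s_mem := (crossedData α).s_mem
      commute := fun b c => by
        show CrossedProduct.incl b * CrossedProduct.incl c = _ * _
        rw [← map_mul, mul_comm, map_mul]
        rfl
      mul_r := by
        rintro γ γ' _ b ⟨a, rfl, -⟩
        show CrossedProduct.single γ a * CrossedProduct.single 1 b = CrossedProduct.single 1 _ * _
        rw [CrossedProduct.single_mul_single, CrossedProduct.single_mul_single, mul_one, one_mul,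
          map_one, mul_comm]
        rfl
      mul_s := by
        intro γ γ' x b hx
        by_cases h : γ = γ'
        · subst h
          obtain ⟨a, rfl, -⟩ := hx
          show CrossedProduct.single γ a * CrossedProduct.single 1 b =
            CrossedProduct.single 1 _ * _
          rw [CrossedProduct.single_mul_single, CrossedProduct.single_mul_single, mul_one,
            one_mul, map_one, mul_comm]
          rfl
        · rw [crossedData_eq_zero α h hx, zero_mul, mul_zero] }
  star_mem := by
    rintro γ γ' _ ⟨b, rfl, hb⟩
    refine ⟨_, CrossedProduct.star_single γ b, fun h => ?_⟩
    rw [hb fun h' => h (by rw [h']), star_zero, map_zero]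

/-! ### The fiber product -/

/-- The subalgebra `∑ A_{γ,γ'} ⊗ C_{γ',γ''}` of `A ⊗ C`. -/
def tensorΓ (V : BGStarData B Γ A) (W : BGStarData B Γ C) : StarSubalgebra ℂ (A ⊗[ℂ] C) :=
  StarAlgebra.adjoin ℂ {t | ∃ γ γ' γ'' : Γ, ∃ a ∈ V.gr γ γ', ∃ c ∈ W.gr γ' γ'', t = a ⊗ₜ c}

namespace tensorΓ

variable {V : BGStarData B Γ A} {W : BGStarData B Γ C}

/-- The element `a ⊗ c` for `a ∈ A_{γ,γ'}` and `c ∈ C_{γ',γ''}`. -/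
def tmul {γ γ' γ'' : Γ} {a : A} {c : C} (ha : a ∈ V.gr γ γ') (hc : c ∈ W.gr γ' γ'') :
    tensorΓ V W :=
  ⟨a ⊗ₜ c, StarAlgebra.subset_adjoin ℂ _ ⟨γ, γ', γ'', a, ha, c, hc, rfl⟩⟩

lemma one_mem (V : BGStarData B Γ A) : (1 : A) ∈ V.gr 1 1 := map_one V.r ▸ V.r_mem 1

/-- The `*`-homomorphism `b ↦ f b ⊗ 1`. -/
def inlHom (f : B →⋆ₐ[ℂ] A) (hf : ∀ b, f b ∈ V.gr 1 1) : B →⋆ₐ[ℂ] tensorΓ V W where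
  toFun b := tmul (hf b) (one_mem W)
  map_one' := Subtype.ext (by simp [tmul, Algebra.TensorProduct.one_def])
  map_mul' b c := Subtype.ext (by simp [tmul])
  map_zero' := Subtype.ext (by simp [tmul])
  map_add' b c := Subtype.ext (by simp [tmul, TensorProduct.add_tmul])
  commutes' z := Subtype.ext (by
    simp [tmul, Algebra.algebraMap_eq_smul_one, Algebra.TensorProduct.one_def,
      TensorProduct.smul_tmul'])
  map_star' b := Subtype.ext (by simp [tmul, map_star f b])

/-- The `*`-homomorphism `b ↦ 1 ⊗ f b`. -/
def inrHom (f : B →⋆ₐ[ℂ] C) (hf : ∀ b, f b ∈ W.gr 1 1) : B →⋆ₐ[ℂ] tensorΓ V W where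
  toFun b := tmul (one_mem V) (hf b)
  map_one' := Subtype.ext (by simp [tmul, Algebra.TensorProduct.one_def])
  map_mul' b c := Subtype.ext (by simp [tmul])
  map_zero' := Subtype.ext (by simp [tmul])
  map_add' b c := Subtype.ext (by simp [tmul, TensorProduct.tmul_add])
  commutes' z := Subtype.ext (by
    simp [tmul, Algebra.algebraMap_eq_smul_one, Algebra.TensorProduct.one_def])
  map_star' b := Subtype.ext (by simp [tmul, map_star f b])

end tensorΓ

/-- The elements `s(b) ⊗ 1 - 1 ⊗ r(b)` of `∑ A_{γ,γ'} ⊗ C_{γ',γ''}`. -/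
def fiberRel (V : BGStarData B Γ A) (W : BGStarData B Γ C) : Set (tensorΓ V W) :=
  Set.range fun b => tensorΓ.inlHom V.s V.s_mem b - tensorΓ.inrHom W.r W.r_mem b

/-- The fiber product `A ⊗̃ C`. -/
def FiberProd (V : BGStarData B Γ A) (W : BGStarData B Γ C) : Type u := StarQuot (fiberRel V W)

namespace FiberProd

variable {V : BGStarData B Γ A} {W : BGStarData B Γ C} {V' : BGStarData B Γ A'}
  {W' : BGStarData B Γ C'}

instance : Ring (FiberProd V W) := inferInstanceAs (Ring (StarQuot _))
instance : StarRing (FiberProd V W) := inferInstanceAs (StarRing (StarQuot _))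
instance : Algebra ℂ (FiberProd V W) := inferInstanceAs (Algebra ℂ (StarQuot _))
instance : StarModule ℂ (FiberProd V W) := inferInstanceAs (StarModule ℂ (StarQuot _))

variable (V W) in
/-- The quotient map. -/
def proj : tensorΓ V W →⋆ₐ[ℂ] FiberProd V W := StarQuot.proj _

/-- The element `a ⊗̃ c` for `a ∈ A_{γ,γ'}` and `c ∈ C_{γ',γ''}`. -/
def tmul {γ γ' γ'' : Γ} {a : A} {c : C} (ha : a ∈ V.gr γ γ') (hc : c ∈ W.gr γ' γ'') :
    FiberProd V W := proj V W (tensorΓ.tmul ha hc)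

variable (V W) in
/-- The `(B, Γ)`-`*`-algebra structure of `A ⊗̃ C`: the component of degree `(γ, γ'')` is spanned by
all `a ⊗̃ c` with `a ∈ A_{γ,γ'}`, `c ∈ C_{γ',γ''}`, and `r(b) = r(b) ⊗̃ 1`, `s(b) = 1 ⊗̃ s(b)`. -/
def data : BGStarData B Γ (FiberProd V W) where
  gr γ γ'' := Submodule.span ℂ {x | ∃ γ' : Γ, ∃ (a : A) (c : C) (ha : a ∈ V.gr γ γ')
    (hc : c ∈ W.gr γ' γ''), x = tmul ha hc}
  r := (proj V W).comp (tensorΓ.inlHom V.r V.r_mem)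
  s := (proj V W).comp (tensorΓ.inrHom W.s W.s_mem)
  r_mem b := Submodule.subset_span ⟨1, _, _, V.r_mem b, tensorΓ.one_mem W, rfl⟩
  s_mem b := Submodule.subset_span ⟨1, _, _, tensorΓ.one_mem V, W.s_mem b, rfl⟩

lemma tmul_mem {γ γ' γ'' : Γ} {a : A} {c : C} (ha : a ∈ V.gr γ γ') (hc : c ∈ W.gr γ' γ'') :
    tmul ha hc ∈ (data V W).gr γ γ'' := Submodule.subset_span ⟨γ', a, c, ha, hc, rfl⟩

/-- `f ⊗ g : A ⊗ C → A' ⊗ C'` for `*`-homomorphisms `f` and `g`. -/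
def mapTensor (f : A →⋆ₐ[ℂ] A') (g : C →⋆ₐ[ℂ] C') : A ⊗[ℂ] C →⋆ₐ[ℂ] A' ⊗[ℂ] C' :=
  { Algebra.TensorProduct.map (f : A →ₐ[ℂ] A') (g : C →ₐ[ℂ] C') with
    map_star' := fun t => by
      show Algebra.TensorProduct.map (f : A →ₐ[ℂ] A') (g : C →ₐ[ℂ] C') (star t) =
        star (Algebra.TensorProduct.map (f : A →ₐ[ℂ] A') (g : C →ₐ[ℂ] C') t)
      induction t with
      | zero => simp
      | tmul a c => simp [map_star f a, map_star g c]
      | add x y hx hy => simp only [star_add, map_add, hx, hy] }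

lemma mapTensor_tmul (f : A →⋆ₐ[ℂ] A') (g : C →⋆ₐ[ℂ] C') (a : A) (c : C) :
    mapTensor f g (a ⊗ₜ c) = f a ⊗ₜ g c := rfl

lemma mapTensor_mem {f : A →⋆ₐ[ℂ] A'} {g : C →⋆ₐ[ℂ] C'} (hf : IsBGStarHom V V' f)
    (hg : IsBGStarHom W W' g) (x : tensorΓ V W) : mapTensor f g (x : A ⊗[ℂ] C) ∈ tensorΓ V' W' := by
  have h : tensorΓ V W ≤ (tensorΓ V' W').comap (mapTensor f g) := by
    refine StarAlgebra.adjoin_le ?_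
    rintro _ ⟨γ, γ', γ'', a, ha, c, hc, rfl⟩
    exact StarAlgebra.subset_adjoin ℂ _
      ⟨γ, γ', γ'', f a, hf.map_gr ha, g c, hg.map_gr hc, mapTensor_tmul f g a c⟩
  exact h x.2

/-- The morphism `f ⊗̃ g : A ⊗̃ C → A' ⊗̃ C'`. -/
def map {f : A →⋆ₐ[ℂ] A'} {g : C →⋆ₐ[ℂ] C'} (hf : IsBGStarHom V V' f) (hg : IsBGStarHom W W' g) :
    FiberProd V W →⋆ₐ[ℂ] FiberProd V' W' :=
  StarQuot.lift ((proj V' W').comp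
    (((mapTensor f g).comp (tensorΓ V W).subtype).codRestrict _ (mapTensor_mem hf hg))) <| by
      rintro _ ⟨b, rfl⟩
      have h : ((mapTensor f g).comp (tensorΓ V W).subtype).codRestrict _ (mapTensor_mem hf hg)
          (tensorΓ.inlHom V.s V.s_mem b - tensorΓ.inrHom W.r W.r_mem b) =
          tensorΓ.inlHom V'.s V'.s_mem b - tensorΓ.inrHom W'.r W'.r_mem b := by
        refine Subtype.ext ?_
        show mapTensor f g (V.s b ⊗ₜ 1 - 1 ⊗ₜ W.r b) = V'.s b ⊗ₜ 1 - 1 ⊗ₜ W'.r b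
        rw [map_sub, mapTensor_tmul, mapTensor_tmul, hf.map_s, hg.map_r, map_one, map_one]
      exact (congrArg (proj V' W') h).trans (StarQuot.proj_eq_zero ⟨b, rfl⟩)

lemma map_tmul {f : A →⋆ₐ[ℂ] A'} {g : C →⋆ₐ[ℂ] C'} (hf : IsBGStarHom V V' f)
    (hg : IsBGStarHom W W' g) {γ γ' γ'' : Γ} {a : A} {c : C} (ha : a ∈ V.gr γ γ')
    (hc : c ∈ W.gr γ' γ'') : map hf hg (tmul ha hc) = tmul (hf.map_gr ha) (hg.map_gr hc) := rfl

end FiberProd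

end BGAlgebras

/-! ### Hopf `*`-algebroids -/

section HopfAlgebroids

variable {B Γ : Type u} [CommCStarAlgebra B] [Group Γ] {α : Γ →* (B ≃⋆ₐ[ℂ] B)}
  {A : Type u} [Ring A] [StarRing A] [Algebra ℂ A] [StarModule ℂ A]

/-- The linear map `B ⋊ Γ → A`, `b γ ↦ r(b)`. -/
def rHat (V : BGStarAlg α A) (x : CrossedProduct α) : A :=
  SkewMonoidAlgebra.sum (k := B) (G := Γ) x fun _ b => V.r b

/-- The linear map `B ⋊ Γ → A`, `γ b ↦ s(b)`, that is, `b γ ↦ s(γ⁻¹(b))`. -/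
def sCheck (V : BGStarAlg α A) (x : CrossedProduct α) : A :=
  SkewMonoidAlgebra.sum (k := B) (G := Γ) x fun γ b => V.s (α γ⁻¹ b)

/-- The structure of a `(B, Γ)`-Hopf `*`-algebroid on a `(B, Γ)`-`*`-algebra `A`.

Coassociativity is formulated in terms of the canonical isomorphism of `(A ⊗̃ A) ⊗̃ A` with
`A ⊗̃ (A ⊗̃ A)`, the counit axioms in terms of the canonical isomorphisms of `A` with
`(B ⋊ Γ) ⊗̃ A` and `A ⊗̃ (B ⋊ Γ)`, which send `a ∈ A_{γ,γ'}` to `γ ⊗̃ a` and `a ⊗̃ γ'`. -/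
structure HopfStarAlgebroid (V : BGStarAlg α A) where
  Δ : A →⋆ₐ[ℂ] FiberProd V.toBGStarData V.toBGStarData
  ε : A →⋆ₐ[ℂ] CrossedProduct α
  S : A →ₗ[ℂ] A
  Δ_hom : IsBGStarHom V.toBGStarData (FiberProd.data V.toBGStarData V.toBGStarData) Δ
  ε_hom : IsBGStarHom V.toBGStarData (crossedData α) ε
  S_one : S 1 = 1
  S_mul : ∀ a b, S (a * b) = S b * S a
  S_gr : ∀ {γ γ' : Γ} {a : A}, a ∈ V.gr γ γ' → S a ∈ V.gr γ'⁻¹ γ⁻¹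
  S_r : ∀ b, S (V.r b) = V.s b
  S_s : ∀ b, S (V.s b) = V.r b
  coassoc : ∃ φ : FiberProd (FiberProd.data V.toBGStarData V.toBGStarData) V.toBGStarData ≃⋆ₐ[ℂ]
      FiberProd V.toBGStarData (FiberProd.data V.toBGStarData V.toBGStarData),
    (∀ {γ₀ γ₁ γ₂ γ₃ : Γ} {a c d : A} (ha : a ∈ V.gr γ₀ γ₁) (hc : c ∈ V.gr γ₁ γ₂)
      (hd : d ∈ V.gr γ₂ γ₃), φ (FiberProd.tmul (FiberProd.tmul_mem ha hc) hd) =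
        FiberProd.tmul ha (FiberProd.tmul_mem hc hd)) ∧
    ∀ a, φ (FiberProd.map Δ_hom (IsBGStarHom.id _) (Δ a)) =
      FiberProd.map (IsBGStarHom.id _) Δ_hom (Δ a)
  counit_left : ∀ {γ γ' : Γ} {a : A} (ha : a ∈ V.gr γ γ'),
    FiberProd.map ε_hom (IsBGStarHom.id _) (Δ a) =
      FiberProd.tmul (single_mem_crossedData α γ 1) ha
  counit_right : ∀ {γ γ' : Γ} {a : A} (ha : a ∈ V.gr γ γ'),
    FiberProd.map (IsBGStarHom.id _) ε_hom (Δ a) =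
      FiberProd.tmul ha (single_mem_crossedData α γ' 1)
  antipode_left : ∀ (a : A) (m : ℕ) (γ γ' γ'' : Fin m → Γ) (x y : Fin m → A)
    (hx : ∀ i, x i ∈ V.gr (γ i) (γ' i)) (hy : ∀ i, y i ∈ V.gr (γ' i) (γ'' i)),
    Δ a = ∑ i, FiberProd.tmul (hx i) (hy i) → ∑ i, S (x i) * y i = sCheck V (ε a)
  antipode_right : ∀ (a : A) (m : ℕ) (γ γ' γ'' : Fin m → Γ) (x y : Fin m → A)
    (hx : ∀ i, x i ∈ V.gr (γ i) (γ' i)) (hy : ∀ i, y i ∈ V.gr (γ' i) (γ'' i)),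
    Δ a = ∑ i, FiberProd.tmul (hx i) (hy i) → ∑ i, x i * S (y i) = rHat V (ε a)

/-- A matrix `v` with `v_{ij}` of degree `(γ_i, γ_j)` is a matrix corepresentation:
`Δ(v_{ij}) = ∑ v_{ik} ⊗̃ v_{kj}`, `ε(v_{ij}) = δ_{ij} γ_i`, and `(S(v_{ij}))` is inverse to `v`. -/
structure IsMatrixCorep {V : BGStarAlg α A} (H : HopfStarAlgebroid V) {n : ℕ} {g : Fin n → Γ}
    {v : Matrix (Fin n) (Fin n) A} (hv : ∀ i j, v i j ∈ V.gr (g i) (g j)) : Prop where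
  Δ_eq : ∀ i j, H.Δ (v i j) = ∑ k, FiberProd.tmul (hv i k) (hv k j)
  ε_eq : ∀ i j, H.ε (v i j) = if i = j then CrossedProduct.single (g i) 1 else 0
  mul_S : v * v.map H.S = 1
  S_mul : v.map H.S * v = 1

end HopfAlgebroids

/-! ## `(B, Γ)`-C⋆-algebras -/

section BGCStarAlgebras

open MaxTensor

variable {B Γ : Type u} [CommCStarAlgebra B] [Group Γ]

variable (B Γ) in
/-- The data underlying a `(B, Γ)`-C⋆-algebra: `*`-homomorphisms `δ : A → C⋆(Γ) ⊗ A` and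
`δ̄ : A → A ⊗ C⋆(Γ)`, where `⊗` is the maximal tensor product, and `*`-homomorphisms `r` and `s`
from `B` to `A_{e,e}`. -/
structure BGCData (A : Type u) [CStarAlgebra A] where
  δ : A →⋆ₐ[ℂ] GroupCStar Γ ⊗ᵐ A
  δbar : A →⋆ₐ[ℂ] A ⊗ᵐ GroupCStar Γ
  r : B →⋆ₐ[ℂ] A
  s : B →⋆ₐ[ℂ] A
  δ_r : ∀ b, δ (r b) = tmul (GroupCStar.gen 1) (r b)
  δ_s : ∀ b, δ (s b) = tmul (GroupCStar.gen 1) (s b)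
  δbar_r : ∀ b, δbar (r b) = tmul (r b) (GroupCStar.gen 1)
  δbar_s : ∀ b, δbar (s b) = tmul (s b) (GroupCStar.gen 1)

variable {A C D A' C' : Type u} [CStarAlgebra A] [CStarAlgebra C] [CStarAlgebra D]
  [CStarAlgebra A'] [CStarAlgebra C']

/-- The subspace `A_{γ,γ'} = {a : δ(a) = γ ⊗ a, δ̄(a) = a ⊗ γ'}`. -/
def BGCData.gr (V : BGCData B Γ A) (γ γ' : Γ) : Submodule ℂ A where
  carrier := {a | V.δ a = tmul (GroupCStar.gen γ) a ∧ V.δbar a = tmul a (GroupCStar.gen γ')}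
  add_mem' {a b} ha hb := ⟨by rw [map_add, ha.1, hb.1, tmul_add],
    by rw [map_add, ha.2, hb.2, add_tmul]⟩
  zero_mem' := by
    have h1 := tmul_smul (0 : ℂ) (GroupCStar.gen γ) (0 : A)
    have h2 := smul_tmul (0 : ℂ) (0 : A) (GroupCStar.gen γ')
    rw [zero_smul, zero_smul] at h1 h2
    exact ⟨by rw [map_zero, h1], by rw [map_zero, h2]⟩
  smul_mem' z a ha := ⟨by rw [map_smul, ha.1, tmul_smul], by rw [map_smul, ha.2, smul_tmul]⟩

lemma BGCData.one_mem (V : BGCData B Γ A) : (1 : A) ∈ V.gr 1 1 :=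
  ⟨by rw [map_one, map_one, MaxTensor.one_def], by rw [map_one, map_one, MaxTensor.one_def]⟩

/-- The axioms of a `(B, Γ)`-C⋆-algebra: `(A, δ, δ̄)` is a `(ℂ, Γ)`-C⋆-algebra, that is, `δ` and
`δ̄` are commuting injective coactions of `C⋆(Γ)`, and the sum of the subspaces `A_{γ,γ'}` is a
`(B, Γ)`-`*`-algebra with respect to `r` and `s`. -/
structure IsBGCStar (α : Γ →* (B ≃⋆ₐ[ℂ] B)) (V : BGCData B Γ A) : Prop where
  δ_injective : Function.Injective V.δ
  δbar_injective : Function.Injective V.δbar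
  coact_left : ∀ a, map (StarAlgHom.id ℂ _) V.δ (V.δ a) =
    assocHom _ _ _ (map GroupCStar.comul (StarAlgHom.id ℂ _) (V.δ a))
  coact_right : ∀ a, assocHom _ _ _ (map V.δbar (StarAlgHom.id ℂ _) (V.δbar a)) =
    map (StarAlgHom.id ℂ _) GroupCStar.comul (V.δbar a)
  coact_comm : ∀ a, assocHom _ _ _ (map V.δ (StarAlgHom.id ℂ _) (V.δbar a)) =
    map (StarAlgHom.id ℂ _) V.δbar (V.δ a)
  commute : ∀ b c, Commute (V.r b) (V.s c)
  mul_r : ∀ {γ γ' : Γ} {a : A} (b : B), a ∈ V.gr γ γ' → a * V.r b = V.r (α γ b) * a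
  mul_s : ∀ {γ γ' : Γ} {a : A} (b : B), a ∈ V.gr γ γ' → a * V.s b = V.s (α γ' b) * a

/-- Morphisms of `(B, Γ)`-C⋆-algebras. -/
structure IsBGCHom (V : BGCData B Γ A) (W : BGCData B Γ C) (f : A →⋆ₐ[ℂ] C) : Prop where
  map_δ : ∀ a, W.δ (f a) = map (StarAlgHom.id ℂ _) f (V.δ a)
  map_δbar : ∀ a, W.δbar (f a) = map f (StarAlgHom.id ℂ _) (V.δbar a)
  map_r : ∀ b, f (V.r b) = W.r b
  map_s : ∀ b, f (V.s b) = W.s b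

lemma IsBGCHom.id (V : BGCData B Γ A) : IsBGCHom V V (StarAlgHom.id ℂ A) :=
  ⟨fun _ => (map_id _).symm, fun _ => (map_id _).symm, fun _ => rfl, fun _ => rfl⟩

/-! ### The cotensor product and the fiber product -/

/-- The cotensor product `{x ∈ A ⊗ C : (δ̄ ⊗ id)(x) = (id ⊗ δ)(x)}`. -/
def cotensor (V : BGCData B Γ A) (W : BGCData B Γ C) : StarSubalgebra ℂ (A ⊗ᵐ C) :=
  StarAlgHom.equalizer ((assocHom _ _ _).comp (map V.δbar (StarAlgHom.id ℂ C)))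
    (map (StarAlgHom.id ℂ A) W.δ)

lemma mem_cotensor {V : BGCData B Γ A} {W : BGCData B Γ C} {x : A ⊗ᵐ C} :
    x ∈ cotensor V W ↔ assocHom _ _ _ (map V.δbar (StarAlgHom.id ℂ C) x) =
      map (StarAlgHom.id ℂ A) W.δ x := Iff.rfl

instance (V : BGCData B Γ A) (W : BGCData B Γ C) : IsClosed (cotensor V W : Set (A ⊗ᵐ C)) :=
  isClosed_eq (CStarEnv.continuous_hom _) (CStarEnv.continuous_hom _)

instance (V : BGCData B Γ A) (W : BGCData B Γ C) : CStarAlgebra (cotensor V W) :=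
  StarSubalgebra.cstarAlgebra (cotensor V W)

namespace cotensor

variable {V : BGCData B Γ A} {W : BGCData B Γ C} {V' : BGCData B Γ A'} {W' : BGCData B Γ C'}

/-- The element `a ⊗ c` for `a ∈ A_{γ,γ'}` and `c ∈ C_{γ',γ''}`. -/
def elem {γ γ' γ'' : Γ} {a : A} {c : C} (ha : a ∈ V.gr γ γ') (hc : c ∈ W.gr γ' γ'') :
    cotensor V W :=
  ⟨tmul a c, mem_cotensor.2 (by rw [map_tmul, map_tmul, ha.2, hc.1, assocHom_tmul]; rfl)⟩

/-- `f ⊗ g`, restricted to the cotensor products. -/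
def mapHom {f : A →⋆ₐ[ℂ] A'} {g : C →⋆ₐ[ℂ] C'} (hf : IsBGCHom V V' f) (hg : IsBGCHom W W' g) :
    cotensor V W →⋆ₐ[ℂ] cotensor V' W' :=
  ((map f g).comp (cotensor V W).subtype).codRestrict _ fun x => by
    have hx := mem_cotensor.1 x.2
    have h1 : V'.δbar.comp f = (map f (StarAlgHom.id ℂ _)).comp V.δbar :=
      StarAlgHom.ext hf.map_δbar
    have h2 : W'.δ.comp g = (map (StarAlgHom.id ℂ _) g).comp W.δ := StarAlgHom.ext hg.map_δ
    have h3 : (StarAlgHom.id ℂ A').comp f = f.comp (StarAlgHom.id ℂ A) := rfl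
    have h4 : (StarAlgHom.id ℂ C').comp g = g.comp (StarAlgHom.id ℂ C) := rfl
    show map f g (x : A ⊗ᵐ C) ∈ cotensor V' W'
    rw [mem_cotensor, map_map, map_map, h1, h2, h3, h4, ← map_map, assocHom_map, hx, map_map]

end cotensor

/-- The elements `t(b) = s(b) ⊗ 1 - 1 ⊗ r(b)` of the cotensor product. -/
def fiberRelC (V : BGCData B Γ A) (W : BGCData B Γ C) : Set (cotensor V W) :=
  {x | ∃ b : B, (x : A ⊗ᵐ C) = tmul (V.s b) 1 - tmul 1 (W.r b)}

/-- The fiber product of `(B, Γ)`-C⋆-algebras: the quotient of the cotensor product by the closed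
ideal generated by `t(B)`. -/
def FiberC (V : BGCData B Γ A) (W : BGCData B Γ C) : Type u := CStarQuot (fiberRelC V W)

instance (V : BGCData B Γ A) (W : BGCData B Γ C) : CStarAlgebra (FiberC V W) :=
  inferInstanceAs (CStarAlgebra (CStarQuot _))

namespace FiberC

variable {V : BGCData B Γ A} {W : BGCData B Γ C} {V' : BGCData B Γ A'} {W' : BGCData B Γ C'}

variable (V W) in
/-- The quotient map `q`. -/
def proj : cotensor V W →⋆ₐ[ℂ] FiberC V W := CStarQuot.proj _

/-- The class of `a ⊗ c` for `a ∈ A_{γ,γ'}` and `c ∈ C_{γ',γ''}`. -/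
def elem {γ γ' γ'' : Γ} {a : A} {c : C} (ha : a ∈ V.gr γ γ') (hc : c ∈ W.gr γ' γ'') :
    FiberC V W := proj V W (cotensor.elem ha hc)

/-- The morphism of fiber products induced by two morphisms. -/
def map {f : A →⋆ₐ[ℂ] A'} {g : C →⋆ₐ[ℂ] C'} (hf : IsBGCHom V V' f) (hg : IsBGCHom W W' g) :
    FiberC V W →⋆ₐ[ℂ] FiberC V' W' :=
  CStarQuot.lift ((proj V' W').comp (cotensor.mapHom hf hg)) fun x hx => by
    obtain ⟨b, hb⟩ := hx
    refine CStarQuot.proj_eq_zero (T := fiberRelC V' W') ⟨b, ?_⟩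
    show MaxTensor.map f g (x : A ⊗ᵐ C) = _
    rw [hb, map_sub, map_tmul, map_tmul, hf.map_s, hg.map_r, map_one, map_one]

lemma r_mem (V : BGCData B Γ A) (b : B) : V.r b ∈ V.gr 1 1 := ⟨V.δ_r b, V.δbar_r b⟩
lemma s_mem (V : BGCData B Γ A) (b : B) : V.s b ∈ V.gr 1 1 := ⟨V.δ_s b, V.δbar_s b⟩

/-- `Z` is the `(B, Γ)`-C⋆-algebra structure of the fiber product that is induced by the
restrictions of `δ ⊗ id` and `id ⊗ δ̄` to the cotensor product and by `r(b) = r(b) ⊗ 1`,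
`s(b) = 1 ⊗ s(b)`. It is uniquely determined by its values on the classes of the elements `a ⊗ c`
with `a ∈ A_{γ,γ'}` and `c ∈ C_{γ',γ''}`, which are linearly dense; these have degree
`(γ, γ'')`. -/
structure IsFiberData (V : BGCData B Γ A) (W : BGCData B Γ C) (Z : BGCData B Γ (FiberC V W)) :
    Prop where
  elem_mem : ∀ {γ γ' γ'' : Γ} {a : A} {c : C} (ha : a ∈ V.gr γ γ') (hc : c ∈ W.gr γ' γ''),
    elem ha hc ∈ Z.gr γ γ''
  r_eq : ∀ b, Z.r b = elem (r_mem V b) W.one_mem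
  s_eq : ∀ b, Z.s b = elem V.one_mem (s_mem W b)

end FiberC

end BGCStarAlgebras

/-! ### The `(B, Γ)`-C⋆-algebra `C⋆(A)` -/

section Envelopes

open MaxTensor

variable {B Γ : Type u} [CommCStarAlgebra B] [Group Γ] {α : Γ →* (B ≃⋆ₐ[ℂ] B)}
  {A : Type u} [Ring A] [StarRing A] [Algebra ℂ A] [StarModule ℂ A]

@[elab_as_elim]
lemma BGStarAlg.induction (V : BGStarAlg α A) {p : A → Prop} (a : A)
    (h1 : ∀ γ γ' a, a ∈ V.gr γ γ' → p a) (h2 : ∀ a b, p a → p b → p (a + b)) : p a := by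
  have ha : a ∈ ⨆ q : Γ × Γ, V.gr q.1 q.2 := V.isBGAlg.iSup_eq_top ▸ Submodule.mem_top
  exact Submodule.iSup_induction (motive := p) (p := fun q : Γ × Γ => V.gr q.1 q.2) ha
    (fun q x hx => h1 _ _ x hx) (h1 1 1 0 (Submodule.zero_mem _)) h2

/-- If `f` is a `*`-homomorphism and `U` a homomorphism of `Γ × Γ` into the unitaries of the
commutant of the image of `f`, then there exists a `*`-homomorphism `a ↦ U(γ, γ') f(a)` for
`a ∈ A_{γ,γ'}`. -/
lemma BGStarAlg.exists_twist (V : BGStarAlg α A) {D : Type u} [CStarAlgebra D] (f : A →⋆ₐ[ℂ] D)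
    (U : Γ × Γ →* D) (hU : ∀ q, star (U q) = U q⁻¹) (hc : ∀ q a, Commute (U q) (f a)) :
    ∃ F : A →⋆ₐ[ℂ] D, ∀ γ γ' a, a ∈ V.gr γ γ' → F a = U (γ, γ') * f a := by
  classical
  let W : Γ × Γ → Submodule ℂ A := fun q => V.gr q.1 q.2
  have hW : DirectSum.IsInternal W := DirectSum.isInternal_submodule_of_iSupIndep_of_iSup_eq_top
    V.isBGAlg.indep V.isBGAlg.iSup_eq_top
  let e := LinearEquiv.ofBijective (DirectSum.coeLinearMap W) hW
  let G : A →ₗ[ℂ] D := (DirectSum.toModule ℂ (Γ × Γ) D fun q =>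
    (LinearMap.mulLeft ℂ (U q)).comp ((f : A →ₐ[ℂ] D).toLinearMap.comp (W q).subtype)).comp
    e.symm.toLinearMap
  have hG : ∀ γ γ' a, a ∈ V.gr γ γ' → G a = U (γ, γ') * f a := by
    intro γ γ' a ha
    have h1 : e.symm a = DirectSum.lof ℂ (Γ × Γ) (fun q => W q) (γ, γ') ⟨a, ha⟩ := by
      rw [LinearEquiv.symm_apply_eq]
      exact (DirectSum.coeLinearMap_lof W (γ, γ') ⟨a, ha⟩).symm
    show DirectSum.toModule ℂ (Γ × Γ) D _ (e.symm a) = _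
    rw [h1, DirectSum.toModule_lof]
    rfl
  have hone : G 1 = 1 := by
    have h1 : (1 : A) ∈ V.gr 1 1 := map_one V.r ▸ V.r_mem 1
    rw [hG 1 1 1 h1, map_one, mul_one]
    exact map_one U
  refine ⟨⟨⟨⟨⟨⟨G, hone⟩, fun a b => ?_⟩, map_zero G, map_add G⟩, fun z => ?_⟩, fun a => ?_⟩, hG⟩
  · show G (a * b) = G a * G b
    refine V.induction a ?_ fun x y hx hy => by rw [add_mul, map_add, hx, hy, map_add, add_mul]
    intro γ γ' a ha
    refine V.induction b ?_ fun x y hx hy => by rw [mul_add, map_add, hx, hy, map_add, mul_add]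
    intro δ δ' b hb
    rw [hG _ _ _ (V.isBGAlg.mul_mem ha hb), hG _ _ _ ha, hG _ _ _ hb, map_mul]
    have h1 : U (γ * δ, γ' * δ') = U (γ, γ') * U (δ, δ') := map_mul U (γ, γ') (δ, δ')
    rw [h1, mul_assoc, mul_assoc, ← mul_assoc (U (δ, δ')), (hc (δ, δ') a).eq, mul_assoc]
  · show G (algebraMap ℂ A z) = algebraMap ℂ D z
    rw [Algebra.algebraMap_eq_smul_one, map_smul, hone, Algebra.algebraMap_eq_smul_one]
  · show G (star a) = star (G a)
    refine V.induction a ?_ fun x y hx hy => by rw [star_add, map_add, hx, hy, map_add, star_add]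
    intro γ γ' a ha
    rw [hG _ _ _ (V.star_mem ha), hG _ _ _ ha, star_mul, hU, map_star f]
    have h2 := (hc (γ, γ')⁻¹ (star a)).eq
    rwa [map_star f] at h2

variable [HasEnvelopingCStar A]

lemma BGStarAlg.exists_δ (V : BGStarAlg α A) :
    ∃ F : CStarEnv A →⋆ₐ[ℂ] GroupCStar Γ ⊗ᵐ CStarEnv A,
      ∀ γ γ' a, a ∈ V.gr γ γ' → F (CStarEnv.of a) = tmul (GroupCStar.gen γ) (CStarEnv.of a) := by
  obtain ⟨F, hF⟩ := V.exists_twist ((inr : CStarEnv A →⋆ₐ[ℂ] GroupCStar Γ ⊗ᵐ CStarEnv A).comp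
      CStarEnv.of)
    { toFun := fun q => tmul (GroupCStar.gen q.1) 1
      map_one' := by rw [Prod.fst_one, map_one, MaxTensor.one_def]
      map_mul' := fun q q' => by rw [tmul_mul_tmul, Prod.fst_mul, map_mul, mul_one] }
    (fun q => by
      show star (tmul (GroupCStar.gen q.1) 1) = tmul (GroupCStar.gen q.1⁻¹) 1
      rw [star_tmul, GroupCStar.star_gen, star_one])
    (fun q a => by
      show tmul _ 1 * tmul 1 _ = tmul 1 _ * tmul _ 1
      rw [tmul_mul_tmul, tmul_mul_tmul, mul_one, one_mul, mul_one, one_mul])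
  refine ⟨CStarEnv.lift F, fun γ γ' a ha => ?_⟩
  rw [CStarEnv.lift_of, hF γ γ' a ha]
  show tmul _ 1 * tmul 1 _ = _
  rw [tmul_mul_tmul, mul_one, one_mul]
  rfl

lemma BGStarAlg.exists_δbar (V : BGStarAlg α A) :
    ∃ F : CStarEnv A →⋆ₐ[ℂ] CStarEnv A ⊗ᵐ GroupCStar Γ,
      ∀ γ γ' a, a ∈ V.gr γ γ' → F (CStarEnv.of a) = tmul (CStarEnv.of a) (GroupCStar.gen γ') := by
  obtain ⟨F, hF⟩ := V.exists_twist ((inl : CStarEnv A →⋆ₐ[ℂ] CStarEnv A ⊗ᵐ GroupCStar Γ).comp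
      CStarEnv.of)
    { toFun := fun q => tmul 1 (GroupCStar.gen q.2)
      map_one' := by rw [Prod.snd_one, map_one, MaxTensor.one_def]
      map_mul' := fun q q' => by rw [tmul_mul_tmul, Prod.snd_mul, map_mul, mul_one] }
    (fun q => by
      show star (tmul 1 (GroupCStar.gen q.2)) = tmul 1 (GroupCStar.gen q.2⁻¹)
      rw [star_tmul, GroupCStar.star_gen, star_one])
    (fun q a => by
      show tmul 1 _ * tmul _ 1 = tmul _ 1 * tmul 1 _
      rw [tmul_mul_tmul, tmul_mul_tmul, mul_one, one_mul, mul_one, one_mul])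
  refine ⟨CStarEnv.lift F, fun γ γ' a ha => ?_⟩
  rw [CStarEnv.lift_of, hF γ γ' a ha]
  show tmul 1 _ * tmul _ 1 = _
  rw [tmul_mul_tmul, mul_one, one_mul]
  rfl

/-- The `(B, Γ)`-C⋆-algebra structure of `C⋆(A)`, given by `δ(a) = γ ⊗ a` and `δ̄(a) = a ⊗ γ'` for
`a ∈ A_{γ,γ'}`, and by `r` and `s`. -/
def envData (V : BGStarAlg α A) : BGCData B Γ (CStarEnv A) where
  δ := V.exists_δ.choose
  δbar := V.exists_δbar.choose
  r := CStarEnv.of.comp V.r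
  s := CStarEnv.of.comp V.s
  δ_r b := V.exists_δ.choose_spec 1 1 _ (V.r_mem b)
  δ_s b := V.exists_δ.choose_spec 1 1 _ (V.s_mem b)
  δbar_r b := V.exists_δbar.choose_spec 1 1 _ (V.r_mem b)
  δbar_s b := V.exists_δbar.choose_spec 1 1 _ (V.s_mem b)

lemma of_mem_envData (V : BGStarAlg α A) {γ γ' : Γ} {a : A} (ha : a ∈ V.gr γ γ') :
    (CStarEnv.of a : CStarEnv A) ∈ (envData V).gr γ γ' :=
  ⟨V.exists_δ.choose_spec γ γ' a ha, V.exists_δbar.choose_spec γ γ' a ha⟩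

end Envelopes

/-! ### Compact Hopf C⋆-algebroids -/

section CompactHopf

open MaxTensor

variable {B Γ : Type u} [CommCStarAlgebra B] [Group Γ] {α : Γ →* (B ≃⋆ₐ[ℂ] B)}

variable (α) in
/-- The full crossed product `C⋆(B ⋊ Γ)`. -/
abbrev CrossedCStar : Type u := CStarEnv (CrossedProduct α)

variable (α) in
/-- The `(B, Γ)`-C⋆-algebra structure of `C⋆(B ⋊ Γ)`. -/
def crossedDataC : BGCData B Γ (CrossedCStar α) := envData (crossedAlg α)

variable (α) in
/-- The natural map `ι : C⋆(Γ) → C⋆(B ⋊ Γ)`. -/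
def iotaΓ : GroupCStar Γ →⋆ₐ[ℂ] CrossedCStar α :=
  GroupCStar.lift
    { toFun := fun γ => CStarEnv.of (CrossedProduct.single γ 1)
      map_one' := by rw [← CrossedProduct.one_def, map_one]
      map_mul' := fun γ γ' => by
        rw [← map_mul, CrossedProduct.single_mul_single, map_one, mul_one] }
    fun γ => by
      show star (CStarEnv.of (CrossedProduct.single γ 1)) =
        CStarEnv.of (CrossedProduct.single γ⁻¹ 1)
      rw [← map_star, CrossedProduct.star_single, star_one, map_one]

lemma iotaΓ_gen (γ : Γ) : iotaΓ α (GroupCStar.gen γ) = CStarEnv.of (CrossedProduct.single γ 1) :=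
  GroupCStar.lift_gen _ _ γ

lemma iotaΓ_mem (γ : Γ) : iotaΓ α (GroupCStar.gen γ) ∈ (crossedDataC α).gr γ γ := by
  rw [iotaΓ_gen]
  exact of_mem_envData (crossedAlg α) (single_mem_crossedData α γ 1)

lemma δbar_comp_iotaΓ : (crossedDataC α).δbar.comp (iotaΓ α) =
    (map (iotaΓ α) (StarAlgHom.id ℂ _)).comp GroupCStar.comul := by
  refine GroupCStar.hom_ext fun γ => ?_
  show (crossedDataC α).δbar (iotaΓ α (GroupCStar.gen γ)) =
    map (iotaΓ α) (StarAlgHom.id ℂ _) (GroupCStar.comul (GroupCStar.gen γ))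
  rw [GroupCStar.comul_gen, map_tmul, (iotaΓ_mem γ).2]
  rfl

lemma δ_comp_iotaΓ : (crossedDataC α).δ.comp (iotaΓ α) =
    (map (StarAlgHom.id ℂ _) (iotaΓ α)).comp GroupCStar.comul := by
  refine GroupCStar.hom_ext fun γ => ?_
  show (crossedDataC α).δ (iotaΓ α (GroupCStar.gen γ)) =
    map (StarAlgHom.id ℂ _) (iotaΓ α) (GroupCStar.comul (GroupCStar.gen γ))
  rw [GroupCStar.comul_gen, map_tmul, (iotaΓ_mem γ).1]
  rfl

variable {A : Type u} [CStarAlgebra A] {V : BGCData B Γ A}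

/-- The isomorphism `L = q ∘ (ι ⊗ id) ∘ δ` of `A` with the fiber product of `C⋆(B ⋊ Γ)` and `A`. -/
def leftUnit (hV : IsBGCStar α V) : A →⋆ₐ[ℂ] FiberC (crossedDataC α) V :=
  (FiberC.proj _ _).comp
    (((map (iotaΓ α) (StarAlgHom.id ℂ A)).comp V.δ).codRestrict _ fun a => by
      show map (iotaΓ α) (StarAlgHom.id ℂ A) (V.δ a) ∈ cotensor (crossedDataC α) V
      have h2 : V.δ.comp (StarAlgHom.id ℂ A) = (StarAlgHom.id ℂ _).comp V.δ := rfl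
      have h3 : (StarAlgHom.id ℂ (CrossedCStar α)).comp (iotaΓ α) =
        (iotaΓ α).comp (StarAlgHom.id ℂ _) := rfl
      rw [mem_cotensor, map_map, map_map, δbar_comp_iotaΓ, h2, h3, ← map_map (StarAlgHom.id ℂ _),
        hV.coact_left, ← map_map, assocHom_map]
      congr 2
      exact StarAlgHom.ext fun x => map_id x)

/-- The isomorphism `R = q ∘ (id ⊗ ι) ∘ δ̄` of `A` with the fiber product of `A` and `C⋆(B ⋊ Γ)`. -/
def rightUnit (hV : IsBGCStar α V) : A →⋆ₐ[ℂ] FiberC V (crossedDataC α) :=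
  (FiberC.proj _ _).comp
    (((map (StarAlgHom.id ℂ A) (iotaΓ α)).comp V.δbar).codRestrict _ fun a => by
      show map (StarAlgHom.id ℂ A) (iotaΓ α) (V.δbar a) ∈ cotensor V (crossedDataC α)
      have h1 : V.δbar.comp (StarAlgHom.id ℂ A) =
          (map (StarAlgHom.id ℂ A) (StarAlgHom.id ℂ (GroupCStar Γ))).comp V.δbar :=
        StarAlgHom.ext fun x => (map_id (V.δbar x)).symm
      have h2 : (StarAlgHom.id ℂ (CrossedCStar α)).comp (iotaΓ α) =
        (iotaΓ α).comp (StarAlgHom.id ℂ _) := rfl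
      rw [mem_cotensor, map_map, map_map, δ_comp_iotaΓ, h1, h2, ← map_map, assocHom_map,
        hV.coact_right, map_map])

variable (α V) in
/-- The structure of a compact `(B, Γ)`-Hopf C⋆-algebroid on `A`.

Coassociativity is formulated in terms of the canonical isomorphism `φ` between the two threefold
fiber products. The closed subspaces in the cancellation conditions are spanned by all products
`Δ(a)(1 ⊗ c)` and `(c ⊗ 1)Δ(a)`, respectively, where `c` belongs to some `A_{e,γ}` or `A_{γ,e}`,
respectively. -/
structure CompactHopf where
  isBGCStar : IsBGCStar α V
  fiber : BGCData B Γ (FiberC V V)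
  isFiber : FiberC.IsFiberData V V fiber
  Δ : A →⋆ₐ[ℂ] FiberC V V
  Δ_hom : IsBGCHom V fiber Δ
  coassoc : ∃ φ : FiberC fiber V ≃⋆ₐ[ℂ] FiberC V fiber,
    (∀ {γ₀ γ₁ γ₂ γ₃ : Γ} {a c d : A} (ha : a ∈ V.gr γ₀ γ₁) (hc : c ∈ V.gr γ₁ γ₂)
      (hd : d ∈ V.gr γ₂ γ₃), φ (FiberC.elem (isFiber.elem_mem ha hc) hd) =
        FiberC.elem ha (isFiber.elem_mem hc hd)) ∧
    ∀ a, φ (FiberC.map Δ_hom (IsBGCHom.id V) (Δ a)) = FiberC.map (IsBGCHom.id V) Δ_hom (Δ a)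
  cancel_left : closure (Submodule.span ℂ {x | ∃ (a : A) (γ : Γ) (c : A) (hc : c ∈ V.gr 1 γ),
    x = Δ a * FiberC.elem V.one_mem hc} : Set (FiberC V V)) = Set.univ
  cancel_right : closure (Submodule.span ℂ {x | ∃ (a : A) (γ : Γ) (c : A) (hc : c ∈ V.gr γ 1),
    x = FiberC.elem hc V.one_mem * Δ a} : Set (FiberC V V)) = Set.univ

/-- A counit of a compact `(B, Γ)`-Hopf C⋆-algebroid: a morphism from `A` to `C⋆(B ⋊ Γ)` such that
`(ε ⊠ id) ∘ Δ` and `(id ⊠ ε) ∘ Δ` are the canonical isomorphisms `L` and `R`. -/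
structure CompactHopf.IsCounit (K : CompactHopf α V) (ε : A →⋆ₐ[ℂ] CrossedCStar α) : Prop where
  hom : IsBGCHom V (crossedDataC α) ε
  counit_left : ∀ a, FiberC.map hom (IsBGCHom.id V) (K.Δ a) = leftUnit K.isBGCStar a
  counit_right : ∀ a, FiberC.map (IsBGCHom.id V) hom (K.Δ a) = rightUnit K.isBGCStar a

/-- The comultiplication of `K` extends the comultiplication of `H` along the canonical map
`A ⊗̃ A → C⋆(A) ⊠ C⋆(A)`. -/
def CompactHopf.Extends {A : Type u} [Ring A] [StarRing A] [Algebra ℂ A] [StarModule ℂ A]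
    [HasEnvelopingCStar A] {V : BGStarAlg α A} (K : CompactHopf α (envData V))
    (H : HopfStarAlgebroid V) : Prop :=
  ∃ j : FiberProd V.toBGStarData V.toBGStarData →⋆ₐ[ℂ] FiberC (envData V) (envData V),
    (∀ {γ γ' γ'' : Γ} {a c : A} (ha : a ∈ V.gr γ γ') (hc : c ∈ V.gr γ' γ''),
      j (FiberProd.tmul ha hc) = FiberC.elem (of_mem_envData V ha) (of_mem_envData V hc)) ∧
    ∀ a, K.Δ (CStarEnv.of a) = j (H.Δ a)

end CompactHopf

/-! ## Free dynamical quantum groups -/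

section FreeQuantumGroups

open scoped Matrix

variable {B Γ : Type u} [CommCStarAlgebra B] [Group Γ]

/-- The diagonal matrix `∇ = diag(γ_1, …, γ_n)` over `B ⋊ Γ`. -/
def nabla (α : Γ →* (B ≃⋆ₐ[ℂ] B)) {n : ℕ} (g : Fin n → Γ) :
    Matrix (Fin n) (Fin n) (CrossedProduct α) :=
  Matrix.diagonal fun i => CrossedProduct.single (g i) 1

/-- `M_n(B)`, regarded as a subalgebra of `M_n(B ⋊ Γ)`. -/
def toCrossed (α : Γ →* (B ≃⋆ₐ[ℂ] B)) {n : ℕ} (F : Matrix (Fin n) (Fin n) B) :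
    Matrix (Fin n) (Fin n) (CrossedProduct α) := F.map CrossedProduct.incl

/-- `F ∈ M_n(B)` is `∇`-even: `∇ F ∇⁻¹ ∈ M_n(B)`. -/
def IsEven (α : Γ →* (B ≃⋆ₐ[ℂ] B)) {n : ℕ} (g : Fin n → Γ) (F : Matrix (Fin n) (Fin n) B) : Prop :=
  ∃ F' : Matrix (Fin n) (Fin n) B, nabla α g * toCrossed α F *
    nabla α (fun i => (g i)⁻¹) = toCrossed α F'

/-- `F ∈ M_n(B)` is `∇`-odd: `∇ F ∇ ∈ M_n(B)`. -/
def IsOdd (α : Γ →* (B ≃⋆ₐ[ℂ] B)) {n : ℕ} (g : Fin n → Γ) (F : Matrix (Fin n) (Fin n) B) : Prop :=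
  ∃ F' : Matrix (Fin n) (Fin n) B, nabla α g * toCrossed α F * nabla α g =
    toCrossed α F'

/-- The matrix `(γ_i(F_{ij}))`. It is equal to `∇ F ∇⁻¹` if `F` is `∇`-even, and to `∇ F ∇` if `F` is
`∇`-odd. -/
def twist (α : Γ →* (B ≃⋆ₐ[ℂ] B)) {n : ℕ} (g : Fin n → Γ) (F : Matrix (Fin n) (Fin n) B) :
    Matrix (Fin n) (Fin n) B := Matrix.of fun i j => α (g i) (F i j)

lemma nabla_mul_nabla (α : Γ →* (B ≃⋆ₐ[ℂ] B)) {n : ℕ} (g h : Fin n → Γ)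
    (F : Matrix (Fin n) (Fin n) B) (i j : Fin n) :
    (nabla α g * toCrossed α F * nabla α h) i j =
      CrossedProduct.single (g i * h j) (α (g i) (F i j)) := by
  refine (Matrix.mul_diagonal _ _ i j).trans ?_
  refine (congrArg (· * CrossedProduct.single (h j) 1) (Matrix.diagonal_mul _ _ i j)).trans ?_
  show CrossedProduct.single (g i) 1 * CrossedProduct.single 1 (F i j) *
    CrossedProduct.single (h j) 1 = _
  rw [CrossedProduct.single_mul_single, CrossedProduct.single_mul_single, one_mul, mul_one,
    map_one, mul_one]

lemma nabla_mul_nabla_eq {α : Γ →* (B ≃⋆ₐ[ℂ] B)} {n : ℕ} {g h : Fin n → Γ}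
    {F F' : Matrix (Fin n) (Fin n) B}
    (hF : nabla α g * toCrossed α F * nabla α h = toCrossed α F') :
    F' = twist α g F ∧ ∀ i j, g i * h j ≠ 1 → F i j = 0 := by
  have h1 : ∀ i j, CrossedProduct.single (g i * h j) (α (g i) (F i j)) =
      (CrossedProduct.single 1 (F' i j) : CrossedProduct α) := fun i j => by
    rw [← nabla_mul_nabla, hF]
    rfl
  have h2 : ∀ i j, g i * h j ≠ 1 → F i j = 0 ∧ F' i j = 0 := by
    intro i j hij
    constructor
    · have h3 := congrArg (CrossedProduct.coeff (g i * h j)) (h1 i j)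
      rw [CrossedProduct.coeff_single_same, CrossedProduct.coeff_single_ne hij] at h3
      exact (map_eq_zero_iff (α (g i)) (α (g i)).injective).1 h3
    · have h3 := congrArg (CrossedProduct.coeff 1) (h1 i j)
      rw [CrossedProduct.coeff_single_same, CrossedProduct.coeff_single_ne hij.symm] at h3
      exact h3.symm
  refine ⟨?_, fun i j hij => (h2 i j hij).1⟩
  ext i j
  by_cases hij : g i * h j = 1
  · have h3 := congrArg (CrossedProduct.coeff 1) (h1 i j)
    rw [hij, CrossedProduct.coeff_single_same, CrossedProduct.coeff_single_same] at h3
    exact h3.symm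
  · show F' i j = α (g i) (F i j)
    rw [(h2 i j hij).1, (h2 i j hij).2, map_zero]

lemma IsEven.twist_eq {α : Γ →* (B ≃⋆ₐ[ℂ] B)} {n : ℕ} {g : Fin n → Γ}
    {F : Matrix (Fin n) (Fin n) B} (hF : IsEven α g F) : nabla α g * toCrossed α F *
      nabla α (fun i => (g i)⁻¹) = toCrossed α (twist α g F) := by
  obtain ⟨F', h⟩ := hF
  rw [← (nabla_mul_nabla_eq h).1, h]

lemma IsOdd.twist_eq {α : Γ →* (B ≃⋆ₐ[ℂ] B)} {n : ℕ} {g : Fin n → Γ}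
    {F : Matrix (Fin n) (Fin n) B} (hF : IsOdd α g F) : nabla α g * toCrossed α F *
      nabla α g = toCrossed α (twist α g F) := by
  obtain ⟨F', h⟩ := hF
  rw [← (nabla_mul_nabla_eq h).1, h]

variable (α : Γ →* (B ≃⋆ₐ[ℂ] B)) {n : ℕ} (g : Fin n → Γ)

/-- `v` is invertible and `r_n(F') v^{-⊤} = v s_n(F)`, where `F' = (γ_i(F_{ij}))` and where `v^{-⊤}`
denotes the transpose of `v⁻¹`. -/
def InvTransposeRel (F : Matrix (Fin n) (Fin n) B) {A : Type u} [Ring A] [Algebra ℂ A]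
    (r s : B →ₐ[ℂ] A) (v : Matrix (Fin n) (Fin n) A) : Prop :=
  ∃ w : Matrix (Fin n) (Fin n) A, v * w = 1 ∧ w * v = 1 ∧
    (twist α g F).map r * wᵀ = v * F.map s

/-- `r_n(F') v = v s_n(F)`, where `F' = (γ_i(F_{ij}))`. -/
def SelfRel (F : Matrix (Fin n) (Fin n) B) {A : Type u} [Ring A] [Algebra ℂ A]
    (r s : B →ₐ[ℂ] A) (v : Matrix (Fin n) (Fin n) A) : Prop :=
  (twist α g F).map r * v = v * F.map s

/-- `r_n(F') v̄ = v s_n(F)`, where `F' = (γ_i(F_{ij}))` and `v̄ = (v_{ij}⋆)`. -/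
def BarRel (F : Matrix (Fin n) (Fin n) B) {A : Type u} [Ring A] [StarRing A] [Algebra ℂ A]
    (r s : B →⋆ₐ[ℂ] A) (v : Matrix (Fin n) (Fin n) A) : Prop :=
  (twist α g F).map r * v.map star = v * F.map s

/-- `v` is unitary, `v̄ = (v_{ij}⋆)` is invertible and `r_n(F') v̄^{-⊤} = v s_n(F)`, where
`F' = (γ_i(F_{ij}))` and `v̄^{-⊤}` denotes the transpose of `v̄⁻¹`. -/
def UnitaryRel (F : Matrix (Fin n) (Fin n) B) {A : Type u} [Ring A] [StarRing A] [Algebra ℂ A]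
    (r s : B →⋆ₐ[ℂ] A) (v : Matrix (Fin n) (Fin n) A) : Prop :=
  v * vᴴ = 1 ∧ vᴴ * v = 1 ∧
    ∃ w : Matrix (Fin n) (Fin n) A, v.map star * w = 1 ∧ w * v.map star = 1 ∧
      (twist α g F).map r * wᵀ = v * F.map s

/-- `(A, v)` is the free unitary dynamical quantum group with parameters `(∇, F)`: the universal
`(B, Γ)`-`*`-algebra with a unitary matrix `v` such that `v_{ij} ∈ A_{γ_i,γ_j}`, `v̄` is invertible
and `r_n(∇F∇⁻¹) v̄^{-⊤} = v s_n(F)`. -/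
structure IsFreeUnitary (F : Matrix (Fin n) (Fin n) B) {A : Type u} [Ring A] [StarRing A]
    [Algebra ℂ A] [StarModule ℂ A] (V : BGStarAlg α A) (v : Matrix (Fin n) (Fin n) A) : Prop where
  v_mem : ∀ i j, v i j ∈ V.gr (g i) (g j)
  rel : UnitaryRel α g F V.r V.s v
  universal : ∀ (C : Type u) [Ring C] [StarRing C] [Algebra ℂ C] [StarModule ℂ C]
    (W : BGStarAlg α C) (w : Matrix (Fin n) (Fin n) C), (∀ i j, w i j ∈ W.gr (g i) (g j)) →
    UnitaryRel α g F W.r W.s w →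
    ∃! f : A →⋆ₐ[ℂ] C, IsBGStarHom V.toBGStarData W.toBGStarData f ∧ ∀ i j, f (v i j) = w i j

/-- `(A, v)` is the free orthogonal dynamical quantum group with parameters `(∇, F, G)`. As a
`(B, Γ)`-algebra, it is universal with an invertible matrix `v` such that `v_{ij} ∈ A_{γ_i,γ_j}`,
`r_n(∇F∇) v^{-⊤} = v s_n(F)` and `r_n(∇Q∇⁻¹) v = v s_n(Q)`, where `Q = G(∇Ḡ∇)`. The involution is
the one that satisfies `r_n(∇G∇) v̄ = v s_n(G)`. -/
structure IsFreeOrthogonal (F G : Matrix (Fin n) (Fin n) B) {A : Type u} [Ring A] [StarRing A]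
    [Algebra ℂ A] [StarModule ℂ A] (V : BGStarAlg α A) (v : Matrix (Fin n) (Fin n) A) : Prop where
  v_mem : ∀ i j, v i j ∈ V.gr (g i) (g j)
  rel_F : InvTransposeRel α g F V.toBGAlg.r V.toBGAlg.s v
  rel_Q : SelfRel α g (G * twist α g (G.map star)) V.toBGAlg.r V.toBGAlg.s v
  universal : ∀ (C : Type u) [Ring C] [Algebra ℂ C] (W : BGAlg α C)
    (w : Matrix (Fin n) (Fin n) C), (∀ i j, w i j ∈ W.gr (g i) (g j)) →
    InvTransposeRel α g F W.r W.s w →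
    SelfRel α g (G * twist α g (G.map star)) W.r W.s w →
    ∃! f : A →ₐ[ℂ] C, IsBGHom V.toBGAlg W f ∧ ∀ i j, f (v i j) = w i j
  rel_G : BarRel α g G V.r V.s v

/-- The relations between `r`, `s` and `v`: the images of `r` and `s` commute, and
`v_{ij} r(b) = r(γ_i(b)) v_{ij}` and `v_{ij} s(b) = s(γ_j(b)) v_{ij}`. -/
structure BaseRel {D : Type u} [CStarAlgebra D] (r s : B →⋆ₐ[ℂ] D)
    (v : Matrix (Fin n) (Fin n) D) : Prop where
  commute : ∀ b c, Commute (r b) (s c)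
  mul_r : ∀ i j b, v i j * r b = r (α (g i) b) * v i j
  mul_s : ∀ i j b, v i j * s b = s (α (g j) b) * v i j

/-- `X` is the universal C⋆-algebra generated by the images of `*`-homomorphisms `r`, `s` of `B` and
by the entries of an `n × n`-matrix `v`, subject to the relations `R`. -/
structure IsUniversalCStar
    (R : ∀ (D : Type u) [CStarAlgebra D], (B →⋆ₐ[ℂ] D) → (B →⋆ₐ[ℂ] D) →
      Matrix (Fin n) (Fin n) D → Prop)
    {X : Type u} [CStarAlgebra X] (r s : B →⋆ₐ[ℂ] X) (v : Matrix (Fin n) (Fin n) X) : Prop where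
  rel : R X r s v
  generates : closure (StarAlgebra.adjoin ℂ (Set.range r ∪ Set.range s ∪
    {x | ∃ i j, x = v i j}) : Set X) = Set.univ
  universal : ∀ (D : Type u) [CStarAlgebra D] (r' s' : B →⋆ₐ[ℂ] D) (v' : Matrix (Fin n) (Fin n) D),
    R D r' s' v' → ∃! f : X →⋆ₐ[ℂ] D, (∀ b, f (r b) = r' b) ∧ (∀ b, f (s b) = s' b) ∧
      ∀ i j, f (v i j) = v' i j

/-- The relations of the first presentation. -/
def UnitaryPresentation (F : Matrix (Fin n) (Fin n) B) (D : Type u) [CStarAlgebra D]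
    (r s : B →⋆ₐ[ℂ] D) (v : Matrix (Fin n) (Fin n) D) : Prop :=
  BaseRel α g r s v ∧ UnitaryRel α g F r s v

/-- The relations of the second presentation. -/
def OrthogonalPresentation (F G : Matrix (Fin n) (Fin n) B) (D : Type u) [CStarAlgebra D]
    (r s : B →⋆ₐ[ℂ] D) (v : Matrix (Fin n) (Fin n) D) : Prop :=
  BaseRel α g r s v ∧ InvTransposeRel α g F (r : B →ₐ[ℂ] D) (s : B →ₐ[ℂ] D) v ∧
    BarRel α g G r s v

variable {α g}

/-- The explicit formulas `δ(v_{ij}) = γ_i ⊗ v_{ij}`, `δ̄(v_{ij}) = v_{ij} ⊗ γ_j`,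
`Δ(v_{ij}) = ∑ v_{ik} ⊗ v_{kj}` and `ε(v_{ij}) = δ_{ij} γ_i`. -/
structure IsExplicit {X : Type u} [CStarAlgebra X] {V : BGCData B Γ X} (K : CompactHopf α V)
    (ε : X →⋆ₐ[ℂ] CrossedCStar α) (g : Fin n → Γ) (v : Matrix (Fin n) (Fin n) X) : Prop where
  δ_eq : ∀ i j, V.δ (v i j) = MaxTensor.tmul (GroupCStar.gen (g i)) (v i j)
  δbar_eq : ∀ i j, V.δbar (v i j) = MaxTensor.tmul (v i j) (GroupCStar.gen (g j))
  Δ_eq : ∀ i j, K.Δ (v i j) = ∑ k, FiberC.elem (V := V) (W := V) (γ := g i) (γ' := g k)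
    (γ'' := g j) ⟨δ_eq i k, δbar_eq i k⟩ ⟨δ_eq k j, δbar_eq k j⟩
  ε_eq : ∀ i j, ε (v i j) = if i = j then iotaΓ α (GroupCStar.gen (g i)) else 0

end FreeQuantumGroups

end

/-!
# Enveloping C⋆-algebras of Hopf `*`-algebroids and free dynamical quantum groups

*The cotensor product.* The fiber product `A ⊠ C` is a quotient of the cotensor product of `A` and
`C`, a C⋆-subalgebra of the maximal tensor product `A ⊗ C`. The maximal tensor product does not
preserve inclusions, so that coassociativity is not formal. The remedy is a conditional expectation
`E` of `A ⊗ C` onto the cotensor product, which annihilates the elementary tensors of homogeneous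
elements with different inner degrees. It comes from the slice map of `X ⊗ C⋆(Γ × Γ)` for the
diagonal subgroup (`slice`, `IsHomogDense.expect`); slice maps are contractive because their
compositions with states are positive functionals, to which the Gelfand–Naimark–Segal construction
applies (`norm_algSlice_le`). The matrices `(E(u_k⋆ u_l))` are sums of Gram matrices, one for each
degree (`IsClassExpectation`), so `id ⊗ E` takes states of `Z ⊗ (A □ C)` to positive functionals on
`Z ⊗ (A ⊗ C)`. Hence `Z ⊗ (A □ C)` embeds into `Z ⊗ (A ⊗ C)` (`IsHomogDense.inclusion_injective`).
Since the relations `s(b) ⊗ 1 - 1 ⊗ r(b)` have trivial degree and can be moved past homogeneous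
elements, homomorphisms on cotensor products descend to quotients in both factors
(`exists_cotensor_lift`), and the fiber product of C⋆-algebras is associative
(`IsHomogDense.exists_fiber_assoc`).

*Hopf `*`-algebroids.* The algebraic fiber product maps to the C⋆-algebraic one
(`FiberProd.toFiberC`), so `Δ` and `ε` extend to the enveloping C⋆-algebra, and the axioms hold
there because they hold on homogeneous elements. Cancellation is the identity
`a ⊗ c = ∑ Δ(x_i) (1 ⊗ S(y_i) c)` for `Δ(a) = ∑ x_i ⊗ y_i` and its mirror image
(`HopfStarAlgebroid.tmul_mem_spanLeft`, `HopfStarAlgebroid.exists_compactHopf`).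

*Free algebras.* Both families are treated as instances of one scheme (`MatrixPresentation`): three
matrices `v`, `u` (which becomes `v̄`) and `z`, some of which are inverse to the transpose of
others, with intertwiners from `M_n(B)`. The universal algebra without involution is a quotient of a free
algebra. A universal property suffices for each structure: systems in the group algebra of `Γ × Γ`
over `A` give the grading (`IsUniversalAlg.exists_bgAlg`), systems in the conjugate opposite algebra
the involution (`IsUniversalAlg.exists_bgStarAlg`), the products of matrices the comultiplication,
diagonal matrices the counit, and the inverse matrices, which form a system in the opposite algebra,
the antipode (`IsPresented.exists_hopf`). The relations of the adjoints follow from `F = F⋆` in the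
unitary case and from `G F⋆ = F G⋆` and the relation of `Q` in the orthogonal case.

*Boundedness.* The entries of a unitary matrix are contractions in every representation. In the
orthogonal case, `G⁻¹ F = c M̄ M⊤` makes `r_n(M⁻¹) v s_n(∇⁻¹ M ∇)` unitary (`exists_unitary_conj`).
-/

noncomputable section

/-! ### Positive functionals -/

section PositiveFunctionals

/-- A hermitian positive functional on a `*`-algebra. -/
structure IsPosFunctional {A : Type u} [Ring A] [StarRing A] [Algebra ℂ A] (f : A →ₗ[ℂ] ℂ) :
    Prop where
  apply_star : ∀ a, f (star a) = star (f a)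
  nonneg : ∀ a, 0 ≤ (f (star a * a)).re

variable {A : Type u} [Ring A] [StarRing A] [Algebra ℂ A] [StarModule ℂ A] {f : A →ₗ[ℂ] ℂ}

/-- The elements of `A` that act boundedly by left multiplication on the pre-Hilbert space given
by `f`. -/
def IsBoundedFor (f : A →ₗ[ℂ] ℂ) (a : A) : Prop :=
  ∃ C : ℝ, ∀ x, (f (star (a * x) * (a * x))).re ≤ C * (f (star x * x)).re

lemma IsBoundedFor.mul (hf : IsPosFunctional f) {a b : A} (ha : IsBoundedFor f a)
    (hb : IsBoundedFor f b) : IsBoundedFor f (a * b) := by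
  obtain ⟨C, hC⟩ := ha
  obtain ⟨D, hD⟩ := hb
  refine ⟨max C 0 * D, fun x => ?_⟩
  rw [mul_assoc a b x, mul_assoc (max C 0)]
  refine (hC _).trans ?_
  refine (mul_le_mul_of_nonneg_right (le_max_left C 0) (hf.nonneg _)).trans ?_
  exact mul_le_mul_of_nonneg_left (hD x) (le_max_right C 0)

lemma IsBoundedFor.add (hf : IsPosFunctional f) {a b : A} (ha : IsBoundedFor f a)
    (hb : IsBoundedFor f b) : IsBoundedFor f (a + b) := by
  obtain ⟨C, hC⟩ := ha
  obtain ⟨D, hD⟩ := hb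
  refine ⟨2 * (C + D), fun x => ?_⟩
  have h1 := hf.nonneg (a * x - b * x)
  have h2 : star ((a + b) * x) * ((a + b) * x) + star (a * x - b * x) * (a * x - b * x) =
      (2 : ℂ) • (star (a * x) * (a * x)) + (2 : ℂ) • (star (b * x) * (b * x)) := by
    rw [add_mul, star_add, star_sub, two_smul, two_smul]
    noncomm_ring
  have h3 := congrArg (fun y => (f y).re) h2
  simp only [map_add, map_smul, Complex.add_re, smul_eq_mul, Complex.mul_re, Complex.re_ofNat,
    Complex.im_ofNat, zero_mul, sub_zero] at h3
  nlinarith [hC x, hD x]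

/-- The Gelfand–Naimark–Segal construction for a positive functional on a `*`-algebra: if all
elements act boundedly, then `f(w⋆ w) ≤ c² f(1)` as soon as `c` bounds the norm of `w` in every
representation. -/
lemma IsPosFunctional.le_of_forall_norm_le (hf : IsPosFunctional f)
    (hb : ∀ a, IsBoundedFor f a) {w : A} {c : ℝ}
    (hc : ∀ (D : Type u) [CStarAlgebra D] (π : A →⋆ₐ[ℂ] D), ‖π w‖ ≤ c) :
    (f (star w * w)).re ≤ c ^ 2 * (f 1).re := by
  let core : PreInnerProductSpace.Core ℂ A :=
    { inner := fun a b => f (star a * b)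
      conj_inner_symm := fun a b => by
        show star (f (star b * a)) = f (star a * b)
        rw [← hf.apply_star, star_mul, star_star]
      re_inner_nonneg := fun a => hf.nonneg a
      add_left := fun a b c => by rw [star_add, add_mul, map_add]
      smul_left := fun a b z => by
        rw [star_smul, smul_mul_assoc, map_smul]
        rfl }
  let i1 : SeminormedAddCommGroup A := InnerProductSpace.Core.toSeminormedAddCommGroup (c := core)
  let i2 : InnerProductSpace ℂ A := InnerProductSpace.ofCore core
  have hinner : ∀ a b : A, inner ℂ a b = f (star a * b) := fun _ _ => rfl
  have hnorm : ∀ a : A, ‖a‖ ^ 2 = (f (star a * a)).re := fun a => by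
    rw [← hinner]
    exact norm_sq_eq_re_inner (𝕜 := ℂ) a
  have hL : ∀ a : A, ∃ L : A →L[ℂ] A, ∀ x, L x = a * x := fun a => by
    obtain ⟨C, hC⟩ := hb a
    refine ⟨(LinearMap.mulLeft ℂ a).mkContinuous (Real.sqrt (max C 0)) fun x => ?_, fun x => rfl⟩
    refine le_of_sq_le_sq ?_ (by positivity)
    rw [mul_pow, hnorm, hnorm, Real.sq_sqrt (le_max_right _ _)]
    exact (hC x).trans (mul_le_mul_of_nonneg_right (le_max_left C 0) (hf.nonneg _))
  choose L hL using hL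
  let H := UniformSpace.Completion A
  have hLc : ∀ a x : A, (L a).completion (x : H) = ((a * x : A) : H) := fun a x => by
    rw [ContinuousLinearMap.completion_apply_coe, hL]
  have hext : ∀ S T : H →L[ℂ] H, (∀ x : A, S (x : H) = T (x : H)) → S = T := fun S T h => by
    ext x
    induction x using UniformSpace.Completion.induction_on with
    | hp => exact isClosed_eq S.continuous T.continuous
    | ih x => exact h x
  let π : A →⋆ₐ[ℂ] (H →L[ℂ] H) :=
    { toFun := fun a => (L a).completion
      map_one' := hext _ _ fun x => by rw [hLc, one_mul]; rfl
      map_mul' := fun a b => hext _ _ fun x => by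
        show _ = (L a).completion ((L b).completion _)
        rw [hLc, hLc, hLc, mul_assoc]
      map_zero' := hext _ _ fun x => by
        rw [hLc, zero_mul]
        rfl
      map_add' := fun a b => hext _ _ fun x => by
        rw [_root_.add_apply, hLc, hLc, hLc, add_mul, UniformSpace.Completion.coe_add]
      commutes' := fun z => hext _ _ fun x => by
        rw [hLc, ← Algebra.smul_def, Algebra.algebraMap_eq_smul_one,
          _root_.smul_apply, UniformSpace.Completion.coe_smul]
        rfl
      map_star' := fun a => by
        refine (ContinuousLinearMap.eq_adjoint_iff _ _).2 fun x y => ?_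
        induction x, y using UniformSpace.Completion.induction_on₂ with
        | hp => apply isClosed_eq <;> fun_prop
        | ih x y =>
          rw [hLc, hLc, UniformSpace.Completion.inner_coe, UniformSpace.Completion.inner_coe,
            hinner, hinner, star_mul, star_star, mul_assoc] }
  have h1 := hc _ π
  have h2 : ‖π w ((1 : A) : H)‖ ≤ c * ‖((1 : A) : H)‖ :=
    ((π w).le_opNorm _).trans (mul_le_mul_of_nonneg_right h1 (norm_nonneg _))
  have h3 : π w ((1 : A) : H) = ((w : A) : H) := by
    show (L w).completion _ = _
    rw [hLc, mul_one]
  rw [h3, UniformSpace.Completion.norm_coe, UniformSpace.Completion.norm_coe] at h2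
  have h4 := pow_le_pow_left₀ (norm_nonneg _) h2 2
  rw [mul_pow, hnorm, hnorm, star_one, one_mul] at h4
  exact h4

/-- The image of a C⋆-algebra acts boundedly for every positive functional. -/
lemma IsPosFunctional.isBoundedFor_map (hf : IsPosFunctional f) {D : Type u} [CStarAlgebra D]
    (i : D →⋆ₐ[ℂ] A) (d : D) : IsBoundedFor f (i d) := by
  let : PartialOrder D := CStarAlgebra.spectralOrder D
  have : StarOrderedRing D := CStarAlgebra.spectralOrderedRing D
  have h0 : (0 : D) ≤ algebraMap ℝ D (‖star d * d‖) - star d * d :=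
    sub_nonneg.2 (IsSelfAdjoint.star_mul_self d).le_algebraMap_norm_self
  obtain ⟨y, hy⟩ := CStarAlgebra.nonneg_iff_eq_star_mul_self.1 h0
  refine ⟨‖star d * d‖, fun x => ?_⟩
  have h1 := hf.nonneg (i y * x)
  have h2 : star (i y * x) * (i y * x) =
      ((‖star d * d‖ : ℝ) : ℂ) • (star x * x) - star (i d * x) * (i d * x) := by
    have h3 : i (star y * y) = ((‖star d * d‖ : ℝ) : ℂ) • (1 : A) - i (star d * d) := by
      rw [← hy, map_sub]
      congr 1
      rw [IsScalarTower.algebraMap_apply ℝ ℂ D, AlgHomClass.commutes,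
        Algebra.algebraMap_eq_smul_one]
      rfl
    calc star (i y * x) * (i y * x) = star x * i (star y * y) * x := by
          rw [star_mul, map_mul, map_star i]
          noncomm_ring
      _ = _ := by
          rw [h3, mul_sub, sub_mul, star_mul, map_mul, map_star i, mul_smul_comm, mul_one,
            smul_mul_assoc]
          noncomm_ring
  rw [h2, map_sub, map_smul, Complex.sub_re, smul_eq_mul, Complex.re_ofReal_mul] at h1
  linarith

end PositiveFunctionals

/-- Enough states: every element of a C⋆-algebra attains its norm on some state. -/
lemma exists_state_apply_eq_norm_sq {D : Type u} [CStarAlgebra D] (y : D) :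
    ∃ f : D →L[ℂ] ℂ, IsPosFunctional (f : D →ₗ[ℂ] ℂ) ∧ (f 1).re ≤ 1 ∧
      (f (star y * y)).re = ‖y‖ ^ 2 := by
  rcases subsingleton_or_nontrivial D with _ | _
  · refine ⟨0, ⟨fun a => by simp, fun a => by simp⟩, by simp, ?_⟩
    rw [Subsingleton.elim y 0]
    simp
  let : PartialOrder D := CStarAlgebra.spectralOrder D
  have : StarOrderedRing D := CStarAlgebra.spectralOrderedRing D
  have hp : 0 ≤ star y * y := star_mul_self_nonneg y
  have h1 : (1 + ‖star y * y‖ : ℝ) ≤ ‖1 + star y * y‖ := by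
    have h := spectrum.add_mem_add_iff (r := (‖star y * y‖ : ℝ)) (s := 1) (a := star y * y)
    have h2 := h.2 (CStarAlgebra.norm_mem_spectrum_of_nonneg hp)
    have h3 := spectrum.norm_le_norm_of_mem h2
    rw [map_one] at h3
    rw [Real.norm_of_nonneg (by positivity)] at h3
    linarith
  obtain ⟨g, hg1, hg2⟩ := exists_dual_vector'' ℂ (1 + star y * y)
  have hle : ∀ a : D, (g a).re ≤ ‖a‖ := fun a =>
    (Complex.re_le_norm _).trans ((g.le_opNorm a).trans
      (mul_le_of_le_one_left (norm_nonneg _) hg1))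
  have hre : (g 1).re + (g (star y * y)).re = ‖1 + star y * y‖ := by
    rw [← Complex.add_re, ← map_add, hg2]
    rfl
  have hone : (g 1).re ≤ 1 := (hle 1).trans CStarRing.norm_one.le
  have hy := hle (star y * y)
  have hone' : (g 1).re = 1 := by linarith
  have hy' : (g (star y * y)).re = ‖star y * y‖ := by linarith
  have hpos : ∀ a : D, 0 ≤ (g (star a * a)).re := by
    intro a
    have key : ∀ b : D, 0 ≤ b → ‖b‖ ≤ 1 → 0 ≤ (g b).re := by
      intro b hb hb1
      have hb2 : b ≤ 1 := (CStarAlgebra.norm_le_one_iff_of_nonneg b hb).1 hb1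
      have h := hle (1 - b)
      have h' : ‖1 - b‖ ≤ 1 := (CStarAlgebra.norm_le_one_iff_of_nonneg _ (sub_nonneg.2 hb2)).2
        (sub_le_self _ hb)
      rw [map_sub, Complex.sub_re] at h
      linarith
    by_cases ha : a = 0
    · simp [ha]
    · have hn : 0 < ‖a‖ := norm_pos_iff.2 ha
      have h := key (star ((‖a‖⁻¹ : ℂ) • a) * ((‖a‖⁻¹ : ℂ) • a)) (star_mul_self_nonneg _) (by
        rw [CStarRing.norm_star_mul_self, norm_smul]
        simp [hn.ne'])
      have h2 : star ((‖a‖⁻¹ : ℂ) • a) * ((‖a‖⁻¹ : ℂ) • a) =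
          (((‖a‖⁻¹ * ‖a‖⁻¹ : ℝ)) : ℂ) • (star a * a) := by
        rw [star_smul, smul_mul_assoc, mul_smul_comm, smul_smul]
        simp
      rw [h2, map_smul, smul_eq_mul, Complex.re_ofReal_mul] at h
      exact nonneg_of_mul_nonneg_right h (by positivity)
  -- Averaging `g` with its adjoint makes it hermitian without changing the real parts involved.
  let G : D →ₗ[ℂ] ℂ :=
    { toFun := fun a => (1 / 2 : ℂ) * (g a + star (g (star a)))
      map_add' := fun a b => by
        rw [star_add, map_add, map_add, star_add]
        ring
      map_smul' := fun z a => by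
        rw [star_smul, map_smul, map_smul, smul_eq_mul, smul_eq_mul, star_mul', star_star,
          RingHom.id_apply, smul_eq_mul]
        ring }
  have hG : ∀ a, G a = (1 / 2 : ℂ) * (g a + star (g (star a))) := fun _ => rfl
  have hGsa : ∀ a, star a = a → (G a).re = (g a).re := by
    intro a ha
    rw [hG, ha]
    simp
    ring
  refine ⟨G.mkContinuous 1 fun a => ?_, ⟨fun a => ?_, fun a => ?_⟩, ?_, ?_⟩
  · have h3 : ‖g a‖ ≤ ‖a‖ := (g.le_opNorm a).trans (mul_le_of_le_one_left (norm_nonneg _) hg1)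
    have h4 : ‖g (star a)‖ ≤ ‖a‖ := by
      rw [← norm_star a]
      exact (g.le_opNorm _).trans (mul_le_of_le_one_left (norm_nonneg _) hg1)
    rw [hG, norm_mul]
    have h5 := norm_add_le (g a) (star (g (star a)))
    rw [norm_star] at h5
    have h6 : ‖(1 / 2 : ℂ)‖ = 1 / 2 := by simp
    rw [h6]
    linarith
  · show G (star a) = star (G a)
    rw [hG, hG, star_star, star_mul', star_add, star_star]
    simp
    ring
  · show 0 ≤ (G (star a * a)).re
    rw [hGsa _ (by rw [star_mul, star_star])]
    exact hpos a
  · show (G 1).re ≤ 1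
    rw [hGsa 1 (star_one D), hone']
  · show (G (star y * y)).re = _
    rw [hGsa _ (by rw [star_mul, star_star]), hy', CStarRing.norm_star_mul_self, sq]

/-! ### Shortcut instances -/

section Shortcuts

variable {A C G : Type u} [CStarAlgebra A] [CStarAlgebra C] [Group G]

instance MaxTensor.instCStarAlgebra : CStarAlgebra (A ⊗ᵐ C) := inferInstance
instance MaxTensor.instRing : Ring (A ⊗ᵐ C) := inferInstance
instance MaxTensor.instSemiring : Semiring (A ⊗ᵐ C) := inferInstance
instance MaxTensor.instAlgebra : Algebra ℂ (A ⊗ᵐ C) := inferInstance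
instance MaxTensor.instStar : Star (A ⊗ᵐ C) := inferInstance
instance MaxTensor.instAddCommMonoid : AddCommMonoid (A ⊗ᵐ C) := inferInstance
instance MaxTensor.instModule : Module ℂ (A ⊗ᵐ C) := inferInstance
instance MaxTensor.instNormedAddCommGroup : NormedAddCommGroup (A ⊗ᵐ C) := inferInstance
instance MaxTensor.instNormedSpace : NormedSpace ℂ (A ⊗ᵐ C) := inferInstance
instance MaxTensor.instTopologicalSpace : TopologicalSpace (A ⊗ᵐ C) := inferInstance
instance GroupCStar.instCStarAlgebra : CStarAlgebra (GroupCStar G) := inferInstance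

end Shortcuts

/-! ### Slice maps on `X ⊗ C⋆(G)` -/

section Slices

open MaxTensor

namespace MaxTensor

variable {X Y D : Type u} [CStarAlgebra X] [CStarAlgebra Y] [CStarAlgebra D]

lemma tmul_eq (x : X) (y : Y) : (tmul x y : X ⊗ᵐ Y) = inl x * inr y := by
  rw [inl_apply, inr_apply, tmul_mul_tmul, mul_one, one_mul]

lemma continuous_tmul : Continuous fun p : X × Y => (tmul p.1 p.2 : X ⊗ᵐ Y) := by
  simp only [tmul_eq]
  exact ((CStarEnv.continuous_hom _).comp continuous_fst).mul
    ((CStarEnv.continuous_hom _).comp continuous_snd)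

lemma continuous_tmul_left (y : Y) : Continuous fun x : X => (tmul x y : X ⊗ᵐ Y) :=
  continuous_tmul.comp (continuous_id.prodMk continuous_const)

lemma continuous_tmul_right (x : X) : Continuous fun y : Y => (tmul x y : X ⊗ᵐ Y) :=
  continuous_tmul.comp (continuous_const.prodMk continuous_id)

lemma zero_tmul (y : Y) : (tmul 0 y : X ⊗ᵐ Y) = 0 := by
  rw [tmul_eq, map_zero, zero_mul]

lemma tmul_zero (x : X) : (tmul x 0 : X ⊗ᵐ Y) = 0 := by
  rw [tmul_eq, map_zero, mul_zero]

/-- The elementary tensors of elements of two dense linear spans are linearly dense. -/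
lemma span_tmul_dense {S : Set X} {T : Set Y} (hS : closure (Submodule.span ℂ S : Set X) = Set.univ)
    (hT : closure (Submodule.span ℂ T : Set Y) = Set.univ) :
    (Submodule.span ℂ {z : X ⊗ᵐ Y | ∃ x ∈ S, ∃ y ∈ T, z = tmul x y}).topologicalClosure = ⊤ := by
  set N := Submodule.span ℂ {z : X ⊗ᵐ Y | ∃ x ∈ S, ∃ y ∈ T, z = tmul x y}
  have h1 : ∀ x ∈ S, ∀ y, (tmul x y : X ⊗ᵐ Y) ∈ N.topologicalClosure := by
    intro x hx y
    have hy : y ∈ closure (Submodule.span ℂ T : Set Y) := hT ▸ Set.mem_univ y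
    refine map_mem_closure (continuous_tmul_right x) hy fun t ht => ?_
    show _ ∈ N
    induction ht using Submodule.span_induction with
    | mem t ht => exact Submodule.subset_span ⟨x, hx, t, ht, rfl⟩
    | zero => rw [tmul_zero]; exact N.zero_mem
    | add a b _ _ ha hb => rw [tmul_add]; exact N.add_mem ha hb
    | smul z a _ ha => rw [tmul_smul]; exact N.smul_mem z ha
  have h2 : ∀ x y, (tmul x y : X ⊗ᵐ Y) ∈ N.topologicalClosure := by
    intro x y
    have hx : x ∈ closure (Submodule.span ℂ S : Set X) := hS ▸ Set.mem_univ x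
    have h := map_mem_closure (t := (N.topologicalClosure : Set _)) (continuous_tmul_left y) hx
      fun t ht => ?_
    · rwa [N.isClosed_topologicalClosure.closure_eq] at h
    · show _ ∈ N.topologicalClosure
      induction ht using Submodule.span_induction with
      | mem t ht => exact h1 t ht y
      | zero => rw [zero_tmul]; exact Submodule.zero_mem _
      | add a b _ _ ha hb => rw [add_tmul]; exact Submodule.add_mem _ ha hb
      | smul z a _ ha => rw [smul_tmul]; exact Submodule.smul_mem _ z ha
  rw [eq_top_iff]
  intro z _
  have hz : z ∈ closure (Set.range (CStarEnv.of : X ⊗[ℂ] Y → X ⊗ᵐ Y)) := CStarEnv.denseRange_of z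
  refine closure_minimal ?_ N.isClosed_topologicalClosure hz
  rintro _ ⟨t, rfl⟩
  induction t with
  | zero => rw [map_zero]; exact Submodule.zero_mem _
  | tmul x y => exact h2 x y
  | add a b ha hb => rw [map_add]; exact Submodule.add_mem _ ha hb

/-- The flip `X ⊗ Y → Y ⊗ X`. -/
def flip (X Y : Type u) [CStarAlgebra X] [CStarAlgebra Y] : X ⊗ᵐ Y →⋆ₐ[ℂ] Y ⊗ᵐ X :=
  lift inr inl fun a c => by
    show inr a * inl c = inl c * inr a
    rw [inl_apply, inr_apply, tmul_mul_tmul, tmul_mul_tmul, mul_one, one_mul, mul_one, one_mul]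

@[simp] lemma flip_tmul (x : X) (y : Y) : flip X Y (tmul x y) = tmul y x := by
  rw [flip, lift_tmul, inl_apply, inr_apply, tmul_mul_tmul, mul_one, one_mul]

lemma flip_flip (z : X ⊗ᵐ Y) : flip Y X (flip X Y z) = z :=
  DFunLike.congr_fun (hom_ext (f := (flip Y X).comp (flip X Y)) (g := StarAlgHom.id ℂ _)
    fun a c => by simp) z

/-- Commutation of the images of two `*`-homomorphisms can be checked on a dense subalgebra. -/
lemma commute_of_dense {A : Type u} [Ring A] [StarRing A] [Algebra ℂ A] [StarModule ℂ A]
    [HasEnvelopingCStar A] (g : CStarEnv A →⋆ₐ[ℂ] D) {d : D}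
    (h : ∀ a, Commute d (g (CStarEnv.of a))) (y : CStarEnv A) : Commute d (g y) :=
  CStarEnv.eq_on (f := fun y => d * g y) (g := fun y => g y * d)
    (continuous_const.mul (CStarEnv.continuous_hom g))
    ((CStarEnv.continuous_hom g).mul continuous_const) h y

end MaxTensor

variable {X : Type u} [CStarAlgebra X] {G : Type u} [Group G]

lemma GroupCStar.span_gen_dense :
    closure (Submodule.span ℂ (Set.range (GroupCStar.gen : G →* GroupCStar G)) :
      Set (GroupCStar G)) = Set.univ := by
  rw [Set.eq_univ_iff_forall]
  intro z
  refine closure_mono ?_ (CStarEnv.denseRange_of z)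
  rintro _ ⟨p, rfl⟩
  show CStarEnv.of p ∈ Submodule.span ℂ _
  induction p using MonoidAlgebra.induction_linear with
  | zero => rw [map_zero]; exact Submodule.zero_mem _
  | add a b ha hb => rw [map_add]; exact Submodule.add_mem _ ha hb
  | single g z =>
    have h : (MonoidAlgebra.single g z : MonoidAlgebra ℂ G) = z • MonoidAlgebra.single g 1 := by
      rw [MonoidAlgebra.smul_single, smul_eq_mul, mul_one]
    rw [h, map_smul]
    exact Submodule.smul_mem _ _ (Submodule.subset_span ⟨g, rfl⟩)

/-- `∑ x_g ⊗ g`, as an element of the algebraic tensor product of `X` and `ℂ G`. -/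
def groupSum (X G : Type u) [CStarAlgebra X] [Group G] :
    (G →₀ X) →ₗ[ℂ] X ⊗[ℂ] MonoidAlgebra ℂ G :=
  Finsupp.lsum ℂ fun g => (TensorProduct.mk ℂ X (MonoidAlgebra ℂ G)).flip (MonoidAlgebra.single g 1)

lemma groupSum_apply (x : G →₀ X) :
    groupSum X G x = ∑ g ∈ x.support, x g ⊗ₜ MonoidAlgebra.single g 1 := rfl

lemma groupSum_surjective : Function.Surjective (groupSum X G) := by
  rw [← LinearMap.range_eq_top, eq_top_iff]
  intro w _
  induction w with
  | zero => exact Submodule.zero_mem _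
  | add a b ha hb => exact Submodule.add_mem _ (ha trivial) (hb trivial)
  | tmul x p =>
    induction p using MonoidAlgebra.induction_linear with
    | zero => rw [TensorProduct.tmul_zero]; exact Submodule.zero_mem _
    | add a b ha hb =>
      rw [TensorProduct.tmul_add]
      exact Submodule.add_mem _ (ha trivial) (hb trivial)
    | single g z =>
      have h : (MonoidAlgebra.single g z : MonoidAlgebra ℂ G) = z • MonoidAlgebra.single g 1 := by
        rw [MonoidAlgebra.smul_single, smul_eq_mul, mul_one]
      rw [h, TensorProduct.tmul_smul]
      refine Submodule.smul_mem _ _ ⟨Finsupp.single g x, ?_⟩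
      simp [groupSum]

open Classical in
/-- The characteristic function of a subgroup, extended linearly to the group algebra. -/
def subgroupChar (H : Subgroup G) : MonoidAlgebra ℂ G →ₗ[ℂ] ℂ :=
  (Finsupp.lsum ℂ fun g => if g ∈ H then LinearMap.id else 0).comp
    (MonoidAlgebra.coeffLinearEquiv (S := ℂ) (M := G) ℂ).toLinearMap

open Classical in
lemma subgroupChar_single (H : Subgroup G) (g : G) (z : ℂ) :
    subgroupChar H (MonoidAlgebra.single g z) = if g ∈ H then z else 0 := by
  show (Finsupp.lsum ℂ fun g => if g ∈ H then (LinearMap.id : ℂ →ₗ[ℂ] ℂ) else 0)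
    (Finsupp.single g z) = _
  rw [Finsupp.lsum_single]
  split_ifs <;> rfl

/-- The algebraic slice map `∑ x_g ⊗ g ↦ ∑_{g ∈ H} x_g`. -/
def algSlice (X : Type u) [CStarAlgebra X] (H : Subgroup G) :
    X ⊗[ℂ] MonoidAlgebra ℂ G →ₗ[ℂ] X :=
  TensorProduct.lift ((LinearMap.lsmul ℂ X).flip.compl₂ (subgroupChar H))

open Classical in
lemma algSlice_tmul (H : Subgroup G) (x : X) (g : G) :
    algSlice X H (x ⊗ₜ MonoidAlgebra.single g 1) = if g ∈ H then x else 0 := by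
  show subgroupChar H (MonoidAlgebra.single g 1) • x = _
  rw [subgroupChar_single]
  split_ifs
  · rw [one_smul]
  · rw [zero_smul]

open Classical in
/-- The slice map takes `w⋆ w` to the sum over all cosets `gH` of the squares of the partial sums
of `w` over `gH`. -/
lemma algSlice_star_mul_self (H : Subgroup G) (x : G →₀ X) :
    algSlice X H (star (groupSum X G x) * groupSum X G x) =
      ∑ c ∈ x.support.image (QuotientGroup.mk (s := H)),
        star (∑ g ∈ x.support with QuotientGroup.mk (s := H) g = c, x g) *
          ∑ g ∈ x.support with QuotientGroup.mk (s := H) g = c, x g := by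
  rw [groupSum_apply, star_sum, Finset.sum_mul_sum, map_sum]
  simp only [map_sum, TensorProduct.star_tmul, star_single, star_one,
    Algebra.TensorProduct.tmul_mul_tmul, MonoidAlgebra.single_mul_single, mul_one, algSlice_tmul]
  rw [← Finset.sum_fiberwise_of_maps_to (g := QuotientGroup.mk (s := H))
    (t := x.support.image (QuotientGroup.mk (s := H)))
    (fun g hg => Finset.mem_image_of_mem _ hg)]
  refine Finset.sum_congr rfl fun c hc => ?_
  rw [star_sum, Finset.sum_mul_sum]
  refine Finset.sum_congr rfl fun g hg => ?_
  rw [Finset.sum_filter]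
  refine Finset.sum_congr rfl fun g' _ => ?_
  have hgc := (Finset.mem_filter.1 hg).2
  refine if_congr ?_ rfl rfl
  rw [← QuotientGroup.eq, hgc, eq_comm]

open Classical in
lemma algSlice_groupSum (H : Subgroup G) (x : G →₀ X) :
    algSlice X H (groupSum X G x) =
      ∑ g ∈ x.support with QuotientGroup.mk (s := H) g = QuotientGroup.mk (s := H) 1, x g := by
  rw [groupSum_apply, map_sum, Finset.sum_filter]
  refine Finset.sum_congr rfl fun g _ => ?_
  rw [algSlice_tmul]
  refine if_congr ?_ rfl rfl
  rw [eq_comm, QuotientGroup.eq, inv_one, one_mul]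

/-- `x ↦ x ⊗ 1`. -/
def tensorInl (X A : Type u) [CStarAlgebra X] [Ring A] [StarRing A] [Algebra ℂ A]
    [StarModule ℂ A] : X →⋆ₐ[ℂ] X ⊗[ℂ] A :=
  { (Algebra.TensorProduct.includeLeft : X →ₐ[ℂ] X ⊗[ℂ] A) with
    map_star' := fun a => by simp }

/-- `a ↦ 1 ⊗ a`. -/
def tensorInr (X A : Type u) [CStarAlgebra X] [Ring A] [StarRing A] [Algebra ℂ A]
    [StarModule ℂ A] : A →⋆ₐ[ℂ] X ⊗[ℂ] A :=
  { (Algebra.TensorProduct.includeRight : A →ₐ[ℂ] X ⊗[ℂ] A) with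
    map_star' := fun a => by simp }

/-- The canonical map from the algebraic tensor product of `X` and `ℂ G` to `X ⊗ C⋆(G)`. -/
def groupTensor (X G : Type u) [CStarAlgebra X] [Group G] :
    X ⊗[ℂ] MonoidAlgebra ℂ G →⋆ₐ[ℂ] X ⊗ᵐ GroupCStar G :=
  CStarEnv.of.comp (FiberProd.mapTensor (StarAlgHom.id ℂ X) CStarEnv.of)

lemma groupTensor_tmul (x : X) (g : G) :
    groupTensor X G (x ⊗ₜ MonoidAlgebra.single g 1) = tmul x (GroupCStar.gen g) := rfl

lemma groupTensor_denseRange : DenseRange (groupTensor X G) := by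
  intro z
  have hX : closure (Submodule.span ℂ (Set.univ : Set X) : Set X) = Set.univ := by
    rw [Submodule.span_univ]; exact closure_univ
  have h := span_tmul_dense hX (GroupCStar.span_gen_dense (G := G))
  have hz : z ∈ (Submodule.span ℂ _).topologicalClosure := h ▸ Submodule.mem_top
  refine closure_mono ?_ hz
  intro w hw
  have h2 : Submodule.span ℂ {z : X ⊗ᵐ GroupCStar G | ∃ x ∈ Set.univ, ∃ y ∈ Set.range GroupCStar.gen,
      z = tmul x y} ≤ LinearMap.range (groupTensor X G :
      X ⊗[ℂ] MonoidAlgebra ℂ G →ₐ[ℂ] X ⊗ᵐ GroupCStar G).toLinearMap := by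
    refine Submodule.span_le.2 ?_
    rintro _ ⟨x, -, _, ⟨g, rfl⟩, rfl⟩
    exact ⟨x ⊗ₜ MonoidAlgebra.single g 1, groupTensor_tmul x g⟩
  exact h2 hw

/-- Every representation of the algebraic tensor product is bounded by the norm of
`X ⊗ C⋆(G)`. -/
lemma norm_rep_le_groupTensor {D : Type u} [CStarAlgebra D]
    (π : X ⊗[ℂ] MonoidAlgebra ℂ G →⋆ₐ[ℂ] D) (w : X ⊗[ℂ] MonoidAlgebra ℂ G) :
    ‖π w‖ ≤ ‖groupTensor X G w‖ := by
  have hc : ∀ (x : X) (p : MonoidAlgebra ℂ G), Commute (π (tensorInl X _ x)) (π (tensorInr X _ p)) :=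
    fun x p => by
      rw [commute_iff_eq, ← map_mul, ← map_mul]
      congr 1
      show (x ⊗ₜ (1 : MonoidAlgebra ℂ G)) * ((1 : X) ⊗ₜ p) = ((1 : X) ⊗ₜ p) * (x ⊗ₜ 1)
      simp
  let φ : X ⊗ᵐ GroupCStar G →⋆ₐ[ℂ] D := MaxTensor.lift (π.comp (tensorInl X _))
    (CStarEnv.lift (π.comp (tensorInr X _))) fun x y => by
      refine commute_of_dense _ (fun p => ?_) y
      rw [CStarEnv.lift_of]
      exact hc x p
  have h : φ (groupTensor X G w) = π w := by
    induction w with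
    | zero => simp
    | add a b ha hb => rw [map_add, map_add, map_add, ha, hb]
    | tmul x p =>
      show φ (tmul x (CStarEnv.of p)) = _
      rw [MaxTensor.lift_tmul, CStarEnv.lift_of]
      show π (x ⊗ₜ 1) * π (1 ⊗ₜ p) = _
      rw [← map_mul]
      simp
  rw [← h]
  exact NonUnitalStarAlgHom.norm_apply_le φ _

open Classical in
lemma algSlice_star (H : Subgroup G) (w : X ⊗[ℂ] MonoidAlgebra ℂ G) :
    algSlice X H (star w) = star (algSlice X H w) := by
  obtain ⟨x, rfl⟩ := groupSum_surjective w
  rw [groupSum_apply, star_sum, map_sum, map_sum, star_sum]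
  refine Finset.sum_congr rfl fun g _ => ?_
  rw [TensorProduct.star_tmul, star_single, star_one, algSlice_tmul, algSlice_tmul,
    H.inv_mem_iff]
  split_ifs
  · rfl
  · rw [star_zero]

lemma isPosFunctional_algSlice (H : Subgroup G) {f : X →L[ℂ] ℂ}
    (hf : IsPosFunctional (f : X →ₗ[ℂ] ℂ)) :
    IsPosFunctional ((f : X →ₗ[ℂ] ℂ).comp (algSlice X H)) := by
  refine ⟨fun a => ?_, fun a => ?_⟩
  · show f (algSlice X H (star a)) = _
    rw [algSlice_star]
    exact hf.apply_star _
  · obtain ⟨x, rfl⟩ := groupSum_surjective a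
    show 0 ≤ (f (algSlice X H _)).re
    rw [algSlice_star_mul_self, map_sum, Complex.re_sum]
    exact Finset.sum_nonneg fun c _ => hf.nonneg _

/-- Elementary tensors with a unitary group element act boundedly for every positive functional. -/
lemma isBoundedFor_tensor {F : X ⊗[ℂ] MonoidAlgebra ℂ G →ₗ[ℂ] ℂ} (hF : IsPosFunctional F)
    (a : X ⊗[ℂ] MonoidAlgebra ℂ G) : IsBoundedFor F a := by
  induction a with
  | zero => exact ⟨0, fun x => by simp⟩
  | add a b ha hb => exact ha.add hF hb
  | tmul x p =>
    induction p using MonoidAlgebra.induction_linear with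
    | zero => exact ⟨0, fun x => by simp⟩
    | add a b ha hb => rw [TensorProduct.tmul_add]; exact ha.add hF hb
    | single g z =>
      have h : x ⊗ₜ[ℂ] (MonoidAlgebra.single g z : MonoidAlgebra ℂ G) =
          tensorInl X (MonoidAlgebra ℂ G) (z • x) * ((1 : X) ⊗ₜ MonoidAlgebra.single g 1) := by
        show _ = ((z • x) ⊗ₜ (1 : MonoidAlgebra ℂ G)) * _
        rw [Algebra.TensorProduct.tmul_mul_tmul, one_mul, mul_one, TensorProduct.smul_tmul,
          MonoidAlgebra.smul_single, smul_eq_mul, mul_one]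
      have hu : star ((1 : X) ⊗ₜ[ℂ] (MonoidAlgebra.single g 1 : MonoidAlgebra ℂ G)) *
          ((1 : X) ⊗ₜ[ℂ] (MonoidAlgebra.single g 1 : MonoidAlgebra ℂ G)) = 1 := by
        rw [TensorProduct.star_tmul, star_single, Algebra.TensorProduct.tmul_mul_tmul,
          MonoidAlgebra.single_mul_single, inv_mul_cancel, star_one, star_one, one_mul, one_mul,
          ← MonoidAlgebra.one_def, ← Algebra.TensorProduct.one_def]
      rw [h]
      refine (hF.isBoundedFor_map (tensorInl X (MonoidAlgebra ℂ G)) _).mul hF ⟨1, fun y => ?_⟩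
      rw [star_mul, mul_assoc, ← mul_assoc (star _) _ y, hu, one_mul, one_mul]

open Classical in
/-- The slice map dominates the square of the partial sum over the trivial coset. -/
lemma algSlice_sq_le (H : Subgroup G) {f : X →L[ℂ] ℂ} (hf : IsPosFunctional (f : X →ₗ[ℂ] ℂ))
    (w : X ⊗[ℂ] MonoidAlgebra ℂ G) :
    (f (star (algSlice X H w) * algSlice X H w)).re ≤ (f (algSlice X H (star w * w))).re := by
  obtain ⟨x, rfl⟩ := groupSum_surjective w
  rw [algSlice_star_mul_self, map_sum, Complex.re_sum, algSlice_groupSum]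
  have hn : ∀ c ∈ x.support.image (QuotientGroup.mk (s := H)),
      0 ≤ (f (star (∑ g ∈ x.support with QuotientGroup.mk (s := H) g = c, x g) *
        ∑ g ∈ x.support with QuotientGroup.mk (s := H) g = c, x g)).re := fun c _ => hf.nonneg _
  by_cases hc : QuotientGroup.mk (s := H) 1 ∈ x.support.image (QuotientGroup.mk (s := H))
  · exact Finset.single_le_sum hn hc
  · have h0 : ∑ g ∈ x.support with QuotientGroup.mk (s := H) g = QuotientGroup.mk (s := H) 1,
        x g = 0 := by
      refine Finset.sum_eq_zero fun g hg => ?_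
      exact absurd (Finset.mem_image.2 ⟨g, (Finset.mem_filter.1 hg).1, (Finset.mem_filter.1 hg).2⟩)
        hc
    rw [h0, mul_zero, map_zero]
    exact Finset.sum_nonneg hn

/-- The slice map is contractive, because its composition with a state is a positive functional. -/
lemma norm_algSlice_le (H : Subgroup G) (w : X ⊗[ℂ] MonoidAlgebra ℂ G) :
    ‖algSlice X H w‖ ≤ ‖groupTensor X G w‖ := by
  classical
  obtain ⟨f, hf, hf1, hfy⟩ := exists_state_apply_eq_norm_sq (algSlice X H w)
  have hF := isPosFunctional_algSlice H hf
  have h1 := hF.le_of_forall_norm_le (isBoundedFor_tensor hF) (w := w) (c := ‖groupTensor X G w‖)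
    fun D _ π => norm_rep_le_groupTensor π w
  have hone : algSlice X H (1 : X ⊗[ℂ] MonoidAlgebra ℂ G) = 1 := by
    rw [Algebra.TensorProduct.one_def, MonoidAlgebra.one_def, algSlice_tmul, if_pos H.one_mem]
  have h2 := algSlice_sq_le H hf w
  rw [hfy] at h2
  have h3 : (f (algSlice X H (star w * w))).re ≤ ‖groupTensor X G w‖ ^ 2 * (f 1).re := by
    rw [← hone]
    exact h1
  refine (sq_le_sq₀ (norm_nonneg _) (norm_nonneg _)).1 (h2.trans (h3.trans ?_))
  exact mul_le_of_le_one_right (sq_nonneg _) hf1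

/-- `groupTensor` as a linear map. -/
def groupTensorLin (X G : Type u) [CStarAlgebra X] [Group G] :
    X ⊗[ℂ] MonoidAlgebra ℂ G →ₗ[ℂ] X ⊗ᵐ GroupCStar G :=
  (groupTensor X G : X ⊗[ℂ] MonoidAlgebra ℂ G →ₐ[ℂ] X ⊗ᵐ GroupCStar G).toLinearMap

/-- The slice map `X ⊗ C⋆(G) → X`, `x ⊗ g ↦ x` if `g ∈ H` and `x ⊗ g ↦ 0` otherwise. -/
def slice (X : Type u) [CStarAlgebra X] (H : Subgroup G) : X ⊗ᵐ GroupCStar G →L[ℂ] X :=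
  (algSlice X H).extendOfNorm (groupTensorLin X G)

open Classical in
lemma slice_tmul (H : Subgroup G) (x : X) (g : G) :
    slice X H (tmul x (GroupCStar.gen g)) = if g ∈ H then x else 0 := by
  rw [← algSlice_tmul]
  exact LinearMap.extendOfNorm_eq (f := algSlice X H) (e := groupTensorLin X G)
    groupTensor_denseRange ⟨1, fun w => by rw [one_mul]; exact norm_algSlice_le H w⟩
    (x ⊗ₜ MonoidAlgebra.single g 1)

end Slices

/-! ### Density arguments -/

section Density

variable {A C D : Type u} [CStarAlgebra A] [CStarAlgebra C] [CStarAlgebra D]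

/-- Two continuous linear maps coincide if they coincide on a linearly dense set. -/
lemma clm_eq_of_dense {E F : Type*} [NormedAddCommGroup E] [NormedSpace ℂ E]
    [NormedAddCommGroup F] [NormedSpace ℂ F] {S : Set E}
    (hS : closure (Submodule.span ℂ S : Set E) = Set.univ) {f g : E →L[ℂ] F}
    (h : ∀ a ∈ S, f a = g a) (x : E) : f x = g x := by
  have h1 := ContinuousLinearMap.ext_on (dense_iff_closure_eq.2 hS) h
  rw [h1]

/-- A `*`-homomorphism of C⋆-algebras, as a continuous linear map. -/
def StarAlgHom.clm (f : A →⋆ₐ[ℂ] D) : A →L[ℂ] D :=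
  ⟨(f : A →ₐ[ℂ] D).toLinearMap, CStarEnv.continuous_hom f⟩

lemma starAlgHom_eq_of_dense {S : Set A} (hS : closure (Submodule.span ℂ S : Set A) = Set.univ)
    {f g : A →⋆ₐ[ℂ] D} (h : ∀ a ∈ S, f a = g a) (x : A) : f x = g x :=
  clm_eq_of_dense hS (f := StarAlgHom.clm f) (g := StarAlgHom.clm g) h x

lemma commute_of_span_dense {S : Set A} (hS : closure (Submodule.span ℂ S : Set A) = Set.univ)
    {f : A →⋆ₐ[ℂ] D} {d : D} (h : ∀ a ∈ S, Commute (f a) d) (x : A) : Commute (f x) d :=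
  clm_eq_of_dense hS (f := ((ContinuousLinearMap.mul ℂ D).flip d).comp (StarAlgHom.clm f))
    (g := ((ContinuousLinearMap.mul ℂ D) d).comp (StarAlgHom.clm f)) h x

/-- A continuous linear map takes a linearly dense set into a closed submodule only if it takes
all elements into it. -/
lemma clm_mem_of_dense {E F : Type*} [NormedAddCommGroup E] [NormedSpace ℂ E]
    [NormedAddCommGroup F] [NormedSpace ℂ F] {S : Set E}
    (hS : closure (Submodule.span ℂ S : Set E) = Set.univ) (f : E →L[ℂ] F) {N : Submodule ℂ F}
    (hN : IsClosed (N : Set F)) (h : ∀ a ∈ S, f a ∈ N) (x : E) : f x ∈ N := by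
  have hx : x ∈ closure (Submodule.span ℂ S : Set E) := hS ▸ Set.mem_univ x
  have h1 : Submodule.span ℂ S ≤ N.comap f.toLinearMap := Submodule.span_le.2 h
  exact closure_minimal (t := f ⁻¹' N) h1 (hN.preimage f.continuous) hx

lemma maxTensor_span_dense {S : Set A} {T : Set C}
    (hS : closure (Submodule.span ℂ S : Set A) = Set.univ)
    (hT : closure (Submodule.span ℂ T : Set C) = Set.univ) :
    closure (Submodule.span ℂ {z : A ⊗ᵐ C | ∃ x ∈ S, ∃ y ∈ T, z = MaxTensor.tmul x y} :
      Set (A ⊗ᵐ C)) = Set.univ := by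
  have h := MaxTensor.span_tmul_dense hS hT
  rw [← Submodule.topologicalClosure_coe, h]
  rfl

lemma span_univ_dense : closure (Submodule.span ℂ (Set.univ : Set A) : Set A) = Set.univ := by
  rw [Submodule.span_univ]
  exact closure_univ

end Density

/-! ### Coactions and homogeneous elements -/

section Coactions

open MaxTensor

variable {B Γ : Type u} [CommCStarAlgebra B] [Group Γ] {α : Γ →* (B ≃⋆ₐ[ℂ] B)}
  {A C D : Type u} [CStarAlgebra A] [CStarAlgebra C] [CStarAlgebra D]

variable (α) in
/-- `S` is a linearly dense set of homogeneous elements that satisfy the commutation relations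
with the images of `r` and `s`. -/
structure IsHomogDense (V : BGCData B Γ A) (S : Set A) : Prop where
  homog : ∀ a ∈ S, ∃ γ γ', a ∈ V.gr γ γ' ∧ (∀ b, a * V.r b = V.r (α γ b) * a) ∧
    ∀ b, a * V.s b = V.s (α γ' b) * a
  dense : closure (Submodule.span ℂ S : Set A) = Set.univ

/-- The slice map `C⋆(G) ⊗ X → X`. -/
def sliceLeft (X : Type u) [CStarAlgebra X] (H : Subgroup Γ) : GroupCStar Γ ⊗ᵐ X →L[ℂ] X :=
  (slice X H).comp (StarAlgHom.clm (MaxTensor.flip _ _))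

open Classical in
lemma sliceLeft_tmul (H : Subgroup Γ) (x : A) (g : Γ) :
    sliceLeft A H (tmul (GroupCStar.gen g) x) = if g ∈ H then x else 0 := by
  show slice A H (MaxTensor.flip _ _ _) = _
  rw [flip_tmul, slice_tmul]

/-- The projection of `A` onto the homogeneous component of left degree `γ`. -/
def BGCData.projLeft (V : BGCData B Γ A) (γ : Γ) : A →L[ℂ] A :=
  (sliceLeft A ⊥).comp ((((ContinuousLinearMap.mul ℂ _)) (tmul (GroupCStar.gen γ⁻¹) 1)).comp
    (StarAlgHom.clm V.δ))

/-- The projection of `A` onto the homogeneous component of right degree `γ`. -/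
def BGCData.projRight (V : BGCData B Γ A) (γ : Γ) : A →L[ℂ] A :=
  (slice A ⊥).comp ((((ContinuousLinearMap.mul ℂ _)) (tmul 1 (GroupCStar.gen γ⁻¹))).comp
    (StarAlgHom.clm V.δbar))

open Classical in
lemma BGCData.projLeft_apply (V : BGCData B Γ A) (γ : Γ) {η η' : Γ} {a : A} (ha : a ∈ V.gr η η') :
    V.projLeft γ a = if η = γ then a else 0 := by
  show sliceLeft A ⊥ (tmul (GroupCStar.gen γ⁻¹) 1 * V.δ a) = _
  rw [ha.1, tmul_mul_tmul, ← map_mul, one_mul, sliceLeft_tmul]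
  refine if_congr ?_ rfl rfl
  rw [Subgroup.mem_bot, inv_mul_eq_one, eq_comm]

open Classical in
lemma BGCData.projRight_apply (V : BGCData B Γ A) (γ : Γ) {η η' : Γ} {a : A}
    (ha : a ∈ V.gr η η') : V.projRight γ a = if η' = γ then a else 0 := by
  show slice A ⊥ (tmul 1 (GroupCStar.gen γ⁻¹) * V.δbar a) = _
  rw [ha.2, tmul_mul_tmul, ← map_mul, one_mul, slice_tmul]
  refine if_congr ?_ rfl rfl
  rw [Subgroup.mem_bot, inv_mul_eq_one, eq_comm]

namespace IsHomogDense

variable {V : BGCData B Γ A} {S : Set A} (hS : IsHomogDense α V S)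
include hS

lemma mul_r {γ γ' : Γ} {a : A} (b : B) (ha : a ∈ V.gr γ γ') : a * V.r b = V.r (α γ b) * a := by
  classical
  have h := clm_eq_of_dense hS.dense
    (f := ((ContinuousLinearMap.mul ℂ A).flip (V.r b)).comp (V.projLeft γ))
    (g := (ContinuousLinearMap.mul ℂ A (V.r (α γ b))).comp (V.projLeft γ)) (fun x hx => by
      obtain ⟨η, η', h1, h2, -⟩ := hS.homog x hx
      show V.projLeft γ x * V.r b = V.r (α γ b) * V.projLeft γ x
      rw [V.projLeft_apply γ h1]
      split_ifs with h
      · rw [h2, h]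
      · rw [zero_mul, mul_zero]) a
  have h' : V.projLeft γ a * V.r b = V.r (α γ b) * V.projLeft γ a := h
  rwa [V.projLeft_apply γ ha, if_pos rfl] at h'

lemma mul_s {γ γ' : Γ} {a : A} (b : B) (ha : a ∈ V.gr γ γ') : a * V.s b = V.s (α γ' b) * a := by
  classical
  have h := clm_eq_of_dense hS.dense
    (f := ((ContinuousLinearMap.mul ℂ A).flip (V.s b)).comp (V.projRight γ'))
    (g := (ContinuousLinearMap.mul ℂ A (V.s (α γ' b))).comp (V.projRight γ')) (fun x hx => by
      obtain ⟨η, η', h1, -, h2⟩ := hS.homog x hx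
      show V.projRight γ' x * V.s b = V.s (α γ' b) * V.projRight γ' x
      rw [V.projRight_apply γ' h1]
      split_ifs with h
      · rw [h2, h]
      · rw [zero_mul, mul_zero]) a
  have h' : V.projRight γ' a * V.s b = V.s (α γ' b) * V.projRight γ' a := h
  rwa [V.projRight_apply γ' ha, if_pos rfl] at h'

lemma isBGCStar (hc : ∀ b c, Commute (V.r b) (V.s c)) : IsBGCStar α V where
  δ_injective := by
    classical
    refine Function.LeftInverse.injective (g := sliceLeft A (⊤ : Subgroup Γ)) fun a => ?_
    refine clm_eq_of_dense hS.dense (f := (sliceLeft A ⊤).comp (StarAlgHom.clm V.δ))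
      (g := ContinuousLinearMap.id ℂ A) (fun x hx => ?_) a
    obtain ⟨η, η', h1, -⟩ := hS.homog x hx
    show sliceLeft A ⊤ (V.δ x) = x
    rw [h1.1, sliceLeft_tmul, if_pos (Subgroup.mem_top _)]
  δbar_injective := by
    classical
    refine Function.LeftInverse.injective (g := slice A (⊤ : Subgroup Γ)) fun a => ?_
    refine clm_eq_of_dense hS.dense (f := (slice A ⊤).comp (StarAlgHom.clm V.δbar))
      (g := ContinuousLinearMap.id ℂ A) (fun x hx => ?_) a
    obtain ⟨η, η', h1, -⟩ := hS.homog x hx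
    show slice A ⊤ (V.δbar x) = x
    rw [h1.2, slice_tmul, if_pos (Subgroup.mem_top _)]
  coact_left a := by
    refine starAlgHom_eq_of_dense hS.dense (f := (map (StarAlgHom.id ℂ _) V.δ).comp V.δ)
      (g := (assocHom _ _ _).comp ((map GroupCStar.comul (StarAlgHom.id ℂ _)).comp V.δ))
      (fun x hx => ?_) a
    obtain ⟨η, η', h1, -⟩ := hS.homog x hx
    simp [h1.1]
  coact_right a := by
    refine starAlgHom_eq_of_dense hS.dense
      (f := (assocHom _ _ _).comp ((map V.δbar (StarAlgHom.id ℂ _)).comp V.δbar))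
      (g := (map (StarAlgHom.id ℂ _) GroupCStar.comul).comp V.δbar) (fun x hx => ?_) a
    obtain ⟨η, η', h1, -⟩ := hS.homog x hx
    simp [h1.2]
  coact_comm a := by
    refine starAlgHom_eq_of_dense hS.dense
      (f := (assocHom _ _ _).comp ((map V.δ (StarAlgHom.id ℂ _)).comp V.δbar))
      (g := (map (StarAlgHom.id ℂ _) V.δbar).comp V.δ) (fun x hx => ?_) a
    obtain ⟨η, η', h1, -⟩ := hS.homog x hx
    simp [h1.1, h1.2]
  commute := hc
  mul_r b ha := hS.mul_r b ha
  mul_s b ha := hS.mul_s b ha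

end IsHomogDense

/-- A `*`-homomorphism is a morphism of `(B, Γ)`-C⋆-algebras if it preserves the degrees of a
linearly dense set of homogeneous elements. -/
lemma isBGCHom_of_dense {V : BGCData B Γ A} {W : BGCData B Γ C} {S : Set A}
    (hS : closure (Submodule.span ℂ S : Set A) = Set.univ) {f : A →⋆ₐ[ℂ] C}
    (h : ∀ a ∈ S, ∃ γ γ', a ∈ V.gr γ γ' ∧ f a ∈ W.gr γ γ') (hr : ∀ b, f (V.r b) = W.r b)
    (hs : ∀ b, f (V.s b) = W.s b) : IsBGCHom V W f where
  map_δ a := by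
    refine starAlgHom_eq_of_dense hS (f := W.δ.comp f)
      (g := (map (StarAlgHom.id ℂ _) f).comp V.δ) (fun x hx => ?_) a
    obtain ⟨η, η', h1, h2⟩ := h x hx
    simp [h1.1, h2.1]
  map_δbar a := by
    refine starAlgHom_eq_of_dense hS (f := W.δbar.comp f)
      (g := (map f (StarAlgHom.id ℂ _)).comp V.δbar) (fun x hx => ?_) a
    obtain ⟨η, η', h1, h2⟩ := h x hx
    simp [h1.2, h2.2]
  map_r := hr
  map_s := hs

lemma IsBGCHom.map_gr {V : BGCData B Γ A} {W : BGCData B Γ C} {f : A →⋆ₐ[ℂ] C}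
    (hf : IsBGCHom V W f) {γ γ' : Γ} {a : A} (ha : a ∈ V.gr γ γ') : f a ∈ W.gr γ γ' :=
  ⟨by rw [hf.map_δ, ha.1, map_tmul]; rfl, by rw [hf.map_δbar, ha.2, map_tmul]; rfl⟩

end Coactions

/-! ### The conditional expectation onto the cotensor product -/

section Matching

open MaxTensor

variable {B Γ : Type u} [CommCStarAlgebra B] [Group Γ] {α : Γ →* (B ≃⋆ₐ[ℂ] B)}
  {A C D : Type u} [CStarAlgebra A] [CStarAlgebra C] [CStarAlgebra D]

/-- The homomorphism `C⋆(G) → C⋆(G')` induced by a group homomorphism. -/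
def GroupCStar.mapHom {G G' : Type u} [Group G] [Group G'] (i : G →* G') :
    GroupCStar G →⋆ₐ[ℂ] GroupCStar G' :=
  GroupCStar.lift (GroupCStar.gen.comp i) fun γ => by
    show star (GroupCStar.gen (i γ)) = GroupCStar.gen (i γ⁻¹)
    rw [GroupCStar.star_gen, map_inv i]

@[simp] lemma GroupCStar.mapHom_gen {G G' : Type u} [Group G] [Group G'] (i : G →* G') (γ : G) :
    GroupCStar.mapHom i (GroupCStar.gen γ) = GroupCStar.gen (i γ) :=
  GroupCStar.lift_gen _ _ γ

variable (Γ) in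
/-- The diagonal subgroup of `Γ × Γ`. -/
def diagSubgroup : Subgroup (Γ × Γ) := (MonoidHom.fst Γ Γ).eqLocus (MonoidHom.snd Γ Γ)

variable {V : BGCData B Γ A} {W : BGCData B Γ C} {S : Set A} {T : Set C}

/-- The map `A ⊗ (C⋆(Γ) ⊗ C) → (A ⊗ C) ⊗ C⋆(Γ × Γ)`, `a ⊗ (γ ⊗ c) ↦ (a ⊗ c) ⊗ (γ', γ)` for `a` of
right degree `γ'`. -/
def IsHomogDense.spread (hS : IsHomogDense α V S) (C : Type u) [CStarAlgebra C] :
    A ⊗ᵐ (GroupCStar Γ ⊗ᵐ C) →⋆ₐ[ℂ] (A ⊗ᵐ C) ⊗ᵐ GroupCStar (Γ × Γ) :=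
  lift ((map inl (GroupCStar.mapHom (MonoidHom.inl Γ Γ))).comp V.δbar)
    ((map inr (GroupCStar.mapHom (MonoidHom.inr Γ Γ))).comp (MaxTensor.flip _ _)) fun a z => by
      refine commute_of_span_dense hS.dense (fun x hx => ?_) a
      obtain ⟨η, η', h1, -⟩ := hS.homog x hx
      refine Commute.symm (commute_of_span_dense (maxTensor_span_dense GroupCStar.span_gen_dense
        span_univ_dense) ?_ z)
      rintro _ ⟨_, ⟨γ, rfl⟩, c, -, rfl⟩
      simp only [StarAlgHom.comp_apply, h1.2, flip_tmul, map_tmul, GroupCStar.mapHom_gen,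
        inl_apply, inr_apply]
      rw [commute_iff_eq, tmul_mul_tmul, tmul_mul_tmul, tmul_mul_tmul, tmul_mul_tmul, ← map_mul,
        ← map_mul]
      simp

lemma IsHomogDense.spread_tmul (hS : IsHomogDense α V S) {η η' : Γ} {a : A} (ha : a ∈ V.gr η η')
    (γ : Γ) (c : C) : hS.spread C (tmul a (tmul (GroupCStar.gen γ) c)) =
      tmul (tmul a c) (GroupCStar.gen (η', γ)) := by
  rw [IsHomogDense.spread, lift_tmul]
  simp only [StarAlgHom.comp_apply, ha.2, flip_tmul, map_tmul, GroupCStar.mapHom_gen,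
        inl_apply, inr_apply]
  rw [tmul_mul_tmul, tmul_mul_tmul, ← map_mul]
  simp

/-- The conditional expectation from `A ⊗ C` onto the cotensor product of `A` and `C`, which
annihilates all `a ⊗ c` with homogeneous `a` and `c` of degrees `(γ₁, γ₂)` and `(γ₃, γ₄)` such that
`γ₂ ≠ γ₃`. -/
def IsHomogDense.expect (hS : IsHomogDense α V S) (W : BGCData B Γ C) : A ⊗ᵐ C →L[ℂ] A ⊗ᵐ C :=
  (slice (A ⊗ᵐ C) (diagSubgroup Γ)).comp
    (StarAlgHom.clm ((hS.spread C).comp (map (StarAlgHom.id ℂ A) W.δ)))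

open Classical in
lemma IsHomogDense.expect_tmul (hS : IsHomogDense α V S) {γ₁ γ₂ γ₃ γ₄ : Γ} {a : A} {c : C}
    (ha : a ∈ V.gr γ₁ γ₂) (hc : c ∈ W.gr γ₃ γ₄) :
    hS.expect W (tmul a c) = if γ₂ = γ₃ then tmul a c else 0 := by
  show slice _ _ (hS.spread C (map _ _ _)) = _
  rw [map_tmul, hc.1]
  show slice _ _ (hS.spread C (tmul a _)) = _
  rw [hS.spread_tmul ha, slice_tmul]
  rfl

lemma IsHomogDense.expect_of_mem (hS : IsHomogDense α V S) {x : A ⊗ᵐ C}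
    (hx : x ∈ cotensor V W) : hS.expect W x = x := by
  classical
  show slice _ _ (hS.spread C (map _ _ _)) = _
  rw [← mem_cotensor.1 hx]
  refine clm_eq_of_dense (maxTensor_span_dense hS.dense span_univ_dense)
    (f := (slice _ _).comp (StarAlgHom.clm ((hS.spread C).comp ((assocHom _ _ _).comp
      (map V.δbar (StarAlgHom.id ℂ C)))))) (g := ContinuousLinearMap.id ℂ _) ?_ x
  rintro _ ⟨a, ha, c, -, rfl⟩
  obtain ⟨η, η', h1, -⟩ := hS.homog a ha
  show slice _ _ (hS.spread C (assocHom _ _ _ (map _ _ _))) = tmul a c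
  rw [map_tmul, h1.2, assocHom_tmul, hS.spread_tmul h1, slice_tmul]
  exact if_pos rfl

/-- The elementary tensors of homogeneous elements with matching degrees. -/
def cotensor.elems (V : BGCData B Γ A) (W : BGCData B Γ C) (S : Set A) (T : Set C) :
    Set (cotensor V W) :=
  {x | ∃ (γ γ' γ'' : Γ) (a : A) (c : C) (ha : a ∈ V.gr γ γ') (hc : c ∈ W.gr γ' γ''),
    a ∈ S ∧ c ∈ T ∧ x = cotensor.elem ha hc}

lemma IsHomogDense.expect_mem_span (hS : IsHomogDense α V S) (hT : IsHomogDense α W T) {x : A ⊗ᵐ C}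
    (hx : x ∈ Submodule.span ℂ {z : A ⊗ᵐ C | ∃ a ∈ S, ∃ c ∈ T, z = tmul a c}) :
    hS.expect W x ∈ (Submodule.span ℂ (cotensor.elems V W S T)).map
      (cotensor V W).subtype.toAlgHom.toLinearMap := by
  classical
  induction hx using Submodule.span_induction with
  | zero => rw [map_zero]; exact Submodule.zero_mem _
  | add x y _ _ hx hy => rw [map_add]; exact Submodule.add_mem _ hx hy
  | smul z x _ hx => rw [map_smul]; exact Submodule.smul_mem _ _ hx
  | mem x hx =>
    obtain ⟨a, ha, c, hc, rfl⟩ := hx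
    obtain ⟨γ, γ', h1, -⟩ := hS.homog a ha
    obtain ⟨η, η', h2, -⟩ := hT.homog c hc
    rw [hS.expect_tmul h1 h2]
    split_ifs with h
    · subst h
      exact ⟨_, Submodule.subset_span ⟨γ, γ', η', a, c, h1, h2, ha, hc, rfl⟩, rfl⟩
    · exact Submodule.zero_mem _

lemma IsHomogDense.expect_mem (hS : IsHomogDense α V S) (hT : IsHomogDense α W T) (x : A ⊗ᵐ C) :
    hS.expect W x ∈ cotensor V W := by
  refine clm_mem_of_dense (maxTensor_span_dense hS.dense hT.dense) (hS.expect W)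
    (N := (cotensor V W).toSubalgebra.toSubmodule)
    (inferInstanceAs (IsClosed (cotensor V W : Set (A ⊗ᵐ C)))) (fun y hy => ?_) x
  obtain ⟨z, -, hz⟩ := hS.expect_mem_span hT (Submodule.subset_span hy)
  rw [← hz]
  exact z.2

/-- The elementary tensors of homogeneous elements with matching degrees are linearly dense in the
cotensor product. -/
lemma cotensor.elems_dense (hS : IsHomogDense α V S) (hT : IsHomogDense α W T) :
    closure (Submodule.span ℂ (cotensor.elems V W S T) : Set (cotensor V W)) = Set.univ := by
  rw [Set.eq_univ_iff_forall]
  intro x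
  have hx : (x : A ⊗ᵐ C) ∈ closure (Submodule.span ℂ
      {z : A ⊗ᵐ C | ∃ a ∈ S, ∃ c ∈ T, z = tmul a c} : Set (A ⊗ᵐ C)) := by
    rw [maxTensor_span_dense hS.dense hT.dense]; exact Set.mem_univ _
  have h := map_mem_closure (hS.expect W).continuous hx
    fun y hy => hS.expect_mem_span hT hy
  rw [hS.expect_of_mem x.2] at h
  rw [closure_subtype]
  exact h

end Matching

lemma MaxTensor.tmul_sum {A C : Type u} [CStarAlgebra A] [CStarAlgebra C] {ι : Type*}
    (s : Finset ι) (a : A) (g : ι → C) :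
    (MaxTensor.tmul a (∑ i ∈ s, g i) : A ⊗ᵐ C) = ∑ i ∈ s, MaxTensor.tmul a (g i) :=
  map_sum ((CStarEnv.of : A ⊗[ℂ] C →⋆ₐ[ℂ] A ⊗ᵐ C).toAlgHom.toLinearMap.comp
    (TensorProduct.mk ℂ A C a)) g s

/-! ### Gram matrices in C⋆-subalgebras -/

section Gram

variable {D E : Type u} [CStarAlgebra D] [CStarAlgebra E]

/-- An injective `*`-homomorphism reflects positivity, because it preserves spectra. -/
lemma exists_star_mul_self_of_map {D E : Type*} [CStarAlgebra D] [CStarAlgebra E]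
    (φ : D →⋆ₐ[ℂ] E) (hφ : Function.Injective φ) {a : D} {b : E} (h : φ a = star b * b) :
    ∃ c, a = star c * c := by
  let : PartialOrder D := CStarAlgebra.spectralOrder D
  have : StarOrderedRing D := CStarAlgebra.spectralOrderedRing D
  let : PartialOrder E := CStarAlgebra.spectralOrder E
  have : StarOrderedRing E := CStarAlgebra.spectralOrderedRing E
  have hsa : IsSelfAdjoint a := hφ (by rw [map_star, h, star_mul, star_star])
  have h1 : 0 ≤ φ a := h ▸ star_mul_self_nonneg b
  rw [← CStarAlgebra.nonneg_iff_eq_star_mul_self]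
  rw [StarOrderedRing.nonneg_iff_spectrum_nonneg (R := ℝ) _ (hsa.map φ),
    hsa.map_spectrum_real φ hφ] at h1
  exact (StarOrderedRing.nonneg_iff_spectrum_nonneg (R := ℝ) _ hsa).2 h1

/-- The entrywise application of a `*`-homomorphism to matrices. -/
def cstarMatrixMap (n : Type) [Fintype n] [DecidableEq n] (φ : D →⋆ₐ[ℂ] E) :
    CStarMatrix n n D →⋆ₐ[ℂ] CStarMatrix n n E where
  toFun M := M.map φ
  map_one' := by
    ext i j
    simp only [CStarMatrix.map_apply, CStarMatrix.one_apply]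
    split_ifs <;> simp
  map_mul' M N := by
    ext i j
    simp [CStarMatrix.mul_apply]
  map_zero' := by
    ext i j
    simp
  map_add' M N := by
    ext i j
    simp
  commutes' z := by
    ext i j
    simp only [CStarMatrix.map_apply, CStarMatrix.algebraMap_apply]
    split_ifs
    · exact AlgHomClass.commutes φ z
    · exact map_zero φ
  map_star' M := by
    ext i j
    simp [CStarMatrix.star_apply, map_star]

/-- If the Gram matrix of finitely many elements of `E` has entries in the C⋆-subalgebra `D`, then
it is of the form `N⋆ N` for some matrix `N` with entries in `D`. -/
lemma exists_gram {φ : D →⋆ₐ[ℂ] E} (hφ : Function.Injective φ) {m : ℕ} (u : Fin m → E)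
    (M : Fin m → Fin m → D) (hM : ∀ k l, φ (M k l) = star (u k) * u l) :
    ∃ N : Fin m → Fin m → D, ∀ k l, M k l = ∑ i, star (N i k) * N i l := by
  rcases m with _ | m
  · exact ⟨M, fun k => k.elim0⟩
  · let : PartialOrder D := CStarAlgebra.spectralOrder D
    have : StarOrderedRing D := CStarAlgebra.spectralOrderedRing D
    let : PartialOrder E := CStarAlgebra.spectralOrder E
    have : StarOrderedRing E := CStarAlgebra.spectralOrderedRing E
    let R : CStarMatrix (Fin (m + 1)) (Fin (m + 1)) E :=
      CStarMatrix.ofMatrix fun i k => if i = 0 then u k else 0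
    have h1 : cstarMatrixMap (Fin (m + 1)) φ (CStarMatrix.ofMatrix M) = star R * R := by
      ext k l
      show φ (M k l) = _
      rw [hM, CStarMatrix.mul_apply, Finset.sum_eq_single 0]
      · have h0 : ∀ j, R 0 j = u j := fun j => by
          show (if (0 : Fin (m + 1)) = 0 then u j else 0) = u j
          exact if_pos rfl
        rw [CStarMatrix.star_apply, h0, h0]
      · intro i _ hi
        have h0 : R i l = 0 := by
          show (if i = 0 then u l else 0) = 0
          exact if_neg hi
        rw [h0, mul_zero]
      · exact fun h => absurd (Finset.mem_univ _) h
    have h2 : Function.Injective (cstarMatrixMap (Fin (m + 1)) φ) := fun P Q h => by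
      ext i j
      exact hφ (congrFun (congrFun h i) j)
    obtain ⟨N, hN⟩ := exists_star_mul_self_of_map _ h2 h1
    refine ⟨fun i k => N i k, fun k l => ?_⟩
    have h3 := congrFun (congrFun hN k) l
    rw [CStarMatrix.mul_apply] at h3
    simp only [CStarMatrix.star_apply] at h3
    exact h3

open MaxTensor in
lemma sum_gram_nonneg {Z : Type u} [CStarAlgebra Z] {φ : D →⋆ₐ[ℂ] E} (hφ : Function.Injective φ)
    {m : ℕ} (u : Fin m → E) (M : Fin m → Fin m → D) (hM : ∀ k l, φ (M k l) = star (u k) * u l)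
    (z : Fin m → Z) {f : Z ⊗ᵐ D →L[ℂ] ℂ} (hf : IsPosFunctional (f : Z ⊗ᵐ D →ₗ[ℂ] ℂ)) :
    0 ≤ (f (∑ k, ∑ l, tmul (star (z k) * z l) (M k l))).re := by
  obtain ⟨N, hN⟩ := exists_gram hφ u M hM
  have h : ∑ k, ∑ l, (tmul (star (z k) * z l) (M k l) : Z ⊗ᵐ D) =
      ∑ i, star (∑ k, tmul (z k) (N i k)) * ∑ l, tmul (z l) (N i l) := by
    simp only [hN, MaxTensor.tmul_sum, star_sum, Finset.sum_mul_sum, star_tmul, tmul_mul_tmul]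
    exact (Finset.sum_congr rfl fun k _ => Finset.sum_comm).trans Finset.sum_comm
  rw [h, map_sum, Complex.re_sum]
  exact Finset.sum_nonneg fun i _ => hf.nonneg _

end Gram

/-! ### Conditional expectations that are orthogonal projections of a grading -/

section Expectation

open MaxTensor

variable {X D Z I : Type u} [CStarAlgebra X] [CStarAlgebra D] [CStarAlgebra Z]

/-- `E` is a conditional expectation from `X` onto its subalgebra `D`, embedded by `φ`, such that
finitely many elements `u_k` of a linearly dense set `U` can be assigned to classes `d_k`, and
`E (u_k⋆ u_l)` is `u_k⋆ u_l` or `0`, depending on whether the classes of `u_k` and `u_l` coincide. -/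
structure IsClassExpectation (I : Type u) (φ : D →⋆ₐ[ℂ] X) (E : X →L[ℂ] D) (U : Set X) : Prop where
  injective : Function.Injective φ
  apply_map : ∀ d, E (φ d) = d
  apply_star : ∀ x, E (star x) = star (E x)
  dense : closure (Submodule.span ℂ U : Set X) = Set.univ
  classes : ∀ (m : ℕ) (u : Fin m → X), (∀ k, u k ∈ U) → ∃ d : Fin m → I,
    (∀ k l, d k = d l → φ (E (star (u k) * u l)) = star (u k) * u l) ∧
    ∀ k l, d k ≠ d l → E (star (u k) * u l) = 0

namespace IsClassExpectation

variable {φ : D →⋆ₐ[ℂ] X} {E : X →L[ℂ] D} {U : Set X}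

variable (Z E) in
/-- The linear map `id ⊗ E` on algebraic tensor products. -/
def tensorExpect : Z ⊗[ℂ] X →ₗ[ℂ] Z ⊗ᵐ D :=
  (CStarEnv.of : Z ⊗[ℂ] D →⋆ₐ[ℂ] Z ⊗ᵐ D).toAlgHom.toLinearMap.comp
    (TensorProduct.map LinearMap.id E.toLinearMap)

lemma tensorExpect_tmul (z : Z) (x : X) : tensorExpect Z E (z ⊗ₜ x) = tmul z (E x) := rfl

lemma tensorExpect_sq {m : ℕ} (z : Fin m → Z) (x : Fin m → X) :
    tensorExpect Z E (star (∑ k, z k ⊗ₜ[ℂ] x k) * ∑ k, z k ⊗ₜ[ℂ] x k) =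
      ∑ k, ∑ l, tmul (star (z k) * z l) (E (star (x k) * x l)) := by
  rw [star_sum, Finset.sum_mul_sum, map_sum]
  refine Finset.sum_congr rfl fun k _ => ?_
  rw [map_sum]
  refine Finset.sum_congr rfl fun l _ => ?_
  rw [TensorProduct.star_tmul, Algebra.TensorProduct.tmul_mul_tmul, tensorExpect_tmul]

variable (h : IsClassExpectation I φ E U)
include h

lemma tensorExpect_star (w : Z ⊗[ℂ] X) :
    tensorExpect Z E (star w) = star (tensorExpect Z E w) := by
  induction w with
  | zero => rw [star_zero, map_zero, star_zero]
  | add x y hx hy => rw [star_add, map_add, hx, hy, map_add, star_add]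
  | tmul z x =>
    rw [TensorProduct.star_tmul, tensorExpect_tmul, tensorExpect_tmul, h.apply_star, star_tmul]

/-- For elements `u_k` of `U`, the matrix `(E(u_k⋆ u_l))` is a sum of Gram matrices, one for each
class. -/
lemma tensorExpect_nonneg_of_mem {f : Z ⊗ᵐ D →L[ℂ] ℂ}
    (hf : IsPosFunctional (f : Z ⊗ᵐ D →ₗ[ℂ] ℂ)) {m : ℕ}
    (z : Fin m → Z) (u : Fin m → X) (hu : ∀ k, u k ∈ U) :
    0 ≤ (f (∑ k, ∑ l, tmul (star (z k) * z l) (E (star (u k) * u l)))).re := by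
  classical
  obtain ⟨d, hd1, hd2⟩ := h.classes m u hu
  let M : I → Fin m → Fin m → D := fun e k l =>
    if d k = e ∧ d l = e then E (star (u k) * u l) else 0
  have hM : ∀ e k l, φ (M e k l) =
      star (if d k = e then u k else 0) * (if d l = e then u l else 0) := by
    intro e k l
    by_cases h1 : d k = e
    · by_cases h2 : d l = e
      · have h3 : M e k l = E (star (u k) * u l) := if_pos ⟨h1, h2⟩
        rw [if_pos h1, if_pos h2, h3]
        exact hd1 k l (h1.trans h2.symm)
      · have h3 : M e k l = 0 := if_neg fun h => h2 h.2
        rw [if_neg h2, mul_zero, h3, map_zero]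
    · have h3 : M e k l = 0 := if_neg fun h => h1 h.1
      rw [if_neg h1, star_zero, zero_mul, h3, map_zero]
  have hsum : ∀ k l, E (star (u k) * u l) = ∑ e ∈ Finset.univ.image d, M e k l := by
    intro k l
    rw [Finset.sum_eq_single (d k)]
    · by_cases h : d k = d l
      · exact (if_pos ⟨rfl, h.symm⟩).symm
      · exact (hd2 k l h).trans (if_neg fun h' => h h'.2.symm).symm
    · exact fun e _ he => if_neg fun h => he h.1.symm
    · exact fun h => absurd (Finset.mem_image_of_mem d (Finset.mem_univ k)) h
  have h1 : ∑ k, ∑ l, tmul (star (z k) * z l) (E (star (u k) * u l)) =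
      ∑ e ∈ Finset.univ.image d, ∑ k, ∑ l, (tmul (star (z k) * z l) (M e k l) : Z ⊗ᵐ D) := by
    simp only [hsum, MaxTensor.tmul_sum]
    exact (Finset.sum_congr rfl fun k _ => Finset.sum_comm).trans Finset.sum_comm
  rw [h1, map_sum, Complex.re_sum]
  exact Finset.sum_nonneg fun e _ => sum_gram_nonneg h.injective _ (M e) (hM e) z hf

/-- The map `id ⊗ E` is positive. -/
lemma isPosFunctional_tensorExpect {f : Z ⊗ᵐ D →L[ℂ] ℂ}
    (hf : IsPosFunctional (f : Z ⊗ᵐ D →ₗ[ℂ] ℂ)) :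
    IsPosFunctional ((f : Z ⊗ᵐ D →ₗ[ℂ] ℂ).comp (tensorExpect Z E)) := by
  refine ⟨fun w => ?_, fun w => ?_⟩
  · show f (tensorExpect Z E (star w)) = _
    rw [h.tensorExpect_star]
    exact hf.apply_star _
  · show 0 ≤ (f (tensorExpect Z E (star w * w))).re
    obtain ⟨m, z, x, rfl⟩ := TensorProduct.exists_sum_tmul_eq w
    have hx : x ∈ closure (Set.pi Set.univ fun _ => (Submodule.span ℂ U : Set X)) := by
      rw [closure_pi_set, h.dense, Set.pi_univ]
      exact Set.mem_univ x
    -- The value depends continuously on the second tensor factors, which can be approximated by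
    -- linear combinations of elements of `U`.
    have hcl : IsClosed {x : Fin m → X | 0 ≤ (f (∑ k, ∑ l, tmul (star (z k) * z l)
        (E (star (x k) * x l)))).re} := by
      refine isClosed_le continuous_const (Complex.continuous_re.comp (f.continuous.comp ?_))
      refine continuous_finsetSum _ fun k _ => continuous_finsetSum _ fun l _ => ?_
      refine (MaxTensor.continuous_tmul_right _).comp (E.continuous.comp ?_)
      exact (continuous_star.comp (continuous_apply k)).mul (continuous_apply l)
    rw [tensorExpect_sq]
    refine closure_minimal (fun y hy => ?_) hcl hx
    show 0 ≤ (f _).re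
    rw [← tensorExpect_sq]
    have hy2 : ∑ k, z k ⊗ₜ[ℂ] y k ∈
        Submodule.span ℂ {t : Z ⊗[ℂ] X | ∃ z, ∃ u ∈ U, t = z ⊗ₜ u} := by
      refine Submodule.sum_mem _ fun k _ => ?_
      have hk : y k ∈ Submodule.span ℂ U := hy k (Set.mem_univ k)
      generalize y k = x' at hk
      induction hk using Submodule.span_induction with
      | zero => rw [TensorProduct.tmul_zero]; exact Submodule.zero_mem _
      | add a b _ _ ha hb => rw [TensorProduct.tmul_add]; exact Submodule.add_mem _ ha hb
      | smul c a _ ha => rw [TensorProduct.tmul_smul]; exact Submodule.smul_mem _ _ ha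
      | mem a ha => exact Submodule.subset_span ⟨_, a, ha, rfl⟩
    obtain ⟨n, c, t, ht⟩ := Submodule.mem_span_set'.1 hy2
    choose z' u hu htu using fun j => (t j).2
    have h3 : ∑ k, z k ⊗ₜ[ℂ] y k = ∑ j, (c j • z' j) ⊗ₜ[ℂ] u j := by
      rw [← ht]
      refine Finset.sum_congr rfl fun j _ => ?_
      rw [htu j, TensorProduct.smul_tmul']
    rw [h3, tensorExpect_sq]
    exact h.tensorExpect_nonneg_of_mem hf _ u hu

lemma tensorExpect_mapTensor (t : Z ⊗[ℂ] D) :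
    tensorExpect Z E (FiberProd.mapTensor (StarAlgHom.id ℂ Z) φ t) = CStarEnv.of t := by
  induction t with
  | zero => simp only [map_zero]
  | add x y hx hy => simp only [map_add, hx, hy]
  | tmul z x =>
    rw [FiberProd.mapTensor_tmul, tensorExpect_tmul, h.apply_map]
    rfl

omit h in
lemma of_mapTensor (t : Z ⊗[ℂ] D) :
    (CStarEnv.of (FiberProd.mapTensor (StarAlgHom.id ℂ Z) φ t) : Z ⊗ᵐ X) =
      map (StarAlgHom.id ℂ Z) φ (CStarEnv.of t) := by
  induction t with
  | zero => simp only [map_zero]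
  | add x y hx hy => simp only [map_add, hx, hy]
  | tmul z x => exact (map_tmul (StarAlgHom.id ℂ Z) φ z x).symm

/-- Positive functionals on `Z ⊗ D` extend to `Z ⊗ X` by means of `id ⊗ E`. -/
lemma norm_le_map (y : Z ⊗ᵐ D) : ‖y‖ ≤ ‖map (StarAlgHom.id ℂ Z) φ y‖ := by
  refine CStarEnv.denseRange_of.induction_on
    (p := fun y : Z ⊗ᵐ D => ‖y‖ ≤ ‖map (StarAlgHom.id ℂ Z) φ y‖) y
    (isClosed_le continuous_norm (CStarEnv.continuous_hom _).norm) fun t => ?_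
  obtain ⟨f, hf, hf1, hfy⟩ := exists_state_apply_eq_norm_sq (CStarEnv.of t : Z ⊗ᵐ D)
  have hF := h.isPosFunctional_tensorExpect hf
  have hb : ∀ w : Z ⊗[ℂ] X, IsBoundedFor _ w := fun w => by
    induction w with
    | zero => exact ⟨0, fun x => by simp⟩
    | add x y hx hy => exact hx.add hF hy
    | tmul z x =>
      have h : z ⊗ₜ[ℂ] x = inclLeft Z X z * inclRight Z X x := by
        show _ = (z ⊗ₜ[ℂ] (1 : X)) * ((1 : Z) ⊗ₜ[ℂ] x)
        rw [Algebra.TensorProduct.tmul_mul_tmul, mul_one, one_mul]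
      rw [h]
      exact (hF.isBoundedFor_map _ z).mul hF (hF.isBoundedFor_map _ x)
  have h1 := hF.le_of_forall_norm_le hb
    (w := FiberProd.mapTensor (StarAlgHom.id ℂ Z) φ t)
    fun D _ π => (le_universalNorm π _).trans (CStarEnv.norm_coe (A := Z ⊗[ℂ] X) _).ge
  have h2 : (f (star (CStarEnv.of t) * CStarEnv.of t)).re ≤
      ‖(CStarEnv.of (FiberProd.mapTensor (StarAlgHom.id ℂ Z) φ t) : Z ⊗ᵐ X)‖ ^ 2 * (f 1).re := by
    have h3 := h.tensorExpect_mapTensor (Z := Z) (star t * t)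
    have h4 := h.tensorExpect_mapTensor (Z := Z) 1
    rw [map_mul, map_star, map_mul CStarEnv.of, map_star CStarEnv.of] at h3
    rw [map_one (FiberProd.mapTensor (StarAlgHom.id ℂ Z) φ), map_one CStarEnv.of] at h4
    rw [← h3, ← h4]
    exact h1
  rw [hfy, of_mapTensor] at h2
  refine (sq_le_sq₀ (norm_nonneg _) (norm_nonneg _)).1 (h2.trans ?_)
  exact mul_le_of_le_one_right (sq_nonneg _) hf1

lemma map_injective : Function.Injective (map (StarAlgHom.id ℂ Z) φ) := by
  rw [injective_iff_map_eq_zero]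
  intro y hy
  have h := h.norm_le_map y
  rw [hy, norm_zero] at h
  exact norm_le_zero_iff.1 h

end IsClassExpectation

end Expectation

/-! ### Tensor products with a cotensor product -/

section CotensorInclusion

open MaxTensor

variable {B Γ : Type u} [CommCStarAlgebra B] [Group Γ] {α : Γ →* (B ≃⋆ₐ[ℂ] B)}
  {A C D Z : Type u} [CStarAlgebra A] [CStarAlgebra C] [CStarAlgebra D] [CStarAlgebra Z]
  {V : BGCData B Γ A} {W : BGCData B Γ C} {S : Set A} {T : Set C}

lemma BGCData.mul_mem (V : BGCData B Γ A) {γ γ' η η' : Γ} {a b : A} (ha : a ∈ V.gr γ γ')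
    (hb : b ∈ V.gr η η') : a * b ∈ V.gr (γ * η) (γ' * η') :=
  ⟨by rw [map_mul, ha.1, hb.1, tmul_mul_tmul, map_mul],
    by rw [map_mul, ha.2, hb.2, tmul_mul_tmul, map_mul]⟩

lemma BGCData.star_mem (V : BGCData B Γ A) {γ γ' : Γ} {a : A} (ha : a ∈ V.gr γ γ') :
    star a ∈ V.gr γ⁻¹ γ'⁻¹ :=
  ⟨by rw [map_star, ha.1, star_tmul, GroupCStar.star_gen],
    by rw [map_star, ha.2, star_tmul, GroupCStar.star_gen]⟩

lemma IsHomogDense.expect_star (hS : IsHomogDense α V S) (hT : IsHomogDense α W T) (x : A ⊗ᵐ C) :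
    hS.expect W (star x) = star (hS.expect W x) := by
  classical
  have h := map_mem_closure (t := {x : A ⊗ᵐ C | hS.expect W (star x) = star (hS.expect W x)})
    continuous_id (maxTensor_span_dense hS.dense hT.dense ▸ Set.mem_univ x) fun y hy => ?_
  · have hc : IsClosed {x : A ⊗ᵐ C | hS.expect W (star x) = star (hS.expect W x)} :=
      isClosed_eq ((hS.expect W).continuous.comp continuous_star)
        (continuous_star.comp (hS.expect W).continuous)
    rwa [hc.closure_eq] at h
  · show hS.expect W (star y) = star (hS.expect W y)
    induction hy using Submodule.span_induction with
    | zero => rw [star_zero, map_zero, star_zero]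
    | add x y _ _ hx hy => rw [star_add, map_add, hx, hy, map_add, star_add]
    | smul z x _ hx => rw [star_smul, map_smul, hx, map_smul, star_smul]
    | mem x hx =>
      obtain ⟨a, ha, c, hc, rfl⟩ := hx
      obtain ⟨γ, γ', h1, -⟩ := hS.homog a ha
      obtain ⟨η, η', h2, -⟩ := hT.homog c hc
      rw [star_tmul, hS.expect_tmul h1 h2, hS.expect_tmul (V.star_mem h1) (W.star_mem h2)]
      simp only [inv_inj]
      split_ifs
      · rw [star_tmul]
      · rw [star_zero]

/-- The conditional expectation `A ⊗ C → A □ C`. -/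
def IsHomogDense.expectHom (hS : IsHomogDense α V S) (hT : IsHomogDense α W T) :
    A ⊗ᵐ C →L[ℂ] cotensor V W where
  toFun x := ⟨hS.expect W x, hS.expect_mem hT x⟩
  map_add' x y := Subtype.ext (map_add (hS.expect W) x y)
  map_smul' z x := Subtype.ext (map_smul (hS.expect W) z x)
  cont := Continuous.subtype_mk (hS.expect W).continuous _

lemma IsHomogDense.isClassExpectation (hS : IsHomogDense α V S) (hT : IsHomogDense α W T) :
    IsClassExpectation Γ (cotensor V W).subtype (hS.expectHom hT)
      {z : A ⊗ᵐ C | ∃ a ∈ S, ∃ c ∈ T, z = tmul a c} where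
  injective := Subtype.val_injective
  apply_map x := Subtype.ext (hS.expect_of_mem x.2)
  apply_star x := Subtype.ext (hS.expect_star hT x)
  dense := maxTensor_span_dense hS.dense hT.dense
  classes m u hu := by
    classical
    choose a ha c hc huac using hu
    choose γ p hp _ using fun k => hS.homog (a k) (ha k)
    choose q η hq _ using fun k => hT.homog (c k) (hc k)
    have hd : ∀ k l, hS.expect W (star (u k) * u l) =
        if q k * (p k)⁻¹ = q l * (p l)⁻¹ then star (u k) * u l else 0 := by
      intro k l
      rw [huac k, huac l, star_tmul, tmul_mul_tmul,
        hS.expect_tmul (V.mul_mem (V.star_mem (hp k)) (hp l)) (W.mul_mem (W.star_mem (hq k)) (hq l))]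
      refine if_congr ?_ rfl rfl
      rw [eq_comm, inv_mul_eq_iff_eq_mul, ← mul_assoc, eq_comm, ← eq_mul_inv_iff_mul_eq]
    exact ⟨fun k => q k * (p k)⁻¹, fun k l h => (hd k l).trans (if_pos h),
      fun k l h => Subtype.ext ((hd k l).trans (if_neg h))⟩

/-- For every C⋆-algebra `Z`, the tensor product of `Z` with a cotensor product of `A` and `C`
embeds into `Z ⊗ (A ⊗ C)`. -/
lemma IsHomogDense.inclusion_injective (hS : IsHomogDense α V S) (hT : IsHomogDense α W T)
    (Z : Type u) [CStarAlgebra Z] :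
    Function.Injective (map (StarAlgHom.id ℂ Z) (cotensor V W).subtype) :=
  (hS.isClassExpectation hT).map_injective

end CotensorInclusion

/-! ### Factorization of `*`-homomorphisms -/

section Factorization

variable {X Y K D : Type u} [CStarAlgebra X] [CStarAlgebra Y] [CStarAlgebra K] [CStarAlgebra D]

/-- A `*`-homomorphism that takes a linearly dense set into the image of an injective
`*`-homomorphism factors through the latter, because injective `*`-homomorphisms are isometric. -/
lemma exists_factor {i : X →⋆ₐ[ℂ] Y} (hi : Function.Injective i) (h : K →⋆ₐ[ℂ] Y) {S : Set K}
    (hS : closure (Submodule.span ℂ S : Set K) = Set.univ) (hr : ∀ k ∈ S, ∃ x, i x = h k) :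
    ∃ f : K →⋆ₐ[ℂ] X, ∀ k, i (f k) = h k := by
  have hiso : Isometry i := NonUnitalStarAlgHom.isometry i hi
  have hall : ∀ k, ∃ x, i x = h k := fun k =>
    clm_mem_of_dense hS (StarAlgHom.clm h) (N := LinearMap.range (StarAlgHom.clm i).toLinearMap)
      hiso.isClosedEmbedding.isClosed_range hr k
  choose f hf using hall
  refine ⟨⟨⟨⟨⟨⟨f, hi ?_⟩, fun a b => hi ?_⟩, hi ?_, fun a b => hi ?_⟩, fun z => hi ?_⟩,
    fun a => hi ?_⟩, hf⟩
  · rw [hf, map_one, map_one]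
  · rw [hf, map_mul, map_mul, hf, hf]
  · show i (f 0) = i 0
    rw [hf, map_zero, map_zero]
  · show i (f (a + b)) = i (f a + f b)
    rw [hf, map_add, map_add, hf, hf]
  · show i (f (algebraMap ℂ K z)) = _
    rw [hf, AlgHomClass.commutes h, AlgHomClass.commutes i]
  · show i (f (star a)) = i (star (f a))
    rw [hf, map_star, map_star, hf]

/-- A `*`-homomorphism that vanishes on the kernel of a `*`-homomorphism with dense range factors
through the latter. -/
lemma exists_factor_of_ker {p : K →⋆ₐ[ℂ] Y} {S : Set Y}
    (hS : closure (Submodule.span ℂ S : Set Y) = Set.univ) (hp : ∀ y ∈ S, ∃ k, p k = y)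
    (h : K →⋆ₐ[ℂ] D) (hk : ∀ k, p k = 0 → h k = 0) :
    ∃ f : Y →⋆ₐ[ℂ] D, ∀ k, f (p k) = h k := by
  let T : Set K := {k | p k = 0}
  let pb : CStarQuot T →⋆ₐ[ℂ] Y := CStarQuot.lift p fun _ hx => hx
  let hb : CStarQuot T →⋆ₐ[ℂ] D := CStarQuot.lift h fun x hx => hk x hx
  have hpb : Function.Injective pb := by
    rw [injective_iff_map_eq_zero]
    intro x hx
    obtain ⟨x, rfl⟩ := CStarQuot.proj_surjective x
    exact CStarQuot.proj_eq_zero (T := T) hx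
  obtain ⟨s, hs⟩ := exists_factor hpb (StarAlgHom.id ℂ Y) hS fun y hy => by
    obtain ⟨k, hk⟩ := hp y hy
    exact ⟨CStarQuot.proj T k, hk⟩
  refine ⟨hb.comp s, fun k => ?_⟩
  have h1 : s (p k) = CStarQuot.proj T k := hpb (hs (p k))
  show hb (s (p k)) = h k
  rw [h1]
  rfl

end Factorization

/-! ### The structure of cotensor products and fiber products -/

section CotensorData

open MaxTensor

lemma MaxTensor.commute_inl_of_dense {X Y D : Type u} [CStarAlgebra X] [CStarAlgebra Y]
    [CStarAlgebra D] {f : X ⊗ᵐ Y →⋆ₐ[ℂ] D} {d : D} (h : ∀ x y, Commute (f (tmul x y)) d)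
    (z : X ⊗ᵐ Y) : Commute (f z) d :=
  commute_of_span_dense (maxTensor_span_dense span_univ_dense span_univ_dense)
    (by rintro _ ⟨x, -, y, -, rfl⟩; exact h x y) z

/-- The canonical map `A ⊗ (C ⊗ D) → (A ⊗ C) ⊗ D`. -/
def assocInv (A C D : Type u) [CStarAlgebra A] [CStarAlgebra C] [CStarAlgebra D] :
    A ⊗ᵐ (C ⊗ᵐ D) →⋆ₐ[ℂ] (A ⊗ᵐ C) ⊗ᵐ D :=
  lift (inl.comp inl) (map inr (StarAlgHom.id ℂ D)) fun a z =>
    (commute_inl_of_dense (fun c d => by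
      rw [map_tmul, commute_iff_eq]
      show tmul (tmul 1 c) d * tmul (tmul a 1) 1 = tmul (tmul a 1) 1 * tmul (tmul 1 c) d
      simp only [tmul_mul_tmul, mul_one, one_mul]) z).symm

@[simp] lemma assocInv_tmul {A C D : Type u} [CStarAlgebra A] [CStarAlgebra C] [CStarAlgebra D]
    (a : A) (c : C) (d : D) : assocInv A C D (tmul a (tmul c d)) = tmul (tmul a c) d := by
  rw [assocInv, lift_tmul, map_tmul]
  show tmul (tmul a 1) 1 * tmul (tmul 1 c) d = _
  simp only [tmul_mul_tmul, mul_one, one_mul]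

variable {B Γ : Type u} [CommCStarAlgebra B] [Group Γ] {α : Γ →* (B ≃⋆ₐ[ℂ] B)}
  {A C D Z : Type u} [CStarAlgebra A] [CStarAlgebra C] [CStarAlgebra D] [CStarAlgebra Z]
  {V : BGCData B Γ A} {W : BGCData B Γ C} {S : Set A} {T : Set C}

lemma IsHomogDense.inclusion_injective_left (hS : IsHomogDense α V S) (hT : IsHomogDense α W T)
    (Z : Type u) [CStarAlgebra Z] :
    Function.Injective (map (cotensor V W).subtype (StarAlgHom.id ℂ Z)) := by
  intro x y hxy
  have h1 : ∀ x : cotensor V W ⊗ᵐ Z, map (StarAlgHom.id ℂ Z) (cotensor V W).subtype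
      (MaxTensor.flip _ _ x) = MaxTensor.flip _ _ (map (cotensor V W).subtype (StarAlgHom.id ℂ Z) x) :=
    fun x => DFunLike.congr_fun (hom_ext
      (f := (map (StarAlgHom.id ℂ Z) (cotensor V W).subtype).comp (MaxTensor.flip _ _))
      (g := (MaxTensor.flip _ _).comp (map (cotensor V W).subtype (StarAlgHom.id ℂ Z)))
      fun a c => by simp) x
  have h2 := hS.inclusion_injective hT Z ((h1 x).trans ((congrArg _ hxy).trans (h1 y).symm))
  rw [← MaxTensor.flip_flip x, h2, MaxTensor.flip_flip]

/-- The `(B, Γ)`-C⋆-algebra structure of a cotensor product. -/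
structure IsCotensorData (V : BGCData B Γ A) (W : BGCData B Γ C) (U : BGCData B Γ (cotensor V W)) :
    Prop where
  elem_mem : ∀ {γ γ' γ'' : Γ} {a : A} {c : C} (ha : a ∈ V.gr γ γ') (hc : c ∈ W.gr γ' γ''),
    cotensor.elem ha hc ∈ U.gr γ γ''
  r_eq : ∀ b, U.r b = cotensor.elem (FiberC.r_mem V b) W.one_mem
  s_eq : ∀ b, U.s b = cotensor.elem V.one_mem (FiberC.s_mem W b)

lemma exists_cotensorData (hS : IsHomogDense α V S) (hT : IsHomogDense α W T) :
    ∃ U : BGCData B Γ (cotensor V W), IsCotensorData V W U := by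
  obtain ⟨δ, hδ⟩ := exists_factor (hS.inclusion_injective hT (GroupCStar Γ))
    (((assocHom _ _ _).comp (map V.δ (StarAlgHom.id ℂ C))).comp (cotensor V W).subtype)
    (cotensor.elems_dense hS hT) (by
      rintro _ ⟨γ, γ', γ'', a, c, ha, hc, -, -, rfl⟩
      refine ⟨tmul (GroupCStar.gen γ) (cotensor.elem ha hc), ?_⟩
      rw [map_tmul]
      show tmul (GroupCStar.gen γ) (tmul a c) = assocHom _ _ _ (map _ _ (tmul a c))
      rw [map_tmul, ha.1, assocHom_tmul]
      rfl)
  obtain ⟨δbar, hδbar⟩ := exists_factor (hS.inclusion_injective_left hT (GroupCStar Γ))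
    (((assocInv _ _ _).comp (map (StarAlgHom.id ℂ A) W.δbar)).comp (cotensor V W).subtype)
    (cotensor.elems_dense hS hT) (by
      rintro _ ⟨γ, γ', γ'', a, c, ha, hc, -, -, rfl⟩
      refine ⟨tmul (cotensor.elem ha hc) (GroupCStar.gen γ''), ?_⟩
      rw [map_tmul]
      show tmul (tmul a c) (GroupCStar.gen γ'') = assocInv _ _ _ (map _ _ (tmul a c))
      rw [map_tmul, hc.2, assocInv_tmul]
      rfl)
  have h1 : ∀ {γ γ' γ'' : Γ} {a : A} {c : C} (ha : a ∈ V.gr γ γ') (hc : c ∈ W.gr γ' γ''),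
      δ (cotensor.elem ha hc) = tmul (GroupCStar.gen γ) (cotensor.elem ha hc) := by
    intro γ γ' γ'' a c ha hc
    refine hS.inclusion_injective hT (GroupCStar Γ) ((hδ _).trans ?_)
    rw [map_tmul]
    show assocHom _ _ _ (map _ _ (tmul a c)) = tmul (GroupCStar.gen γ) (tmul a c)
    rw [map_tmul, ha.1, assocHom_tmul]
    rfl
  have h2 : ∀ {γ γ' γ'' : Γ} {a : A} {c : C} (ha : a ∈ V.gr γ γ') (hc : c ∈ W.gr γ' γ''),
      δbar (cotensor.elem ha hc) = tmul (cotensor.elem ha hc) (GroupCStar.gen γ'') := by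
    intro γ γ' γ'' a c ha hc
    refine hS.inclusion_injective_left hT (GroupCStar Γ) ((hδbar _).trans ?_)
    rw [map_tmul]
    show assocInv _ _ _ (map _ _ (tmul a c)) = tmul (tmul a c) (GroupCStar.gen γ'')
    rw [map_tmul, hc.2, assocInv_tmul]
    rfl
  let r : B →⋆ₐ[ℂ] cotensor V W := (inl.comp V.r).codRestrict _ fun b =>
    (cotensor.elem (FiberC.r_mem V b) W.one_mem).2
  let s : B →⋆ₐ[ℂ] cotensor V W := (inr.comp W.s).codRestrict _ fun b =>
    (cotensor.elem V.one_mem (FiberC.s_mem W b)).2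
  have hr : ∀ b, r b = cotensor.elem (FiberC.r_mem V b) W.one_mem := fun b => rfl
  have hs : ∀ b, s b = cotensor.elem V.one_mem (FiberC.s_mem W b) := fun b => rfl
  let U : BGCData B Γ (cotensor V W) :=
    { δ := δ, δbar := δbar, r := r, s := s
      δ_r := fun b => h1 (FiberC.r_mem V b) W.one_mem
      δ_s := fun b => h1 V.one_mem (FiberC.s_mem W b)
      δbar_r := fun b => h2 (FiberC.r_mem V b) W.one_mem
      δbar_s := fun b => h2 V.one_mem (FiberC.s_mem W b) }
  exact ⟨U, fun ha hc => ⟨h1 ha hc, h2 ha hc⟩, hr, hs⟩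

lemma cotensor.elem_mul {γ γ' γ'' η η' η'' : Γ} {a a' : A} {c c' : C} (ha : a ∈ V.gr γ γ')
    (hc : c ∈ W.gr γ' γ'') (ha' : a' ∈ V.gr η η') (hc' : c' ∈ W.gr η' η'') :
    cotensor.elem ha hc * cotensor.elem ha' hc' =
      cotensor.elem (V.mul_mem ha ha') (W.mul_mem hc hc') :=
  Subtype.ext (tmul_mul_tmul a a' c c')

lemma span_image_dense {X Y : Type u} [CStarAlgebra X] [CStarAlgebra Y] {S : Set X}
    (hS : closure (Submodule.span ℂ S : Set X) = Set.univ) (q : X →⋆ₐ[ℂ] Y)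
    (hq : DenseRange q) : closure (Submodule.span ℂ (q '' S) : Set Y) = Set.univ := by
  rw [Set.eq_univ_iff_forall]
  intro y
  refine closure_minimal ?_ isClosed_closure (hq y)
  rintro _ ⟨x, rfl⟩
  have hx : x ∈ closure (Submodule.span ℂ S : Set X) := hS ▸ Set.mem_univ x
  refine map_mem_closure (CStarEnv.continuous_hom q) hx fun z hz => ?_
  have h := Submodule.mem_map_of_mem (f := (StarAlgHom.clm q).toLinearMap) hz
  rwa [Submodule.map_span] at h

/-- The image of a dense set of homogeneous elements under a morphism with dense range. -/
lemma IsHomogDense.image (hS : IsHomogDense α V S) {q : A →⋆ₐ[ℂ] C} (hq : IsBGCHom V W q)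
    (hd : DenseRange q) : IsHomogDense α W (q '' S) where
  homog := by
    rintro _ ⟨a, ha, rfl⟩
    obtain ⟨γ, γ', h1, h2, h3⟩ := hS.homog a ha
    refine ⟨γ, γ', hq.map_gr h1, fun b => ?_, fun b => ?_⟩
    · rw [← hq.map_r, ← map_mul, h2, map_mul, hq.map_r]
    · rw [← hq.map_s, ← map_mul, h3, map_mul, hq.map_s]
  dense := span_image_dense hS.dense q hd

/-- The quotient of a `(B, Γ)`-C⋆-algebra by relations of trivial degree. -/
lemma exists_quotientData (U : BGCData B Γ A) {R : Set A} (hR : ∀ t ∈ R, t ∈ U.gr 1 1) :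
    ∃ Q : BGCData B Γ (CStarQuot R), IsBGCHom U Q (CStarQuot.proj R) := by
  let q := CStarQuot.proj R
  have hzero : ∀ {t}, t ∈ R → q t = 0 := fun ht => CStarQuot.proj_eq_zero ht
  let δ : CStarQuot R →⋆ₐ[ℂ] GroupCStar Γ ⊗ᵐ CStarQuot R :=
    CStarQuot.lift ((map (StarAlgHom.id ℂ _) q).comp U.δ) fun t ht => by
      show map _ q (U.δ t) = 0
      rw [(hR t ht).1, map_tmul, hzero ht, MaxTensor.tmul_zero]
  let δbar : CStarQuot R →⋆ₐ[ℂ] CStarQuot R ⊗ᵐ GroupCStar Γ :=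
    CStarQuot.lift ((map q (StarAlgHom.id ℂ _)).comp U.δbar) fun t ht => by
      show map q _ (U.δbar t) = 0
      rw [(hR t ht).2, map_tmul, hzero ht, MaxTensor.zero_tmul]
  have h1 : ∀ a, δ (q a) = map (StarAlgHom.id ℂ _) q (U.δ a) := fun a => rfl
  have h2 : ∀ a, δbar (q a) = map q (StarAlgHom.id ℂ _) (U.δbar a) := fun a => rfl
  refine ⟨{ δ := δ, δbar := δbar, r := q.comp U.r, s := q.comp U.s
            δ_r := fun b => ?_, δ_s := fun b => ?_, δbar_r := fun b => ?_, δbar_s := fun b => ?_ },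
    ⟨h1, h2, fun b => rfl, fun b => rfl⟩⟩
  · exact (h1 _).trans ((congrArg (map (StarAlgHom.id ℂ _) q) (U.δ_r b)).trans (map_tmul _ _ _ _))
  · exact (h1 _).trans ((congrArg (map (StarAlgHom.id ℂ _) q) (U.δ_s b)).trans (map_tmul _ _ _ _))
  · exact (h2 _).trans ((congrArg (map q (StarAlgHom.id ℂ _)) (U.δbar_r b)).trans (map_tmul _ _ _ _))
  · exact (h2 _).trans ((congrArg (map q (StarAlgHom.id ℂ _)) (U.δbar_s b)).trans (map_tmul _ _ _ _))

lemma IsCotensorData.fiberRel_mem {U : BGCData B Γ (cotensor V W)} (hU : IsCotensorData V W U)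
    {t : cotensor V W} (ht : t ∈ fiberRelC V W) : t ∈ U.gr 1 1 := by
  obtain ⟨b, hb⟩ := ht
  have h : t = cotensor.elem (FiberC.s_mem V b) W.one_mem -
      cotensor.elem V.one_mem (FiberC.r_mem W b) := Subtype.ext hb
  rw [h]
  exact Submodule.sub_mem _ (hU.elem_mem _ _) (hU.elem_mem _ _)

lemma IsCotensorData.exists_fiberData {U : BGCData B Γ (cotensor V W)}
    (hU : IsCotensorData V W U) : ∃ Q : BGCData B Γ (FiberC V W),
      FiberC.IsFiberData V W Q ∧ IsBGCHom U Q (FiberC.proj V W) := by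
  obtain ⟨Q, hQ⟩ := exists_quotientData U (R := fiberRelC V W) fun t ht => hU.fiberRel_mem ht
  refine ⟨Q, ⟨fun ha hc => hQ.map_gr (hU.elem_mem ha hc), fun b => ?_, fun b => ?_⟩, hQ⟩
  · exact (hQ.map_r b).symm.trans (congrArg _ (hU.r_eq b))
  · exact (hQ.map_s b).symm.trans (congrArg _ (hU.s_eq b))

end CotensorData

/-! ### Homomorphisms on cotensor products of quotients -/

section CotensorQuotients

open MaxTensor

variable {B Γ : Type u} [CommCStarAlgebra B] [Group Γ] {α : Γ →* (B ≃⋆ₐ[ℂ] B)}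
  {A C M M' D : Type u} [CStarAlgebra A] [CStarAlgebra C] [CStarAlgebra M] [CStarAlgebra M']
  [CStarAlgebra D]

/-- `q` is the quotient map with respect to the closed ideal generated by `R`. -/
structure IsCStarQuotMap (R : Set A) (q : A →⋆ₐ[ℂ] M) : Prop where
  surjective : Function.Surjective q
  map_eq_zero : ∀ {t}, t ∈ R → q t = 0
  exists_lift : ∀ {D : Type u} [CStarAlgebra D] (f : A →⋆ₐ[ℂ] D), (∀ t ∈ R, f t = 0) →
    ∃ f' : M →⋆ₐ[ℂ] D, ∀ a, f' (q a) = f a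

lemma isCStarQuotMap_id : IsCStarQuotMap (∅ : Set A) (StarAlgHom.id ℂ A) :=
  ⟨Function.surjective_id, fun h => h.elim, fun f _ => ⟨f, fun _ => rfl⟩⟩

lemma isCStarQuotMap_proj (R : Set A) : IsCStarQuotMap R (CStarQuot.proj R) :=
  ⟨CStarQuot.proj_surjective, fun h => CStarQuot.proj_eq_zero h, fun f hf => ⟨CStarQuot.lift f hf, fun _ => rfl⟩⟩

lemma IsCStarQuotMap.mem_closedIdeal {R : Set A} {q : A →⋆ₐ[ℂ] M} (hq : IsCStarQuotMap R q)
    {R' : Set C} {q' : C →⋆ₐ[ℂ] M'} (hq' : IsCStarQuotMap R' q') {x : A ⊗ᵐ C}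
    (hx : map q q' x = 0) :
    x ∈ closedIdeal {n : A ⊗ᵐ C | (∃ t ∈ R, n = tmul t 1) ∨ ∃ t ∈ R', n = tmul 1 t} := by
  set N := {n : A ⊗ᵐ C | (∃ t ∈ R, n = tmul t 1) ∨ ∃ t ∈ R', n = tmul 1 t}
  obtain ⟨f, hf⟩ := hq.exists_lift ((CStarQuot.proj N).comp inl) fun t ht =>
    CStarQuot.proj_eq_zero (T := N) (Or.inl ⟨t, ht, rfl⟩)
  obtain ⟨g, hg⟩ := hq'.exists_lift ((CStarQuot.proj N).comp inr) fun t ht =>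
    CStarQuot.proj_eq_zero (T := N) (Or.inr ⟨t, ht, rfl⟩)
  have hc : ∀ a c, Commute (f a) (g c) := by
    intro a c
    obtain ⟨a, rfl⟩ := hq.surjective a
    obtain ⟨c, rfl⟩ := hq'.surjective c
    rw [hf, hg, commute_iff_eq]
    show CStarQuot.proj N (tmul a 1) * CStarQuot.proj N (tmul 1 c) =
      CStarQuot.proj N (tmul 1 c) * CStarQuot.proj N (tmul a 1)
    rw [← map_mul, ← map_mul, tmul_mul_tmul, tmul_mul_tmul]
    simp only [mul_one, one_mul]
  have h1 : (lift f g hc).comp (map q q') = CStarQuot.proj N := hom_ext fun a c => by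
    show lift f g hc (map q q' (tmul a c)) = _
    rw [map_tmul, lift_tmul, hf, hg]
    show CStarQuot.proj N (tmul a 1) * CStarQuot.proj N (tmul 1 c) = _
    rw [← map_mul, tmul_mul_tmul, mul_one, one_mul]
  have h2 : CStarQuot.proj N x = 0 := by
    rw [← h1]
    show lift f g hc (map q q' x) = 0
    rw [hx, map_zero]
  exact Ideal.Quotient.eq_zero_iff_mem.1 h2

/-- Relations of trivial degree that can be moved past homogeneous elements. -/
structure IsNormalRel (U : BGCData B Γ A) (S R : Set A) : Prop where
  mem : ∀ t ∈ R, t ∈ U.gr 1 1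
  star_mem : ∀ t ∈ R, star t ∈ R
  exists_comm : ∀ a ∈ S, ∀ t ∈ R, ∃ t' ∈ R, a * t = t' * a

lemma isNormalRel_empty (U : BGCData B Γ A) (S : Set A) : IsNormalRel U S ∅ :=
  ⟨fun _ h => h.elim, fun _ h => h.elim, fun _ _ _ h => h.elim⟩

/-- A continuous linear map on a C⋆-algebra that annihilates the products of a relation with two
elements of a linearly dense set annihilates the closed ideal generated by the relations, if the
relations can be moved past the dense set. -/
lemma clm_eq_zero_of_mem_closedIdeal {X : Type u} [CStarAlgebra X] {E N : Set X}
    (hE : closure (Submodule.span ℂ E : Set X) = Set.univ) (hN : ∀ n ∈ N, star n ∈ N)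
    (hc : ∀ y ∈ E, ∀ n ∈ N, ∃ n' ∈ N, y * n = n' * y) (H : X →L[ℂ] D)
    (h0 : ∀ n ∈ N, ∀ y ∈ E, ∀ z ∈ E, H (n * (y * z)) = 0) {x : X} (hx : x ∈ closedIdeal N) :
    H x = 0 := by
  have h1 : ∀ n ∈ N, ∀ y z, H (y * n * z) = 0 := by
    intro n hn y z
    have h2 : ∀ z ∈ E, ∀ y, H (y * n * z) = 0 := fun z hz y =>
      clm_eq_of_dense hE (f := H.comp ((ContinuousLinearMap.mul ℂ X).flip (n * z))) (g := 0)
        (fun y hy => by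
          show H (y * (n * z)) = 0
          obtain ⟨n', hn', h⟩ := hc y hy n hn
          rw [← mul_assoc, h, mul_assoc]
          exact h0 n' hn' y hy z hz) y |> fun h => by rw [mul_assoc]; exact h
    exact clm_eq_of_dense hE (f := H.comp (ContinuousLinearMap.mul ℂ X (y * n))) (g := 0)
      (fun z hz => h2 z hz y) z
  let J : Ideal X :=
    { carrier := {x | ∀ y z, H (y * x * z) = 0 ∧ H (y * star x * z) = 0}
      add_mem' := fun {a b} ha hb y z => by
        rw [star_add, mul_add, mul_add, add_mul, add_mul, map_add, map_add, (ha y z).1, (hb y z).1,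
          (ha y z).2, (hb y z).2, add_zero]
        exact ⟨rfl, rfl⟩
      zero_mem' := fun y z => by simp
      smul_mem' := fun c x hx y z => by
        refine ⟨?_, ?_⟩
        · rw [smul_eq_mul, ← mul_assoc]
          exact (hx (y * c) z).1
        · rw [smul_eq_mul, star_mul, ← mul_assoc, mul_assoc]
          exact (hx y (star c * z)).2 }
  have hJ : IsClosedStarIdeal J :=
    { isTwoSided := ⟨fun {a} b ha y z => by
        refine ⟨?_, ?_⟩
        · rw [← mul_assoc, mul_assoc]
          exact (ha y (b * z)).1
        · rw [star_mul, ← mul_assoc]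
          exact (ha (y * star b) z).2⟩
      isClosed := by
        have : (J : Set X) = ⋂ y, ⋂ z, {x | H (y * x * z) = 0} ∩ {x | H (y * star x * z) = 0} := by
          ext x
          simp only [Set.mem_iInter]
          rfl
        rw [this]
        refine isClosed_iInter fun y => isClosed_iInter fun z => IsClosed.inter ?_ ?_
        · exact isClosed_eq (by fun_prop) continuous_const
        · exact isClosed_eq (by fun_prop) continuous_const
      star_mem := fun x hx y z => by
        rw [star_star]
        exact ⟨(hx y z).2, (hx y z).1⟩ }
  have h2 := (mem_closedIdeal.1 hx J hJ fun n hn y z => ⟨h1 n hn y z, h1 _ (hN n hn) y z⟩) 1 1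
  simpa using h2.1

lemma span_dense_of_forall {E₀ E : Set A} (h₀ : closure (Submodule.span ℂ E₀ : Set A) = Set.univ)
    (h : ∀ x ∈ E₀, x ∈ E ∨ x = 0) : closure (Submodule.span ℂ E : Set A) = Set.univ := by
  rw [Set.eq_univ_iff_forall]
  intro x
  refine closure_mono (Submodule.span_le.2 fun y hy => ?_) (h₀ ▸ Set.mem_univ x)
  rcases h y hy with h | h
  · exact Submodule.subset_span h
  · rw [h]; exact Submodule.zero_mem _

lemma starAlgHom_eq_zero_of_injective {f : A →⋆ₐ[ℂ] C} (hf : Function.Injective f) {x : A}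
    (h : f x = 0) : x = 0 := hf (h.trans (map_zero f).symm)

lemma cotensor.elem_eq_zero {V : BGCData B Γ A} {W : BGCData B Γ C} {γ γ' γ'' : Γ} {a : A} {c : C}
    (ha : a ∈ V.gr γ γ') (hc : c ∈ W.gr γ' γ'') (h : tmul a c = 0) : cotensor.elem ha hc = 0 :=
  starAlgHom_eq_zero_of_injective (f := (cotensor V W).subtype) Subtype.val_injective h

/-- The tensor product of two homogeneous elements vanishes if one of the factors has several
degrees, and one choice of the degrees matches whereas another one does not. -/
lemma tmul_eq_zero_of_ne {V : BGCData B Γ A} {W : BGCData B Γ C} {γ₀ γ₁ γ₂ γ γ' η η' : Γ} {a : A}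
    {c : C} (ha : a ∈ V.gr γ₀ γ₁) (hc : c ∈ W.gr γ₁ γ₂) (ha' : a ∈ V.gr γ γ') (hc' : c ∈ W.gr η η')
    (hne : γ' ≠ η) : tmul a c = 0 := by
  classical
  by_cases hγ₁ : γ₁ = γ'
  · have h5 := W.projLeft_apply γ₁ hc
    rw [if_pos rfl, W.projLeft_apply γ₁ hc', if_neg fun h => hne (hγ₁.symm.trans h.symm)] at h5
    rw [← h5, MaxTensor.tmul_zero]
  · have h5 := V.projRight_apply γ₁ ha
    rw [if_pos rfl, V.projRight_apply γ₁ ha', if_neg fun h => hγ₁ h.symm] at h5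
    rw [← h5, MaxTensor.zero_tmul]

lemma cotensor.dense_of {V : BGCData B Γ A} {W : BGCData B Γ C} {S : Set A} {T : Set C}
    (hS : IsHomogDense α V S) (hT : IsHomogDense α W T) {E : Set (cotensor V W)}
    (h : ∀ a ∈ S, ∀ c ∈ T, ∃ γ γ' η η', a ∈ V.gr γ γ' ∧ c ∈ W.gr η η' ∧
      (γ' = η → ∀ x : cotensor V W, (x : A ⊗ᵐ C) = tmul a c → x ∈ E)) :
    closure (Submodule.span ℂ E : Set (cotensor V W)) = Set.univ := by
  refine span_dense_of_forall (cotensor.elems_dense hS hT) ?_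
  rintro _ ⟨γ₀, γ₁, γ₂, a, c, hx, hy, ha, hc, rfl⟩
  obtain ⟨γ, γ', η, η', h1, h2, h3⟩ := h a ha c hc
  by_cases hγ : γ' = η
  · exact Or.inl (h3 hγ _ rfl)
  · exact Or.inr (cotensor.elem_eq_zero hx hy (tmul_eq_zero_of_ne hx hy h1 h2 hγ))

variable {U : BGCData B Γ A} {U' : BGCData B Γ C} {P : BGCData B Γ M} {P' : BGCData B Γ M'}
  {S R : Set A} {S' R' : Set C} {q : A →⋆ₐ[ℂ] M} {q' : C →⋆ₐ[ℂ] M'}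

/-- A `*`-homomorphism on a cotensor product that annihilates normal relations of trivial degree in
both factors factors through the cotensor product of the quotients. -/
lemma exists_cotensor_lift (hS : IsHomogDense α U S) (hS' : IsHomogDense α U' S')
    (hR : IsNormalRel U S R) (hR' : IsNormalRel U' S' R') (hq : IsCStarQuotMap R q)
    (hq' : IsCStarQuotMap R' q') (hqP : IsBGCHom U P q) (hqP' : IsBGCHom U' P' q')
    (h : cotensor U U' →⋆ₐ[ℂ] D) (h1 : ∀ (t) (ht : t ∈ R),
      h (cotensor.elem (hR.mem t ht) U'.one_mem) = 0)
    (h2 : ∀ (t) (ht : t ∈ R'), h (cotensor.elem U.one_mem (hR'.mem t ht)) = 0) :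
    ∃ f : cotensor P P' →⋆ₐ[ℂ] D, ∀ x, f (cotensor.mapHom hqP hqP' x) = h x := by
  classical
  refine exists_factor_of_ker (S := Set.range (cotensor.mapHom hqP hqP'))
    (cotensor.dense_of (hS.image hqP hq.surjective.denseRange)
      (hS'.image hqP' hq'.surjective.denseRange) ?_) (fun _ hy => hy) h ?_
  · rintro _ ⟨a, ha, rfl⟩ _ ⟨c, hc, rfl⟩
    obtain ⟨γ, γ', h3, -⟩ := hS.homog a ha
    obtain ⟨η, η', h4, -⟩ := hS'.homog c hc
    refine ⟨γ, γ', η, η', hqP.map_gr h3, hqP'.map_gr h4, fun hγ x hx => ?_⟩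
    subst hγ
    exact ⟨cotensor.elem h3 h4, Subtype.ext ((map_tmul q q' a c).trans hx.symm)⟩
  · intro x hx
    have hx' : (x : A ⊗ᵐ C) ∈ closedIdeal
        {n : A ⊗ᵐ C | (∃ t ∈ R, n = tmul t 1) ∨ ∃ t ∈ R', n = tmul 1 t} :=
      hq.mem_closedIdeal hq' (congrArg Subtype.val hx)
    have h3 := clm_eq_zero_of_mem_closedIdeal (maxTensor_span_dense hS.dense hS'.dense) ?_ ?_
      ((StarAlgHom.clm h).comp (hS.expectHom hS')) ?_ hx'
    · have h4 : hS.expectHom hS' (x : A ⊗ᵐ C) = x := Subtype.ext (hS.expect_of_mem x.2)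
      have h5 : h (hS.expectHom hS' (x : A ⊗ᵐ C)) = 0 := h3
      rwa [h4] at h5
    · rintro _ (⟨t, ht, rfl⟩ | ⟨t, ht, rfl⟩)
      · exact Or.inl ⟨star t, hR.star_mem t ht, by rw [star_tmul, star_one]⟩
      · exact Or.inr ⟨star t, hR'.star_mem t ht, by rw [star_tmul, star_one]⟩
    · rintro _ ⟨a, ha, c, hc, rfl⟩ _ (⟨t, ht, rfl⟩ | ⟨t, ht, rfl⟩)
      · obtain ⟨t', ht', h⟩ := hR.exists_comm a ha t ht
        exact ⟨_, Or.inl ⟨t', ht', rfl⟩, by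
          rw [tmul_mul_tmul, tmul_mul_tmul, h, mul_one, one_mul]⟩
      · obtain ⟨t', ht', h⟩ := hR'.exists_comm c hc t ht
        exact ⟨_, Or.inr ⟨t', ht', rfl⟩, by
          rw [tmul_mul_tmul, tmul_mul_tmul, h, mul_one, one_mul]⟩
    · rintro n hn _ ⟨a, ha, c, hc, rfl⟩ _ ⟨a', ha', c', hc', rfl⟩
      obtain ⟨γ, γ', hγ, -⟩ := hS.homog a ha
      obtain ⟨γ₁, γ₁', hγ₁, -⟩ := hS.homog a' ha'
      obtain ⟨η, η', hη, -⟩ := hS'.homog c hc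
      obtain ⟨η₁, η₁', hη₁, -⟩ := hS'.homog c' hc'
      have haa := U.mul_mem hγ hγ₁
      have hcc := U'.mul_mem hη hη₁
      show h (hS.expectHom hS' _) = 0
      rw [tmul_mul_tmul]
      rcases hn with ⟨t, ht, rfl⟩ | ⟨t, ht, rfl⟩
      · rw [tmul_mul_tmul, one_mul]
        by_cases hd : γ' * γ₁' = η * η₁
        · have h4 : hS.expectHom hS' (tmul (t * (a * a')) (c * c')) =
              cotensor.elem (hR.mem t ht) U'.one_mem * cotensor.elem haa (hd ▸ hcc) := by
            refine Subtype.ext ?_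
            show hS.expect U' _ = tmul t 1 * tmul _ _
            rw [hS.expect_tmul (U.mul_mem (hR.mem t ht) haa) hcc, one_mul, if_pos hd,
              tmul_mul_tmul, one_mul]
          rw [h4, map_mul, h1 t ht, zero_mul]
        · have h4 : hS.expectHom hS' (tmul (t * (a * a')) (c * c')) = 0 := by
            refine Subtype.ext ?_
            show hS.expect U' _ = 0
            rw [hS.expect_tmul (U.mul_mem (hR.mem t ht) haa) hcc, one_mul, if_neg hd]
          rw [h4, map_zero]
      · rw [tmul_mul_tmul, one_mul]
        by_cases hd : γ' * γ₁' = η * η₁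
        · have h4 : hS.expectHom hS' (tmul (a * a') (t * (c * c'))) =
              cotensor.elem U.one_mem (hR'.mem t ht) * cotensor.elem haa (hd ▸ hcc) := by
            refine Subtype.ext ?_
            show hS.expect U' _ = tmul 1 t * tmul _ _
            rw [hS.expect_tmul haa (U'.mul_mem (hR'.mem t ht) hcc), one_mul, if_pos hd,
              tmul_mul_tmul, one_mul]
          rw [h4, map_mul, h2 t ht, zero_mul]
        · have h4 : hS.expectHom hS' (tmul (a * a') (t * (c * c'))) = 0 := by
            refine Subtype.ext ?_
            show hS.expect U' _ = 0
            rw [hS.expect_tmul haa (U'.mul_mem (hR'.mem t ht) hcc), one_mul, if_neg hd]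
          rw [h4, map_zero]

end CotensorQuotients

/-! ### Associativity of the fiber product -/

section FiberAssoc

open MaxTensor

variable {B Γ : Type u} [CommCStarAlgebra B] [Group Γ] {α : Γ →* (B ≃⋆ₐ[ℂ] B)}
  {A C D M X Y K : Type u} [CStarAlgebra A] [CStarAlgebra C] [CStarAlgebra D] [CStarAlgebra M]
  [CStarAlgebra X] [CStarAlgebra Y] [CStarAlgebra K]

/-- A relation between two C⋆-algebras whose first projection is linearly dense and that is
the equality relation after mapping into a third C⋆-algebra is part of the graph of a
`*`-homomorphism. -/
lemma exists_hom_of_graph {i : X →⋆ₐ[ℂ] Y} (hi : Function.Injective i) (h : K →⋆ₐ[ℂ] Y)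
    {E : Set K} (hE : closure (Submodule.span ℂ E : Set K) = Set.univ) {G : K → X → Prop}
    (hEG : ∀ k ∈ E, ∃ x, G k x) (hG : ∀ k x, G k x → i x = h k) :
    ∃ θ : K →⋆ₐ[ℂ] X, ∀ k x, G k x → θ k = x := by
  obtain ⟨θ, hθ⟩ := exists_factor hi h hE fun k hk => by
    obtain ⟨x, hx⟩ := hEG k hk
    exact ⟨x, hG k x hx⟩
  exact ⟨θ, fun k x hx => hi ((hθ k).trans (hG k x hx).symm)⟩

/-- `ι` identifies the `(B, Γ)`-C⋆-algebra `D` with the cotensor product of `A` with itself. -/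
structure IsCotensorModel (V : BGCData B Γ A) (S : Set A) (U : BGCData B Γ D)
    (ι : D →⋆ₐ[ℂ] A ⊗ᵐ A) : Prop where
  injective : Function.Injective ι
  injective_left : Function.Injective (map (StarAlgHom.id ℂ A) ι)
  injective_right : Function.Injective (map ι (StarAlgHom.id ℂ A))
  exists_elem : ∀ {γ γ' γ'' : Γ} {a c : A}, a ∈ V.gr γ γ' → c ∈ V.gr γ' γ'' → ∃ x, ι x = tmul a c
  mem_gr : ∀ {γ γ' γ'' : Γ} {a c : A}, a ∈ V.gr γ γ' → c ∈ V.gr γ' γ'' → ∀ x, ι x = tmul a c →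
    x ∈ U.gr γ γ''
  map_r : ∀ b, ι (U.r b) = tmul (V.r b) 1
  map_s : ∀ b, ι (U.s b) = tmul 1 (V.s b)
  dense : closure (Submodule.span ℂ {x : D | ∃ (γ γ' γ'' : Γ) (a c : A), a ∈ V.gr γ γ' ∧
    c ∈ V.gr γ' γ'' ∧ a ∈ S ∧ c ∈ S ∧ ι x = tmul a c} : Set D) = Set.univ

variable {V : BGCData B Γ A} {S : Set A} {U : BGCData B Γ D} {ι : D →⋆ₐ[ℂ] A ⊗ᵐ A}

/-- The elements of the cotensor product that correspond to elementary tensors of homogeneous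
elements. -/
def cotensorModelElems (V : BGCData B Γ A) (S : Set A) (ι : D →⋆ₐ[ℂ] A ⊗ᵐ A) : Set D :=
  {x : D | ∃ (γ γ' γ'' : Γ) (a c : A), a ∈ V.gr γ γ' ∧ c ∈ V.gr γ' γ'' ∧ a ∈ S ∧ c ∈ S ∧
    ι x = tmul a c}

/-- The relations `s(b) ⊗ 1 = 1 ⊗ r(b)`. -/
def cotensorModelRel (V : BGCData B Γ A) (ι : D →⋆ₐ[ℂ] A ⊗ᵐ A) : Set D :=
  {x : D | ∃ b : B, ι x = tmul (V.s b) 1 - tmul 1 (V.r b)}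

lemma IsCotensorModel.isHomogDense (hU : IsCotensorModel V S U ι) (hS : IsHomogDense α V S) :
    IsHomogDense α U (cotensorModelElems V S ι) where
  homog := by
    rintro x ⟨γ, γ', γ'', a, c, ha, hc, -, -, hx⟩
    refine ⟨γ, γ'', hU.mem_gr ha hc x hx, fun b => hU.injective ?_, fun b => hU.injective ?_⟩
    · rw [map_mul, map_mul, hx, hU.map_r, hU.map_r, tmul_mul_tmul, tmul_mul_tmul, hS.mul_r b ha,
        one_mul, mul_one]
    · rw [map_mul, map_mul, hx, hU.map_s, hU.map_s, tmul_mul_tmul, tmul_mul_tmul, hS.mul_s b hc,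
        one_mul, mul_one]
  dense := hU.dense

/-- The relations of the fiber product can be moved past homogeneous elements. -/
lemma IsCotensorModel.isNormalRel (hU : IsCotensorModel V S U ι) (hS : IsHomogDense α V S) :
    IsNormalRel U (cotensorModelElems V S ι) (cotensorModelRel V ι) where
  mem := by
    rintro t ⟨b, hb⟩
    obtain ⟨x, hx⟩ := hU.exists_elem (FiberC.s_mem V b) V.one_mem
    obtain ⟨y, hy⟩ := hU.exists_elem V.one_mem (FiberC.r_mem V b)
    have h : t = x - y := hU.injective (by rw [hb, map_sub, hx, hy])
    rw [h]
    exact Submodule.sub_mem _ (hU.mem_gr (FiberC.s_mem V b) V.one_mem x hx)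
      (hU.mem_gr V.one_mem (FiberC.r_mem V b) y hy)
  star_mem := by
    rintro t ⟨b, hb⟩
    exact ⟨star b, by rw [map_star, hb, star_sub, star_tmul, star_tmul, star_one, map_star,
      map_star]⟩
  exists_comm := by
    rintro e ⟨γ, γ', γ'', a, c, ha, hc, -, -, he⟩ t ⟨b, hb⟩
    obtain ⟨x, hx⟩ := hU.exists_elem (FiberC.s_mem V (α γ' b)) V.one_mem
    obtain ⟨y, hy⟩ := hU.exists_elem V.one_mem (FiberC.r_mem V (α γ' b))
    refine ⟨x - y, ⟨α γ' b, by rw [map_sub, hx, hy]⟩, hU.injective ?_⟩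
    rw [map_mul, map_mul, map_sub, hx, hy, he, hb, mul_sub, sub_mul, tmul_mul_tmul, tmul_mul_tmul,
      tmul_mul_tmul, tmul_mul_tmul, hS.mul_s b ha, hS.mul_r b hc]
    simp only [one_mul, mul_one]

/-- The relation between `(a ⊗ c) ⊗ d` and `a ⊗ (c ⊗ d)` for homogeneous elements of matching
degrees. -/
def AssocGraph (V : BGCData B Γ A) (ι : D →⋆ₐ[ℂ] A ⊗ᵐ A) (x : D ⊗ᵐ A) (y : A ⊗ᵐ D) : Prop :=
  ∃ (γ₀ γ₁ γ₂ γ₃ : Γ) (a c d : A) (x₀ y₀ : D), a ∈ V.gr γ₀ γ₁ ∧ c ∈ V.gr γ₁ γ₂ ∧ d ∈ V.gr γ₂ γ₃ ∧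
    ι x₀ = tmul a c ∧ ι y₀ = tmul c d ∧ x = tmul x₀ d ∧ y = tmul a y₀

lemma IsCotensorModel.dense_left (hU : IsCotensorModel V S U ι) (hS : IsHomogDense α V S) :
    closure (Submodule.span ℂ {x : cotensor U V | ∃ y : cotensor V U, AssocGraph V ι x y} :
      Set (cotensor U V)) = Set.univ := by
  refine cotensor.dense_of (hU.isHomogDense hS) hS ?_
  rintro x₀ ⟨γ₀, γ₁, γ₂, a, c, ha, hc, -, -, hx₀⟩ d hd
  obtain ⟨η, η', h, -⟩ := hS.homog d hd
  refine ⟨γ₀, γ₂, η, η', hU.mem_gr ha hc x₀ hx₀, h, fun he x hx => ?_⟩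
  subst he
  obtain ⟨y₀, hy₀⟩ := hU.exists_elem hc h
  exact ⟨cotensor.elem ha (hU.mem_gr hc h y₀ hy₀), _, _, _, _, a, c, d, x₀, y₀, ha, hc, h, hx₀, hy₀,
    hx, rfl⟩

lemma IsCotensorModel.dense_right (hU : IsCotensorModel V S U ι) (hS : IsHomogDense α V S) :
    closure (Submodule.span ℂ {y : cotensor V U | ∃ x : cotensor U V, AssocGraph V ι x y} :
      Set (cotensor V U)) = Set.univ := by
  refine cotensor.dense_of hS (hU.isHomogDense hS) ?_
  rintro a ha y₀ ⟨γ₀, γ₁, γ₂, c, d, hc, hd, -, -, hy₀⟩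
  obtain ⟨η, η', h, -⟩ := hS.homog a ha
  refine ⟨η, η', γ₀, γ₂, h, hU.mem_gr hc hd y₀ hy₀, fun he y hy => ?_⟩
  subst he
  obtain ⟨x₀, hx₀⟩ := hU.exists_elem h hc
  exact ⟨cotensor.elem (hU.mem_gr h hc x₀ hx₀) hd, _, _, _, _, a, c, d, x₀, y₀, h, hc, hd, hx₀, hy₀,
    rfl, hy⟩

lemma IsCotensorModel.exists_assoc (hU : IsCotensorModel V S U ι) (hS : IsHomogDense α V S) :
    ∃ θ : cotensor U V →⋆ₐ[ℂ] cotensor V U, ∀ (x : cotensor U V) (y : cotensor V U),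
      AssocGraph V ι x y → θ x = y := by
  refine exists_hom_of_graph (G := fun (x : cotensor U V) (y : cotensor V U) => AssocGraph V ι x y)
    (i := (map (StarAlgHom.id ℂ A) ι).comp (cotensor V U).subtype)
    (hU.injective_left.comp Subtype.val_injective)
    ((assocHom A A A).comp ((map ι (StarAlgHom.id ℂ A)).comp (cotensor U V).subtype))
    (hU.dense_left hS) (fun _ h => h) ?_
  rintro x y ⟨γ₀, γ₁, γ₂, γ₃, a, c, d, x₀, y₀, ha, hc, hd, hx₀, hy₀, hx, hy⟩
  show map (StarAlgHom.id ℂ A) ι (y : A ⊗ᵐ D) =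
    assocHom A A A (map ι (StarAlgHom.id ℂ A) (x : D ⊗ᵐ A))
  rw [hx, hy, map_tmul, map_tmul, hx₀, hy₀]
  exact (assocHom_tmul a c d).symm

lemma IsCotensorModel.exists_assoc_inv (hU : IsCotensorModel V S U ι) (hS : IsHomogDense α V S) :
    ∃ θ : cotensor V U →⋆ₐ[ℂ] cotensor U V, ∀ (y : cotensor V U) (x : cotensor U V),
      AssocGraph V ι x y → θ y = x := by
  refine exists_hom_of_graph (G := fun (y : cotensor V U) (x : cotensor U V) => AssocGraph V ι x y)
    (i := (map ι (StarAlgHom.id ℂ A)).comp (cotensor U V).subtype)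
    (hU.injective_right.comp Subtype.val_injective)
    ((assocInv A A A).comp ((map (StarAlgHom.id ℂ A) ι).comp (cotensor V U).subtype))
    (hU.dense_right hS) (fun _ h => h) ?_
  rintro y x ⟨γ₀, γ₁, γ₂, γ₃, a, c, d, x₀, y₀, ha, hc, hd, hx₀, hy₀, hx, hy⟩
  show map ι (StarAlgHom.id ℂ A) (x : D ⊗ᵐ A) =
    assocInv A A A (map (StarAlgHom.id ℂ A) ι (y : A ⊗ᵐ D))
  rw [hx, hy, map_tmul, map_tmul, hx₀, hy₀]
  exact (assocInv_tmul a c d).symm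

lemma FiberC.proj_eq_of_coe {V : BGCData B Γ A} {W : BGCData B Γ C} {x y : cotensor V W}
    (h : (x : A ⊗ᵐ C) = y) : FiberC.proj V W x = FiberC.proj V W y :=
  congrArg _ (Subtype.ext h)

lemma FiberC.elem_s_one {V : BGCData B Γ A} {W : BGCData B Γ C} (b : B) :
    FiberC.elem (FiberC.s_mem V b) W.one_mem = FiberC.elem V.one_mem (FiberC.r_mem W b) :=
  sub_eq_zero.1 ((map_sub (FiberC.proj V W) _ _).symm.trans
    (CStarQuot.proj_eq_zero (T := fiberRelC V W) ⟨b, rfl⟩))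

lemma FiberC.dense {V : BGCData B Γ A} {W : BGCData B Γ C} {E : Set (cotensor V W)}
    (hE : closure (Submodule.span ℂ E : Set (cotensor V W)) = Set.univ) :
    closure (Submodule.span ℂ (FiberC.proj V W '' E) : Set (FiberC V W)) = Set.univ :=
  span_image_dense hE _ CStarQuot.proj_surjective.denseRange

variable {p : D →⋆ₐ[ℂ] M} {Q : BGCData B Γ M}

/-- The map `(a ⊗ c) ⊗ d ↦ a ⊗ (c ⊗ d)` from a cotensor product to a fiber product. -/
lemma IsCotensorModel.exists_assoc_proj (hU : IsCotensorModel V S U ι) (hS : IsHomogDense α V S)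
    (hUQ : IsBGCHom U Q p) :
    ∃ g : cotensor U V →⋆ₐ[ℂ] FiberC V Q, ∀ {γ₀ γ₁ γ₂ γ₃ : Γ} {a c d : A} {x₀ y₀ : D}
      (hx : x₀ ∈ U.gr γ₀ γ₂) (hy : p y₀ ∈ Q.gr γ₁ γ₃) (ha : a ∈ V.gr γ₀ γ₁)
      (_ : c ∈ V.gr γ₁ γ₂) (hd : d ∈ V.gr γ₂ γ₃),
        ι x₀ = tmul a c → ι y₀ = tmul c d → g (cotensor.elem hx hd) = FiberC.elem ha hy := by
  obtain ⟨θ, hθ⟩ := hU.exists_assoc hS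
  refine ⟨(FiberC.proj V Q).comp ((cotensor.mapHom (IsBGCHom.id V) hUQ).comp θ), ?_⟩
  intro γ₀ γ₁ γ₂ γ₃ a c d x₀ y₀ hx hy ha hc hd hx₀ hy₀
  have h1 : θ (cotensor.elem hx hd) = cotensor.elem ha (hU.mem_gr hc hd y₀ hy₀) :=
    hθ _ _ ⟨_, _, _, _, a, c, d, x₀, y₀, ha, hc, hd, hx₀, hy₀, rfl, rfl⟩
  have h2 : cotensor.mapHom (IsBGCHom.id V) hUQ (cotensor.elem ha (hU.mem_gr hc hd y₀ hy₀)) =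
      cotensor.elem ha hy := Subtype.ext (map_tmul _ _ _ _)
  exact congrArg (FiberC.proj V Q) ((congrArg (cotensor.mapHom (IsBGCHom.id V) hUQ) h1).trans h2)

lemma IsCotensorModel.exists_assoc_inv_proj (hU : IsCotensorModel V S U ι)
    (hS : IsHomogDense α V S) (hUQ : IsBGCHom U Q p) :
    ∃ g : cotensor V U →⋆ₐ[ℂ] FiberC Q V, ∀ {γ₀ γ₁ γ₂ γ₃ : Γ} {a c d : A} {x₀ y₀ : D}
      (hx : p x₀ ∈ Q.gr γ₀ γ₂) (hy : y₀ ∈ U.gr γ₁ γ₃) (ha : a ∈ V.gr γ₀ γ₁)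
      (_ : c ∈ V.gr γ₁ γ₂) (hd : d ∈ V.gr γ₂ γ₃),
        ι x₀ = tmul a c → ι y₀ = tmul c d → g (cotensor.elem ha hy) = FiberC.elem hx hd := by
  obtain ⟨θ, hθ⟩ := hU.exists_assoc_inv hS
  refine ⟨(FiberC.proj Q V).comp ((cotensor.mapHom hUQ (IsBGCHom.id V)).comp θ), ?_⟩
  intro γ₀ γ₁ γ₂ γ₃ a c d x₀ y₀ hx hy ha hc hd hx₀ hy₀
  have h1 : θ (cotensor.elem ha hy) = cotensor.elem (hU.mem_gr ha hc x₀ hx₀) hd :=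
    hθ _ _ ⟨_, _, _, _, a, c, d, x₀, y₀, ha, hc, hd, hx₀, hy₀, rfl, rfl⟩
  have h2 : cotensor.mapHom hUQ (IsBGCHom.id V) (cotensor.elem (hU.mem_gr ha hc x₀ hx₀) hd) =
      cotensor.elem hx hd := Subtype.ext (map_tmul _ _ _ _)
  exact congrArg (FiberC.proj Q V) ((congrArg (cotensor.mapHom hUQ (IsBGCHom.id V)) h1).trans h2)

/-- The relation `s(b) ⊗ (1 ⊗ 1) = 1 ⊗ (r(b) ⊗ 1)`. -/
lemma IsCotensorModel.elem_s_one (hU : IsCotensorModel V S U ι) (hUQ : IsBGCHom U Q p) {b : B}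
    {x y : D} (hx : ι x = tmul 1 1) (hy : ι y = tmul (V.r b) 1) (h1 : p x ∈ Q.gr 1 1)
    (h2 : p y ∈ Q.gr 1 1) : FiberC.elem (FiberC.s_mem V b) h1 = FiberC.elem V.one_mem h2 := by
  have hx1 : x = 1 := hU.injective (by rw [hx, map_one, MaxTensor.one_def])
  have hy1 : y = U.r b := hU.injective (by rw [hy, hU.map_r])
  have h3 : p x = 1 := (congrArg p hx1).trans (map_one p)
  have h4 : p y = Q.r b := (congrArg p hy1).trans (hUQ.map_r b)
  exact (FiberC.proj_eq_of_coe (congrArg (tmul (V.s b)) h3)).trans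
    ((FiberC.elem_s_one b).trans (FiberC.proj_eq_of_coe (congrArg (tmul 1) h4.symm)))

/-- The relation `(1 ⊗ s(b)) ⊗ 1 = (1 ⊗ 1) ⊗ r(b)`. -/
lemma IsCotensorModel.elem_one_s (hU : IsCotensorModel V S U ι) (hUQ : IsBGCHom U Q p) {b : B}
    {x y : D} (hx : ι x = tmul 1 1) (hy : ι y = tmul 1 (V.s b)) (h1 : p x ∈ Q.gr 1 1)
    (h2 : p y ∈ Q.gr 1 1) : FiberC.elem h2 V.one_mem = FiberC.elem h1 (FiberC.r_mem V b) := by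
  have hx1 : x = 1 := hU.injective (by rw [hx, map_one, MaxTensor.one_def])
  have hy1 : y = U.s b := hU.injective (by rw [hy, hU.map_s])
  have h3 : p x = 1 := (congrArg p hx1).trans (map_one p)
  have h4 : p y = Q.s b := (congrArg p hy1).trans (hUQ.map_s b)
  exact (FiberC.proj_eq_of_coe (congrArg (tmul · 1) h4)).trans
    ((FiberC.elem_s_one b).trans (FiberC.proj_eq_of_coe (congrArg (tmul · (V.r b)) h3.symm)))

variable (hU : IsCotensorModel V S U ι) (hS : IsHomogDense α V S) (hUQ : IsBGCHom U Q p)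
  (hp : IsCStarQuotMap (cotensorModelRel V ι) p)
include hU hS hUQ hp

lemma IsCotensorModel.exists_assoc_cotensor :
    ∃ f : cotensor Q V →⋆ₐ[ℂ] FiberC V Q, ∀ {γ₀ γ₁ γ₂ γ₃ : Γ} {a c d : A} {x₀ y₀ : D}
      (hx : p x₀ ∈ Q.gr γ₀ γ₂) (hy : p y₀ ∈ Q.gr γ₁ γ₃) (ha : a ∈ V.gr γ₀ γ₁)
      (_ : c ∈ V.gr γ₁ γ₂) (hd : d ∈ V.gr γ₂ γ₃),
        ι x₀ = tmul a c → ι y₀ = tmul c d → f (cotensor.elem hx hd) = FiberC.elem ha hy := by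
  obtain ⟨g, hg⟩ := hU.exists_assoc_proj hS hUQ
  have hR := hU.isNormalRel hS
  have h1 : ∀ (t) (ht : t ∈ cotensorModelRel V ι),
      g (cotensor.elem (hR.mem t ht) V.one_mem) = 0 := by
    rintro t ⟨b, hb⟩
    obtain ⟨x, hx⟩ := hU.exists_elem (FiberC.s_mem V b) V.one_mem
    obtain ⟨y, hy⟩ := hU.exists_elem V.one_mem (FiberC.r_mem V b)
    obtain ⟨e, he⟩ := hU.exists_elem V.one_mem V.one_mem
    obtain ⟨z, hz⟩ := hU.exists_elem (FiberC.r_mem V b) V.one_mem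
    have hxm := hU.mem_gr (FiberC.s_mem V b) V.one_mem x hx
    have hym := hU.mem_gr V.one_mem (FiberC.r_mem V b) y hy
    have hem := hUQ.map_gr (hU.mem_gr V.one_mem V.one_mem e he)
    have hzm := hUQ.map_gr (hU.mem_gr (FiberC.r_mem V b) V.one_mem z hz)
    have ht : t = x - y := hU.injective (by rw [hb, map_sub, hx, hy])
    have h2 : cotensor.elem (hR.mem t ⟨b, hb⟩) V.one_mem =
        cotensor.elem hxm V.one_mem - cotensor.elem hym V.one_mem :=
      Subtype.ext ((congrArg inl ht).trans (map_sub (inl : D →⋆ₐ[ℂ] D ⊗ᵐ A) x y))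
    rw [h2, map_sub, hg hxm hem (FiberC.s_mem V b) V.one_mem V.one_mem hx he,
      hg hym hzm V.one_mem (FiberC.r_mem V b) V.one_mem hy hz, sub_eq_zero]
    exact hU.elem_s_one hUQ he hz hem hzm
  obtain ⟨f, hf⟩ := exists_cotensor_lift (hU.isHomogDense hS) hS hR
    (isNormalRel_empty V S) hp isCStarQuotMap_id hUQ (IsBGCHom.id V) g h1 (fun t ht => ht.elim)
  refine ⟨f, fun {γ₀ γ₁ γ₂ γ₃ a c d x₀ y₀} hx hy ha hc hd hx₀ hy₀ => ?_⟩
  have h2 : cotensor.mapHom hUQ (IsBGCHom.id V) (cotensor.elem (hU.mem_gr ha hc x₀ hx₀) hd) =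
      cotensor.elem hx hd := Subtype.ext (map_tmul _ _ _ _)
  exact (congrArg f h2).symm.trans ((hf _).trans (hg _ hy ha hc hd hx₀ hy₀))

lemma IsCotensorModel.exists_assoc_inv_cotensor :
    ∃ f : cotensor V Q →⋆ₐ[ℂ] FiberC Q V, ∀ {γ₀ γ₁ γ₂ γ₃ : Γ} {a c d : A} {x₀ y₀ : D}
      (hx : p x₀ ∈ Q.gr γ₀ γ₂) (hy : p y₀ ∈ Q.gr γ₁ γ₃) (ha : a ∈ V.gr γ₀ γ₁)
      (_ : c ∈ V.gr γ₁ γ₂) (hd : d ∈ V.gr γ₂ γ₃),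
        ι x₀ = tmul a c → ι y₀ = tmul c d → f (cotensor.elem ha hy) = FiberC.elem hx hd := by
  obtain ⟨g, hg⟩ := hU.exists_assoc_inv_proj hS hUQ
  have hR := hU.isNormalRel hS
  have h1 : ∀ (t) (ht : t ∈ cotensorModelRel V ι),
      g (cotensor.elem V.one_mem (hR.mem t ht)) = 0 := by
    rintro t ⟨b, hb⟩
    obtain ⟨x, hx⟩ := hU.exists_elem (FiberC.s_mem V b) V.one_mem
    obtain ⟨y, hy⟩ := hU.exists_elem V.one_mem (FiberC.r_mem V b)
    obtain ⟨e, he⟩ := hU.exists_elem V.one_mem V.one_mem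
    obtain ⟨z, hz⟩ := hU.exists_elem V.one_mem (FiberC.s_mem V b)
    have hxm := hU.mem_gr (FiberC.s_mem V b) V.one_mem x hx
    have hym := hU.mem_gr V.one_mem (FiberC.r_mem V b) y hy
    have hem := hUQ.map_gr (hU.mem_gr V.one_mem V.one_mem e he)
    have hzm := hUQ.map_gr (hU.mem_gr V.one_mem (FiberC.s_mem V b) z hz)
    have ht : t = x - y := hU.injective (by rw [hb, map_sub, hx, hy])
    have h2 : cotensor.elem V.one_mem (hR.mem t ⟨b, hb⟩) =
        cotensor.elem V.one_mem hxm - cotensor.elem V.one_mem hym :=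
      Subtype.ext ((congrArg inr ht).trans (map_sub (inr : D →⋆ₐ[ℂ] A ⊗ᵐ D) x y))
    rw [h2, map_sub, hg hzm hxm V.one_mem (FiberC.s_mem V b) V.one_mem hz hx,
      hg hem hym V.one_mem V.one_mem (FiberC.r_mem V b) he hy, sub_eq_zero]
    exact hU.elem_one_s hUQ he hz hem hzm
  obtain ⟨f, hf⟩ := exists_cotensor_lift hS (hU.isHomogDense hS) (isNormalRel_empty V S) hR
    isCStarQuotMap_id hp (IsBGCHom.id V) hUQ g (fun t ht => ht.elim) h1
  refine ⟨f, fun {γ₀ γ₁ γ₂ γ₃ a c d x₀ y₀} hx hy ha hc hd hx₀ hy₀ => ?_⟩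
  have h2 : cotensor.mapHom (IsBGCHom.id V) hUQ (cotensor.elem ha (hU.mem_gr hc hd y₀ hy₀)) =
      cotensor.elem ha hy := Subtype.ext (map_tmul _ _ _ _)
  exact (congrArg f h2).symm.trans ((hf _).trans (hg hx _ ha hc hd hx₀ hy₀))

lemma IsCotensorModel.exists_fiber_assoc :
    ∃ φ : FiberC Q V →⋆ₐ[ℂ] FiberC V Q, ∀ {γ₀ γ₁ γ₂ γ₃ : Γ} {a c d : A} {x₀ y₀ : D}
      (hx : p x₀ ∈ Q.gr γ₀ γ₂) (hy : p y₀ ∈ Q.gr γ₁ γ₃) (ha : a ∈ V.gr γ₀ γ₁)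
      (_ : c ∈ V.gr γ₁ γ₂) (hd : d ∈ V.gr γ₂ γ₃),
        ι x₀ = tmul a c → ι y₀ = tmul c d → φ (FiberC.elem hx hd) = FiberC.elem ha hy := by
  obtain ⟨f, hf⟩ := hU.exists_assoc_cotensor hS hUQ hp
  refine ⟨CStarQuot.lift f ?_, fun hx hy ha hc hd hx₀ hy₀ => hf hx hy ha hc hd hx₀ hy₀⟩
  rintro x ⟨b, hb⟩
  obtain ⟨z, hz⟩ := hU.exists_elem V.one_mem (FiberC.s_mem V b)
  obtain ⟨e, he⟩ := hU.exists_elem V.one_mem V.one_mem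
  obtain ⟨w, hw⟩ := hU.exists_elem (FiberC.s_mem V b) V.one_mem
  obtain ⟨y, hy⟩ := hU.exists_elem V.one_mem (FiberC.r_mem V b)
  have hzm := hUQ.map_gr (hU.mem_gr V.one_mem (FiberC.s_mem V b) z hz)
  have hem := hUQ.map_gr (hU.mem_gr V.one_mem V.one_mem e he)
  have hwm := hUQ.map_gr (hU.mem_gr (FiberC.s_mem V b) V.one_mem w hw)
  have hym := hUQ.map_gr (hU.mem_gr V.one_mem (FiberC.r_mem V b) y hy)
  have he1 : p e = 1 := (congrArg p (hU.injective (by rw [he, map_one, MaxTensor.one_def]))).trans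
    (map_one p)
  have hz1 : p z = Q.s b := (congrArg p (hU.injective (by rw [hz, hU.map_s]))).trans (hUQ.map_s b)
  have hwy : p w = p y := by
    rw [← sub_eq_zero, ← map_sub]
    exact hp.map_eq_zero ⟨b, by rw [map_sub, hw, hy]⟩
  have h1 : x = cotensor.elem hzm V.one_mem - cotensor.elem hem (FiberC.r_mem V b) :=
    Subtype.ext (hb.trans (congrArg₂ (fun p q => tmul p 1 - tmul q (V.r b)) hz1.symm he1.symm))
  rw [h1, map_sub, hf hzm hwm V.one_mem (FiberC.s_mem V b) V.one_mem hz hw,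
    hf hem hym V.one_mem V.one_mem (FiberC.r_mem V b) he hy, sub_eq_zero]
  exact FiberC.proj_eq_of_coe (congrArg (tmul 1) hwy)

lemma IsCotensorModel.exists_fiber_assoc_inv :
    ∃ φ : FiberC V Q →⋆ₐ[ℂ] FiberC Q V, ∀ {γ₀ γ₁ γ₂ γ₃ : Γ} {a c d : A} {x₀ y₀ : D}
      (hx : p x₀ ∈ Q.gr γ₀ γ₂) (hy : p y₀ ∈ Q.gr γ₁ γ₃) (ha : a ∈ V.gr γ₀ γ₁)
      (_ : c ∈ V.gr γ₁ γ₂) (hd : d ∈ V.gr γ₂ γ₃),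
        ι x₀ = tmul a c → ι y₀ = tmul c d → φ (FiberC.elem ha hy) = FiberC.elem hx hd := by
  obtain ⟨f, hf⟩ := hU.exists_assoc_inv_cotensor hS hUQ hp
  refine ⟨CStarQuot.lift f ?_, fun hx hy ha hc hd hx₀ hy₀ => hf hx hy ha hc hd hx₀ hy₀⟩
  rintro x ⟨b, hb⟩
  obtain ⟨z, hz⟩ := hU.exists_elem (FiberC.r_mem V b) V.one_mem
  obtain ⟨e, he⟩ := hU.exists_elem V.one_mem V.one_mem
  obtain ⟨w, hw⟩ := hU.exists_elem (FiberC.s_mem V b) V.one_mem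
  obtain ⟨y, hy⟩ := hU.exists_elem V.one_mem (FiberC.r_mem V b)
  have hzm := hUQ.map_gr (hU.mem_gr (FiberC.r_mem V b) V.one_mem z hz)
  have hem := hUQ.map_gr (hU.mem_gr V.one_mem V.one_mem e he)
  have hwm := hUQ.map_gr (hU.mem_gr (FiberC.s_mem V b) V.one_mem w hw)
  have hym := hUQ.map_gr (hU.mem_gr V.one_mem (FiberC.r_mem V b) y hy)
  have he1 : p e = 1 := (congrArg p (hU.injective (by rw [he, map_one, MaxTensor.one_def]))).trans
    (map_one p)
  have hz1 : p z = Q.r b := (congrArg p (hU.injective (by rw [hz, hU.map_r]))).trans (hUQ.map_r b)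
  have hwy : p w = p y := by
    rw [← sub_eq_zero, ← map_sub]
    exact hp.map_eq_zero ⟨b, by rw [map_sub, hw, hy]⟩
  have h1 : x = cotensor.elem (FiberC.s_mem V b) hem - cotensor.elem V.one_mem hzm :=
    Subtype.ext (hb.trans (congrArg₂ (fun p q => tmul (V.s b) p - tmul 1 q) he1.symm hz1.symm))
  rw [h1, map_sub, hf hwm hem (FiberC.s_mem V b) V.one_mem V.one_mem hw he,
    hf hym hzm V.one_mem (FiberC.r_mem V b) V.one_mem hy hz, sub_eq_zero]
  exact FiberC.proj_eq_of_coe (congrArg (tmul · 1) hwy)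

/-- The canonical isomorphism between the two threefold fiber products. -/
lemma IsCotensorModel.exists_fiber_assoc_equiv :
    ∃ φ : FiberC Q V ≃⋆ₐ[ℂ] FiberC V Q, ∀ {γ₀ γ₁ γ₂ γ₃ : Γ} {a c d : A} {x₀ y₀ : D}
      (hx : p x₀ ∈ Q.gr γ₀ γ₂) (hy : p y₀ ∈ Q.gr γ₁ γ₃) (ha : a ∈ V.gr γ₀ γ₁)
      (_ : c ∈ V.gr γ₁ γ₂) (hd : d ∈ V.gr γ₂ γ₃),
        ι x₀ = tmul a c → ι y₀ = tmul c d → φ (FiberC.elem hx hd) = FiberC.elem ha hy := by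
  obtain ⟨f, hf⟩ := hU.exists_fiber_assoc hS hUQ hp
  obtain ⟨g, hg⟩ := hU.exists_fiber_assoc_inv hS hUQ hp
  have hSQ := (hU.isHomogDense hS).image hUQ hp.surjective.denseRange
  have h1 : ∀ x, g (f x) = x := by
    refine starAlgHom_eq_of_dense (f := g.comp f) (g := StarAlgHom.id ℂ _) (FiberC.dense
      (E := {x : cotensor Q V | ∃ (γ₀ γ₁ γ₂ γ₃ : Γ) (a c d : A) (x₀ y₀ : D)
        (hx : p x₀ ∈ Q.gr γ₀ γ₂) (_ : p y₀ ∈ Q.gr γ₁ γ₃) (_ : a ∈ V.gr γ₀ γ₁)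
        (_ : c ∈ V.gr γ₁ γ₂) (hd : d ∈ V.gr γ₂ γ₃), ι x₀ = tmul a c ∧ ι y₀ = tmul c d ∧
          x = cotensor.elem hx hd})
      (cotensor.dense_of hSQ hS ?_)) ?_
    · rintro _ ⟨x₀, ⟨γ₀, γ₁, γ₂, a, c, ha, hc, -, -, hx₀⟩, rfl⟩ d hd
      obtain ⟨η, η', h, -⟩ := hS.homog d hd
      have hxm := hUQ.map_gr (hU.mem_gr ha hc x₀ hx₀)
      refine ⟨γ₀, γ₂, η, η', hxm, h, fun he x hx => ?_⟩
      subst he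
      obtain ⟨y₀, hy₀⟩ := hU.exists_elem hc h
      exact ⟨_, _, _, _, a, c, d, x₀, y₀, hxm, hUQ.map_gr (hU.mem_gr hc h y₀ hy₀), ha, hc, h, hx₀,
        hy₀, Subtype.ext hx⟩
    · rintro _ ⟨_, ⟨γ₀, γ₁, γ₂, γ₃, a, c, d, x₀, y₀, hx, hy, ha, hc, hd, hx₀, hy₀, rfl⟩, rfl⟩
      exact (congrArg g (hf hx hy ha hc hd hx₀ hy₀)).trans (hg hx hy ha hc hd hx₀ hy₀)
  have h2 : ∀ x, f (g x) = x := by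
    refine starAlgHom_eq_of_dense (f := f.comp g) (g := StarAlgHom.id ℂ _) (FiberC.dense
      (E := {x : cotensor V Q | ∃ (γ₀ γ₁ γ₂ γ₃ : Γ) (a c d : A) (x₀ y₀ : D)
        (_ : p x₀ ∈ Q.gr γ₀ γ₂) (hy : p y₀ ∈ Q.gr γ₁ γ₃) (ha : a ∈ V.gr γ₀ γ₁)
        (_ : c ∈ V.gr γ₁ γ₂) (_ : d ∈ V.gr γ₂ γ₃), ι x₀ = tmul a c ∧ ι y₀ = tmul c d ∧
          x = cotensor.elem ha hy})
      (cotensor.dense_of hS hSQ ?_)) ?_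
    · rintro a ha _ ⟨y₀, ⟨γ₀, γ₁, γ₂, c, d, hc, hd, -, -, hy₀⟩, rfl⟩
      obtain ⟨η, η', h, -⟩ := hS.homog a ha
      have hym := hUQ.map_gr (hU.mem_gr hc hd y₀ hy₀)
      refine ⟨η, η', γ₀, γ₂, h, hym, fun he x hx => ?_⟩
      subst he
      obtain ⟨x₀, hx₀⟩ := hU.exists_elem h hc
      exact ⟨_, _, _, _, a, c, d, x₀, y₀, hUQ.map_gr (hU.mem_gr h hc x₀ hx₀), hym, h, hc, hd, hx₀,
        hy₀, Subtype.ext hx⟩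
    · rintro _ ⟨_, ⟨γ₀, γ₁, γ₂, γ₃, a, c, d, x₀, y₀, hx, hy, ha, hc, hd, hx₀, hy₀, rfl⟩, rfl⟩
      exact (congrArg f (hg hx hy ha hc hd hx₀ hy₀)).trans (hf hx hy ha hc hd hx₀ hy₀)
  exact ⟨StarAlgEquiv.ofBijective f ⟨Function.LeftInverse.injective h1,
    Function.RightInverse.surjective h2⟩, fun hx hy ha hc hd hx₀ hy₀ =>
      hf hx hy ha hc hd hx₀ hy₀⟩

end FiberAssoc

section FiberAssocCotensor

open MaxTensor

variable {B Γ : Type u} [CommCStarAlgebra B] [Group Γ] {α : Γ →* (B ≃⋆ₐ[ℂ] B)}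
  {A : Type u} [CStarAlgebra A] {V : BGCData B Γ A} {S : Set A}

lemma IsCotensorData.isCotensorModel {U : BGCData B Γ (cotensor V V)}
    (hU : IsCotensorData V V U) (hS : IsHomogDense α V S) :
    IsCotensorModel V S U (cotensor V V).subtype where
  injective := Subtype.val_injective
  injective_left := hS.inclusion_injective hS A
  injective_right := hS.inclusion_injective_left hS A
  exists_elem ha hc := ⟨cotensor.elem ha hc, rfl⟩
  mem_gr ha hc x hx := by
    have h : x = cotensor.elem ha hc := Subtype.ext hx
    rw [h]
    exact hU.elem_mem ha hc
  map_r b := congrArg Subtype.val (hU.r_eq b)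
  map_s b := congrArg Subtype.val (hU.s_eq b)
  dense := cotensor.dense_of hS hS fun a ha c hc => by
    obtain ⟨γ, γ', h1, -⟩ := hS.homog a ha
    obtain ⟨η, η', h2, -⟩ := hS.homog c hc
    refine ⟨γ, γ', η, η', h1, h2, fun he x hx => ?_⟩
    subst he
    exact ⟨γ, γ', η', a, c, h1, h2, ha, hc, hx⟩

/-- The fiber product of a `(B, Γ)`-C⋆-algebra with itself is a `(B, Γ)`-C⋆-algebra, and the fiber
product is associative. -/
lemma IsHomogDense.exists_fiber_assoc (hS : IsHomogDense α V S) :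
    ∃ (Q : BGCData B Γ (FiberC V V)) (hQ : FiberC.IsFiberData V V Q)
      (φ : FiberC Q V ≃⋆ₐ[ℂ] FiberC V Q), ∀ {γ₀ γ₁ γ₂ γ₃ : Γ} {a c d : A}
      (ha : a ∈ V.gr γ₀ γ₁) (hc : c ∈ V.gr γ₁ γ₂) (hd : d ∈ V.gr γ₂ γ₃),
        φ (FiberC.elem (hQ.elem_mem ha hc) hd) = FiberC.elem ha (hQ.elem_mem hc hd) := by
  obtain ⟨U, hU⟩ := exists_cotensorData hS hS
  obtain ⟨Q, hQ, hUQ⟩ := hU.exists_fiberData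
  obtain ⟨φ, hφ⟩ := (hU.isCotensorModel hS).exists_fiber_assoc_equiv hS hUQ
    (isCStarQuotMap_proj (fiberRelC V V))
  exact ⟨Q, hQ, φ, fun ha hc hd =>
    hφ (hQ.elem_mem ha hc) (hQ.elem_mem hc hd) ha hc hd rfl rfl⟩

end FiberAssocCotensor

/-! ### Linear maps on algebraic fiber products -/

section FiberProducts

variable {B Γ : Type u} [CommCStarAlgebra B] [Group Γ] {α : Γ →* (B ≃⋆ₐ[ℂ] B)}
  {A C D : Type u} [Ring A] [StarRing A] [Algebra ℂ A] [StarModule ℂ A]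
  [Ring C] [StarRing C] [Algebra ℂ C] [StarModule ℂ C]
  [Ring D] [StarRing D] [Algebra ℂ D] [StarModule ℂ D]

/-- The multiplicative axioms of a `(B, Γ)`-`*`-algebra, without the requirement that `A` is the
direct sum of its homogeneous components. -/
structure BGStarData.IsCompatible (α : Γ →* (B ≃⋆ₐ[ℂ] B)) (V : BGStarData B Γ A) : Prop where
  mul_mem : ∀ {γ γ' δ δ' : Γ} {a b : A}, a ∈ V.gr γ γ' → b ∈ V.gr δ δ' →
    a * b ∈ V.gr (γ * δ) (γ' * δ')
  star_mem : ∀ {γ γ' : Γ} {a : A}, a ∈ V.gr γ γ' → star a ∈ V.gr γ⁻¹ γ'⁻¹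
  mul_r : ∀ {γ γ' : Γ} {a : A} (b : B), a ∈ V.gr γ γ' → a * V.r b = V.r (α γ b) * a
  mul_s : ∀ {γ γ' : Γ} {a : A} (b : B), a ∈ V.gr γ γ' → a * V.s b = V.s (α γ' b) * a

lemma BGStarAlg.isCompatible (V : BGStarAlg α A) : V.toBGStarData.IsCompatible α :=
  ⟨V.isBGAlg.mul_mem, V.star_mem, V.isBGAlg.mul_r, V.isBGAlg.mul_s⟩

lemma crossedData_isCompatible : (crossedData α).IsCompatible α := (crossedAlg α).isCompatible

lemma StarQuot.exists_liftLinear {E : Type*} [AddCommGroup E] [Module ℂ E] {T : Set A}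
    (L : A →ₗ[ℂ] E) (h : ∀ x ∈ starIdeal T, L x = 0) :
    ∃ F : StarQuot T →ₗ[ℂ] E, ∀ x, F (StarQuot.proj T x) = L x := by
  have hw : ∀ x y, StarQuot.proj T x = StarQuot.proj T y → L x = L y := fun x y hxy => by
    rw [← sub_eq_zero, ← map_sub]
    refine h _ (Ideal.Quotient.eq_zero_iff_mem.1 ?_)
    exact (map_sub (StarQuot.proj T) x y).trans (sub_eq_zero.2 hxy)
  let g := Function.surjInv (StarQuot.proj_surjective (T := T))
  have hg : ∀ z, StarQuot.proj T (g z) = z := Function.surjInv_eq _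
  refine ⟨⟨⟨fun z => L (g z), fun x y => ?_⟩, fun c x => ?_⟩, fun x => hw _ _ (hg _)⟩
  · rw [← map_add]
    exact hw _ _ (by rw [hg, map_add, hg, hg])
  · show L (g (c • x)) = c • L (g x)
    rw [← map_smul]
    exact hw _ _ (by rw [hg, map_smul, hg])

variable {V : BGStarData B Γ A} {W : BGStarData B Γ C}

namespace tensorΓ

lemma mem_span (hV : V.IsCompatible α) (hW : W.IsCompatible α) (x : tensorΓ V W) :
    (x : A ⊗[ℂ] C) ∈ Submodule.span ℂ {t : A ⊗[ℂ] C | ∃ γ γ' γ'' : Γ, ∃ a ∈ V.gr γ γ',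
      ∃ c ∈ W.gr γ' γ'', t = a ⊗ₜ c} := by
  obtain ⟨x, hx⟩ := x
  show x ∈ _
  refine StarAlgebra.adjoin_induction (fun x h => Submodule.subset_span h) ?_ ?_ ?_ ?_ hx
  · intro z
    rw [Algebra.algebraMap_eq_smul_one]
    exact Submodule.smul_mem _ _ (Submodule.subset_span
      ⟨1, 1, 1, 1, one_mem V, 1, one_mem W, Algebra.TensorProduct.one_def⟩)
  · exact fun x y _ _ hx hy => Submodule.add_mem _ hx hy
  · intro x y hx' hy' hx hy
    clear hx' hy'
    induction hx using Submodule.span_induction with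
    | zero => rw [zero_mul]; exact Submodule.zero_mem _
    | add a b _ _ ha hb => rw [add_mul]; exact Submodule.add_mem _ ha hb
    | smul z a _ ha => rw [smul_mul_assoc]; exact Submodule.smul_mem _ _ ha
    | mem a ha =>
      induction hy using Submodule.span_induction with
      | zero => rw [mul_zero]; exact Submodule.zero_mem _
      | add a b _ _ ha hb => rw [mul_add]; exact Submodule.add_mem _ ha hb
      | smul z a _ ha => rw [mul_smul_comm]; exact Submodule.smul_mem _ _ ha
      | mem b hb =>
        obtain ⟨γ, γ', γ'', a, ha, c, hc, rfl⟩ := ha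
        obtain ⟨η, η', η'', b, hb, d, hd, rfl⟩ := hb
        rw [Algebra.TensorProduct.tmul_mul_tmul]
        exact Submodule.subset_span ⟨_, _, _, _, hV.mul_mem ha hb, _, hW.mul_mem hc hd, rfl⟩
  · intro x hx' hx
    clear hx'
    induction hx using Submodule.span_induction with
    | zero => rw [star_zero]; exact Submodule.zero_mem _
    | add a b _ _ ha hb => rw [star_add]; exact Submodule.add_mem _ ha hb
    | smul z a _ ha => rw [star_smul]; exact Submodule.smul_mem _ _ ha
    | mem a ha =>
      obtain ⟨γ, γ', γ'', a, ha, c, hc, rfl⟩ := ha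
      rw [TensorProduct.star_tmul]
      exact Submodule.subset_span ⟨_, _, _, _, hV.star_mem ha, _, hW.star_mem hc, rfl⟩

lemma span_tmul (hV : V.IsCompatible α) (hW : W.IsCompatible α) (x : tensorΓ V W) :
    x ∈ Submodule.span ℂ {t : tensorΓ V W | ∃ (γ γ' γ'' : Γ) (a : A) (c : C)
      (ha : a ∈ V.gr γ γ') (hc : c ∈ W.gr γ' γ''), t = tmul ha hc} := by
  have h := mem_span hV hW x
  have h2 : {t : A ⊗[ℂ] C | ∃ γ γ' γ'' : Γ, ∃ a ∈ V.gr γ γ', ∃ c ∈ W.gr γ' γ'', t = a ⊗ₜ c} =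
      (tensorΓ V W).subtype.toAlgHom.toLinearMap '' {t : tensorΓ V W | ∃ (γ γ' γ'' : Γ) (a : A)
        (c : C) (ha : a ∈ V.gr γ γ') (hc : c ∈ W.gr γ' γ''), t = tmul ha hc} := by
    ext t
    constructor
    · rintro ⟨γ, γ', γ'', a, ha, c, hc, rfl⟩
      exact ⟨tmul ha hc, ⟨γ, γ', γ'', a, c, ha, hc, rfl⟩, rfl⟩
    · rintro ⟨_, ⟨γ, γ', γ'', a, c, ha, hc, rfl⟩, rfl⟩
      exact ⟨γ, γ', γ'', a, ha, c, hc, rfl⟩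
  rw [h2, ← Submodule.map_span] at h
  obtain ⟨y, hy, hyx⟩ := h
  have : y = x := Subtype.ext hyx
  rwa [this] at hy

@[elab_as_elim]
lemma induction (hV : V.IsCompatible α) (hW : W.IsCompatible α) {p : tensorΓ V W → Prop}
    (x : tensorΓ V W) (h0 : p 0) (hadd : ∀ x y, p x → p y → p (x + y))
    (hsmul : ∀ (z : ℂ) x, p x → p (z • x))
    (h : ∀ {γ γ' γ'' : Γ} {a : A} {c : C} (ha : a ∈ V.gr γ γ') (hc : c ∈ W.gr γ' γ''),
      p (tmul ha hc)) : p x := by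
  induction span_tmul hV hW x using Submodule.span_induction with
  | zero => exact h0
  | add x y _ _ hx hy => exact hadd x y hx hy
  | smul z x _ hx => exact hsmul z x hx
  | mem x hx =>
    obtain ⟨γ, γ', γ'', a, c, ha, hc, rfl⟩ := hx
    exact h ha hc

lemma tmul_mul_tmul {γ γ' γ'' η η' η'' : Γ} {a a' : A} {c c' : C} (hV : V.IsCompatible α)
    (hW : W.IsCompatible α) (ha : a ∈ V.gr γ γ') (hc : c ∈ W.gr γ' γ'') (ha' : a' ∈ V.gr η η')
    (hc' : c' ∈ W.gr η' η'') : tmul ha hc * tmul ha' hc' =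
      tmul (hV.mul_mem ha ha') (hW.mul_mem hc hc') :=
  Subtype.ext (Algebra.TensorProduct.tmul_mul_tmul _ _ _ _)

lemma star_tmul {γ γ' γ'' : Γ} {a : A} {c : C} (hV : V.IsCompatible α)
    (hW : W.IsCompatible α) (ha : a ∈ V.gr γ γ') (hc : c ∈ W.gr γ' γ'') :
    star (tmul ha hc) = tmul (hV.star_mem ha) (hW.star_mem hc) :=
  Subtype.ext (TensorProduct.star_tmul _ _)

/-- The relation `s(b) ⊗ 1 - 1 ⊗ r(b)`. -/
def rel (V : BGStarData B Γ A) (W : BGStarData B Γ C) (b : B) : tensorΓ V W :=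
  inlHom V.s V.s_mem b - inrHom W.r W.r_mem b

lemma tmul_mul_rel (hV : V.IsCompatible α) (hW : W.IsCompatible α) {γ γ' γ'' : Γ} {a : A} {c : C}
    (ha : a ∈ V.gr γ γ') (hc : c ∈ W.gr γ' γ'') (b : B) :
    tmul ha hc * rel V W b = rel V W (α γ' b) * tmul ha hc := by
  refine Subtype.ext ?_
  show (a ⊗ₜ c) * (V.s b ⊗ₜ 1 - 1 ⊗ₜ W.r b) =
    (V.s (α γ' b) ⊗ₜ 1 - 1 ⊗ₜ W.r (α γ' b)) * ((a ⊗ₜ c : A ⊗[ℂ] C))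
  simp only [mul_sub, sub_mul, Algebra.TensorProduct.tmul_mul_tmul, one_mul, mul_one,
    hV.mul_s b ha, hW.mul_r b hc]

/-- The span of the products of relations with elementary tensors. -/
def relSpan (V : BGStarData B Γ A) (W : BGStarData B Γ C) : Submodule ℂ (tensorΓ V W) :=
  Submodule.span ℂ {x | ∃ (b : B) (γ γ' γ'' : Γ) (a : A) (c : C) (ha : a ∈ V.gr γ γ')
    (hc : c ∈ W.gr γ' γ''), x = rel V W b * tmul ha hc}

lemma rel_mul_mem (hV : V.IsCompatible α) (hW : W.IsCompatible α) (b : B) (x : tensorΓ V W) :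
    rel V W b * x ∈ relSpan V W := by
  induction x using tensorΓ.induction hV hW with
  | h0 => rw [mul_zero]; exact Submodule.zero_mem _
  | hadd x y hx hy => rw [mul_add]; exact Submodule.add_mem _ hx hy
  | hsmul z x hx => rw [mul_smul_comm]; exact Submodule.smul_mem _ _ hx
  | h ha hc => exact Submodule.subset_span ⟨b, _, _, _, _, _, ha, hc, rfl⟩

lemma mul_rel_mul_mem (hV : V.IsCompatible α) (hW : W.IsCompatible α) (b : B)
    (x y : tensorΓ V W) : x * (rel V W b * y) ∈ relSpan V W := by
  induction x using tensorΓ.induction hV hW with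
  | h0 => rw [zero_mul]; exact Submodule.zero_mem _
  | hadd x y hx hy => rw [add_mul]; exact Submodule.add_mem _ hx hy
  | hsmul z x hx => rw [smul_mul_assoc]; exact Submodule.smul_mem _ _ hx
  | h ha hc =>
    rw [← mul_assoc, tmul_mul_rel hV hW ha hc, mul_assoc]
    exact rel_mul_mem hV hW _ _

lemma star_rel (b : B) : star (rel V W b) = rel V W (star b) := by
  rw [rel, rel, star_sub, map_star, map_star]

/-- The ideal of relations of the fiber product is spanned by the products of relations with
elementary tensors, because the relations can be moved past homogeneous elements. -/
lemma starIdeal_le (hV : V.IsCompatible α) (hW : W.IsCompatible α) {x : tensorΓ V W}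
    (hx : x ∈ starIdeal (fiberRel V W)) : x ∈ relSpan V W := by
  let N : Ideal (tensorΓ V W) :=
    { carrier := relSpan V W
      add_mem' := Submodule.add_mem _
      zero_mem' := Submodule.zero_mem _
      smul_mem' := fun c x hx => by
        show c * x ∈ relSpan V W
        induction hx using Submodule.span_induction with
        | zero => rw [mul_zero]; exact Submodule.zero_mem _
        | add x y _ _ hx hy => rw [mul_add]; exact Submodule.add_mem _ hx hy
        | smul z x _ hx => rw [mul_smul_comm]; exact Submodule.smul_mem _ _ hx
        | mem x hx =>
          obtain ⟨b, _, _, _, _, _, ha, hc, rfl⟩ := hx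
          exact mul_rel_mul_mem hV hW b _ _ }
  have hN : IsStarIdeal N :=
    { isTwoSided := ⟨fun {x} c hx => by
        show x * c ∈ relSpan V W
        change x ∈ relSpan V W at hx
        induction hx using Submodule.span_induction with
        | zero => rw [zero_mul]; exact Submodule.zero_mem _
        | add x y _ _ hx hy => rw [add_mul]; exact Submodule.add_mem _ hx hy
        | smul z x _ hx => rw [smul_mul_assoc]; exact Submodule.smul_mem _ _ hx
        | mem x hx =>
          obtain ⟨b, _, _, _, _, _, ha, hc, rfl⟩ := hx
          rw [mul_assoc]
          exact rel_mul_mem hV hW b _⟩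
      star_mem := fun x hx => by
        show star x ∈ relSpan V W
        change x ∈ relSpan V W at hx
        induction hx using Submodule.span_induction with
        | zero => rw [star_zero]; exact Submodule.zero_mem _
        | add x y _ _ hx hy => rw [star_add]; exact Submodule.add_mem _ hx hy
        | smul z x _ hx => rw [star_smul]; exact Submodule.smul_mem _ _ hx
        | mem x hx =>
          obtain ⟨b, _, _, _, _, _, ha, hc, rfl⟩ := hx
          rw [star_mul, star_rel, ← mul_one (rel V W (star b))]
          exact mul_rel_mul_mem hV hW _ _ _ }
  refine mem_starIdeal.1 hx N hN ?_
  rintro _ ⟨b, rfl⟩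
  have h := rel_mul_mem hV hW b 1
  rwa [mul_one] at h

end tensorΓ

namespace FiberProd

@[elab_as_elim]
lemma induction (hV : V.IsCompatible α) (hW : W.IsCompatible α) {p : FiberProd V W → Prop}
    (x : FiberProd V W) (h0 : p 0) (hadd : ∀ x y, p x → p y → p (x + y))
    (hsmul : ∀ (z : ℂ) x, p x → p (z • x))
    (h : ∀ {γ γ' γ'' : Γ} {a : A} {c : C} (ha : a ∈ V.gr γ γ') (hc : c ∈ W.gr γ' γ''),
      p (tmul ha hc)) : p x := by
  obtain ⟨x, rfl⟩ := StarQuot.proj_surjective x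
  induction x using tensorΓ.induction hV hW with
  | h0 => exact h0
  | hadd x y hx hy => exact hadd _ _ hx hy
  | hsmul z x hx => exact hsmul _ _ hx
  | h ha hc => exact h ha hc

/-- A linear map on a fiber product is given by a bilinear map that is balanced on homogeneous
elements of matching degrees. -/
lemma exists_liftLinear (hV : V.IsCompatible α) (hW : W.IsCompatible α) {E : Type*}
    [AddCommGroup E] [Module ℂ E] (β : A →ₗ[ℂ] C →ₗ[ℂ] E)
    (hβ : ∀ {γ γ' γ'' : Γ} {a : A} {c : C}, a ∈ V.gr γ γ' → c ∈ W.gr γ' γ'' → ∀ b,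
      β (V.s b * a) c = β a (W.r b * c)) :
    ∃ F : FiberProd V W →ₗ[ℂ] E, ∀ {γ γ' γ'' : Γ} {a : A} {c : C} (ha : a ∈ V.gr γ γ')
      (hc : c ∈ W.gr γ' γ''), F (tmul ha hc) = β a c := by
  let L : tensorΓ V W →ₗ[ℂ] E :=
    (TensorProduct.lift β).comp (tensorΓ V W).subtype.toAlgHom.toLinearMap
  have hL : ∀ x ∈ tensorΓ.relSpan V W, L x = 0 := by
    intro x hx
    induction hx using Submodule.span_induction with
    | zero => exact map_zero L
    | add x y _ _ hx hy => rw [map_add, hx, hy, add_zero]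
    | smul z x _ hx => rw [map_smul, hx, smul_zero]
    | mem x hx =>
      obtain ⟨b, γ, γ', γ'', a, c, ha, hc, rfl⟩ := hx
      show TensorProduct.lift β ((V.s b ⊗ₜ 1 - 1 ⊗ₜ W.r b) * (a ⊗ₜ c)) = 0
      rw [sub_mul, Algebra.TensorProduct.tmul_mul_tmul, Algebra.TensorProduct.tmul_mul_tmul,
        map_sub, TensorProduct.lift.tmul, TensorProduct.lift.tmul, one_mul, one_mul, hβ ha hc,
        sub_self]
  obtain ⟨F, hF⟩ := StarQuot.exists_liftLinear L fun x hx => hL x (tensorΓ.starIdeal_le hV hW hx)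
  refine ⟨F, fun {γ γ' γ'' a c} ha hc => (hF _).trans ?_⟩
  exact TensorProduct.lift.tmul _ _

lemma tmul_mul_tmul {γ γ' γ'' η η' η'' : Γ} {a a' : A} {c c' : C} (hV : V.IsCompatible α)
    (hW : W.IsCompatible α) (ha : a ∈ V.gr γ γ') (hc : c ∈ W.gr γ' γ'') (ha' : a' ∈ V.gr η η')
    (hc' : c' ∈ W.gr η' η'') : tmul ha hc * tmul ha' hc' =
      tmul (hV.mul_mem ha ha') (hW.mul_mem hc hc') :=
  ((map_mul (proj V W) _ _).symm).trans
    (congrArg (proj V W) (tensorΓ.tmul_mul_tmul hV hW ha hc ha' hc'))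

lemma star_tmul {γ γ' γ'' : Γ} {a : A} {c : C} (hV : V.IsCompatible α)
    (hW : W.IsCompatible α) (ha : a ∈ V.gr γ γ') (hc : c ∈ W.gr γ' γ'') :
    star (tmul ha hc) = tmul (hV.star_mem ha) (hW.star_mem hc) :=
  ((map_star (proj V W) _).symm).trans (congrArg (proj V W) (tensorΓ.star_tmul hV hW ha hc))

lemma tmul_add_left {γ γ' γ'' : Γ} {a a' : A} {c : C} (ha : a ∈ V.gr γ γ') (ha' : a' ∈ V.gr γ γ')
    (hc : c ∈ W.gr γ' γ'') : tmul (Submodule.add_mem _ ha ha') hc = tmul ha hc + tmul ha' hc :=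
  (congrArg (proj V W) (Subtype.ext (TensorProduct.add_tmul a a' c))).trans (map_add (proj V W) _ _)

lemma tmul_add_right {γ γ' γ'' : Γ} {a : A} {c c' : C} (ha : a ∈ V.gr γ γ') (hc : c ∈ W.gr γ' γ'')
    (hc' : c' ∈ W.gr γ' γ'') : tmul ha (Submodule.add_mem _ hc hc') = tmul ha hc + tmul ha hc' :=
  (congrArg (proj V W) (Subtype.ext (TensorProduct.tmul_add a c c'))).trans (map_add (proj V W) _ _)

lemma tmul_smul_left {γ γ' γ'' : Γ} {a : A} {c : C} (z : ℂ) (ha : a ∈ V.gr γ γ')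
    (hc : c ∈ W.gr γ' γ'') : tmul (Submodule.smul_mem _ z ha) hc = z • tmul ha hc :=
  (congrArg (proj V W) (Subtype.ext (TensorProduct.smul_tmul' z a c))).trans (map_smul (proj V W) _ _)

lemma tmul_smul_right {γ γ' γ'' : Γ} {a : A} {c : C} (z : ℂ) (ha : a ∈ V.gr γ γ')
    (hc : c ∈ W.gr γ' γ'') : tmul ha (Submodule.smul_mem _ z hc) = z • tmul ha hc :=
  (congrArg (proj V W) (Subtype.ext (TensorProduct.tmul_smul z a c))).trans (map_smul (proj V W) _ _)

lemma tmul_eq_of_eq {γ γ' γ'' η η' η'' : Γ} {a a' : A} {c c' : C} (ha : a ∈ V.gr γ γ')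
    (hc : c ∈ W.gr γ' γ'') (ha' : a' ∈ V.gr η η') (hc' : c' ∈ W.gr η' η'') (h1 : a = a')
    (h2 : c = c') : tmul ha hc = tmul ha' hc' :=
  congrArg (proj V W) (Subtype.ext (congrArg₂ (fun x y => x ⊗ₜ[ℂ] y) h1 h2))

lemma tmul_zero_left {γ γ' γ'' : Γ} {c : C} (ha : (0 : A) ∈ V.gr γ γ') (hc : c ∈ W.gr γ' γ'') :
    tmul ha hc = 0 :=
  (congrArg (proj V W) (Subtype.ext (TensorProduct.zero_tmul A c))).trans (map_zero (proj V W))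

lemma tmul_zero_right {γ γ' γ'' : Γ} {a : A} (ha : a ∈ V.gr γ γ') (hc : (0 : C) ∈ W.gr γ' γ'') :
    tmul ha hc = 0 :=
  (congrArg (proj V W) (Subtype.ext (TensorProduct.tmul_zero C a))).trans (map_zero (proj V W))

/-- The relation `s(b) a ⊗̃ c = a ⊗̃ r(b) c`. -/
lemma tmul_balanced {γ γ' γ'' : Γ} {a : A} {c : C}
    (ha : a ∈ V.gr γ γ') (hc : c ∈ W.gr γ' γ'') {b : B} (h1 : V.s b * a ∈ V.gr γ γ')
    (h2 : W.r b * c ∈ W.gr γ' γ'') : tmul h1 hc = tmul ha h2 := by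
  have h : proj V W (tensorΓ.rel V W b * tensorΓ.tmul ha hc) = 0 := by
    refine (map_mul (proj V W) _ _).trans ?_
    have h3 : proj V W (tensorΓ.rel V W b) = 0 := StarQuot.proj_eq_zero ⟨b, rfl⟩
    rw [h3, zero_mul]
  have h4 : tensorΓ.rel V W b * tensorΓ.tmul ha hc = tensorΓ.tmul h1 hc - tensorΓ.tmul ha h2 := by
    refine Subtype.ext ?_
    show (V.s b ⊗ₜ 1 - 1 ⊗ₜ W.r b) * (a ⊗ₜ c : A ⊗[ℂ] C) = (V.s b * a) ⊗ₜ c - a ⊗ₜ (W.r b * c)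
    simp only [sub_mul, Algebra.TensorProduct.tmul_mul_tmul, one_mul]
  rw [h4, map_sub, sub_eq_zero] at h
  exact h

/-- The fiber product satisfies the multiplicative axioms of a `(B, Γ)`-`*`-algebra. -/
lemma isCompatible (hV : V.IsCompatible α) (hW : W.IsCompatible α) :
    (data V W).IsCompatible α where
  mul_mem {γ γ' δ δ' x y} hx hy := by
    induction hx using Submodule.span_induction with
    | zero => rw [zero_mul]; exact Submodule.zero_mem _
    | add x y _ _ hx hy => rw [add_mul]; exact Submodule.add_mem _ hx hy
    | smul z x _ hx => rw [smul_mul_assoc]; exact Submodule.smul_mem _ _ hx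
    | mem x hx =>
      obtain ⟨_, _, _, ha, hc, rfl⟩ := hx
      induction hy using Submodule.span_induction with
      | zero => rw [mul_zero]; exact Submodule.zero_mem _
      | add x y _ _ hx hy => rw [mul_add]; exact Submodule.add_mem _ hx hy
      | smul z x _ hx => rw [mul_smul_comm]; exact Submodule.smul_mem _ _ hx
      | mem x hx =>
        obtain ⟨_, _, _, ha', hc', rfl⟩ := hx
        rw [tmul_mul_tmul hV hW]
        exact tmul_mem _ _
  star_mem {γ γ' x} hx := by
    induction hx using Submodule.span_induction with
    | zero => rw [star_zero]; exact Submodule.zero_mem _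
    | add x y _ _ hx hy => rw [star_add]; exact Submodule.add_mem _ hx hy
    | smul z x _ hx => rw [star_smul]; exact Submodule.smul_mem _ _ hx
    | mem x hx =>
      obtain ⟨_, _, _, ha, hc, rfl⟩ := hx
      rw [star_tmul hV hW]
      exact tmul_mem _ _
  mul_r {γ γ' x} b hx := by
    induction hx using Submodule.span_induction with
    | zero => rw [zero_mul, mul_zero]
    | add x y _ _ hx hy => rw [add_mul, hx, hy, mul_add]
    | smul z x _ hx => rw [smul_mul_assoc, hx, mul_smul_comm]
    | mem x hx =>
      obtain ⟨_, _, _, ha, hc, rfl⟩ := hx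
      show tmul ha hc * tmul (V.r_mem b) (tensorΓ.one_mem W) =
        tmul (V.r_mem _) (tensorΓ.one_mem W) * tmul ha hc
      rw [tmul_mul_tmul hV hW, tmul_mul_tmul hV hW]
      exact tmul_eq_of_eq _ _ _ _ (hV.mul_r b ha) (by rw [mul_one, one_mul])
  mul_s {γ γ' x} b hx := by
    induction hx using Submodule.span_induction with
    | zero => rw [zero_mul, mul_zero]
    | add x y _ _ hx hy => rw [add_mul, hx, hy, mul_add]
    | smul z x _ hx => rw [smul_mul_assoc, hx, mul_smul_comm]
    | mem x hx =>
      obtain ⟨_, _, _, ha, hc, rfl⟩ := hx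
      show tmul ha hc * tmul (tensorΓ.one_mem V) (W.s_mem b) =
        tmul (tensorΓ.one_mem V) (W.s_mem _) * tmul ha hc
      rw [tmul_mul_tmul hV hW, tmul_mul_tmul hV hW]
      exact tmul_eq_of_eq _ _ _ _ (by rw [mul_one, one_mul]) (hW.mul_s b hc)

/-- Every element of a fiber product is a finite sum of elementary tensors. -/
lemma exists_sum (hV : V.IsCompatible α) (hW : W.IsCompatible α) (z : FiberProd V W) :
    ∃ (m : ℕ) (γ γ' γ'' : Fin m → Γ) (x : Fin m → A) (y : Fin m → C)
      (hx : ∀ i, x i ∈ V.gr (γ i) (γ' i)) (hy : ∀ i, y i ∈ W.gr (γ' i) (γ'' i)),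
      z = ∑ i, tmul (hx i) (hy i) := by
  suffices h : ∃ (l : List (FiberProd V W)), (∀ x ∈ l, ∃ (γ γ' γ'' : Γ) (a : A) (c : C)
      (ha : a ∈ V.gr γ γ') (hc : c ∈ W.gr γ' γ''), x = tmul ha hc) ∧ z = l.sum by
    obtain ⟨l, hl, rfl⟩ := h
    choose γ γ' γ'' a c ha hc h using fun i : Fin l.length => hl _ (l.get_mem i)
    refine ⟨l.length, γ, γ', γ'', a, c, ha, hc, ?_⟩
    rw [← Finset.sum_congr rfl fun i _ => h i]
    exact (Fin.sum_univ_getElem l).symm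
  induction z using FiberProd.induction hV hW with
  | h0 => exact ⟨[], by simp, by simp⟩
  | hadd x y hx hy =>
    obtain ⟨l, hl, rfl⟩ := hx
    obtain ⟨l', hl', rfl⟩ := hy
    refine ⟨l ++ l', fun x hx => ?_, by simp⟩
    rcases List.mem_append.1 hx with h | h
    · exact hl x h
    · exact hl' x h
  | hsmul z x hx =>
    obtain ⟨l, hl, rfl⟩ := hx
    refine ⟨l.map (z • ·), fun x hx => ?_, List.smul_sum⟩
    obtain ⟨y, hy, rfl⟩ := List.mem_map.1 hx
    obtain ⟨γ, γ', γ'', a, c, ha, hc, rfl⟩ := hl y hy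
    exact ⟨γ, γ', γ'', z • a, c, Submodule.smul_mem _ z ha, hc, (tmul_smul_left z ha hc).symm⟩
  | h ha hc => exact ⟨[tmul ha hc], by
      intro x hx
      rw [List.mem_singleton] at hx
      exact ⟨_, _, _, _, _, ha, hc, hx⟩, by simp⟩

end FiberProd

end FiberProducts

/-! ### Homomorphisms from algebraic to C⋆-algebraic fiber products -/

section Representations

variable {B Γ : Type u} [CommCStarAlgebra B] [Group Γ] {α : Γ →* (B ≃⋆ₐ[ℂ] B)}
  {A C A' C' X Y X' Y' : Type u} [Ring A] [StarRing A] [Algebra ℂ A] [StarModule ℂ A]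
  [Ring C] [StarRing C] [Algebra ℂ C] [StarModule ℂ C]
  [Ring A'] [StarRing A'] [Algebra ℂ A'] [StarModule ℂ A']
  [Ring C'] [StarRing C'] [Algebra ℂ C'] [StarModule ℂ C']
  [CStarAlgebra X] [CStarAlgebra Y] [CStarAlgebra X'] [CStarAlgebra Y']

/-- A `*`-homomorphism from a `(B, Γ)`-`*`-algebra to a `(B, Γ)`-C⋆-algebra that is compatible with
the degrees, with `r` and with `s`. -/
structure IsBGRep (V : BGStarData B Γ A) (Z : BGCData B Γ X) (f : A →⋆ₐ[ℂ] X) : Prop where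
  map_gr : ∀ {γ γ' : Γ} {a : A}, a ∈ V.gr γ γ' → f a ∈ Z.gr γ γ'
  map_r : ∀ b, f (V.r b) = Z.r b
  map_s : ∀ b, f (V.s b) = Z.s b

lemma isBGRep_of [HasEnvelopingCStar A] (V : BGStarAlg α A) :
    IsBGRep V.toBGStarData (envData V) CStarEnv.of :=
  ⟨fun h => of_mem_envData V h, fun _ => rfl, fun _ => rfl⟩

variable (α) in
lemma isBGRep_of_crossed : IsBGRep (crossedData α) (crossedDataC α) CStarEnv.of :=
  isBGRep_of (crossedAlg α)

variable {V : BGStarData B Γ A} {W : BGStarData B Γ C} {V' : BGStarData B Γ A'}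
  {W' : BGStarData B Γ C'} {Z : BGCData B Γ X} {Z' : BGCData B Γ Y} {P : BGCData B Γ X'}
  {P' : BGCData B Γ Y'} {f : A →⋆ₐ[ℂ] X} {g : C →⋆ₐ[ℂ] Y} {f' : A' →⋆ₐ[ℂ] X'} {g' : C' →⋆ₐ[ℂ] Y'}

lemma FiberProd.exists_toFiberC (hf : IsBGRep V Z f) (hg : IsBGRep W Z' g) :
    ∃ j : FiberProd V W →⋆ₐ[ℂ] FiberC Z Z', ∀ {γ γ' γ'' : Γ} {a : A} {c : C} (ha : a ∈ V.gr γ γ')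
      (hc : c ∈ W.gr γ' γ''), j (tmul ha hc) = FiberC.elem (hf.map_gr ha) (hg.map_gr hc) := by
  let F : A ⊗[ℂ] C →⋆ₐ[ℂ] X ⊗ᵐ Y := CStarEnv.of.comp (mapTensor f g)
  have hF : ∀ a c, F (a ⊗ₜ c) = MaxTensor.tmul (f a) (g c) := fun a c => rfl
  have h : tensorΓ V W ≤ (cotensor Z Z').comap F := by
    refine StarAlgebra.adjoin_le ?_
    rintro _ ⟨γ, γ', γ'', a, ha, c, hc, rfl⟩
    exact (cotensor.elem (hf.map_gr ha) (hg.map_gr hc)).2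
  let j₀ : tensorΓ V W →⋆ₐ[ℂ] FiberC Z Z' :=
    (FiberC.proj Z Z').comp ((F.comp (tensorΓ V W).subtype).codRestrict _ fun x => h x.2)
  refine ⟨StarQuot.lift j₀ ?_, fun ha hc => rfl⟩
  rintro _ ⟨b, rfl⟩
  refine CStarQuot.proj_eq_zero (T := fiberRelC Z Z') ⟨b, ?_⟩
  show F (V.s b ⊗ₜ 1 - 1 ⊗ₜ W.r b) = _
  rw [map_sub, hF, hF, map_one, map_one, hf.map_s, hg.map_r]

/-- The canonical map from an algebraic fiber product to a C⋆-algebraic one. -/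
def FiberProd.toFiberC (hf : IsBGRep V Z f) (hg : IsBGRep W Z' g) :
    FiberProd V W →⋆ₐ[ℂ] FiberC Z Z' := (FiberProd.exists_toFiberC hf hg).choose

lemma FiberProd.toFiberC_tmul (hf : IsBGRep V Z f) (hg : IsBGRep W Z' g) {γ γ' γ'' : Γ} {a : A}
    {c : C} (ha : a ∈ V.gr γ γ') (hc : c ∈ W.gr γ' γ'') :
    toFiberC hf hg (tmul ha hc) = FiberC.elem (hf.map_gr ha) (hg.map_gr hc) :=
  (FiberProd.exists_toFiberC hf hg).choose_spec ha hc

lemma FiberC.elem_mul_elem {γ γ' γ'' η η' η'' : Γ} {a a' : X} {c c' : Y} (ha : a ∈ Z.gr γ γ')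
    (hc : c ∈ Z'.gr γ' γ'') (ha' : a' ∈ Z.gr η η') (hc' : c' ∈ Z'.gr η' η'') :
    FiberC.elem ha hc * FiberC.elem ha' hc' =
      FiberC.elem (Z.mul_mem ha ha') (Z'.mul_mem hc hc') :=
  (map_mul (FiberC.proj Z Z') _ _).symm.trans
    (congrArg (FiberC.proj Z Z') (cotensor.elem_mul ha hc ha' hc'))

lemma FiberC.elem_eq_of_eq {γ γ' γ'' η η' η'' : Γ} {a a' : X} {c c' : Y} (ha : a ∈ Z.gr γ γ')
    (hc : c ∈ Z'.gr γ' γ'') (ha' : a' ∈ Z.gr η η') (hc' : c' ∈ Z'.gr η' η'') (h1 : a = a')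
    (h2 : c = c') : FiberC.elem ha hc = FiberC.elem ha' hc' :=
  FiberC.proj_eq_of_coe (congrArg₂ MaxTensor.tmul h1 h2)

lemma FiberProd.toFiberC_isBGRep (hf : IsBGRep V Z f) (hg : IsBGRep W Z' g)
    {Q : BGCData B Γ (FiberC Z Z')} (hQ : FiberC.IsFiberData Z Z' Q) :
    IsBGRep (data V W) Q (toFiberC hf hg) where
  map_gr {γ γ' x} hx := by
    induction hx using Submodule.span_induction with
    | zero => rw [map_zero]; exact Submodule.zero_mem _
    | add x y _ _ hx hy => rw [map_add]; exact Submodule.add_mem _ hx hy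
    | smul z x _ hx => rw [map_smul]; exact Submodule.smul_mem _ _ hx
    | mem x hx =>
      obtain ⟨_, _, _, ha, hc, rfl⟩ := hx
      rw [toFiberC_tmul]
      exact hQ.elem_mem _ _
  map_r b := by
    rw [hQ.r_eq]
    exact (toFiberC_tmul hf hg (V.r_mem b) (tensorΓ.one_mem W)).trans
      (FiberC.elem_eq_of_eq _ _ _ _ (hf.map_r b) (map_one g))
  map_s b := by
    rw [hQ.s_eq]
    exact (toFiberC_tmul hf hg (tensorΓ.one_mem V) (W.s_mem b)).trans
      (FiberC.elem_eq_of_eq _ _ _ _ (map_one f) (hg.map_s b))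

lemma FiberC.map_elem {F : X →⋆ₐ[ℂ] X'} {G : Y →⋆ₐ[ℂ] Y'} (hF : IsBGCHom Z P F)
    (hG : IsBGCHom Z' P' G) {γ γ' γ'' : Γ} {a : X} {c : Y} (ha : a ∈ Z.gr γ γ')
    (hc : c ∈ Z'.gr γ' γ'') :
    FiberC.map hF hG (FiberC.elem ha hc) = FiberC.elem (hF.map_gr ha) (hG.map_gr hc) :=
  FiberC.proj_eq_of_coe (MaxTensor.map_tmul F G a c)

/-- The canonical maps between fiber products are natural. -/
lemma FiberProd.toFiberC_map (hV : V.IsCompatible α) (hW : W.IsCompatible α)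
    (hf : IsBGRep V Z f) (hg : IsBGRep W Z' g)
    (hf' : IsBGRep V' P f') (hg' : IsBGRep W' P' g') {φ : A →⋆ₐ[ℂ] A'} {ψ : C →⋆ₐ[ℂ] C'}
    (hφ : IsBGStarHom V V' φ) (hψ : IsBGStarHom W W' ψ) {F : X →⋆ₐ[ℂ] X'} {G : Y →⋆ₐ[ℂ] Y'}
    (hF : IsBGCHom Z P F) (hG : IsBGCHom Z' P' G) (h1 : ∀ a, F (f a) = f' (φ a))
    (h2 : ∀ c, G (g c) = g' (ψ c)) (x : FiberProd V W) :
    FiberC.map hF hG (toFiberC hf hg x) = toFiberC hf' hg' (FiberProd.map hφ hψ x) := by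
  induction x using FiberProd.induction hV hW with
  | h0 => simp only [map_zero]
  | hadd x y hx hy => simp only [map_add, hx, hy]
  | hsmul z x hx => simp only [map_smul, hx]
  | h ha hc =>
    rw [toFiberC_tmul, FiberC.map_elem, FiberProd.map_tmul, toFiberC_tmul]
    exact FiberC.elem_eq_of_eq _ _ _ _ (h1 _) (h2 _)

end Representations

/-! ### The comultiplication and the counit of the enveloping algebra -/

section Extension

variable {B Γ : Type u} [CommCStarAlgebra B] [Group Γ] {α : Γ →* (B ≃⋆ₐ[ℂ] B)}
  {A : Type u} [Ring A] [StarRing A] [Algebra ℂ A] [StarModule ℂ A] [HasEnvelopingCStar A]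
  (V : BGStarAlg α A)

/-- The images of the homogeneous elements in the enveloping C⋆-algebra. -/
def homogImages : Set (CStarEnv A) :=
  {x | ∃ (γ γ' : Γ) (a : A), a ∈ V.gr γ γ' ∧ x = CStarEnv.of a}

lemma isHomogDense_homogImages : IsHomogDense α (envData V) (homogImages V) where
  homog := by
    rintro _ ⟨γ, γ', a, ha, rfl⟩
    refine ⟨γ, γ', of_mem_envData V ha, fun b => ?_, fun b => ?_⟩
    · show CStarEnv.of a * CStarEnv.of (V.r b) = CStarEnv.of (V.r _) * CStarEnv.of a
      rw [← map_mul, ← map_mul, V.isCompatible.mul_r b ha]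
    · show CStarEnv.of a * CStarEnv.of (V.s b) = CStarEnv.of (V.s _) * CStarEnv.of a
      rw [← map_mul, ← map_mul, V.isCompatible.mul_s b ha]
  dense := by
    rw [Set.eq_univ_iff_forall]
    intro x
    refine closure_mono ?_ (CStarEnv.denseRange_of x)
    rintro _ ⟨a, rfl⟩
    refine V.induction a ?_ ?_
    · intro γ γ' a ha
      exact Submodule.subset_span ⟨γ, γ', a, ha, rfl⟩
    · intro a b ha hb
      rw [map_add]
      exact Submodule.add_mem _ ha hb

lemma isBGCStar_envData : IsBGCStar α (envData V) :=
  (isHomogDense_homogImages V).isBGCStar fun b c => by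
    show CStarEnv.of (V.r b) * CStarEnv.of (V.s c) = CStarEnv.of (V.s c) * CStarEnv.of (V.r b)
    rw [← map_mul, ← map_mul]
    exact congrArg _ (V.isBGAlg.commute b c)

/-- A morphism on the enveloping C⋆-algebra is determined by the underlying algebra. -/
lemma IsBGRep.lift {X : Type u} [CStarAlgebra X] {Z : BGCData B Γ X} {π : A →⋆ₐ[ℂ] X}
    (hπ : IsBGRep V.toBGStarData Z π) : IsBGCHom (envData V) Z (CStarEnv.lift π) :=
  isBGCHom_of_dense (isHomogDense_homogImages V).dense
    (by
      rintro _ ⟨γ, γ', a, ha, rfl⟩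
      refine ⟨γ, γ', of_mem_envData V ha, ?_⟩
      rw [CStarEnv.lift_of]
      exact hπ.map_gr ha)
    (fun b => (CStarEnv.lift_of _ _).trans (hπ.map_r b))
    (fun b => (CStarEnv.lift_of _ _).trans (hπ.map_s b))

variable {V}

lemma IsBGRep.comp {A' X : Type u} [Ring A'] [StarRing A'] [Algebra ℂ A'] [StarModule ℂ A']
    [CStarAlgebra X] {V₁ : BGStarData B Γ A} {V₂ : BGStarData B Γ A'} {Z : BGCData B Γ X}
    {π : A' →⋆ₐ[ℂ] X} {f : A →⋆ₐ[ℂ] A'} (hπ : IsBGRep V₂ Z π) (hf : IsBGStarHom V₁ V₂ f) :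
    IsBGRep V₁ Z (π.comp f) :=
  ⟨fun h => hπ.map_gr (hf.map_gr h), fun b => (congrArg π (hf.map_r b)).trans (hπ.map_r b),
    fun b => (congrArg π (hf.map_s b)).trans (hπ.map_s b)⟩

variable (V) in
/-- The canonical map `A ⊗̃ A → C⋆(A) ⊠ C⋆(A)`. -/
def BGStarAlg.toFiberC :
    FiberProd V.toBGStarData V.toBGStarData →⋆ₐ[ℂ] FiberC (envData V) (envData V) :=
  FiberProd.toFiberC (isBGRep_of V) (isBGRep_of V)

/-- The comultiplication of the enveloping C⋆-algebra. -/
def HopfStarAlgebroid.envΔ (H : HopfStarAlgebroid V) :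
    CStarEnv A →⋆ₐ[ℂ] FiberC (envData V) (envData V) := CStarEnv.lift (V.toFiberC.comp H.Δ)

lemma HopfStarAlgebroid.envΔ_of (H : HopfStarAlgebroid V) (a : A) :
    H.envΔ (CStarEnv.of a) = V.toFiberC (H.Δ a) := CStarEnv.lift_of _ _

lemma HopfStarAlgebroid.envΔ_hom (H : HopfStarAlgebroid V)
    {Q : BGCData B Γ (FiberC (envData V) (envData V))}
    (hQ : FiberC.IsFiberData (envData V) (envData V) Q) : IsBGCHom (envData V) Q H.envΔ :=
  IsBGRep.lift V ((FiberProd.toFiberC_isBGRep _ _ hQ).comp H.Δ_hom)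

lemma HopfStarAlgebroid.envε_hom (H : HopfStarAlgebroid V) :
    IsBGCHom (envData V) (crossedDataC α) (CStarEnv.map H.ε) :=
  IsBGRep.lift V ((isBGRep_of_crossed α).comp H.ε_hom)

lemma HopfStarAlgebroid.env_coassoc (H : HopfStarAlgebroid V)
    {Q : BGCData B Γ (FiberC (envData V) (envData V))}
    (hQ : FiberC.IsFiberData (envData V) (envData V) Q)
    (φ : FiberC Q (envData V) ≃⋆ₐ[ℂ] FiberC (envData V) Q)
    (hφ : ∀ {γ₀ γ₁ γ₂ γ₃ : Γ} {a c d : CStarEnv A} (ha : a ∈ (envData V).gr γ₀ γ₁)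
      (hc : c ∈ (envData V).gr γ₁ γ₂) (hd : d ∈ (envData V).gr γ₂ γ₃),
        φ (FiberC.elem (hQ.elem_mem ha hc) hd) = FiberC.elem ha (hQ.elem_mem hc hd))
    (x : CStarEnv A) : φ (FiberC.map (H.envΔ_hom hQ) (IsBGCHom.id (envData V)) (H.envΔ x)) =
      FiberC.map (IsBGCHom.id (envData V)) (H.envΔ_hom hQ) (H.envΔ x) := by
  obtain ⟨φ₀, hφ₀, hco⟩ := H.coassoc
  have hVc := V.isCompatible
  have hFc := FiberProd.isCompatible hVc hVc
  have hj := FiberProd.toFiberC_isBGRep (isBGRep_of V) (isBGRep_of V) hQ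
  have key : ∀ y : FiberProd (FiberProd.data V.toBGStarData V.toBGStarData) V.toBGStarData,
      φ (FiberProd.toFiberC hj (isBGRep_of V) y) = FiberProd.toFiberC (isBGRep_of V) hj (φ₀ y) := by
    intro y
    induction y using FiberProd.induction hFc hVc with
    | h0 => simp only [map_zero]
    | hadd x y hx hy => simp only [map_add, hx, hy]
    | hsmul z x hx => simp only [map_smul, hx]
    | @h γ γ' γ'' w d hw hd =>
      rw [FiberProd.toFiberC_tmul]
      revert hw
      intro hw
      have h : ∀ hw' : w ∈ (FiberProd.data V.toBGStarData V.toBGStarData).gr γ γ',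
          φ (FiberC.elem (hj.map_gr hw') (of_mem_envData V hd)) =
            FiberProd.toFiberC (isBGRep_of V) hj (φ₀ (FiberProd.tmul hw' hd)) := by
        induction hw using Submodule.span_induction with
        | zero =>
          intro hw'
          refine Eq.trans ?_ ((congrArg (fun y => FiberProd.toFiberC (isBGRep_of V) hj (φ₀ y))
            (FiberProd.tmul_zero_left hw' hd)).trans
              (show _ = 0 by simp only [map_zero])).symm
          refine (congrArg φ ?_).trans (map_zero φ)
          exact (congrArg (FiberC.proj _ _) (cotensor.elem_eq_zero _ _
            ((congrArg (MaxTensor.tmul · _) (map_zero _)).trans (MaxTensor.zero_tmul _)))).trans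
            (map_zero _)
        | add x y hx hy ihx ihy =>
          intro hw'
          have hx' : x ∈ (FiberProd.data V.toBGStarData V.toBGStarData).gr γ γ' := hx
          have hy' : y ∈ (FiberProd.data V.toBGStarData V.toBGStarData).gr γ γ' := hy
          have h1 := FiberProd.tmul_add_left hx' hy' hd
          have h2 : FiberC.elem (hj.map_gr hw') (of_mem_envData V hd) =
              FiberC.elem (hj.map_gr hx') (of_mem_envData V hd) +
              FiberC.elem (hj.map_gr hy') (of_mem_envData V hd) :=
            (FiberC.proj_eq_of_coe ((congrArg (MaxTensor.tmul · _) (map_add _ x y)).trans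
              (MaxTensor.add_tmul _ _ _))).trans (map_add (FiberC.proj _ _) _ _)
          refine ((congrArg φ h2).trans (map_add φ _ _)).trans ?_
          refine (congrArg₂ (· + ·) (ihx hx') (ihy hy')).trans ?_
          refine Eq.trans ?_ (congrArg (fun y => FiberProd.toFiberC (isBGRep_of V) hj (φ₀ y))
            h1).symm
          simp only [map_add]
        | smul z x hx ihx =>
          intro hw'
          have hx' : x ∈ (FiberProd.data V.toBGStarData V.toBGStarData).gr γ γ' := hx
          have h1 := FiberProd.tmul_smul_left z hx' hd
          have h2 : FiberC.elem (hj.map_gr hw') (of_mem_envData V hd) =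
              z • FiberC.elem (hj.map_gr hx') (of_mem_envData V hd) :=
            (FiberC.proj_eq_of_coe ((congrArg (MaxTensor.tmul · _) (map_smul _ z x)).trans
              (MaxTensor.smul_tmul _ _ _))).trans (map_smul (FiberC.proj _ _) _ _)
          refine ((congrArg φ h2).trans (map_smul φ _ _)).trans ?_
          refine (congrArg (z • ·) (ihx hx')).trans ?_
          refine Eq.trans ?_ (congrArg (fun y => FiberProd.toFiberC (isBGRep_of V) hj (φ₀ y))
            h1).symm
          simp only [map_smul]
        | mem w hw =>
          obtain ⟨γ₁, a, c, ha, hc, rfl⟩ := hw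
          intro hw'
          refine Eq.trans ?_ ((congrArg (FiberProd.toFiberC (isBGRep_of V) hj)
            (hφ₀ ha hc hd)).trans (FiberProd.toFiberC_tmul (isBGRep_of V) hj ha _)).symm
          refine (congrArg φ (FiberC.elem_eq_of_eq _ _ (hQ.elem_mem (of_mem_envData V ha)
            (of_mem_envData V hc)) (of_mem_envData V hd) (FiberProd.toFiberC_tmul _ _ ha hc)
            rfl)).trans ((hφ _ _ _).trans ?_)
          exact FiberC.elem_eq_of_eq _ _ _ _ rfl (FiberProd.toFiberC_tmul _ _ hc hd).symm
      exact h hw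
  refine starAlgHom_eq_of_dense (isHomogDense_homogImages V).dense
    (f := (φ : FiberC Q (envData V) →⋆ₐ[ℂ] FiberC (envData V) Q).comp
      ((FiberC.map (H.envΔ_hom hQ) (IsBGCHom.id (envData V))).comp H.envΔ))
    (g := (FiberC.map (IsBGCHom.id (envData V)) (H.envΔ_hom hQ)).comp H.envΔ) ?_ x
  rintro _ ⟨γ, γ', a, ha, rfl⟩
  show φ (FiberC.map _ _ (H.envΔ (CStarEnv.of a))) = FiberC.map _ _ (H.envΔ (CStarEnv.of a))
  rw [H.envΔ_of]
  have e1 := FiberProd.toFiberC_map hVc hVc (isBGRep_of V) (isBGRep_of V) hj (isBGRep_of V) H.Δ_hom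
    (IsBGStarHom.id _) (H.envΔ_hom hQ) (IsBGCHom.id (envData V)) H.envΔ_of (fun _ => rfl) (H.Δ a)
  have e2 := FiberProd.toFiberC_map hVc hVc (isBGRep_of V) (isBGRep_of V) (isBGRep_of V) hj
    (IsBGStarHom.id _) H.Δ_hom (IsBGCHom.id (envData V)) (H.envΔ_hom hQ) (fun _ => rfl) H.envΔ_of
    (H.Δ a)
  refine (congrArg φ e1).trans ((key _).trans ?_)
  rw [hco]
  exact e2.symm

lemma HopfStarAlgebroid.env_counit_left (H : HopfStarAlgebroid V) (x : CStarEnv A) :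
    FiberC.map H.envε_hom (IsBGCHom.id (envData V)) (H.envΔ x) =
      leftUnit (isBGCStar_envData V) x := by
  have hVc := V.isCompatible
  refine starAlgHom_eq_of_dense (isHomogDense_homogImages V).dense
    (f := (FiberC.map H.envε_hom (IsBGCHom.id (envData V))).comp H.envΔ) ?_ x
  rintro _ ⟨γ, γ', a, ha, rfl⟩
  show FiberC.map _ _ (H.envΔ (CStarEnv.of a)) = _
  rw [H.envΔ_of]
  refine (FiberProd.toFiberC_map hVc hVc (isBGRep_of V) (isBGRep_of V) (isBGRep_of_crossed α)
    (isBGRep_of V) H.ε_hom (IsBGStarHom.id _) H.envε_hom (IsBGCHom.id (envData V))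
    (fun _ => CStarEnv.lift_of _ _) (fun _ => rfl) (H.Δ a)).trans ?_
  rw [H.counit_left ha, FiberProd.toFiberC_tmul]
  refine FiberC.proj_eq_of_coe ?_
  show _ = MaxTensor.map (iotaΓ α) (StarAlgHom.id ℂ _) ((envData V).δ (CStarEnv.of a))
  rw [(of_mem_envData V ha).1, MaxTensor.map_tmul, iotaΓ_gen]
  rfl

lemma HopfStarAlgebroid.env_counit_right (H : HopfStarAlgebroid V) (x : CStarEnv A) :
    FiberC.map (IsBGCHom.id (envData V)) H.envε_hom (H.envΔ x) =
      rightUnit (isBGCStar_envData V) x := by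
  have hVc := V.isCompatible
  refine starAlgHom_eq_of_dense (isHomogDense_homogImages V).dense
    (f := (FiberC.map (IsBGCHom.id (envData V)) H.envε_hom).comp H.envΔ) ?_ x
  rintro _ ⟨γ, γ', a, ha, rfl⟩
  show FiberC.map _ _ (H.envΔ (CStarEnv.of a)) = _
  rw [H.envΔ_of]
  refine (FiberProd.toFiberC_map hVc hVc (isBGRep_of V) (isBGRep_of V) (isBGRep_of V)
    (isBGRep_of_crossed α) (IsBGStarHom.id _) H.ε_hom (IsBGCHom.id (envData V)) H.envε_hom
    (fun _ => rfl) (fun _ => CStarEnv.lift_of _ _) (H.Δ a)).trans ?_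
  rw [H.counit_right ha, FiberProd.toFiberC_tmul]
  refine FiberC.proj_eq_of_coe ?_
  show _ = MaxTensor.map (StarAlgHom.id ℂ _) (iotaΓ α) ((envData V).δbar (CStarEnv.of a))
  rw [(of_mem_envData V ha).2, MaxTensor.map_tmul, iotaΓ_gen]
  rfl

end Extension

/-! ### Cancellation -/

section Cancellation

variable {B Γ : Type u} [CommCStarAlgebra B] [Group Γ] {α : Γ →* (B ≃⋆ₐ[ℂ] B)}
  {A : Type u} [Ring A] [StarRing A] [Algebra ℂ A] [StarModule ℂ A] (V : BGStarAlg α A)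

/-- `rHat` as a linear map. -/
def rHatLin : CrossedProduct α →ₗ[ℂ] A where
  toFun := rHat V
  map_add' x y := SkewMonoidAlgebra.sum_add_index' (k := B) (G := Γ) (fun _ => map_zero V.r)
    fun _ => map_add V.r
  map_smul' z x := by
    refine (SkewMonoidAlgebra.sum_smul_index' (k := B) (G := Γ) fun _ => map_zero V.r).trans ?_
    simp only [map_smul]
    exact (SkewMonoidAlgebra.smul_sum (k := B) (G := Γ)).symm

/-- `sCheck` as a linear map. -/
def sCheckLin : CrossedProduct α →ₗ[ℂ] A where
  toFun := sCheck V
  map_add' x y := SkewMonoidAlgebra.sum_add_index' (k := B) (G := Γ)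
    (fun γ => by rw [map_zero, map_zero]) fun γ b c => by rw [map_add, map_add]
  map_smul' z x := by
    refine (SkewMonoidAlgebra.sum_smul_index' (k := B) (G := Γ)
      fun γ => by rw [map_zero, map_zero]).trans ?_
    simp only [map_smul]
    exact (SkewMonoidAlgebra.smul_sum (k := B) (G := Γ)).symm

lemma rHatLin_single (γ : Γ) (b : B) : rHatLin V (CrossedProduct.single γ b) = V.r b :=
  SkewMonoidAlgebra.sum_single_index (k := B) (G := Γ) (map_zero V.r)

lemma sCheckLin_single (γ : Γ) (b : B) :
    sCheckLin V (CrossedProduct.single γ b) = V.s (α γ⁻¹ b) :=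
  SkewMonoidAlgebra.sum_single_index (k := B) (G := Γ) (h := fun γ b => V.s (α γ⁻¹ b))
    (by rw [map_zero, map_zero])

variable [HasEnvelopingCStar A]

/-- The linear extension of `(a, c) ↦ a ⊗ c` from matching homogeneous elements to all elements of
`A`, where `a ⊗ c` is replaced by zero if the degrees do not match. -/
def matchedTmul : A →ₗ[ℂ] A →ₗ[ℂ] FiberC (envData V) (envData V) :=
  LinearMap.mk₂ ℂ (fun a c => FiberC.proj (envData V) (envData V)
      ((isHomogDense_homogImages V).expectHom (isHomogDense_homogImages V)
        (MaxTensor.tmul (CStarEnv.of a) (CStarEnv.of c))))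
    (fun a a' c => by rw [map_add, MaxTensor.add_tmul, map_add, map_add])
    (fun z a c => by rw [map_smul, MaxTensor.smul_tmul, map_smul, map_smul])
    (fun a c c' => by rw [map_add, MaxTensor.tmul_add, map_add, map_add])
    (fun z a c => by rw [map_smul, MaxTensor.tmul_smul, map_smul, map_smul])

variable {V}

lemma matchedTmul_eq_elem {γ γ' γ'' : Γ} {a c : A} (ha : a ∈ V.gr γ γ') (hc : c ∈ V.gr γ' γ'') :
    matchedTmul V a c = FiberC.elem (of_mem_envData V ha) (of_mem_envData V hc) := by
  classical
  refine FiberC.proj_eq_of_coe ?_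
  refine ((isHomogDense_homogImages V).expect_tmul (of_mem_envData V ha)
    (of_mem_envData V hc)).trans ?_
  rw [if_pos rfl]
  rfl

lemma matchedTmul_eq_zero {γ γ' η η' : Γ} {a c : A} (ha : a ∈ V.gr γ γ') (hc : c ∈ V.gr η η')
    (h : γ' ≠ η) : matchedTmul V a c = 0 := by
  classical
  refine (congrArg (FiberC.proj (envData V) (envData V)) (?_ : _ = (0 : cotensor _ _))).trans
    (map_zero (FiberC.proj (envData V) (envData V)))
  refine Subtype.ext ?_
  refine ((isHomogDense_homogImages V).expect_tmul (of_mem_envData V ha)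
    (of_mem_envData V hc)).trans ?_
  rw [if_neg h]
  rfl

lemma BGStarAlg.toFiberC_tmul (V : BGStarAlg α A) {γ γ' γ'' : Γ} {a c : A}
    (ha : a ∈ V.gr γ γ') (hc : c ∈ V.gr γ' γ'') :
    V.toFiberC (FiberProd.tmul ha hc) = matchedTmul V a c :=
  (FiberProd.toFiberC_tmul (isBGRep_of V) (isBGRep_of V) ha hc).trans
    (matchedTmul_eq_elem ha hc).symm

lemma matchedTmul_balanced (a c : A) (b : B) :
    matchedTmul V (V.s b * a) c = matchedTmul V a (V.r b * c) := by
  induction a using V.induction with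
  | h2 a a' ha ha' => simp only [mul_add, map_add, LinearMap.add_apply, ha, ha']
  | h1 γ γ' a ha =>
  induction c using V.induction with
  | h2 c c' hc hc' => simp only [mul_add, map_add, hc, hc']
  | h1 η η' c hc =>
  have h1 : V.s b * a ∈ V.gr γ γ' := by
    simpa only [one_mul] using V.isCompatible.mul_mem (V.s_mem b) ha
  have h2 : V.r b * c ∈ V.gr η η' := by
    simpa only [one_mul] using V.isCompatible.mul_mem (V.r_mem b) hc
  by_cases h : γ' = η
  · subst h
    rw [← V.toFiberC_tmul h1 hc, ← V.toFiberC_tmul ha h2]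
    exact congrArg _ (FiberProd.tmul_balanced ha hc h1 h2)
  · rw [matchedTmul_eq_zero h1 hc h, matchedTmul_eq_zero ha h2 h]

lemma matchedTmul_mul_right {γ γ' γ'' : Γ} {a c : A} (ha : a ∈ V.gr γ γ') (hc : c ∈ V.gr γ' γ'')
    (u : A) : matchedTmul V a (c * u) =
      V.toFiberC (FiberProd.tmul ha hc) * matchedTmul V 1 u := by
  induction u using V.induction with
  | h2 u u' hu hu' => simp only [mul_add, map_add, hu, hu']
  | h1 η η' u hu =>
  have h1 := V.isCompatible.mul_mem hc hu
  by_cases h : η = 1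
  · subst h
    rw [V.toFiberC_tmul, matchedTmul_eq_elem ha hc, matchedTmul_eq_elem (tensorΓ.one_mem _) hu,
      FiberC.elem_mul_elem]
    rw [mul_one] at h1
    rw [matchedTmul_eq_elem ha h1]
    exact FiberC.elem_eq_of_eq _ _ _ _ (by rw [map_one, mul_one]) (map_mul CStarEnv.of c u)
  · rw [matchedTmul_eq_zero (tensorΓ.one_mem _) hu (Ne.symm h), mul_zero,
      matchedTmul_eq_zero ha h1 fun h' => h (mul_eq_left.1 h'.symm)]

lemma matchedTmul_mul_left {γ γ' γ'' : Γ} {a c : A} (ha : a ∈ V.gr γ γ') (hc : c ∈ V.gr γ' γ'')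
    (u : A) : matchedTmul V (u * a) c =
      matchedTmul V u 1 * V.toFiberC (FiberProd.tmul ha hc) := by
  induction u using V.induction with
  | h2 u u' hu hu' => simp only [add_mul, map_add, LinearMap.add_apply, hu, hu']
  | h1 η η' u hu =>
  have h1 := V.isCompatible.mul_mem hu ha
  by_cases h : η' = 1
  · subst h
    rw [V.toFiberC_tmul, matchedTmul_eq_elem ha hc, matchedTmul_eq_elem hu (tensorΓ.one_mem _),
      FiberC.elem_mul_elem]
    rw [one_mul] at h1
    rw [matchedTmul_eq_elem h1 hc]
    exact FiberC.elem_eq_of_eq _ _ _ _ (map_mul CStarEnv.of u a) (by rw [map_one, one_mul])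
  · rw [matchedTmul_eq_zero hu (tensorΓ.one_mem _) h, zero_mul,
      matchedTmul_eq_zero h1 hc fun h' => h (mul_eq_right.1 h')]

variable (H : HopfStarAlgebroid V)

/-- The span of the products `Δ(a) (1 ⊗ c)`. -/
def HopfStarAlgebroid.spanLeft : Submodule ℂ (FiberC (envData V) (envData V)) :=
  Submodule.span ℂ {x | ∃ (a : CStarEnv A) (γ : Γ) (c : CStarEnv A) (hc : c ∈ (envData V).gr 1 γ),
    x = H.envΔ a * FiberC.elem (envData V).one_mem hc}

/-- The span of the products `(c ⊗ 1) Δ(a)`. -/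
def HopfStarAlgebroid.spanRight : Submodule ℂ (FiberC (envData V) (envData V)) :=
  Submodule.span ℂ {x | ∃ (a : CStarEnv A) (γ : Γ) (c : CStarEnv A) (hc : c ∈ (envData V).gr γ 1),
    x = FiberC.elem hc (envData V).one_mem * H.envΔ a}

lemma HopfStarAlgebroid.mul_mem_spanLeft (x u : A) :
    V.toFiberC (H.Δ x) * matchedTmul V 1 u ∈ H.spanLeft := by
  induction u using V.induction with
  | h2 u u' hu hu' => rw [map_add, mul_add]; exact Submodule.add_mem _ hu hu'
  | h1 η η' u hu =>
  by_cases h : η = 1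
  · subst h
    refine Submodule.subset_span ⟨CStarEnv.of x, η', CStarEnv.of u, of_mem_envData V hu, ?_⟩
    rw [H.envΔ_of, matchedTmul_eq_elem (tensorΓ.one_mem _) hu]
    exact congrArg _ (FiberC.elem_eq_of_eq _ _ _ _ (map_one _) rfl)
  · rw [matchedTmul_eq_zero (tensorΓ.one_mem _) hu (Ne.symm h), mul_zero]
    exact Submodule.zero_mem _

lemma HopfStarAlgebroid.mul_mem_spanRight (x u : A) :
    matchedTmul V u 1 * V.toFiberC (H.Δ x) ∈ H.spanRight := by
  induction u using V.induction with
  | h2 u u' hu hu' =>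
    rw [map_add, LinearMap.add_apply, add_mul]; exact Submodule.add_mem _ hu hu'
  | h1 η η' u hu =>
  by_cases h : η' = 1
  · subst h
    refine Submodule.subset_span ⟨CStarEnv.of x, η, CStarEnv.of u, of_mem_envData V hu, ?_⟩
    rw [H.envΔ_of, matchedTmul_eq_elem hu (tensorΓ.one_mem _)]
    exact congrArg (· * _) (FiberC.elem_eq_of_eq _ _ _ _ rfl (map_one _))
  · rw [matchedTmul_eq_zero hu (tensorΓ.one_mem _) h, zero_mul]
    exact Submodule.zero_mem _

/-- The linear map `u ⊗ w ↦ u S(w)`. -/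
lemma HopfStarAlgebroid.exists_mulS : ∃ ν : FiberProd V.toBGStarData V.toBGStarData →ₗ[ℂ] A,
    (∀ {γ γ' γ'' : Γ} {u w : A} (hu : u ∈ V.gr γ γ') (hw : w ∈ V.gr γ' γ''),
      ν (FiberProd.tmul hu hw) = u * H.S w) ∧
    (∀ b w, ν ((FiberProd.data V.toBGStarData V.toBGStarData).r b * w) = V.r b * ν w) ∧
    ∀ a, ν (H.Δ a) = rHatLin V (H.ε a) := by
  have hVc := V.isCompatible
  obtain ⟨ν, hν⟩ := FiberProd.exists_liftLinear hVc hVc ((LinearMap.mul ℂ A).compl₂ H.S) (by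
    intro γ γ' γ'' u w hu hw b
    have h1 : u * H.S w ∈ V.gr (γ * γ''⁻¹) 1 := by
      simpa only [mul_inv_cancel] using hVc.mul_mem hu (H.S_gr hw)
    show V.s b * u * H.S w = u * H.S (V.r b * w)
    rw [H.S_mul, H.S_r, ← mul_assoc, hVc.mul_s b h1, map_one, mul_assoc]
    rfl)
  replace hν : ∀ {γ γ' γ'' : Γ} {u w : A} (hu : u ∈ V.gr γ γ') (hw : w ∈ V.gr γ' γ''),
    ν (FiberProd.tmul hu hw) = u * H.S w := fun hu hw => hν hu hw
  refine ⟨ν, hν, fun b w => ?_, fun a => ?_⟩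
  · induction w using FiberProd.induction hVc hVc with
    | h0 => simp only [mul_zero, map_zero]
    | hadd x y hx hy => simp only [mul_add, map_add, hx, hy]
    | hsmul z x hx => simp only [mul_smul_comm, map_smul, hx]
    | h hu hw =>
      refine (congrArg ν (FiberProd.tmul_mul_tmul hVc hVc (V.r_mem b) (tensorΓ.one_mem _)
        hu hw)).trans ?_
      rw [hν, hν, one_mul, mul_assoc]
  · obtain ⟨m, γ, γ', γ'', x, y, hx, hy, h⟩ := FiberProd.exists_sum hVc hVc (H.Δ a)
    rw [h, map_sum, Finset.sum_congr rfl fun i _ => hν (hx i) (hy i)]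
    exact H.antipode_right a m γ γ' γ'' x y hx hy h

/-- The linear map `u ⊗ w ↦ S(u) w`. -/
lemma HopfStarAlgebroid.exists_Smul : ∃ μ : FiberProd V.toBGStarData V.toBGStarData →ₗ[ℂ] A,
    (∀ {γ γ' γ'' : Γ} {u w : A} (hu : u ∈ V.gr γ γ') (hw : w ∈ V.gr γ' γ''),
      μ (FiberProd.tmul hu hw) = H.S u * w) ∧
    ∀ a, μ (H.Δ a) = sCheckLin V (H.ε a) := by
  have hVc := V.isCompatible
  obtain ⟨μ, hμ⟩ := FiberProd.exists_liftLinear hVc hVc ((LinearMap.mul ℂ A).comp H.S) (by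
    intro γ γ' γ'' u w hu hw b
    show H.S (V.s b * u) * w = H.S u * (V.r b * w)
    rw [H.S_mul, H.S_s, mul_assoc])
  replace hμ : ∀ {γ γ' γ'' : Γ} {u w : A} (hu : u ∈ V.gr γ γ') (hw : w ∈ V.gr γ' γ''),
    μ (FiberProd.tmul hu hw) = H.S u * w := fun hu hw => hμ hu hw
  refine ⟨μ, hμ, fun a => ?_⟩
  obtain ⟨m, γ, γ', γ'', x, y, hx, hy, h⟩ := FiberProd.exists_sum hVc hVc (H.Δ a)
  rw [h, map_sum, Finset.sum_congr rfl fun i _ => hμ (hx i) (hy i)]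
  exact H.antipode_left a m γ γ' γ'' x y hx hy h

/-- `a ⊗ c = ∑ Δ(x_i) (1 ⊗ S(y_i) c)` if `Δ(a) = ∑ x_i ⊗ y_i`. -/
lemma HopfStarAlgebroid.tmul_mem_spanLeft {γ γ' : Γ} {a : A} (ha : a ∈ V.gr γ γ') (c : A) :
    matchedTmul V a c ∈ H.spanLeft := by
  have hVc := V.isCompatible
  have hFc := FiberProd.isCompatible hVc hVc
  obtain ⟨ν, hν, hνr, hνΔ⟩ := H.exists_mulS
  obtain ⟨φ, hφ, hco⟩ := H.coassoc
  obtain ⟨R, hR⟩ := FiberProd.exists_liftLinear hVc hFc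
    ((matchedTmul V).compl₂ ((LinearMap.mulRight ℂ c).comp ν)) (by
      intro _ _ _ x w _ _ b
      show matchedTmul V (V.s b * x) (ν w * c) = matchedTmul V x (ν (_ * w) * c)
      rw [matchedTmul_balanced, hνr, mul_assoc])
  obtain ⟨R', hR'⟩ := FiberProd.exists_liftLinear hVc (crossedData_isCompatible (α := α))
    ((matchedTmul V).compl₂ ((LinearMap.mulRight ℂ c).comp (rHatLin V))) (by
      intro _ _ _ x e _ he b
      obtain ⟨b', rfl, -⟩ := he
      show matchedTmul V (V.s b * x) (rHatLin V (CrossedProduct.single _ b') * c) =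
        matchedTmul V x (rHatLin V (CrossedProduct.single 1 b * CrossedProduct.single _ b') * c)
      rw [matchedTmul_balanced, CrossedProduct.single_mul_single, rHatLin_single, rHatLin_single,
        map_one, ← mul_assoc, ← map_mul]
      rfl)
  have key1 : ∀ {η₀ η₁ η₂ : Γ} {z : FiberProd V.toBGStarData V.toBGStarData} {y : A}
      (hz : z ∈ (FiberProd.data V.toBGStarData V.toBGStarData).gr η₀ η₁) (hy : y ∈ V.gr η₁ η₂),
      R (φ (FiberProd.tmul hz hy)) = V.toFiberC z * matchedTmul V 1 (H.S y * c) := by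
    intro η₀ η₁ η₂ z y hz hy
    have h : ∀ hz' : z ∈ (FiberProd.data V.toBGStarData V.toBGStarData).gr η₀ η₁,
        R (φ (FiberProd.tmul hz' hy)) = V.toFiberC z * matchedTmul V 1 (H.S y * c) := by
      induction hz using Submodule.span_induction with
      | zero =>
        intro hz'
        rw [map_zero, zero_mul]
        refine (congrArg (fun t => R (φ t)) (FiberProd.tmul_zero_left hz' hy)).trans ?_
        show _ = (0 : FiberC (envData V) (envData V))
        simp only [map_zero]
      | add x x' hx hx' ihx ihx' =>
        intro hz'
        have h1 : x ∈ (FiberProd.data V.toBGStarData V.toBGStarData).gr η₀ η₁ := hx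
        have h2 : x' ∈ (FiberProd.data V.toBGStarData V.toBGStarData).gr η₀ η₁ := hx'
        refine (congrArg (fun t => R (φ t)) (FiberProd.tmul_add_left h1 h2 hy)).trans ?_
        rw [map_add (V.toFiberC), add_mul, ← ihx h1, ← ihx' h2]
        simp only [map_add]
      | smul z x hx ihx =>
        intro hz'
        have h1 : x ∈ (FiberProd.data V.toBGStarData V.toBGStarData).gr η₀ η₁ := hx
        refine (congrArg (fun t => R (φ t)) (FiberProd.tmul_smul_left z h1 hy)).trans ?_
        rw [map_smul (V.toFiberC), smul_mul_assoc, ← ihx h1]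
        simp only [map_smul]
      | mem z hz =>
        obtain ⟨η, a, d, ha, hd, rfl⟩ := hz
        intro hz'
        refine (congrArg R (hφ ha hd hy)).trans ((hR ha (FiberProd.tmul_mem hd hy)).trans ?_)
        show matchedTmul V a (ν (FiberProd.tmul hd hy) * c) = _
        rw [hν, mul_assoc, matchedTmul_mul_right ha hd]
    exact h hz
  have key2 : ∀ z, R (φ (FiberProd.map H.Δ_hom (IsBGStarHom.id _) z)) ∈ H.spanLeft := by
    intro z
    induction z using FiberProd.induction hVc hVc with
    | h0 => simp only [map_zero]; exact Submodule.zero_mem _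
    | hadd x y hx hy => simp only [map_add]; exact Submodule.add_mem _ hx hy
    | hsmul z x hx => simp only [map_smul]; exact Submodule.smul_mem _ _ hx
    | h hx hy =>
      rw [FiberProd.map_tmul]
      exact (key1 (H.Δ_hom.map_gr hx) hy).symm ▸ H.mul_mem_spanLeft _ _
  have key3 : ∀ z, R (FiberProd.map (IsBGStarHom.id _) H.Δ_hom z) =
      R' (FiberProd.map (IsBGStarHom.id _) H.ε_hom z) := by
    intro z
    induction z using FiberProd.induction hVc hVc with
    | h0 => simp only [map_zero]
    | hadd x y hx hy => simp only [map_add, hx, hy]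
    | hsmul z x hx => simp only [map_smul, hx]
    | @h _ _ _ x y hx hy =>
      rw [FiberProd.map_tmul, FiberProd.map_tmul]
      refine (hR _ _).trans (Eq.trans ?_ (hR' _ _).symm)
      show matchedTmul V x (ν (H.Δ y) * c) = matchedTmul V x (rHatLin V (H.ε y) * c)
      rw [hνΔ]
  have h := key2 (H.Δ a)
  rw [hco, key3, H.counit_right ha, hR'] at h
  have h1 : matchedTmul V a (rHatLin V (CrossedProduct.single γ' 1) * c) ∈ H.spanLeft := h
  rwa [rHatLin_single, map_one, one_mul] at h1

/-- `c ⊗ a = ∑ (c S(x_i) ⊗ 1) Δ(y_i)` if `Δ(a) = ∑ x_i ⊗ y_i`. -/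
lemma HopfStarAlgebroid.tmul_mem_spanRight {γ γ' η η' : Γ} {a c : A} (hc : c ∈ V.gr η η')
    (ha : a ∈ V.gr γ γ') : matchedTmul V c a ∈ H.spanRight := by
  have hVc := V.isCompatible
  have hFc := FiberProd.isCompatible hVc hVc
  obtain ⟨μ, hμ, hμΔ⟩ := H.exists_Smul
  obtain ⟨φ, hφ, hco⟩ := H.coassoc
  have hμs : ∀ {δ δ' : Γ} {w : FiberProd V.toBGStarData V.toBGStarData}
      (_ : w ∈ (FiberProd.data V.toBGStarData V.toBGStarData).gr δ δ') (b : B),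
      c * μ ((FiberProd.data V.toBGStarData V.toBGStarData).s b * w) =
        V.s (α (η' * δ⁻¹) b) * (c * μ w) := by
    intro δ δ' w hw b
    induction hw using Submodule.span_induction with
    | zero => simp only [map_zero, mul_zero]
    | add x y _ _ hx hy => simp only [mul_add, map_add, hx, hy]
    | smul z x _ hx => simp only [mul_smul_comm, map_smul, hx]
    | mem w hw =>
      obtain ⟨δ₁, u, d, hu, hd, rfl⟩ := hw
      refine (congrArg (fun t => c * μ t) (FiberProd.tmul_mul_tmul hVc hVc (tensorΓ.one_mem _)
        (V.s_mem b) hu hd)).trans ?_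
      show c * μ _ = _
      rw [hμ, hμ, one_mul, ← mul_assoc (H.S u), ← mul_assoc c, ← mul_assoc c, ← mul_assoc c,
        ← mul_assoc (V.s _), ← hVc.mul_s b (hVc.mul_mem hc (H.S_gr hu))]
  have hμ0 : ∀ {δ δ' δ'' : Γ} {w : FiberProd V.toBGStarData V.toBGStarData} {y : A}
      (_ : w ∈ (FiberProd.data V.toBGStarData V.toBGStarData).gr δ δ') (_ : y ∈ V.gr δ' δ'')
      (_ : η' ≠ δ), matchedTmul V (c * μ w) y = 0 := by
    intro δ δ' δ'' w y hw hy h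
    induction hw using Submodule.span_induction with
    | zero => simp only [map_zero, mul_zero, LinearMap.zero_apply]
    | add x y _ _ hx hy => simp only [mul_add, map_add, LinearMap.add_apply, hx, hy, add_zero]
    | smul z x _ hx =>
      simp only [mul_smul_comm, map_smul, LinearMap.smul_apply, hx, smul_zero]
    | mem w hw =>
      obtain ⟨δ₁, u, d, hu, hd, rfl⟩ := hw
      refine matchedTmul_eq_zero ((hμ hu hd).symm ▸
        hVc.mul_mem hc (hVc.mul_mem (H.S_gr hu) hd)) hy fun h' => h ?_
      rwa [← mul_assoc, mul_eq_right, mul_inv_eq_one] at h'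
  obtain ⟨R, hR⟩ := FiberProd.exists_liftLinear hFc hVc
    ((matchedTmul V).comp ((LinearMap.mulLeft ℂ c).comp μ)) (by
      intro δ δ' δ'' w y hw hy b
      show matchedTmul V (c * μ (_ * w)) y = matchedTmul V (c * μ w) (V.r b * y)
      rw [hμs hw b]
      by_cases h : η' = δ
      · rw [h, mul_inv_cancel, map_one, ← matchedTmul_balanced]
        rfl
      · have hry : ∀ b, V.r b * y ∈ V.gr δ' δ'' := fun b => by
          simpa only [one_mul] using hVc.mul_mem (V.r_mem b) hy
        rw [matchedTmul_balanced, hμ0 hw (hry _) h, hμ0 hw (hry _) h])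
  obtain ⟨R', hR'⟩ := FiberProd.exists_liftLinear (crossedData_isCompatible (α := α)) hVc
    ((matchedTmul V).comp ((LinearMap.mulLeft ℂ c).comp (sCheckLin V))) (by
      intro δ δ' δ'' e y he hy b
      obtain ⟨b', rfl, hb'⟩ := he
      show matchedTmul V (c * sCheckLin V (CrossedProduct.single 1 b * CrossedProduct.single _ b'))
        y = matchedTmul V (c * sCheckLin V (CrossedProduct.single _ b')) (V.r b * y)
      have hs : c * V.s (α δ⁻¹ b') ∈ V.gr η η' := by
        simpa only [mul_one] using hVc.mul_mem hc (V.s_mem (α δ⁻¹ b'))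
      have hry : ∀ b, V.r b * y ∈ V.gr δ' δ'' := fun b => by
        simpa only [one_mul] using hVc.mul_mem (V.r_mem b) hy
      rw [CrossedProduct.single_mul_single, sCheckLin_single, sCheckLin_single, one_mul, map_one α,
        show (1 : B ≃⋆ₐ[ℂ] B) b' = b' from rfl, map_mul (α δ⁻¹), map_mul V.s, ← mul_assoc, hVc.mul_s _ hc,
        mul_assoc, matchedTmul_balanced]
      by_cases h : δ = δ'
      · subst h
        by_cases h : η' = δ
        · rw [h, CrossedProduct.map_map_inv]
        · rw [matchedTmul_eq_zero hs (hry _) h, matchedTmul_eq_zero hs (hry _) h]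
      · rw [hb' h, map_zero, map_zero, mul_zero, map_zero, LinearMap.zero_apply,
          LinearMap.zero_apply])
  have key1 : ∀ {η₀ η₁ η₂ : Γ} {z : FiberProd V.toBGStarData V.toBGStarData} {x : A}
      (hx : x ∈ V.gr η₀ η₁) (hz : z ∈ (FiberProd.data V.toBGStarData V.toBGStarData).gr η₁ η₂),
      R (φ.symm (FiberProd.tmul hx hz)) = matchedTmul V (c * H.S x) 1 * V.toFiberC z := by
    intro η₀ η₁ η₂ z x hx hz
    have h : ∀ hz' : z ∈ (FiberProd.data V.toBGStarData V.toBGStarData).gr η₁ η₂,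
        R (φ.symm (FiberProd.tmul hx hz')) =
          matchedTmul V (c * H.S x) 1 * V.toFiberC z := by
      induction hz using Submodule.span_induction with
      | zero =>
        intro hz'
        rw [map_zero, mul_zero]
        refine (congrArg (fun t => R (φ.symm t)) (FiberProd.tmul_zero_right hx hz')).trans ?_
        show _ = (0 : FiberC (envData V) (envData V))
        simp only [map_zero]
      | add y y' hy hy' ihy ihy' =>
        intro hz'
        have h1 : y ∈ (FiberProd.data V.toBGStarData V.toBGStarData).gr η₁ η₂ := hy
        have h2 : y' ∈ (FiberProd.data V.toBGStarData V.toBGStarData).gr η₁ η₂ := hy'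
        refine (congrArg (fun t => R (φ.symm t)) (FiberProd.tmul_add_right hx h1 h2)).trans ?_
        rw [map_add V.toFiberC, mul_add, ← ihy h1, ← ihy' h2]
        simp only [map_add]
      | smul z y hy ihy =>
        intro hz'
        have h1 : y ∈ (FiberProd.data V.toBGStarData V.toBGStarData).gr η₁ η₂ := hy
        refine (congrArg (fun t => R (φ.symm t)) (FiberProd.tmul_smul_right z hx h1)).trans ?_
        rw [map_smul V.toFiberC, mul_smul_comm, ← ihy h1]
        simp only [map_smul]
      | mem z hz =>
        obtain ⟨δ, d, y, hd, hy, rfl⟩ := hz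
        intro hz'
        refine (congrArg R (φ.symm_apply_eq.2 (hφ hx hd hy).symm)).trans
          ((hR (FiberProd.tmul_mem hx hd) hy).trans ?_)
        show matchedTmul V (c * μ (FiberProd.tmul hx hd)) y = _
        rw [hμ, ← mul_assoc, matchedTmul_mul_left hd hy]
    exact h hz
  have key2 : ∀ z, R (φ.symm (FiberProd.map (IsBGStarHom.id _) H.Δ_hom z)) ∈ H.spanRight := by
    intro z
    induction z using FiberProd.induction hVc hVc with
    | h0 => simp only [map_zero]; exact Submodule.zero_mem _
    | hadd x y hx hy => simp only [map_add]; exact Submodule.add_mem _ hx hy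
    | hsmul z x hx => simp only [map_smul]; exact Submodule.smul_mem _ _ hx
    | h hx hy =>
      rw [FiberProd.map_tmul]
      exact (key1 hx (H.Δ_hom.map_gr hy)).symm ▸ H.mul_mem_spanRight _ _
  have key3 : ∀ z, R (FiberProd.map H.Δ_hom (IsBGStarHom.id _) z) =
      R' (FiberProd.map H.ε_hom (IsBGStarHom.id _) z) := by
    intro z
    induction z using FiberProd.induction hVc hVc with
    | h0 => simp only [map_zero]
    | hadd x y hx hy => simp only [map_add, hx, hy]
    | hsmul z x hx => simp only [map_smul, hx]
    | @h _ _ _ x y hx hy =>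
      rw [FiberProd.map_tmul, FiberProd.map_tmul]
      refine (hR _ _).trans (Eq.trans ?_ (hR' _ _).symm)
      show matchedTmul V (c * μ (H.Δ x)) y = matchedTmul V (c * sCheckLin V (H.ε x)) y
      rw [hμΔ]
  have h := key2 (H.Δ a)
  rw [← hco, φ.symm_apply_apply, key3, H.counit_left ha, hR'] at h
  have h1 : matchedTmul V (c * sCheckLin V (CrossedProduct.single γ 1)) a ∈ H.spanRight := h
  rwa [sCheckLin_single, map_one, map_one, mul_one] at h1

lemma HopfStarAlgebroid.dense_of_matchedTmul {E : Submodule ℂ (FiberC (envData V) (envData V))}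
    (hE : ∀ {γ γ' γ'' : Γ} {a c : A}, a ∈ V.gr γ γ' → c ∈ V.gr γ' γ'' → matchedTmul V a c ∈ E) :
    closure (E : Set (FiberC (envData V) (envData V))) = Set.univ := by
  have hS := isHomogDense_homogImages V
  have h := FiberC.dense (cotensor.dense_of hS hS
    (E := {x : cotensor (envData V) (envData V) | FiberC.proj _ _ x ∈ E}) (by
      rintro _ ⟨γ, γ', a, ha, rfl⟩ _ ⟨η, η', c, hc, rfl⟩
      refine ⟨γ, γ', η, η', of_mem_envData V ha, of_mem_envData V hc, fun h x hx => ?_⟩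
      subst h
      have h1 := hE ha hc
      rw [matchedTmul_eq_elem ha hc] at h1
      exact Eq.mpr (congrArg (· ∈ E) (FiberC.proj_eq_of_coe hx)) h1))
  rw [Set.eq_univ_iff_forall]
  intro x
  refine closure_mono (Submodule.span_le.2 ?_) (h ▸ Set.mem_univ x)
  rintro _ ⟨y, hy, rfl⟩
  exact hy

/-- The comultiplication of a `(B, Γ)`-Hopf `*`-algebroid with an enveloping C⋆-algebra extends to
the structure of a compact `(B, Γ)`-Hopf C⋆-algebroid with a counit. -/
theorem HopfStarAlgebroid.exists_compactHopf :
    ∃ K : CompactHopf α (envData V), K.Extends H ∧ K.IsCounit (CStarEnv.map H.ε) := by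
  obtain ⟨Q, hQ, φ, hφ⟩ := (isHomogDense_homogImages V).exists_fiber_assoc
  exact ⟨{
    isBGCStar := isBGCStar_envData V
    fiber := Q
    isFiber := hQ
    Δ := H.envΔ
    Δ_hom := H.envΔ_hom hQ
    coassoc := ⟨φ, hφ, H.env_coassoc hQ φ hφ⟩
    cancel_left := dense_of_matchedTmul (E := H.spanLeft) fun ha _ => H.tmul_mem_spanLeft ha _
    cancel_right := dense_of_matchedTmul (E := H.spanRight) fun hc ha =>
      H.tmul_mem_spanRight hc ha },
    ⟨V.toFiberC, fun ha hc => FiberProd.toFiberC_tmul _ _ ha hc, H.envΔ_of⟩,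
    ⟨H.envε_hom, H.env_counit_left, H.env_counit_right⟩⟩

end Cancellation

/-! ### Matrices over `B` and matrices of homogeneous elements -/

section Calculus

open Matrix

variable {B Γ : Type u} [CommCStarAlgebra B] [Group Γ] (α : Γ →* (B ≃⋆ₐ[ℂ] B)) {n : ℕ}
  {D : Type u} [Ring D] [Algebra ℂ D]

/-- The matrix `T` vanishes at all positions `(i, j)` with `d'_i ≠ d_j`. -/
def IsSupported (d' d : Fin n → Γ) (T : Matrix (Fin n) (Fin n) B) : Prop :=
  ∀ i j, d' i ≠ d j → T i j = 0

/-- The elements `x` with `x r(b) = r(γ(b)) x` and `x s(b) = s(γ'(b)) x`. -/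
def typed (r s : B →ₐ[ℂ] D) (γ γ' : Γ) : Submodule ℂ D where
  carrier := {x | (∀ b, x * r b = r (α γ b) * x) ∧ ∀ b, x * s b = s (α γ' b) * x}
  add_mem' hx hy := ⟨fun b => by rw [add_mul, mul_add, hx.1, hy.1],
    fun b => by rw [add_mul, mul_add, hx.2, hy.2]⟩
  zero_mem' := ⟨fun b => by rw [zero_mul, mul_zero], fun b => by rw [zero_mul, mul_zero]⟩
  smul_mem' z x hx := ⟨fun b => by rw [smul_mul_assoc, mul_smul_comm, hx.1],
    fun b => by rw [smul_mul_assoc, mul_smul_comm, hx.2]⟩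

variable {α}

lemma mul_mem_typed {r s : B →ₐ[ℂ] D} {γ γ' δ δ' : Γ} {x y : D} (hx : x ∈ typed α r s γ γ')
    (hy : y ∈ typed α r s δ δ') : x * y ∈ typed α r s (γ * δ) (γ' * δ') :=
  ⟨fun b => by rw [mul_assoc, hy.1, ← mul_assoc, hx.1, mul_assoc, map_mul]; rfl,
    fun b => by rw [mul_assoc, hy.2, ← mul_assoc, hx.2, mul_assoc, map_mul]; rfl⟩

lemma map_apply_inv (γ : Γ) (b : B) : α γ (α γ⁻¹ b) = b := CrossedProduct.map_map_inv γ b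

lemma inv_apply_map (γ : Γ) (b : B) : α γ⁻¹ (α γ b) = b := CrossedProduct.map_inv_map γ b

lemma twist_apply (d : Fin n → Γ) (T : Matrix (Fin n) (Fin n) B) (i j : Fin n) :
    twist α d T i j = α (d i) (T i j) := rfl

namespace IsSupported

variable {d d' d'' : Fin n → Γ} {T T' : Matrix (Fin n) (Fin n) B}

lemma twist_apply_right (hT : IsSupported d' d T) (i j : Fin n) :
    twist α d' T i j = α (d j) (T i j) := by
  by_cases h : d' i = d j
  · rw [twist_apply, h]
  · rw [twist_apply, hT i j h, map_zero, map_zero]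

lemma twist (hT : IsSupported d' d T) (e : Fin n → Γ) : IsSupported d' d (twist α e T) :=
  fun i j h => by rw [twist_apply, hT i j h, map_zero]

lemma map_star (hT : IsSupported d' d T) : IsSupported d' d (T.map star) :=
  fun i j h => by rw [Matrix.map_apply, hT i j h, star_zero]

lemma transpose (hT : IsSupported d' d T) : IsSupported d d' Tᵀ :=
  fun i j h => hT j i (Ne.symm h)

lemma inv_inv (hT : IsSupported d' d T) : IsSupported d'⁻¹ d⁻¹ T :=
  fun i j h => hT i j fun h' => h (by rw [Pi.inv_apply, Pi.inv_apply, h'])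

/-- The inverse of a supported matrix is supported, because it intertwines the corresponding
diagonal projections. -/
lemma inverse (hT : IsSupported d' d T) (h1 : T * T' = 1) (h2 : T' * T = 1) :
    IsSupported d d' T' := by
  classical
  intro i j hij
  let p : Matrix (Fin n) (Fin n) B := diagonal fun k => if d k = d' j then 1 else 0
  let p' : Matrix (Fin n) (Fin n) B := diagonal fun k => if d' k = d' j then 1 else 0
  have hp : p' * T = T * p := by
    ext k l
    rw [diagonal_mul, mul_diagonal]
    by_cases h : d' k = d l
    · rw [h, mul_comm]
    · rw [hT k l h, mul_zero, zero_mul]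
  have hp2 : T' * p' = p * T' := by
    calc T' * p' = T' * (p' * T) * T' := by rw [mul_assoc, mul_assoc, h1, mul_one]
      _ = p * T' := by rw [hp, ← mul_assoc, h2, one_mul]
  have h3 := congrFun (congrFun hp2 i) j
  rw [mul_diagonal, diagonal_mul, if_pos rfl, if_neg hij, mul_one, zero_mul] at h3
  exact h3

lemma twist_mul {T₂ : Matrix (Fin n) (Fin n) B} (hT : IsSupported d'' d' T₂)
    (T : Matrix (Fin n) (Fin n) B) :
    _root_.twist α d'' (T₂ * T) = _root_.twist α d'' T₂ * _root_.twist α d' T := by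
  ext i k
  rw [twist_apply, mul_apply, mul_apply, map_sum]
  refine Finset.sum_congr rfl fun j _ => ?_
  rw [twist_apply_right hT, twist_apply, map_mul]
  by_cases h : d'' i = d' j
  · rw [h]
  · rw [hT i j h, map_zero, map_zero, zero_mul, zero_mul]

end IsSupported

lemma twist_one (d : Fin n → Γ) : twist α d (1 : Matrix (Fin n) (Fin n) B) = 1 := by
  ext i j
  rw [twist_apply]
  by_cases h : i = j
  · rw [h, one_apply_eq, map_one]
  · rw [one_apply_ne h, map_zero]

lemma IsSupported.isUnit_twist {d d' : Fin n → Γ} {T T' : Matrix (Fin n) (Fin n) B}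
    (hT : IsSupported d' d T) (h1 : T * T' = 1) (h2 : T' * T = 1) :
    _root_.twist α d' T * _root_.twist α d T' = 1 ∧
      _root_.twist α d T' * _root_.twist α d' T = 1 := by
  rw [← hT.twist_mul, ← (hT.inverse h1 h2).twist_mul, h1, h2, twist_one, twist_one]
  exact ⟨rfl, rfl⟩

lemma twist_inv_twist (d : Fin n → Γ) (T : Matrix (Fin n) (Fin n) B) :
    twist α d⁻¹ (twist α d T) = T := by
  ext i j
  exact inv_apply_map _ _

lemma map_algHom_mul {R : Type*} [Ring R] [Algebra ℂ R] (f : R →ₐ[ℂ] D)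
    (M N : Matrix (Fin n) (Fin n) R) : (M * N).map f = M.map f * N.map f := Matrix.map_mul

lemma map_algHom_one {R : Type*} [Ring R] [Algebra ℂ R] (f : R →ₐ[ℂ] D) :
    (1 : Matrix (Fin n) (Fin n) R).map f = 1 := Matrix.map_one f (map_zero f) (map_one f)

lemma isUnit_map {R : Type*} [Ring R] [Algebra ℂ R] (f : R →ₐ[ℂ] D)
    {M : Matrix (Fin n) (Fin n) R} (hM : IsUnit M) : IsUnit (M.map f) := by
  obtain ⟨N, h1, h2⟩ := isUnit_iff_exists.1 hM
  exact isUnit_iff_exists.2 ⟨N.map f, by rw [← map_algHom_mul, h1, map_algHom_one],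
    by rw [← map_algHom_mul, h2, map_algHom_one]⟩

lemma IsSupported.isUnit {d d' : Fin n → Γ} {T : Matrix (Fin n) (Fin n) B}
    (hT : IsSupported d' d T) (h : IsUnit T) : IsUnit (_root_.twist α d' T) := by
  obtain ⟨N, h1, h2⟩ := isUnit_iff_exists.1 h
  obtain ⟨h3, h4⟩ := hT.isUnit_twist (α := α) h1 h2
  exact isUnit_iff_exists.2 ⟨_, h3, h4⟩

section Typed

variable {r s : B →ₐ[ℂ] D} {d d' : Fin n → Γ} {M M' : Matrix (Fin n) (Fin n) D}
  {T : Matrix (Fin n) (Fin n) B}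

lemma typed_mul_r {γ γ' : Γ} {x : D} (hx : x ∈ typed α r s γ γ') (b : B) :
    r b * x = x * r (α γ⁻¹ b) := by rw [hx.1, map_apply_inv]

lemma typed_mul_s {γ γ' : Γ} {x : D} (hx : x ∈ typed α r s γ γ') (b : B) :
    s b * x = x * s (α γ'⁻¹ b) := by rw [hx.2, map_apply_inv]

lemma transpose_mul_s (hM : ∀ i j, M i j ∈ typed α r s (d i) (d j))
    (T : Matrix (Fin n) (Fin n) B) : (M * T.map s)ᵀ = (twist α d T)ᵀ.map s * Mᵀ := by
  ext i j
  rw [transpose_apply, mul_apply, mul_apply]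
  exact Finset.sum_congr rfl fun k _ => (hM j k).2 (T k i)

lemma transpose_r_mul (hM : ∀ i j, M i j ∈ typed α r s (d i) (d j)) (hT : IsSupported d' d T) :
    ((twist α d' T).map r * M)ᵀ = Mᵀ * Tᵀ.map r := by
  ext i j
  rw [transpose_apply, mul_apply, mul_apply]
  refine Finset.sum_congr rfl fun k _ => ?_
  rw [map_apply, hT.twist_apply_right]
  exact ((hM k i).1 (T j k)).symm

/-- The entries of the inverse of a matrix of homogeneous elements commute with the images of `r`
and `s` up to the action of the inverse degrees. -/
lemma inv_mem_typed {W : Matrix (Fin n) (Fin n) D} (hM : ∀ i j, M i j ∈ typed α r s (d i) (d j))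
    (h1 : M * W = 1) (h2 : W * M = 1) (i j : Fin n) :
    W i j ∈ typed α r s (d j)⁻¹ (d i)⁻¹ := by
  have key : ∀ p q : Fin n → D, diagonal p * M = M * diagonal q →
      W i j * p j = q i * W i j := fun p q h => by
    have h3 : W * diagonal p = diagonal q * W := by
      calc W * diagonal p = W * (diagonal p * M) * W := by rw [mul_assoc, mul_assoc, h1, mul_one]
        _ = diagonal q * W := by rw [h, ← mul_assoc, h2, one_mul]
    have h4 := congrFun (congrFun h3 i) j
    rwa [mul_diagonal, diagonal_mul] at h4
  constructor
  · intro b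
    refine (congrArg _ (congrArg r (map_apply_inv (α := α) (d j) b).symm)).trans
      (key (fun k => r (α (d k) (α (d j)⁻¹ b))) (fun _ => r (α (d j)⁻¹ b)) ?_)
    ext k l
    rw [diagonal_mul, mul_diagonal]
    exact ((hM k l).1 _).symm
  · intro b
    refine key (fun _ => s b) (fun k => s (α (d k)⁻¹ b)) ?_
    ext k l
    rw [diagonal_mul, mul_diagonal]
    exact typed_mul_s (hM k l) b

/-- Conjugation by supported matrices changes the degrees of a matrix of homogeneous elements. -/
lemma conj_mem {gr : Γ → Γ → Submodule ℂ D} {e e' : Fin n → Γ}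
    (hr : ∀ {γ γ' : Γ} {x : D} (b c : B), x ∈ gr γ γ' → r b * x * s c ∈ gr γ γ')
    (hM : ∀ i j, M i j ∈ gr (d i) (d' j)) {R : Matrix (Fin n) (Fin n) B}
    (hR : IsSupported e d R) (hT : IsSupported d' e' T) (i j : Fin n) :
    (R.map r * M * T.map s) i j ∈ gr (e i) (e' j) := by
  rw [mul_apply]
  refine Submodule.sum_mem _ fun l _ => ?_
  rw [mul_apply, Finset.sum_mul]
  refine Submodule.sum_mem _ fun k _ => ?_
  rw [map_apply, map_apply]
  by_cases h : e i = d k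
  · by_cases h' : d' l = e' j
    · rw [h, ← h']
      exact hr _ _ (hM k l)
    · rw [hT l j h', map_zero, mul_zero]
      exact Submodule.zero_mem _
  · rw [hR i k h, map_zero, zero_mul, zero_mul]
    exact Submodule.zero_mem _

end Typed

end Calculus

/-! ### Systems of matrices -/

section Systems

open Matrix

/-- The index set of a system of matrices: `v` and `u` stand for a matrix and the matrix of the
adjoints of its entries, `z` for the third matrix whose invertibility the relations express. -/
inductive Idx : Type u
  | v
  | u
  | z

variable {B Γ : Type u} [CommCStarAlgebra B] [Group Γ] (α : Γ →* (B ≃⋆ₐ[ℂ] B)) {n : ℕ}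

/-- Degrees and relations for systems of matrices: `pairs o p` requires that the matrix `X_p` is the
transpose of the inverse of `X_o`, and `T ∈ intw o o'` that `T` intertwines `X_o` and `X_{o'}`. -/
structure MatrixPresentation (B Γ : Type u) (n : ℕ) where
  d : Idx.{u} → Fin n → Γ
  pairs : Idx.{u} → Idx.{u} → Prop
  intw : Idx.{u} → Idx.{u} → Set (Matrix (Fin n) (Fin n) B)

/-- The relations are compatible with the degrees and imply that all matrices of the system are
invertible and that `X_z` can be expressed in terms of `X_v`. -/
structure MatrixPresentation.IsRegular (P : MatrixPresentation B Γ n) : Prop where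
  pair_d : ∀ {o p}, P.pairs o p → P.d p = (P.d o)⁻¹
  supp : ∀ {o o' T}, T ∈ P.intw o o' → IsSupported (P.d o') (P.d o) T
  pair_v : ∃ p, P.pairs .v p
  inv_u : (∃ p, P.pairs .u p) ∨ ∃ T ∈ P.intw .u .v, IsUnit T
  inv_z : ∃ T ∈ P.intw .z .v, IsUnit T

/-- The matrices `X_o`, together with the homomorphisms `r` and `s`, satisfy the relations of a
presentation. -/
structure IsSystem (P : MatrixPresentation B Γ n) {D : Type u} [Ring D] [Algebra ℂ D]
    (r s : B →ₐ[ℂ] D) (X : Idx.{u} → Matrix (Fin n) (Fin n) D) : Prop where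
  commute : ∀ b c, Commute (r b) (s c)
  typed : ∀ o i j, X o i j ∈ typed α r s (P.d o i) (P.d o j)
  pair_mul : ∀ {o p}, P.pairs o p → X o * (X p)ᵀ = 1
  mul_pair : ∀ {o p}, P.pairs o p → (X p)ᵀ * X o = 1
  intw : ∀ {o o' T}, T ∈ P.intw o o' →
    (twist α (P.d o') T).map r * X o = X o' * T.map s

namespace IsSystem

variable {α} {P : MatrixPresentation B Γ n} {D : Type u} [Ring D] [Algebra ℂ D]
  {r s : B →ₐ[ℂ] D} {X : Idx.{u} → Matrix (Fin n) (Fin n) D}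

lemma map {D' : Type u} [Ring D'] [Algebra ℂ D'] (h : IsSystem α P r s X) (f : D →ₐ[ℂ] D') :
    IsSystem α P (f.comp r) (f.comp s) fun o => (X o).map f where
  commute b c := (h.commute b c).map f
  typed o i j := by
    refine ⟨fun b => ?_, fun b => ?_⟩
    · exact (map_mul f _ _).symm.trans ((congrArg f ((h.typed o i j).1 b)).trans (map_mul f _ _))
    · exact (map_mul f _ _).symm.trans ((congrArg f ((h.typed o i j).2 b)).trans (map_mul f _ _))
  pair_mul hp := by rw [← transpose_map, ← map_algHom_mul, h.pair_mul hp, map_algHom_one]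
  mul_pair hp := by rw [← transpose_map, ← map_algHom_mul, h.mul_pair hp, map_algHom_one]
  intw {o o' T} hT := by
    have h1 := congrArg (fun M : Matrix (Fin n) (Fin n) D => M.map f) (h.intw hT)
    rw [map_algHom_mul, map_algHom_mul, Matrix.map_map, Matrix.map_map] at h1
    exact h1

/-- `X_o = r(T')⁻¹ X_v s(T)` if `T` is an invertible intertwiner. -/
lemma eq_conj (hP : P.IsRegular) (h : IsSystem α P r s X) {o : Idx}
    {T : Matrix (Fin n) (Fin n) B} (hT : T ∈ P.intw o .v) (hu : IsUnit T) :
    ∃ R, R * twist α (P.d .v) T = 1 ∧ twist α (P.d .v) T * R = 1 ∧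
      IsSupported (P.d o) (P.d .v) R ∧ X o = R.map r * X .v * T.map s := by
  obtain ⟨R, h1, h2⟩ := isUnit_iff_exists.1 ((hP.supp hT).isUnit (α := α) hu)
  refine ⟨R, h2, h1, ((hP.supp hT).twist _).inverse h1 h2, ?_⟩
  rw [mul_assoc, ← h.intw hT, ← mul_assoc, ← map_algHom_mul, h2, map_algHom_one, one_mul]

lemma isUnit_of_pair (h : IsSystem α P r s X) {o p : Idx} (hp : P.pairs o p) : IsUnit (X o) :=
  isUnit_iff_exists.2 ⟨_, h.pair_mul hp, h.mul_pair hp⟩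

lemma isUnit (hP : P.IsRegular) (h : IsSystem α P r s X) (o : Idx) : IsUnit (X o) := by
  have hv : IsUnit (X .v) := h.isUnit_of_pair hP.pair_v.choose_spec
  have key : ∀ {o T}, T ∈ P.intw o .v → IsUnit T → IsUnit (X o) := fun hT hu => by
    obtain ⟨R, h1, h2, -, hX⟩ := h.eq_conj hP hT hu
    rw [hX]
    exact ((isUnit_map r (isUnit_iff_exists.2 ⟨_, h1, h2⟩)).mul hv).mul (isUnit_map s hu)
  cases o with
  | v => exact hv
  | u =>
    rcases hP.inv_u with ⟨p, hp⟩ | ⟨T, hT, hu⟩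
    · exact h.isUnit_of_pair hp
    · exact key hT hu
  | z =>
    obtain ⟨T, hT, hu⟩ := hP.inv_z
    exact key hT hu

/-- The inverses of the matrices of a system form a system in the opposite algebra, where `r` and
`s` are exchanged. -/
lemma op (hP : P.IsRegular) (h : IsSystem α P r s X) {W : Idx.{u} → Matrix (Fin n) (Fin n) D}
    (h1 : ∀ o, X o * W o = 1) (h2 : ∀ o, W o * X o = 1) :
    IsSystem α P (s.toOpposite fun b c => by rw [Commute, SemiconjBy, ← map_mul, mul_comm, map_mul])
      (r.toOpposite fun b c => by rw [Commute, SemiconjBy, ← map_mul, mul_comm, map_mul])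
      fun o => (W o).map MulOpposite.op := by
  have hW : ∀ o i j, W o i j ∈ _root_.typed α r s (P.d o j)⁻¹ (P.d o i)⁻¹ := fun o i j =>
    inv_mem_typed (h.typed o) (h1 o) (h2 o) i j
  have hpair : ∀ {o p}, P.pairs o p → W o = (X p)ᵀ := fun {o p} hp =>
    left_inv_eq_right_inv (h2 o) (h.pair_mul hp)
  refine ⟨fun b c => congrArg MulOpposite.op (h.commute c b), fun o i j => ⟨fun b => ?_, fun b => ?_⟩,
    fun {o p} hp => ?_, fun {o p} hp => ?_, fun {o o' T} hT => ?_⟩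
  · refine congrArg MulOpposite.op ?_
    have h3 := typed_mul_s (hW o i j) b
    rwa [inv_inv] at h3
  · refine congrArg MulOpposite.op ?_
    have h3 := typed_mul_r (hW o i j) b
    rwa [inv_inv] at h3
  · ext i j
    rw [mul_apply]
    have h3 := congrFun (congrFun (h2 p) j) i
    rw [← transpose_transpose (X p), ← hpair hp, mul_apply] at h3
    refine ((map_sum (MulOpposite.opAddEquiv (α := D)) _ _).symm.trans
      (congrArg MulOpposite.op h3)).trans ?_
    by_cases hij : i = j
    · rw [hij, one_apply_eq, one_apply_eq]; rfl
    · rw [one_apply_ne hij, one_apply_ne (Ne.symm hij)]; rfl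
  · ext i j
    rw [mul_apply]
    have h3 := congrFun (congrFun (h1 p) j) i
    rw [← transpose_transpose (X p), ← hpair hp, mul_apply] at h3
    refine ((map_sum (MulOpposite.opAddEquiv (α := D)) _ _).symm.trans
      (congrArg MulOpposite.op h3)).trans ?_
    by_cases hij : i = j
    · rw [hij, one_apply_eq, one_apply_eq]; rfl
    · rw [one_apply_ne hij, one_apply_ne (Ne.symm hij)]; rfl
  · have hs := hP.supp hT
    have h3 : W o' * (twist α (P.d o') T).map r = T.map s * W o := by
      calc W o' * (twist α (P.d o') T).map r
          = W o' * ((twist α (P.d o') T).map r * X o) * W o := by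
            rw [mul_assoc, mul_assoc, h1, mul_one]
        _ = T.map s * W o := by rw [h.intw hT, ← mul_assoc, h2, one_mul]
    ext i j
    rw [mul_apply, mul_apply]
    refine (map_sum (MulOpposite.opAddEquiv (α := D)) _ _).symm.trans (Eq.trans
      (congrArg MulOpposite.op ?_) (map_sum (MulOpposite.opAddEquiv (α := D)) _ _))
    have h4 := congrFun (congrFun h3 i) j
    rw [mul_apply, mul_apply] at h4
    refine Eq.trans (Finset.sum_congr rfl fun k _ => ?_) (h4.symm.trans
      (Finset.sum_congr rfl fun k _ => ?_))
    · show W o k j * s (twist α (P.d o') T i k) = s (T i k) * W o k j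
      rw [typed_mul_s (hW o k j), inv_inv, hs.twist_apply_right]
    · show W o' i k * r (α (P.d o' k) (T k j)) = r (T k j) * W o' i k
      rw [typed_mul_r (hW o' i k), inv_inv]

end IsSystem

end Systems

/-! ### The conjugate opposite algebra -/

section ConjOp

open Matrix

/-- The opposite algebra with the conjugate scalar multiplication. A homomorphism `A → ConjOp A` is
a conjugate linear antihomomorphism of `A`. -/
def ConjOp (D : Type u) : Type u := Dᵐᵒᵖ

variable {D : Type u} [Ring D] [Algebra ℂ D]

instance : Ring (ConjOp D) := inferInstanceAs (Ring Dᵐᵒᵖ)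

instance : Algebra ℂ (ConjOp D) :=
  RingHom.toAlgebra' ((algebraMap ℂ Dᵐᵒᵖ).comp (starRingEnd ℂ) : ℂ →+* Dᵐᵒᵖ)
    fun c x => Algebra.commutes (A := Dᵐᵒᵖ) (starRingEnd ℂ c) x

namespace ConjOp

/-- The canonical map `D → ConjOp D`. -/
def mk : D ≃+ ConjOp D := MulOpposite.opAddEquiv

lemma mk_mul (x y : D) : mk (x * y) = mk y * mk x := rfl

lemma mk_one : (mk 1 : ConjOp D) = 1 := rfl

lemma smul_mk (z : ℂ) (x : D) : z • mk x = mk (star z • x) := by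
  rw [Algebra.smul_def, Algebra.smul_def]
  exact (congrArg MulOpposite.op (Algebra.commutes (star z) x)).symm

variable {B : Type u} [CommCStarAlgebra B]

/-- The homomorphism `b ↦ f(b⋆)`. -/
def starLift (f : B →ₐ[ℂ] D) : B →ₐ[ℂ] ConjOp D :=
  AlgHom.ofLinearMap
    { toFun := fun b => mk (f (star b))
      map_add' := fun b c => by rw [star_add, map_add, map_add]
      map_smul' := fun z b => by rw [star_smul, map_smul, RingHom.id_apply, smul_mk] }
    (by show mk (f (star 1)) = 1; rw [star_one, map_one, mk_one])
    (fun b c => by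
      show mk (f (star (b * c))) = mk (f (star b)) * mk (f (star c))
      rw [star_mul, map_mul, mk_mul])

end ConjOp

variable {B Γ : Type u} [CommCStarAlgebra B] [Group Γ] {α : Γ →* (B ≃⋆ₐ[ℂ] B)} {n : ℕ}
  {P : MatrixPresentation B Γ n} {r s : B →ₐ[ℂ] D} {X : Idx.{u} → Matrix (Fin n) (Fin n) D}

/-- Matrices `Z_o` with the properties of the matrices of adjoints form a system in the conjugate
opposite algebra. -/
lemma IsSystem.conjOp (hP : P.IsRegular) (h : IsSystem α P r s X)
    {Z : Idx.{u} → Matrix (Fin n) (Fin n) D}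
    (hZ : ∀ o i j, Z o i j ∈ _root_.typed α r s (P.d o i)⁻¹ (P.d o j)⁻¹)
    (hpair : ∀ {o p}, P.pairs o p → Z p * (Z o)ᵀ = 1 ∧ (Z o)ᵀ * Z p = 1)
    (hintw : ∀ {o o' T}, T ∈ P.intw o o' →
      (T.map star).map r * Z o = Z o' * ((twist α (P.d o') T).map star).map s) :
    IsSystem α P (ConjOp.starLift r) (ConjOp.starLift s) fun o => (Z o).map ConjOp.mk where
  commute b c := congrArg ConjOp.mk (h.commute (star b) (star c)).eq.symm
  typed o i j := by
    refine ⟨fun b => congrArg ConjOp.mk ?_, fun b => congrArg ConjOp.mk ?_⟩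
    · show r (star b) * Z o i j = Z o i j * r (star (α (P.d o i) b))
      rw [typed_mul_r (hZ o i j), inv_inv, map_star (α (P.d o i))]
    · show s (star b) * Z o i j = Z o i j * s (star (α (P.d o j) b))
      rw [typed_mul_s (hZ o i j), inv_inv, map_star (α (P.d o j))]
  pair_mul {o p} hp := by
    ext i j
    rw [mul_apply]
    have h3 := congrFun (congrFun (hpair hp).1 j) i
    rw [mul_apply] at h3
    refine ((map_sum (ConjOp.mk (D := D)) _ _).symm.trans (congrArg ConjOp.mk h3)).trans ?_
    by_cases hij : i = j
    · rw [hij, one_apply_eq, one_apply_eq]; rfl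
    · rw [one_apply_ne hij, one_apply_ne (Ne.symm hij)]; rfl
  mul_pair {o p} hp := by
    ext i j
    rw [mul_apply]
    have h3 := congrFun (congrFun (hpair hp).2 j) i
    rw [mul_apply] at h3
    refine ((map_sum (ConjOp.mk (D := D)) _ _).symm.trans (congrArg ConjOp.mk h3)).trans ?_
    by_cases hij : i = j
    · rw [hij, one_apply_eq, one_apply_eq]; rfl
    · rw [one_apply_ne hij, one_apply_ne (Ne.symm hij)]; rfl
  intw {o o' T} hT := by
    have hs := hP.supp hT
    ext i j
    rw [mul_apply, mul_apply]
    refine (map_sum (ConjOp.mk (D := D)) _ _).symm.trans (Eq.trans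
      (congrArg ConjOp.mk ?_) (map_sum (ConjOp.mk (D := D)) _ _))
    have h4 := congrFun (congrFun (hintw hT) i) j
    rw [mul_apply, mul_apply] at h4
    refine Eq.trans (Finset.sum_congr rfl fun k _ => ?_) (h4.trans
      (Finset.sum_congr rfl fun k _ => ?_))
    · show Z o k j * r (star (twist α (P.d o') T i k)) = r (star (T i k)) * Z o k j
      rw [typed_mul_r (hZ o k j), inv_inv, hs.twist_apply_right, map_star (α (P.d o k))]
    · show Z o' i k * s (star (α (P.d o' k) (T k j))) = s (star (T k j)) * Z o' i k
      rw [typed_mul_s (hZ o' i k), inv_inv, map_star (α (P.d o' k))]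

end ConjOp

/-! ### The universal algebra of a presentation -/

section Universal

open Matrix

variable {B Γ : Type u} [CommCStarAlgebra B] [Group Γ] (α : Γ →* (B ≃⋆ₐ[ℂ] B)) {n : ℕ}
  (P : MatrixPresentation B Γ n)

/-- `A` is the universal algebra generated by the images of `r` and `s` and the entries of the
matrices `X_o`, subject to the relations of a presentation. -/
structure IsUniversalAlg {A : Type u} [Ring A] [Algebra ℂ A] (r s : B →ₐ[ℂ] A)
    (X : Idx.{u} → Matrix (Fin n) (Fin n) A) : Prop where
  sys : IsSystem α P r s X
  exists_hom : ∀ (D : Type u) [Ring D] [Algebra ℂ D] (r' s' : B →ₐ[ℂ] D)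
    (X' : Idx.{u} → Matrix (Fin n) (Fin n) D), IsSystem α P r' s' X' →
    ∃ f : A →ₐ[ℂ] D, (∀ b, f (r b) = r' b) ∧ (∀ b, f (s b) = s' b) ∧ ∀ o i j, f (X o i j) = X' o i j
  generates : ∀ N : Subalgebra ℂ A, (∀ b, r b ∈ N) → (∀ b, s b ∈ N) → (∀ o i j, X o i j ∈ N) → N = ⊤

/-- The evaluation of noncommutative polynomials in `r(b)`, `s(b)` and the matrix entries. -/
def evalFree {D : Type u} [Ring D] [Algebra ℂ D] (r s : B → D)
    (X : Idx.{u} → Matrix (Fin n) (Fin n) D) :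
    FreeAlgebra ℂ (B ⊕ B ⊕ (Idx.{u} × Fin n × Fin n)) →ₐ[ℂ] D :=
  FreeAlgebra.lift ℂ (Sum.elim r (Sum.elim s fun q => X q.1 q.2.1 q.2.2))

/-- The universal algebra is the quotient of a free algebra by all relations that hold in every
system of matrices. -/
lemma exists_isUniversalAlg : ∃ (A : Type u) (_ : Ring A) (_ : Algebra ℂ A) (r s : B →ₐ[ℂ] A)
    (X : Idx.{u} → Matrix (Fin n) (Fin n) A), IsUniversalAlg α P r s X := by
  let F := FreeAlgebra ℂ (B ⊕ B ⊕ (Idx.{u} × Fin n × Fin n))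
  let rel : F → F → Prop := fun x y => ∀ (D : Type u) [Ring D] [Algebra ℂ D] (r s : B →ₐ[ℂ] D)
    (X : Idx.{u} → Matrix (Fin n) (Fin n) D), IsSystem α P r s X →
      evalFree r s X x = evalFree r s X y
  let π : F →ₐ[ℂ] RingQuot rel := RingQuot.mkAlgHom ℂ rel
  have hπ : ∀ {x y : F}, rel x y → π x = π y := fun h => RingQuot.mkAlgHom_rel ℂ h
  let r₀ : B → F := fun b => FreeAlgebra.ι ℂ (Sum.inl b)
  let s₀ : B → F := fun b => FreeAlgebra.ι ℂ (Sum.inr (Sum.inl b))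
  let X₀ : Idx.{u} → Matrix (Fin n) (Fin n) F := fun o =>
    Matrix.of fun i j => FreeAlgebra.ι ℂ (Sum.inr (Sum.inr (o, i, j)))
  have er : ∀ {D : Type u} [Ring D] [Algebra ℂ D] (r s : B →ₐ[ℂ] D)
      (X : Idx.{u} → Matrix (Fin n) (Fin n) D) (b : B), evalFree r s X (r₀ b) = r b :=
    fun r s X b => FreeAlgebra.lift_ι_apply _ _
  have es : ∀ {D : Type u} [Ring D] [Algebra ℂ D] (r s : B →ₐ[ℂ] D)
      (X : Idx.{u} → Matrix (Fin n) (Fin n) D) (b : B), evalFree r s X (s₀ b) = s b :=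
    fun r s X b => FreeAlgebra.lift_ι_apply _ _
  have eX : ∀ {D : Type u} [Ring D] [Algebra ℂ D] (r s : B →ₐ[ℂ] D)
      (X : Idx.{u} → Matrix (Fin n) (Fin n) D) (o i j), evalFree r s X (X₀ o i j) = X o i j :=
    fun r s X o i j => FreeAlgebra.lift_ι_apply _ _
  let r : B →ₐ[ℂ] RingQuot rel := AlgHom.ofLinearMap
    { toFun := fun b => π (r₀ b)
      map_add' := fun b c => (hπ fun D _ _ r s X _ => by
        rw [map_add, er, er, er, map_add]).trans (map_add π _ _)
      map_smul' := fun z b => (hπ fun D _ _ r s X _ => by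
        rw [map_smul, er, er, map_smul, RingHom.id_apply]).trans (map_smul π _ _) }
    ((hπ fun D _ _ r s X _ => by rw [er, map_one, map_one]).trans (map_one π))
    (fun b c => (hπ fun D _ _ r s X _ => by
        rw [map_mul, er, er, er, map_mul]).trans (map_mul π _ _))
  let s : B →ₐ[ℂ] RingQuot rel := AlgHom.ofLinearMap
    { toFun := fun b => π (s₀ b)
      map_add' := fun b c => (hπ fun D _ _ r s X _ => by
        rw [map_add, es, es, es, map_add]).trans (map_add π _ _)
      map_smul' := fun z b => (hπ fun D _ _ r s X _ => by
        rw [map_smul, es, es, map_smul, RingHom.id_apply]).trans (map_smul π _ _) }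
    ((hπ fun D _ _ r s X _ => by rw [es, map_one, map_one]).trans (map_one π))
    (fun b c => (hπ fun D _ _ r s X _ => by
        rw [map_mul, es, es, es, map_mul]).trans (map_mul π _ _))
  let X : Idx.{u} → Matrix (Fin n) (Fin n) (RingQuot rel) := fun o => (X₀ o).map π
  have eM : ∀ {D : Type u} [Ring D] [Algebra ℂ D] (r s : B →ₐ[ℂ] D)
      (X : Idx.{u} → Matrix (Fin n) (Fin n) D) (o), (X₀ o).map (evalFree r s X) = X o :=
    fun r s X o => by ext i j; exact eX r s X o i j
  have hM : ∀ {M N : Matrix (Fin n) (Fin n) F}, (∀ (D : Type u) [Ring D] [Algebra ℂ D]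
      (r s : B →ₐ[ℂ] D) (X : Idx.{u} → Matrix (Fin n) (Fin n) D), IsSystem α P r s X →
        M.map (evalFree r s X) = N.map (evalFree r s X)) → M.map π = N.map π := fun h => by
    ext i j
    exact hπ fun D _ _ r s X hX => congrFun (congrFun (h D r s X hX) i) j
  have hr : ∀ T : Matrix (Fin n) (Fin n) B, T.map r = (T.map r₀).map π := fun T => rfl
  have hs : ∀ T : Matrix (Fin n) (Fin n) B, T.map s = (T.map s₀).map π := fun T => rfl
  have er' : ∀ {D : Type u} [Ring D] [Algebra ℂ D] (r s : B →ₐ[ℂ] D)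
      (X : Idx.{u} → Matrix (Fin n) (Fin n) D) (T : Matrix (Fin n) (Fin n) B),
      (T.map r₀).map (evalFree r s X) = T.map r := fun r s X T => by
    ext i j; exact er r s X _
  have es' : ∀ {D : Type u} [Ring D] [Algebra ℂ D] (r s : B →ₐ[ℂ] D)
      (X : Idx.{u} → Matrix (Fin n) (Fin n) D) (T : Matrix (Fin n) (Fin n) B),
      (T.map s₀).map (evalFree r s X) = T.map s := fun r s X T => by
    ext i j; exact es r s X _
  refine ⟨RingQuot rel, inferInstance, inferInstance, r, s, X, ⟨?_, ?_, ?_, ?_, ?_⟩, ?_, ?_⟩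
  · intro b c
    refine (map_mul π _ _).symm.trans ((hπ fun D _ _ r s X hX => ?_).trans (map_mul π _ _))
    rw [map_mul, map_mul, er, es]
    exact hX.commute b c
  · intro o i j
    refine ⟨fun b => ?_, fun b => ?_⟩
    · refine (map_mul π _ _).symm.trans ((hπ fun D _ _ r s X hX => ?_).trans (map_mul π _ _))
      rw [map_mul, map_mul, er, er, eX]
      exact (hX.typed o i j).1 b
    · refine (map_mul π _ _).symm.trans ((hπ fun D _ _ r s X hX => ?_).trans (map_mul π _ _))
      rw [map_mul, map_mul, es, es, eX]
      exact (hX.typed o i j).2 b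
  · intro o p hp
    rw [← transpose_map, ← map_algHom_mul, ← map_algHom_one π]
    refine hM fun D _ _ r s X hX => ?_
    rw [map_algHom_mul, transpose_map, eM, eM, map_algHom_one, hX.pair_mul hp]
  · intro o p hp
    rw [← transpose_map, ← map_algHom_mul, ← map_algHom_one π]
    refine hM fun D _ _ r s X hX => ?_
    rw [map_algHom_mul, transpose_map, eM, eM, map_algHom_one, hX.mul_pair hp]
  · intro o o' T hT
    rw [hr, hs, ← map_algHom_mul, ← map_algHom_mul]
    refine hM fun D _ _ r s X hX => ?_
    rw [map_algHom_mul, map_algHom_mul, er', es', eM, eM, hX.intw hT]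
  · intro D _ _ r' s' X' h
    refine ⟨RingQuot.liftAlgHom ℂ ⟨evalFree r' s' X', fun x y hxy => hxy D r' s' X' h⟩,
      fun b => ?_, fun b => ?_, fun o i j => ?_⟩
    · exact (RingQuot.liftAlgHom_mkAlgHom_apply ℂ _ _ _).trans (er r' s' X' b)
    · exact (RingQuot.liftAlgHom_mkAlgHom_apply ℂ _ _ _).trans (es r' s' X' b)
    · exact (RingQuot.liftAlgHom_mkAlgHom_apply ℂ _ _ _).trans (eX r' s' X' o i j)
  · intro N h1 h2 h3
    rw [eq_top_iff]
    rintro x -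
    obtain ⟨y, rfl⟩ := RingQuot.mkAlgHom_surjective ℂ rel x
    induction y using FreeAlgebra.induction with
    | grade0 z => rw [AlgHom.commutes]; exact N.algebraMap_mem z
    | grade1 q =>
      rcases q with b | b | ⟨o, i, j⟩
      · exact h1 b
      · exact h2 b
      · exact h3 o i j
    | mul a b ha hb => rw [map_mul]; exact N.mul_mem ha hb
    | add a b ha hb => rw [map_add]; exact N.add_mem ha hb

variable {α P} {A : Type u} [Ring A] [Algebra ℂ A] {r s : B →ₐ[ℂ] A}
  {X : Idx.{u} → Matrix (Fin n) (Fin n) A}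

lemma conj_mem_subalgebra (N : Subalgebra ℂ A) (hr : ∀ b, r b ∈ N) (hs : ∀ b, s b ∈ N)
    {M : Matrix (Fin n) (Fin n) A} (hM : ∀ i j, M i j ∈ N) (R T : Matrix (Fin n) (Fin n) B)
    (i j : Fin n) : (R.map r * M * T.map s) i j ∈ N := by
  rw [mul_apply]
  refine N.sum_mem fun l _ => N.mul_mem ?_ (hs _)
  rw [mul_apply]
  exact N.sum_mem fun k _ => N.mul_mem (hr _) (hM _ _)

/-- A universal algebra is generated by the images of `r` and `s` and the entries of `X_v` and
`X_u`. -/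
lemma IsUniversalAlg.generates' (h : IsUniversalAlg α P r s X) (hP : P.IsRegular)
    (N : Subalgebra ℂ A) (hr : ∀ b, r b ∈ N) (hs : ∀ b, s b ∈ N) (hv : ∀ i j, X .v i j ∈ N)
    (hu : ∀ i j, X .u i j ∈ N) : N = ⊤ := by
  refine h.generates N hr hs fun o i j => ?_
  cases o with
  | v => exact hv i j
  | u => exact hu i j
  | z =>
    obtain ⟨T, hT, hTu⟩ := hP.inv_z
    obtain ⟨R, -, -, -, hX⟩ := h.sys.eq_conj hP hT hTu
    rw [hX]
    exact conj_mem_subalgebra N hr hs hv R T i j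

lemma IsUniversalAlg.hom_ext (h : IsUniversalAlg α P r s X) (hP : P.IsRegular) {D : Type*}
    [Ring D] [Algebra ℂ D] {f f' : A →ₐ[ℂ] D} (hr : ∀ b, f (r b) = f' (r b))
    (hs : ∀ b, f (s b) = f' (s b)) (hv : ∀ i j, f (X .v i j) = f' (X .v i j))
    (hu : ∀ i j, f (X .u i j) = f' (X .u i j)) : f = f' := by
  have h1 := h.generates' hP (AlgHom.equalizer f f') hr hs hv hu
  ext a
  exact (AlgHom.mem_equalizer f f' a).1 (h1 ▸ Algebra.mem_top)

/-- A homomorphism on a universal algebra preserves the involution if it does so on `X_v`. -/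
lemma IsUniversalAlg.map_star_of [StarRing A] [StarModule ℂ A] (h : IsUniversalAlg α P r s X)
    (hP : P.IsRegular) {D : Type*} [Ring D] [StarRing D] [Algebra ℂ D] [StarModule ℂ D]
    (f : A →ₐ[ℂ] D) (hr : ∀ b, f (star (r b)) = star (f (r b)))
    (hs : ∀ b, f (star (s b)) = star (f (s b)))
    (hA : ∀ i j, star (X .v i j) = X .u i j) (hD : ∀ i j, f (X .u i j) = star (f (X .v i j)))
    (a : A) : f (star a) = star (f a) := by
  let N : Subalgebra ℂ A :=
    { carrier := {a | f (star a) = star (f a)}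
      mul_mem' := fun {a b} ha hb => by
        show f (star (a * b)) = star (f (a * b))
        rw [star_mul, map_mul, map_mul, star_mul]
        exact congrArg₂ (· * ·) hb ha
      add_mem' := fun {a b} ha hb => by
        show f (star (a + b)) = star (f (a + b))
        rw [star_add, map_add, map_add, star_add]
        exact congrArg₂ (· + ·) ha hb
      algebraMap_mem' := fun z => by
        show f (star (algebraMap ℂ A z)) = star (f (algebraMap ℂ A z))
        rw [← algebraMap_star_comm, AlgHom.commutes, AlgHom.commutes, algebraMap_star_comm] }
  have h1 := h.generates' hP N hr hs (fun i j => by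
    show f (star _) = _
    rw [hA, hD]) (fun i j => by
    show f (star _) = _
    rw [hD, star_star, ← hA, star_star])
  exact (h1 ▸ Algebra.mem_top : a ∈ N)

end Universal

/-! ### The grading and the involution of a universal algebra -/

section Grading

open Matrix

/-- The span of a submonoid as a subalgebra. -/
def spanSubalgebra {A : Type*} [Ring A] [Algebra ℂ A] (S : Set A) (h1 : 1 ∈ S)
    (hmul : ∀ a ∈ S, ∀ b ∈ S, a * b ∈ S) : Subalgebra ℂ A :=
  (Submodule.span ℂ S).toSubalgebra (Submodule.subset_span h1) fun x y hx hy => by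
    have h := Submodule.mul_mem_mul hx hy
    rw [Submodule.span_mul_span] at h
    refine Submodule.span_mono ?_ h
    rintro _ ⟨a, ha, b, hb, rfl⟩
    exact hmul a ha b hb

lemma mem_spanSubalgebra {A : Type*} [Ring A] [Algebra ℂ A] {S : Set A} {h1 : 1 ∈ S}
    {hmul : ∀ a ∈ S, ∀ b ∈ S, a * b ∈ S} {x : A} :
    x ∈ spanSubalgebra S h1 hmul ↔ x ∈ Submodule.span ℂ S := Iff.rfl

variable {B Γ : Type u} [CommCStarAlgebra B] [Group Γ] {α : Γ →* (B ≃⋆ₐ[ℂ] B)} {n : ℕ}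
  {P : MatrixPresentation B Γ n} {A : Type u} [Ring A] [Algebra ℂ A] {r s : B →ₐ[ℂ] A}
  {X : Idx.{u} → Matrix (Fin n) (Fin n) A}

/-- If subspaces of the homogeneous components contain the generators and are closed under
multiplication, then they are equal to the homogeneous components. -/
lemma IsUniversalAlg.graded_induction (h : IsUniversalAlg α P r s X) (hP : P.IsRegular)
    {gr : Γ → Γ → Submodule ℂ A} (hgr : iSupIndep fun p : Γ × Γ => gr p.1 p.2)
    (Q : Γ → Γ → Submodule ℂ A) (hQ : ∀ γ γ', Q γ γ' ≤ gr γ γ')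
    (hmul : ∀ {γ γ' δ δ' : Γ} {a b : A}, a ∈ Q γ γ' → b ∈ Q δ δ' → a * b ∈ Q (γ * δ) (γ' * δ'))
    (hr : ∀ b, r b ∈ Q 1 1) (hs : ∀ b, s b ∈ Q 1 1)
    (hv : ∀ i j, X .v i j ∈ Q (P.d .v i) (P.d .v j))
    (hu : ∀ i j, X .u i j ∈ Q (P.d .u i) (P.d .u j)) (γ γ' : Γ) : gr γ γ' ≤ Q γ γ' := by
  have h1 := h.generates' hP (spanSubalgebra {a | ∃ γ γ', a ∈ Q γ γ'}
    ⟨1, 1, map_one r ▸ hr 1⟩ fun _ ⟨_, _, ha⟩ _ ⟨_, _, hb⟩ => ⟨_, _, hmul ha hb⟩)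
    (fun b => Submodule.subset_span ⟨_, _, hr b⟩) (fun b => Submodule.subset_span ⟨_, _, hs b⟩)
    (fun i j => Submodule.subset_span ⟨_, _, hv i j⟩)
    (fun i j => Submodule.subset_span ⟨_, _, hu i j⟩)
  have h2 : Q γ γ' ⊔ (⨆ q, ⨆ (_ : q ≠ (γ, γ')), gr q.1 q.2) = ⊤ := by
    rw [eq_top_iff]
    rintro x -
    have hx : x ∈ Submodule.span ℂ {a | ∃ γ γ', a ∈ Q γ γ'} :=
      mem_spanSubalgebra.1 (h1 ▸ Algebra.mem_top)
    refine Submodule.span_le.2 ?_ hx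
    rintro a ⟨δ, δ', ha⟩
    by_cases hδ : (δ, δ') = (γ, γ')
    · obtain ⟨rfl, rfl⟩ := Prod.mk.inj hδ
      exact Submodule.mem_sup_left ha
    · exact Submodule.mem_sup_right (Submodule.mem_iSup_of_mem (δ, δ')
        (Submodule.mem_iSup_of_mem hδ (hQ _ _ ha)))
  have h3 := sup_inf_assoc_of_le (⨆ q, ⨆ (_ : q ≠ (γ, γ')), gr q.1 q.2) (hQ γ γ')
  rw [h2, top_inf_eq, inf_comm, (hgr (γ, γ')).eq_bot, sup_bot_eq] at h3
  exact h3.le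

lemma sum_single {G : Type*} {ι : Type*} (t : Finset ι) (p : G) (f : ι → A) :
    ∑ k ∈ t, MonoidAlgebra.single p (f k) = MonoidAlgebra.single p (∑ k ∈ t, f k) :=
  (map_sum (MonoidAlgebra.singleAddHom p) f t).symm

/-- A system in `A` with degrees gives a system in the group algebra of `Γ × Γ` over `A`. -/
lemma IsSystem.monoidAlgebra (hP : P.IsRegular) (h : IsSystem α P r s X) :
    IsSystem α P (MonoidAlgebra.singleOneAlgHom.comp r : B →ₐ[ℂ] MonoidAlgebra A (Γ × Γ))
      (MonoidAlgebra.singleOneAlgHom.comp s) fun o =>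
        Matrix.of fun i j => MonoidAlgebra.single (P.d o i, P.d o j) (X o i j) where
  commute b c := by
    show MonoidAlgebra.single 1 (r b) * MonoidAlgebra.single 1 (s c) =
      MonoidAlgebra.single 1 (s c) * MonoidAlgebra.single 1 (r b)
    rw [MonoidAlgebra.single_mul_single, MonoidAlgebra.single_mul_single, h.commute b c]
  typed o i j := by
    refine ⟨fun b => ?_, fun b => ?_⟩
    · show MonoidAlgebra.single _ (X o i j) * MonoidAlgebra.single 1 (r b) =
        MonoidAlgebra.single 1 (r _) * MonoidAlgebra.single _ (X o i j)
      rw [MonoidAlgebra.single_mul_single, MonoidAlgebra.single_mul_single, one_mul, mul_one,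
        (h.typed o i j).1]
    · show MonoidAlgebra.single _ (X o i j) * MonoidAlgebra.single 1 (s b) =
        MonoidAlgebra.single 1 (s _) * MonoidAlgebra.single _ (X o i j)
      rw [MonoidAlgebra.single_mul_single, MonoidAlgebra.single_mul_single, one_mul, mul_one,
        (h.typed o i j).2]
  pair_mul {o p} hp := by
    ext1 i j
    have h1 := congrFun (congrFun (h.pair_mul hp) i) j
    rw [mul_apply] at h1 ⊢
    refine (Finset.sum_congr rfl fun k _ => (?_ : _ =
      MonoidAlgebra.single (P.d o i * (P.d o j)⁻¹, (1 : Γ)) (X o i k * X p j k))).trans ?_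
    · show MonoidAlgebra.single _ (X o i k) * MonoidAlgebra.single _ (X p j k) = _
      rw [MonoidAlgebra.single_mul_single, hP.pair_d hp, Prod.mk_mul_mk, Pi.inv_apply,
        Pi.inv_apply, mul_inv_cancel]
    · rw [sum_single]
      refine (congrArg _ h1).trans ?_
      by_cases hij : i = j
      · rw [hij, one_apply_eq, one_apply_eq, mul_inv_cancel]; rfl
      · rw [one_apply_ne hij, one_apply_ne hij, MonoidAlgebra.single_zero]
  mul_pair {o p} hp := by
    ext1 i j
    have h1 := congrFun (congrFun (h.mul_pair hp) i) j
    rw [mul_apply] at h1 ⊢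
    refine (Finset.sum_congr rfl fun k _ => (?_ : _ =
      MonoidAlgebra.single ((1 : Γ), (P.d o i)⁻¹ * P.d o j) (X p k i * X o k j))).trans ?_
    · show MonoidAlgebra.single _ (X p k i) * MonoidAlgebra.single _ (X o k j) = _
      rw [MonoidAlgebra.single_mul_single, hP.pair_d hp, Prod.mk_mul_mk, Pi.inv_apply,
        Pi.inv_apply, inv_mul_cancel]
    · rw [sum_single]
      refine (congrArg _ h1).trans ?_
      by_cases hij : i = j
      · rw [hij, one_apply_eq, one_apply_eq, inv_mul_cancel]; rfl
      · rw [one_apply_ne hij, one_apply_ne hij, MonoidAlgebra.single_zero]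
  intw {o o' T} hT := by
    have hs := hP.supp hT
    ext1 i j
    have h1 := congrFun (congrFun (h.intw hT) i) j
    rw [mul_apply, mul_apply] at h1 ⊢
    refine Eq.trans (Finset.sum_congr rfl fun k _ => (?_ : _ = MonoidAlgebra.single
      (P.d o' i, P.d o j) (r (twist α (P.d o') T i k) * X o k j))) ((sum_single _ _ _).trans
      ((congrArg _ h1).trans ((sum_single _ _ _).symm.trans (Finset.sum_congr rfl fun k _ =>
        (?_ : MonoidAlgebra.single (P.d o' i, P.d o j) (X o' i k * s (T k j)) = _)))))
    · show MonoidAlgebra.single 1 (r (twist α (P.d o') T i k)) *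
        MonoidAlgebra.single _ (X o k j) = _
      rw [MonoidAlgebra.single_mul_single, one_mul]
      by_cases hik : P.d o' i = P.d o k
      · rw [hik]
      · rw [hs.twist _ i k hik, map_zero, zero_mul, MonoidAlgebra.single_zero,
          MonoidAlgebra.single_zero]
    · show _ = MonoidAlgebra.single _ (X o' i k) * MonoidAlgebra.single 1 (s (T k j))
      rw [MonoidAlgebra.single_mul_single, mul_one]
      by_cases hkj : P.d o' k = P.d o j
      · rw [hkj]
      · rw [hs k j hkj, map_zero, mul_zero, MonoidAlgebra.single_zero,
          MonoidAlgebra.single_zero]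

/-- All coefficients of the coaction `c` satisfy the commutation relations with `r` and `s`. -/
lemma IsUniversalAlg.coeff_mem_typed (h : IsUniversalAlg α P r s X)
    (c : A →ₐ[ℂ] MonoidAlgebra A (Γ × Γ)) (hr : ∀ b, c (r b) = MonoidAlgebra.single 1 (r b))
    (hs : ∀ b, c (s b) = MonoidAlgebra.single 1 (s b))
    (hX : ∀ o i j, c (X o i j) = MonoidAlgebra.single (P.d o i, P.d o j) (X o i j)) (a : A)
    (p : Γ × Γ) : (c a).coeff p ∈ typed α r s p.1 p.2 := by
  obtain ⟨S, hS⟩ : ∃ S : Set (MonoidAlgebra A (Γ × Γ)), S = {y | ∃ (q : Γ × Γ) (x : A),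
    x ∈ typed α r s q.1 q.2 ∧ y = MonoidAlgebra.single q x} := ⟨_, rfl⟩
  have mem : ∀ {q : Γ × Γ} {x : A}, x ∈ typed α r s q.1 q.2 → MonoidAlgebra.single q x ∈ S :=
    fun {q x} hx => by rw [hS]; exact ⟨q, x, hx, rfl⟩
  have hr1 : ∀ b, r b ∈ typed α r s (1 : Γ × Γ).1 (1 : Γ × Γ).2 := fun b =>
    ⟨fun b' => by rw [Prod.fst_one, map_one, ← map_mul, mul_comm, map_mul]; rfl,
      fun b' => by rw [Prod.snd_one, map_one]; exact h.sys.commute b b'⟩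
  have hs1 : ∀ b, s b ∈ typed α r s (1 : Γ × Γ).1 (1 : Γ × Γ).2 := fun b =>
    ⟨fun b' => by rw [Prod.fst_one, map_one]; exact (h.sys.commute b' b).symm,
      fun b' => by rw [Prod.snd_one, map_one, ← map_mul, mul_comm, map_mul]; rfl⟩
  have one_mem : (1 : MonoidAlgebra A (Γ × Γ)) ∈ S := by
    have h1 := mem (hr1 1)
    rwa [map_one] at h1
  have mul_mem : ∀ a ∈ S, ∀ b ∈ S, a * b ∈ S := by
    intro a ha b hb
    rw [hS] at ha hb
    obtain ⟨q, x, hx, rfl⟩ := ha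
    obtain ⟨q', x', hx', rfl⟩ := hb
    rw [MonoidAlgebra.single_mul_single]
    exact mem (mul_mem_typed hx hx')
  have h1 : (spanSubalgebra S one_mem mul_mem).comap c = ⊤ := by
    refine h.generates _ (fun b => ?_) (fun b => ?_) (fun o i j => ?_)
    · rw [Subalgebra.mem_comap, hr, mem_spanSubalgebra]
      exact Submodule.subset_span (mem (hr1 b))
    · rw [Subalgebra.mem_comap, hs, mem_spanSubalgebra]
      exact Submodule.subset_span (mem (hs1 b))
    · rw [Subalgebra.mem_comap, hX, mem_spanSubalgebra]
      exact Submodule.subset_span (mem (h.sys.typed o i j))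
  have h2 : c a ∈ Submodule.span ℂ S := by
    have h3 : a ∈ (⊤ : Subalgebra ℂ A) := Algebra.mem_top
    rwa [← h1, Subalgebra.mem_comap, mem_spanSubalgebra] at h3
  clear mem one_mem mul_mem h1
  generalize c a = y at h2
  induction h2 using Submodule.span_induction with
  | zero => rw [MonoidAlgebra.coeff_zero]; exact Submodule.zero_mem _
  | add x y _ _ hx hy => rw [MonoidAlgebra.coeff_add]; exact Submodule.add_mem _ hx hy
  | smul z x _ hx => rw [MonoidAlgebra.coeff_smul]; exact Submodule.smul_mem _ z hx
  | mem y hy =>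
    rw [hS] at hy
    obtain ⟨q, x, hx, rfl⟩ := hy
    rw [MonoidAlgebra.coeff_single]
    by_cases hq : q = p
    · rw [← hq, Finsupp.single_eq_same]; exact hx
    · rw [Finsupp.single_eq_of_ne (Ne.symm hq)]; exact Submodule.zero_mem _

/-- A universal algebra is graded, with the degrees of the generators given by the presentation. -/
lemma IsUniversalAlg.exists_bgAlg (h : IsUniversalAlg α P r s X) (hP : P.IsRegular) :
    ∃ V : BGAlg α A, V.r = r ∧ V.s = s ∧ ∀ o i j, X o i j ∈ V.gr (P.d o i) (P.d o j) := by
  obtain ⟨c, hr, hs, hX⟩ := h.exists_hom _ _ _ _ (h.sys.monoidAlgebra hP)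
  replace hr : ∀ b, c (r b) = MonoidAlgebra.single 1 (r b) := hr
  replace hs : ∀ b, c (s b) = MonoidAlgebra.single 1 (s b) := hs
  replace hX : ∀ o i j, c (X o i j) = MonoidAlgebra.single (P.d o i, P.d o j) (X o i j) := hX
  let gr : Γ → Γ → Submodule ℂ A := fun γ γ' =>
    { carrier := {a | c a = MonoidAlgebra.single (γ, γ') a}
      add_mem' := fun {a b} ha hb => by
        show c (a + b) = _
        rw [map_add, MonoidAlgebra.single_add]; exact congrArg₂ (· + ·) ha hb
      zero_mem' := (map_zero c).trans (MonoidAlgebra.single_zero _).symm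
      smul_mem' := fun z a ha => by
        show c (z • a) = _
        rw [map_smul, ← MonoidAlgebra.smul_single]; exact congrArg _ ha }
  have hone : (1 : A) ∈ gr 1 1 := map_one c
  have hmul : ∀ {γ γ' δ δ' : Γ} {a b : A}, a ∈ gr γ γ' → b ∈ gr δ δ' →
      a * b ∈ gr (γ * δ) (γ' * δ') := fun {γ γ' δ δ' a b} ha hb => by
    show c (a * b) = _
    rw [map_mul, show c a = _ from ha, show c b = _ from hb, MonoidAlgebra.single_mul_single]
    rfl
  have htyped := h.coeff_mem_typed c hr hs hX
  have hcoeff : ∀ {γ γ' a}, a ∈ gr γ γ' → a = (c a).coeff (γ, γ') := fun {γ γ' a} ha => by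
    rw [show c a = _ from ha, MonoidAlgebra.coeff_single, Finsupp.single_eq_same]
  refine ⟨⟨gr, r, s, ?_, ?_, hmul, hr, hs, h.sys.commute, ?_, ?_⟩, rfl, rfl, hX⟩
  · intro p
    rw [Submodule.disjoint_def]
    intro x hx hx'
    have h1 : (⨆ q, ⨆ (_ : q ≠ p), gr q.1 q.2) ≤
        LinearMap.ker ((Finsupp.lapply p).comp
          ((MonoidAlgebra.coeffLinearEquiv ℂ).toLinearMap.comp c.toLinearMap)) := by
      refine iSup_le fun q => iSup_le fun hq y hy => ?_
      show (c y).coeff p = 0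
      rw [show c y = _ from hy, MonoidAlgebra.coeff_single, Finsupp.single_eq_of_ne (Ne.symm hq)]
    exact (hcoeff hx).trans (h1 hx')
  · have h1 := h.generates (spanSubalgebra {a | ∃ γ γ', a ∈ gr γ γ'}
      ⟨1, 1, hone⟩ fun _ ⟨_, _, ha⟩ _ ⟨_, _, hb⟩ => ⟨_, _, hmul ha hb⟩)
      (fun b => Submodule.subset_span ⟨_, _, hr b⟩) (fun b => Submodule.subset_span ⟨_, _, hs b⟩)
      (fun o i j => Submodule.subset_span ⟨_, _, hX o i j⟩)
    rw [eq_top_iff]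
    rintro x -
    have hx : x ∈ Submodule.span ℂ {a | ∃ γ γ', a ∈ gr γ γ'} :=
      mem_spanSubalgebra.1 (h1 ▸ Algebra.mem_top)
    refine Submodule.span_le.2 ?_ hx
    rintro a ⟨γ, γ', ha⟩
    exact Submodule.mem_iSup_of_mem (p := fun q : Γ × Γ => gr q.1 q.2) (γ, γ') ha
  · intro γ γ' a b ha
    have h1 := htyped a (γ, γ')
    rw [← hcoeff ha] at h1
    exact h1.1 b
  · intro γ γ' a b ha
    have h1 := htyped a (γ, γ')
    rw [← hcoeff ha] at h1
    exact h1.2 b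

/-- A system of adjoints defines an involution on a universal algebra. -/
theorem IsUniversalAlg.exists_bgStarAlg (h : IsUniversalAlg α P r s X) (hP : P.IsRegular)
    (hd : P.d .u = (P.d .v)⁻¹) {Z : Idx.{u} → Matrix (Fin n) (Fin n) A}
    (hZ : IsSystem α P (ConjOp.starLift r) (ConjOp.starLift s) fun o => (Z o).map ConjOp.mk)
    (hv : Z .v = X .u) (hu : Z .u = X .v) :
    ∃ (_ : StarRing A) (_ : StarModule ℂ A) (V : BGStarAlg α A), (V.r : B →ₐ[ℂ] A) = r ∧
      (V.s : B →ₐ[ℂ] A) = s ∧ (∀ o i j, X o i j ∈ V.gr (P.d o i) (P.d o j)) ∧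
      ∀ i j, star (X .v i j) = X .u i j := by
  obtain ⟨V, rfl, rfl, hVX⟩ := h.exists_bgAlg hP
  obtain ⟨σ, hr, hs, hX⟩ := h.exists_hom _ _ _ _ hZ
  let st : A → A := fun a => ConjOp.mk.symm (σ a)
  have st_add : ∀ a b, st (a + b) = st a + st b := fun a b =>
    (congrArg _ (map_add σ a b)).trans (map_add ConjOp.mk.symm _ _)
  have st_mul : ∀ a b, st (a * b) = st b * st a := fun a b => congrArg ConjOp.mk.symm (map_mul σ a b)
  have st_smul : ∀ (z : ℂ) a, st (z • a) = star z • st a := fun z a => by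
    show ConjOp.mk.symm (σ (z • a)) = _
    rw [map_smul]
    exact congrArg ConjOp.mk.symm (ConjOp.smul_mk z (st a))
  have st_one : st 1 = 1 := congrArg ConjOp.mk.symm (map_one σ)
  have st_r : ∀ b, st (V.r b) = V.r (star b) := fun b => congrArg ConjOp.mk.symm (hr b)
  have st_s : ∀ b, st (V.s b) = V.s (star b) := fun b => congrArg ConjOp.mk.symm (hs b)
  have st_v : ∀ i j, st (X .v i j) = X .u i j := fun i j => by
    rw [← hv]; exact congrArg ConjOp.mk.symm (hX .v i j)
  have st_u : ∀ i j, st (X .u i j) = X .v i j := fun i j => by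
    rw [← hu]; exact congrArg ConjOp.mk.symm (hX .u i j)
  have st_st : ∀ a, st (st a) = a := by
    let N : Subalgebra ℂ A :=
      { carrier := {a | st (st a) = a}
        mul_mem' := fun {a b} ha hb => by
          show st (st (a * b)) = a * b
          rw [st_mul, st_mul, show st (st a) = a from ha, show st (st b) = b from hb]
        add_mem' := fun {a b} ha hb => by
          show st (st (a + b)) = a + b
          rw [st_add, st_add, show st (st a) = a from ha, show st (st b) = b from hb]
        algebraMap_mem' := fun z => by
          show st (st (algebraMap ℂ A z)) = _
          rw [Algebra.algebraMap_eq_smul_one, st_smul, st_one, st_smul, st_one, star_star] }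
    have h1 := h.generates' hP N (fun b => by show st (st _) = _; rw [st_r, st_r, star_star])
      (fun b => by show st (st _) = _; rw [st_s, st_s, star_star])
      (fun i j => by show st (st _) = _; rw [st_v, st_u])
      (fun i j => by show st (st _) = _; rw [st_u, st_v])
    exact fun a => (h1 ▸ Algebra.mem_top : a ∈ N)
  let _ : StarRing A :=
    { star := st
      star_involutive := st_st
      star_mul := st_mul
      star_add := st_add }
  have hmod : StarModule ℂ A := ⟨st_smul⟩
  let r' : B →⋆ₐ[ℂ] A := { V.r with map_star' := fun b => (st_r b).symm }
  let s' : B →⋆ₐ[ℂ] A := { V.s with map_star' := fun b => (st_s b).symm }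
  have hmem : ∀ {γ γ' : Γ} {a : A}, a ∈ V.gr γ γ' → st a ∈ V.gr γ⁻¹ γ'⁻¹ := by
    intro γ γ' a ha
    refine (h.graded_induction hP V.isBGAlg.indep (fun γ γ' =>
      { carrier := {a | a ∈ V.gr γ γ' ∧ st a ∈ V.gr γ⁻¹ γ'⁻¹}
        add_mem' := fun {a b} ha hb => ⟨Submodule.add_mem _ ha.1 hb.1, by
          rw [st_add]; exact Submodule.add_mem _ ha.2 hb.2⟩
        zero_mem' := ⟨Submodule.zero_mem _, by
          rw [← zero_smul ℂ (0 : A), st_smul, star_zero, zero_smul]; exact Submodule.zero_mem _⟩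
        smul_mem' := fun z a ha => ⟨Submodule.smul_mem _ z ha.1, by
          rw [st_smul]; exact Submodule.smul_mem _ _ ha.2⟩ })
      (fun γ γ' a ha => ha.1) (fun {γ γ' δ δ' a b} ha hb => ⟨V.isBGAlg.mul_mem ha.1 hb.1, ?_⟩)
      (fun b => ⟨V.isBGAlg.r_mem b, ?_⟩) (fun b => ⟨V.isBGAlg.s_mem b, ?_⟩)
      (fun i j => ⟨hVX .v i j, ?_⟩) (fun i j => ⟨hVX .u i j, ?_⟩) γ γ' ha).2
    · rw [st_mul, _root_.mul_inv_rev, _root_.mul_inv_rev]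
      exact V.isBGAlg.mul_mem hb.2 ha.2
    · rw [st_r, inv_one]; exact V.isBGAlg.r_mem _
    · rw [st_s, inv_one]; exact V.isBGAlg.s_mem _
    · rw [st_v]
      have h1 := hVX .u i j
      rwa [hd] at h1
    · rw [st_u]
      have h1 := hVX .v i j
      rw [hd, Pi.inv_apply, Pi.inv_apply, inv_inv, inv_inv]
      exact h1
  exact ⟨_, hmod, ⟨⟨V.gr, r', s', V.isBGAlg.r_mem, V.isBGAlg.s_mem⟩, V.isBGAlg, hmem⟩, rfl, rfl,
    hVX, st_v⟩

end Grading

/-! ### Threefold algebraic fiber products -/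

section Associativity

variable {B Γ : Type u} [CommCStarAlgebra B] [Group Γ] {α : Γ →* (B ≃⋆ₐ[ℂ] B)}
  {A C D : Type u} [Ring A] [StarRing A] [Algebra ℂ A] [StarModule ℂ A]
  [Ring C] [StarRing C] [Algebra ℂ C] [StarModule ℂ C]
  [Ring D] [StarRing D] [Algebra ℂ D] [StarModule ℂ D]

/-- `A` is the direct sum of its homogeneous components, expressed by the universal property of
direct sums. -/
structure BGStarData.IsGraded (V : BGStarData B Γ A) : Prop where
  exists_lift : ∀ {E : Type u} [AddCommGroup E] [Module ℂ E]
    (f : ∀ γ γ', V.gr γ γ' →ₗ[ℂ] E), ∃ F : A →ₗ[ℂ] E, ∀ {γ γ'} (a : V.gr γ γ'), F a = f γ γ' a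
  iSup_eq_top : ⨆ p : Γ × Γ, V.gr p.1 p.2 = ⊤

lemma BGStarAlg.isGraded (V : BGStarAlg α A) : V.toBGStarData.IsGraded where
  exists_lift {E _ _} f := by
    classical
    have h : DirectSum.IsInternal fun p : Γ × Γ => V.gr p.1 p.2 :=
      DirectSum.isInternal_submodule_of_iSupIndep_of_iSup_eq_top V.isBGAlg.indep
        V.isBGAlg.iSup_eq_top
    let e := LinearEquiv.ofBijective
      (DirectSum.coeLinearMap fun p : Γ × Γ => V.gr p.1 p.2) h
    refine ⟨(DirectSum.toModule ℂ (Γ × Γ) E fun p => f p.1 p.2).comp e.symm.toLinearMap,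
      fun {γ γ'} a => ?_⟩
    have h1 : e.symm a = DirectSum.lof ℂ (Γ × Γ) (fun p => V.gr p.1 p.2) (γ, γ') a := by
      rw [LinearEquiv.symm_apply_eq]
      exact (DirectSum.coeLinearMap_lof (fun p : Γ × Γ => V.gr p.1 p.2) (γ, γ') a).symm
    show DirectSum.toModule ℂ (Γ × Γ) E (fun p => f p.1 p.2) (e.symm a) = _
    rw [h1, DirectSum.toModule_lof]
  iSup_eq_top := V.isBGAlg.iSup_eq_top

namespace BGStarData.IsGraded

variable {V : BGStarData B Γ A} {W : BGStarData B Γ C}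

lemma linearMap_ext (hV : V.IsGraded) {E : Type*} [AddCommGroup E] [Module ℂ E]
    {f f' : A →ₗ[ℂ] E} (h : ∀ {γ γ' a}, a ∈ V.gr γ γ' → f a = f' a) : f = f' := by
  have h1 : (⨆ p : Γ × Γ, V.gr p.1 p.2) ≤ LinearMap.eqLocus f f' :=
    iSup_le fun p a ha => h ha
  rw [hV.iSup_eq_top] at h1
  exact LinearMap.ext fun a => h1 Submodule.mem_top

/-- The linear extension of `(a, c) ↦ a ⊗̃ c` from matching homogeneous elements to all elements,
where `a ⊗̃ c` is replaced by zero if the degrees do not match. -/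
lemma exists_matched (hV : V.IsGraded) (hW : W.IsGraded) :
    ∃ m : A →ₗ[ℂ] C →ₗ[ℂ] FiberProd V W,
      (∀ {γ γ' γ'' : Γ} {a : A} {c : C} (ha : a ∈ V.gr γ γ') (hc : c ∈ W.gr γ' γ''),
        m a c = FiberProd.tmul ha hc) ∧
      ∀ {γ γ' η η' : Γ} {a : A} {c : C}, a ∈ V.gr γ γ' → c ∈ W.gr η η' → γ' ≠ η → m a c = 0 := by
  classical
  let p : ∀ γ γ' η' : Γ, W.gr γ' η' →ₗ[ℂ] V.gr γ γ' →ₗ[ℂ] FiberProd V W := fun γ γ' η' =>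
    LinearMap.mk₂ ℂ (fun c a => FiberProd.tmul a.2 c.2)
      (fun c c' a => FiberProd.tmul_add_right a.2 c.2 c'.2)
      (fun z c a => FiberProd.tmul_smul_right z a.2 c.2)
      (fun c a a' => FiberProd.tmul_add_left a.2 a'.2 c.2)
      (fun z c a => FiberProd.tmul_smul_left z a.2 c.2)
  choose G hG using fun γ γ' : Γ => hW.exists_lift (E := V.gr γ γ' →ₗ[ℂ] FiberProd V W)
    fun η η' => if h : γ' = η then h ▸ p γ γ' η' else 0
  obtain ⟨m, hm⟩ := hV.exists_lift fun γ γ' => (G γ γ').flip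
  have key : ∀ {γ γ' η η' : Γ} {a : A} {c : C} (ha : a ∈ V.gr γ γ') (hc : c ∈ W.gr η η'),
      m a c = (if h : γ' = η then h ▸ p γ γ' η' else 0 :
        W.gr η η' →ₗ[ℂ] V.gr γ γ' →ₗ[ℂ] FiberProd V W) ⟨c, hc⟩ ⟨a, ha⟩ := by
    intro γ γ' η η' a c ha hc
    have h1 : m a = (G γ γ').flip ⟨a, ha⟩ := hm ⟨a, ha⟩
    have h2 := hG γ γ' (⟨c, hc⟩ : W.gr η η')
    rw [h1, LinearMap.flip_apply]
    exact LinearMap.congr_fun h2 _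
  refine ⟨m, fun {γ γ' γ'' a c} ha hc => ?_, fun {γ γ' η η' a c} ha hc h => ?_⟩
  · rw [key ha hc, dif_pos rfl]
    rfl
  · rw [key ha hc, dif_neg h]
    rfl

end BGStarData.IsGraded

namespace FiberProd

variable {V : BGStarData B Γ A} {W : BGStarData B Γ C} {Z : BGStarData B Γ D}

lemma r_mul_tmul (hV : V.IsCompatible α) (hW : W.IsCompatible α) {γ γ' γ'' : Γ} {a : A} {c : C}
    (ha : a ∈ V.gr γ γ') (hc : c ∈ W.gr γ' γ'') (b : B) (h : V.r b * a ∈ V.gr γ γ') :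
    (data V W).r b * tmul ha hc = tmul h hc :=
  (tmul_mul_tmul hV hW (V.r_mem b) (tensorΓ.one_mem W) ha hc).trans
    (tmul_eq_of_eq _ _ _ _ rfl (one_mul c))

lemma s_mul_tmul (hV : V.IsCompatible α) (hW : W.IsCompatible α) {γ γ' γ'' : Γ} {a : A} {c : C}
    (ha : a ∈ V.gr γ γ') (hc : c ∈ W.gr γ' γ'') (b : B) (h : W.s b * c ∈ W.gr γ' γ'') :
    (data V W).s b * tmul ha hc = tmul ha h :=
  (tmul_mul_tmul hV hW (tensorΓ.one_mem V) (W.s_mem b) ha hc).trans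
    (tmul_eq_of_eq _ _ _ _ (one_mul a) rfl)

lemma r_mul_mem (hV : V.IsCompatible α) {γ γ' : Γ} {a : A} (ha : a ∈ V.gr γ γ') (b : B) :
    V.r b * a ∈ V.gr γ γ' := by simpa only [one_mul] using hV.mul_mem (V.r_mem b) ha

lemma s_mul_mem (hV : V.IsCompatible α) {γ γ' : Γ} {a : A} (ha : a ∈ V.gr γ γ') (b : B) :
    V.s b * a ∈ V.gr γ γ' := by simpa only [one_mul] using hV.mul_mem (V.s_mem b) ha

lemma isGraded (hV : V.IsCompatible α) (hW : W.IsCompatible α) (hV' : V.IsGraded)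
    (hW' : W.IsGraded) : (data V W).IsGraded where
  exists_lift {E _ _} f := by
    classical
    let p : ∀ γ γ' η' : Γ, W.gr γ' η' →ₗ[ℂ] V.gr γ γ' →ₗ[ℂ] E := fun γ γ' η' =>
      LinearMap.mk₂ ℂ (fun c a => f γ η' ⟨tmul a.2 c.2, tmul_mem a.2 c.2⟩)
        (fun c c' a => (congrArg (f γ η') (Subtype.ext (tmul_add_right a.2 c.2 c'.2))).trans
          (map_add (f γ η') ⟨_, tmul_mem a.2 c.2⟩ ⟨_, tmul_mem a.2 c'.2⟩))
        (fun z c a => (congrArg (f γ η') (Subtype.ext (tmul_smul_right z a.2 c.2))).trans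
          (map_smul (f γ η') z ⟨_, tmul_mem a.2 c.2⟩))
        (fun c a a' => (congrArg (f γ η') (Subtype.ext (tmul_add_left a.2 a'.2 c.2))).trans
          (map_add (f γ η') ⟨_, tmul_mem a.2 c.2⟩ ⟨_, tmul_mem a'.2 c.2⟩))
        (fun z c a => (congrArg (f γ η') (Subtype.ext (tmul_smul_left z a.2 c.2))).trans
          (map_smul (f γ η') z ⟨_, tmul_mem a.2 c.2⟩))
    choose G hG using fun γ γ' : Γ => hW'.exists_lift (E := V.gr γ γ' →ₗ[ℂ] E)
      fun η η' => if h : γ' = η then h ▸ p γ γ' η' else 0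
    obtain ⟨m, hm⟩ := hV'.exists_lift fun γ γ' => (G γ γ').flip
    have key : ∀ {γ γ' η' : Γ} {a : A} {c : C} (ha : a ∈ V.gr γ γ') (hc : c ∈ W.gr γ' η'),
        m a c = f γ η' ⟨tmul ha hc, tmul_mem ha hc⟩ := by
      intro γ γ' η' a c ha hc
      have h1 : m a = (G γ γ').flip ⟨a, ha⟩ := hm ⟨a, ha⟩
      have h2 := hG γ γ' (⟨c, hc⟩ : W.gr γ' η')
      rw [dif_pos rfl] at h2
      rw [h1, LinearMap.flip_apply]
      exact LinearMap.congr_fun h2 _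
    obtain ⟨F, hF⟩ := exists_liftLinear hV hW m fun {γ γ' γ'' a c} ha hc b => by
      rw [key (s_mul_mem hV ha b) hc, key ha (r_mul_mem hW hc b)]
      exact congrArg _ (Subtype.ext (tmul_balanced ha hc _ _))
    refine ⟨F, fun {γ γ'} a => ?_⟩
    obtain ⟨a, ha⟩ := a
    show F a = _
    have h1 : ∃ h : a ∈ (data V W).gr γ γ', F a = f γ γ' ⟨a, h⟩ := by
      induction ha using Submodule.span_induction with
      | zero => exact ⟨Submodule.zero_mem _, (map_zero F).trans (map_zero (f γ γ')).symm⟩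
      | add x y _ _ hx hy =>
        obtain ⟨hx, hx'⟩ := hx
        obtain ⟨hy, hy'⟩ := hy
        exact ⟨Submodule.add_mem _ hx hy, (map_add F x y).trans
          ((congrArg₂ (· + ·) hx' hy').trans (map_add (f γ γ') ⟨x, hx⟩ ⟨y, hy⟩).symm)⟩
      | smul z x _ hx =>
        obtain ⟨hx, hx'⟩ := hx
        exact ⟨Submodule.smul_mem _ z hx, (map_smul F z x).trans
          ((congrArg (z • ·) hx').trans (map_smul (f γ γ') z ⟨x, hx⟩).symm)⟩
      | mem x hx =>
        obtain ⟨γ', a, c, ha, hc, rfl⟩ := hx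
        exact ⟨tmul_mem ha hc, (hF ha hc).trans (key ha hc)⟩
    exact h1.choose_spec
  iSup_eq_top := by
    rw [eq_top_iff]
    rintro x -
    induction x using FiberProd.induction hV hW with
    | h0 => exact Submodule.zero_mem _
    | hadd x y hx hy => exact Submodule.add_mem _ hx hy
    | hsmul z x hx => exact Submodule.smul_mem _ z hx
    | @h γ γ' γ'' a c ha hc =>
      exact Submodule.mem_iSup_of_mem (p := fun q : Γ × Γ => (data V W).gr q.1 q.2) (γ, γ'')
        (tmul_mem ha hc)

/-- A threefold fiber product is spanned by elementary tensors. -/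
lemma induction_left (hV : V.IsCompatible α) (hW : W.IsCompatible α) (hZ : Z.IsCompatible α)
    {p : FiberProd (data V W) Z → Prop} (h0 : p 0) (hadd : ∀ x y, p x → p y → p (x + y))
    (hsmul : ∀ (z : ℂ) x, p x → p (z • x))
    (h : ∀ {γ₀ γ₁ γ₂ γ₃ : Γ} {a : A} {c : C} {d : D} (ha : a ∈ V.gr γ₀ γ₁) (hc : c ∈ W.gr γ₁ γ₂)
      (hd : d ∈ Z.gr γ₂ γ₃), p (tmul (tmul_mem ha hc) hd)) (x : FiberProd (data V W) Z) : p x := by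
  induction x using FiberProd.induction (isCompatible hV hW) hZ with
  | h0 => exact h0
  | hadd x y hx hy => exact hadd x y hx hy
  | hsmul z x hx => exact hsmul z x hx
  | @h γ γ' γ'' w d hw hd =>
    suffices h1 : ∀ hw' : w ∈ (data V W).gr γ γ', p (tmul hw' hd) from h1 hw
    induction hw using Submodule.span_induction with
    | zero => intro hw'; rw [tmul_zero_left]; exact h0
    | add x y hx hy ihx ihy =>
      intro hw'
      have hx' : x ∈ (data V W).gr γ γ' := hx
      have hy' : y ∈ (data V W).gr γ γ' := hy
      exact (congrArg p (tmul_add_left hx' hy' hd)).mpr (hadd _ _ (ihx hx') (ihy hy'))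
    | smul z x hx ihx =>
      intro hw'
      have hx' : x ∈ (data V W).gr γ γ' := hx
      exact (congrArg p (tmul_smul_left z hx' hd)).mpr (hsmul _ _ (ihx hx'))
    | mem x hx =>
      intro hw'
      obtain ⟨_, a, c, ha, hc, rfl⟩ := hx
      exact h ha hc hd

lemma induction_right (hV : V.IsCompatible α) (hW : W.IsCompatible α) (hZ : Z.IsCompatible α)
    {p : FiberProd V (data W Z) → Prop} (h0 : p 0) (hadd : ∀ x y, p x → p y → p (x + y))
    (hsmul : ∀ (z : ℂ) x, p x → p (z • x))
    (h : ∀ {γ₀ γ₁ γ₂ γ₃ : Γ} {a : A} {c : C} {d : D} (ha : a ∈ V.gr γ₀ γ₁) (hc : c ∈ W.gr γ₁ γ₂)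
      (hd : d ∈ Z.gr γ₂ γ₃), p (tmul ha (tmul_mem hc hd))) (x : FiberProd V (data W Z)) : p x := by
  induction x using FiberProd.induction hV (isCompatible hW hZ) with
  | h0 => exact h0
  | hadd x y hx hy => exact hadd x y hx hy
  | hsmul z x hx => exact hsmul z x hx
  | @h γ γ' γ'' a w ha hw =>
    suffices h1 : ∀ hw' : w ∈ (data W Z).gr γ' γ'', p (tmul ha hw') from h1 hw
    induction hw using Submodule.span_induction with
    | zero => intro hw'; rw [tmul_zero_right]; exact h0
    | add x y hx hy ihx ihy =>
      intro hw'
      have hx' : x ∈ (data W Z).gr γ' γ'' := hx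
      have hy' : y ∈ (data W Z).gr γ' γ'' := hy
      exact (congrArg p (tmul_add_right ha hx' hy')).mpr (hadd _ _ (ihx hx') (ihy hy'))
    | smul z x hx ihx =>
      intro hw'
      have hx' : x ∈ (data W Z).gr γ' γ'' := hx
      exact (congrArg p (tmul_smul_right z ha hx')).mpr (hsmul _ _ (ihx hx'))
    | mem x hx =>
      intro hw'
      obtain ⟨_, c, d, hc, hd, rfl⟩ := hx
      exact h ha hc hd

lemma exists_assocLinear (hV : V.IsCompatible α) (hW : W.IsCompatible α) (hZ : Z.IsCompatible α)
    (hV' : V.IsGraded) (hW' : W.IsGraded) (hZ' : Z.IsGraded) :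
    ∃ φ : FiberProd (data V W) Z →ₗ[ℂ] FiberProd V (data W Z),
      ∀ {γ₀ γ₁ γ₂ γ₃ : Γ} {a : A} {c : C} {d : D} (ha : a ∈ V.gr γ₀ γ₁) (hc : c ∈ W.gr γ₁ γ₂)
        (hd : d ∈ Z.gr γ₂ γ₃), φ (tmul (tmul_mem ha hc) hd) = tmul ha (tmul_mem hc hd) := by
  classical
  obtain ⟨m, hm, hm0⟩ := hW'.exists_matched hZ'
  obtain ⟨m', hm', -⟩ := hV'.exists_matched (isGraded hW hZ hW' hZ')
  obtain ⟨L, hL⟩ := exists_liftLinear hV hW (E := D →ₗ[ℂ] FiberProd V (data W Z))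
    (LinearMap.mk₂ ℂ (fun a c => (m' a).comp (m c))
      (fun a a' c => by rw [map_add, LinearMap.add_comp])
      (fun z a c => by rw [map_smul, LinearMap.smul_comp])
      (fun a c c' => by rw [map_add, LinearMap.comp_add])
      (fun z a c => by rw [map_smul, LinearMap.comp_smul]))
    fun {γ γ' γ'' a c} ha hc b => hZ'.linearMap_ext fun {η η' d} hd => by
      show m' (V.s b * a) (m c d) = m' a (m (W.r b * c) d)
      by_cases h : γ'' = η
      · subst h
        rw [hm hc hd, hm (r_mul_mem hW hc b) hd, hm' (s_mul_mem hV ha b) (tmul_mem hc hd),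
          hm' ha (tmul_mem _ hd)]
        refine (tmul_balanced ha (tmul_mem hc hd) _
          (r_mul_mem (isCompatible hW hZ) (tmul_mem hc hd) b)).trans ?_
        exact tmul_eq_of_eq _ _ _ _ rfl (r_mul_tmul hW hZ hc hd b _)
      · rw [hm0 hc hd h, hm0 (r_mul_mem hW hc b) hd h, map_zero, map_zero]
  have hL' : ∀ {γ₀ γ₁ γ₂ γ₃ : Γ} {a : A} {c : C} {d : D} (ha : a ∈ V.gr γ₀ γ₁)
      (hc : c ∈ W.gr γ₁ γ₂) (hd : d ∈ Z.gr γ₂ γ₃),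
      L (tmul ha hc) d = tmul ha (tmul_mem hc hd) := fun {γ₀ γ₁ γ₂ γ₃ a c d} ha hc hd => by
    rw [hL ha hc]
    show m' a (m c d) = _
    rw [hm hc hd, hm' ha (tmul_mem hc hd)]
  obtain ⟨φ, hφ⟩ := exists_liftLinear (isCompatible hV hW) hZ L
    fun {γ γ' γ'' w d} hw hd b => by
      induction hw using Submodule.span_induction with
      | zero => rw [mul_zero, map_zero, LinearMap.zero_apply, LinearMap.zero_apply]
      | add x y _ _ hx hy =>
        rw [mul_add, map_add, map_add, LinearMap.add_apply, LinearMap.add_apply, hx, hy]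
      | smul z x _ hx =>
        rw [mul_smul_comm, map_smul, map_smul, LinearMap.smul_apply, LinearMap.smul_apply, hx]
      | mem x hx =>
        obtain ⟨_, a, c, ha, hc, rfl⟩ := hx
        rw [s_mul_tmul hV hW ha hc b (s_mul_mem hW hc b), hL' ha (s_mul_mem hW hc b) hd,
          hL' ha hc (r_mul_mem hZ hd b)]
        exact tmul_eq_of_eq _ _ _ _ rfl (tmul_balanced hc hd _ _)
  exact ⟨φ, fun {γ₀ γ₁ γ₂ γ₃ a c d} ha hc hd => (hφ _ _).trans (hL' ha hc hd)⟩

lemma exists_assocLinear_symm (hV : V.IsCompatible α) (hW : W.IsCompatible α)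
    (hZ : Z.IsCompatible α) (hV' : V.IsGraded) (hW' : W.IsGraded) (hZ' : Z.IsGraded) :
    ∃ φ : FiberProd V (data W Z) →ₗ[ℂ] FiberProd (data V W) Z,
      ∀ {γ₀ γ₁ γ₂ γ₃ : Γ} {a : A} {c : C} {d : D} (ha : a ∈ V.gr γ₀ γ₁) (hc : c ∈ W.gr γ₁ γ₂)
        (hd : d ∈ Z.gr γ₂ γ₃), φ (tmul ha (tmul_mem hc hd)) = tmul (tmul_mem ha hc) hd := by
  classical
  obtain ⟨m, hm, hm0⟩ := hV'.exists_matched hW'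
  obtain ⟨m', hm', -⟩ := (isGraded hV hW hV' hW').exists_matched hZ'
  obtain ⟨L, hL⟩ := exists_liftLinear hW hZ (E := A →ₗ[ℂ] FiberProd (data V W) Z)
    (LinearMap.mk₂ ℂ (fun c d => (m'.flip d).comp (m.flip c))
      (fun a a' c => by rw [map_add, LinearMap.comp_add])
      (fun z a c => by rw [map_smul, LinearMap.comp_smul])
      (fun a c c' => by rw [map_add, LinearMap.add_comp])
      (fun z a c => by rw [map_smul, LinearMap.smul_comp]))
    fun {γ γ' γ'' c d} hc hd b => hV'.linearMap_ext fun {η η' a} ha => by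
      show m' (m a (W.s b * c)) d = m' (m a c) (Z.r b * d)
      by_cases h : η' = γ
      · subst h
        rw [hm ha hc, hm ha (s_mul_mem hW hc b), hm' (tmul_mem ha _) hd,
          hm' (tmul_mem ha hc) (r_mul_mem hZ hd b)]
        refine Eq.trans ?_ (tmul_balanced (tmul_mem ha hc) hd
          (s_mul_mem (isCompatible hV hW) (tmul_mem ha hc) b) _)
        exact tmul_eq_of_eq _ _ _ _ (s_mul_tmul hV hW ha hc b _).symm rfl
      · rw [hm0 ha hc h, hm0 ha (s_mul_mem hW hc b) h, map_zero, LinearMap.zero_apply,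
          LinearMap.zero_apply]
  have hL' : ∀ {γ₀ γ₁ γ₂ γ₃ : Γ} {a : A} {c : C} {d : D} (ha : a ∈ V.gr γ₀ γ₁)
      (hc : c ∈ W.gr γ₁ γ₂) (hd : d ∈ Z.gr γ₂ γ₃),
      L (tmul hc hd) a = tmul (tmul_mem ha hc) hd := fun {γ₀ γ₁ γ₂ γ₃ a c d} ha hc hd => by
    rw [hL hc hd]
    show m' (m a c) d = _
    rw [hm ha hc, hm' (tmul_mem ha hc) hd]
  obtain ⟨φ, hφ⟩ := exists_liftLinear hV (isCompatible hW hZ) L.flip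
    fun {γ γ' γ'' a w} ha hw b => by
      rw [LinearMap.flip_apply, LinearMap.flip_apply]
      induction hw using Submodule.span_induction with
      | zero => rw [mul_zero, map_zero, LinearMap.zero_apply, LinearMap.zero_apply]
      | add x y _ _ hx hy =>
        rw [mul_add, map_add, map_add, LinearMap.add_apply, LinearMap.add_apply, hx, hy]
      | smul z x _ hx =>
        rw [mul_smul_comm, map_smul, map_smul, LinearMap.smul_apply, LinearMap.smul_apply, hx]
      | mem x hx =>
        obtain ⟨_, c, d, hc, hd, rfl⟩ := hx
        rw [r_mul_tmul hW hZ hc hd b (r_mul_mem hW hc b), hL' ha (r_mul_mem hW hc b) hd,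
          hL' (s_mul_mem hV ha b) hc hd]
        exact tmul_eq_of_eq _ _ _ _ (tmul_balanced ha hc _ _) rfl
  exact ⟨φ, fun {γ₀ γ₁ γ₂ γ₃ a c d} ha hc hd => (hφ _ _).trans (hL' ha hc hd)⟩

/-- The canonical isomorphism of the two threefold fiber products. -/
theorem exists_assoc (hV : V.IsCompatible α) (hW : W.IsCompatible α) (hZ : Z.IsCompatible α)
    (hV' : V.IsGraded) (hW' : W.IsGraded) (hZ' : Z.IsGraded) :
    ∃ φ : FiberProd (data V W) Z ≃⋆ₐ[ℂ] FiberProd V (data W Z),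
      ∀ {γ₀ γ₁ γ₂ γ₃ : Γ} {a : A} {c : C} {d : D} (ha : a ∈ V.gr γ₀ γ₁) (hc : c ∈ W.gr γ₁ γ₂)
        (hd : d ∈ Z.gr γ₂ γ₃), φ (tmul (tmul_mem ha hc) hd) = tmul ha (tmul_mem hc hd) := by
  obtain ⟨φ, hφ⟩ := exists_assocLinear hV hW hZ hV' hW' hZ'
  obtain ⟨ψ, hψ⟩ := exists_assocLinear_symm hV hW hZ hV' hW' hZ'
  have hVW := isCompatible hV hW
  have hWZ := isCompatible hW hZ
  have h1 : ∀ x, ψ (φ x) = x := induction_left hV hW hZ (by rw [map_zero, map_zero])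
    (fun x y hx hy => by rw [map_add, map_add, hx, hy])
    (fun z x hx => by rw [map_smul, map_smul, hx])
    (fun ha hc hd => (congrArg ψ (hφ ha hc hd)).trans (hψ ha hc hd))
  have h2 : ∀ x, φ (ψ x) = x := induction_right hV hW hZ (by rw [map_zero, map_zero])
    (fun x y hx hy => by rw [map_add, map_add, hx, hy])
    (fun z x hx => by rw [map_smul, map_smul, hx])
    (fun ha hc hd => (congrArg φ (hψ ha hc hd)).trans (hφ ha hc hd))
  have hmul : ∀ x y, φ (x * y) = φ x * φ y := by
    intro x y
    refine induction_left hV hW hZ (p := fun x => φ (x * y) = φ x * φ y)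
      (by rw [zero_mul, map_zero, zero_mul])
      (fun x x' hx hx' => by rw [add_mul, map_add, hx, hx', map_add, add_mul])
      (fun z x hx => by rw [smul_mul_assoc, map_smul, hx, map_smul, smul_mul_assoc])
      (fun {γ₀ γ₁ γ₂ γ₃ a c d} ha hc hd => ?_) x
    refine induction_left hV hW hZ
      (p := fun y => φ (tmul (tmul_mem ha hc) hd * y) = φ (tmul (tmul_mem ha hc) hd) * φ y)
      (by rw [mul_zero, map_zero, mul_zero])
      (fun x x' hx hx' => by rw [mul_add, map_add, hx, hx', map_add, mul_add])
      (fun z x hx => by rw [mul_smul_comm, map_smul, hx, map_smul, mul_smul_comm])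
      (fun {γ₀ γ₁ γ₂ γ₃ a' c' d'} ha' hc' hd' => ?_) y
    have e1 := tmul_mul_tmul hVW hZ (tmul_mem ha hc) hd (tmul_mem ha' hc') hd'
    have e2 := tmul_mul_tmul hV hWZ ha (tmul_mem hc hd) ha' (tmul_mem hc' hd')
    have e3 := tmul_eq_of_eq (hVW.mul_mem (tmul_mem ha hc) (tmul_mem ha' hc')) (hZ.mul_mem hd hd')
      (tmul_mem (hV.mul_mem ha ha') (hW.mul_mem hc hc')) (hZ.mul_mem hd hd')
      (tmul_mul_tmul hV hW ha hc ha' hc') rfl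
    have e4 := tmul_eq_of_eq (hV.mul_mem ha ha') (hWZ.mul_mem (tmul_mem hc hd) (tmul_mem hc' hd'))
      (hV.mul_mem ha ha') (tmul_mem (hW.mul_mem hc hc') (hZ.mul_mem hd hd')) rfl
      (tmul_mul_tmul hW hZ hc hd hc' hd')
    exact ((congrArg φ (e1.trans e3)).trans (hφ _ _ _)).trans ((congrArg₂ (· * ·) (hφ ha hc hd)
      (hφ ha' hc' hd')).trans (e2.trans e4)).symm
  have hstar : ∀ x, φ (star x) = star (φ x) := by
    intro x
    refine induction_left hV hW hZ (p := fun x => φ (star x) = star (φ x))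
      (by rw [star_zero, map_zero, star_zero])
      (fun x x' hx hx' => by rw [star_add, map_add, hx, hx', map_add, star_add])
      (fun z x hx => by rw [star_smul, map_smul, hx, map_smul, star_smul])
      (fun {γ₀ γ₁ γ₂ γ₃ a c d} ha hc hd => ?_) x
    have e1 := star_tmul hVW hZ (tmul_mem ha hc) hd
    have e2 := star_tmul hV hWZ ha (tmul_mem hc hd)
    have e3 := tmul_eq_of_eq (hVW.star_mem (tmul_mem ha hc)) (hZ.star_mem hd)
      (tmul_mem (hV.star_mem ha) (hW.star_mem hc)) (hZ.star_mem hd) (star_tmul hV hW ha hc) rfl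
    have e4 := tmul_eq_of_eq (hV.star_mem ha) (hWZ.star_mem (tmul_mem hc hd))
      (hV.star_mem ha) (tmul_mem (hW.star_mem hc) (hZ.star_mem hd)) rfl (star_tmul hW hZ hc hd)
    exact ((congrArg φ (e1.trans e3)).trans (hφ _ _ _)).trans ((congrArg star (hφ ha hc hd)).trans
      (e2.trans e4)).symm
  exact ⟨{
    toFun := φ
    invFun := ψ
    left_inv := h1
    right_inv := h2
    map_mul' := hmul
    map_add' := map_add φ
    map_star' := hstar
    map_smul' := map_smul φ }, hφ⟩

end FiberProd

end Associativity

/-! ### Systems of matrices in fiber products and crossed products -/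

section FiberSystems

open Matrix

variable {B Γ : Type u} [CommCStarAlgebra B] [Group Γ] {α : Γ →* (B ≃⋆ₐ[ℂ] B)} {n : ℕ}

section

variable {A : Type u} [Ring A] [StarRing A] [Algebra ℂ A] [StarModule ℂ A]
  {V : BGStarData B Γ A} {P : MatrixPresentation B Γ n}
  {X : Idx.{u} → Matrix (Fin n) (Fin n) A}

namespace tensorΓ

/-- The matrix with entries `∑ X_{ik} ⊗ X_{kj}`. -/
def matMul {d : Fin n → Γ} {M : Matrix (Fin n) (Fin n) A}
    (hM : ∀ i j, M i j ∈ V.gr (d i) (d j)) : Matrix (Fin n) (Fin n) (tensorΓ V V) :=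
  of fun i j => ∑ k, tmul (hM i k) (hM k j)

lemma coe_matMul {d : Fin n → Γ} {M : Matrix (Fin n) (Fin n) A}
    (hM : ∀ i j, M i j ∈ V.gr (d i) (d j)) (i j : Fin n) :
    (matMul hM i j : A ⊗[ℂ] A) = ∑ k, M i k ⊗ₜ[ℂ] M k j :=
  map_sum (tensorΓ V V).subtype (fun k => tmul (hM i k) (hM k j)) Finset.univ

lemma matMul_mul_transpose {d d' : Fin n → Γ} {M N : Matrix (Fin n) (Fin n) A}
    (hM : ∀ i j, M i j ∈ V.gr (d i) (d j)) (hN : ∀ i j, N i j ∈ V.gr (d' i) (d' j))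
    (h : M * Nᵀ = 1) : matMul hM * (matMul hN)ᵀ = 1 := by
  have h' : ∀ i j, ∑ k, M i k * N j k = (1 : Matrix (Fin n) (Fin n) A) i j := fun i j => by
    rw [← h, mul_apply]; rfl
  ext i j
  rw [mul_apply]
  refine (map_sum (tensorΓ V V).subtype _ _).trans ?_
  have h1 : ∀ k, (tensorΓ V V).subtype (matMul hM i k * (matMul hN)ᵀ k j) =
      ∑ a, ∑ b, (M i a * N j b) ⊗ₜ[ℂ] (M a k * N b k) := fun k => by
    refine (map_mul (tensorΓ V V).subtype _ _).trans ?_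
    refine (congrArg₂ (· * ·) (coe_matMul hM i k) (coe_matMul hN j k)).trans ?_
    rw [Finset.sum_mul_sum]
    exact Finset.sum_congr rfl fun a _ => Finset.sum_congr rfl fun b _ =>
      Algebra.TensorProduct.tmul_mul_tmul _ _ _ _
  rw [Finset.sum_congr rfl fun k _ => h1 k, Finset.sum_comm]
  have h2 : ∀ a, ∑ k, ∑ b, (M i a * N j b) ⊗ₜ[ℂ] (M a k * N b k) =
      (M i a * N j a) ⊗ₜ[ℂ] (1 : A) := fun a => by
    rw [Finset.sum_comm]
    simp only [← TensorProduct.tmul_sum, h', one_apply, TensorProduct.tmul_ite]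
    rw [Finset.sum_ite_eq, if_pos (Finset.mem_univ a)]
  rw [Finset.sum_congr rfl fun a _ => h2 a, ← TensorProduct.sum_tmul, h']
  by_cases hij : i = j
  · rw [hij, one_apply_eq, one_apply_eq]; rfl
  · rw [one_apply_ne hij, one_apply_ne hij, TensorProduct.zero_tmul]; rfl

lemma transpose_matMul_mul {d d' : Fin n → Γ} {M N : Matrix (Fin n) (Fin n) A}
    (hM : ∀ i j, M i j ∈ V.gr (d i) (d j)) (hN : ∀ i j, N i j ∈ V.gr (d' i) (d' j))
    (h : Nᵀ * M = 1) : (matMul hN)ᵀ * matMul hM = 1 := by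
  have h' : ∀ i j, ∑ k, N k i * M k j = (1 : Matrix (Fin n) (Fin n) A) i j := fun i j => by
    rw [← h, mul_apply]; rfl
  ext i j
  rw [mul_apply]
  refine (map_sum (tensorΓ V V).subtype _ _).trans ?_
  have h1 : ∀ k, (tensorΓ V V).subtype ((matMul hN)ᵀ i k * matMul hM k j) =
      ∑ a, ∑ b, (N k a * M k b) ⊗ₜ[ℂ] (N a i * M b j) := fun k => by
    refine (map_mul (tensorΓ V V).subtype _ _).trans ?_
    refine (congrArg₂ (· * ·) (coe_matMul hN k i) (coe_matMul hM k j)).trans ?_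
    rw [Finset.sum_mul_sum]
    exact Finset.sum_congr rfl fun a _ => Finset.sum_congr rfl fun b _ =>
      Algebra.TensorProduct.tmul_mul_tmul _ _ _ _
  rw [Finset.sum_congr rfl fun k _ => h1 k, Finset.sum_comm]
  have h2 : ∀ a, ∑ k, ∑ b, (N k a * M k b) ⊗ₜ[ℂ] (N a i * M b j) =
      (1 : A) ⊗ₜ[ℂ] (N a i * M a j) := fun a => by
    rw [Finset.sum_comm]
    simp only [← TensorProduct.sum_tmul, h', one_apply, TensorProduct.ite_tmul]
    rw [Finset.sum_ite_eq, if_pos (Finset.mem_univ a)]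
  rw [Finset.sum_congr rfl fun a _ => h2 a, ← TensorProduct.tmul_sum, h']
  by_cases hij : i = j
  · rw [hij, one_apply_eq, one_apply_eq]; rfl
  · rw [one_apply_ne hij, one_apply_ne hij, TensorProduct.tmul_zero]; rfl

end tensorΓ

namespace FiberProd

/-- The relation `x s(t) ⊗̃ y = x ⊗̃ r(γ'(t)) y`, where `t = 0` if the degrees do not match. -/
lemma exists_proj_eq (hV : V.IsCompatible α) {γ γ' η η' : Γ} {x y : A} (hx : x ∈ V.gr γ γ')
    (hy : y ∈ V.gr η η') {t : B} (ht : γ' ≠ η → t = 0) :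
    ∃ w w' : tensorΓ V V, (w : A ⊗[ℂ] A) = (x * V.s t) ⊗ₜ y ∧
      (w' : A ⊗[ℂ] A) = x ⊗ₜ (V.r (α γ' t) * y) ∧ proj V V w = proj V V w' := by
  by_cases h : γ' = η
  · subst h
    have h1 := s_mul_mem hV hx (α γ' t)
    have h2 := r_mul_mem hV hy (α γ' t)
    refine ⟨tensorΓ.tmul h1 hy, tensorΓ.tmul hx h2, ?_, rfl, tmul_balanced hx hy h1 h2⟩
    rw [hV.mul_s t hx]
    rfl
  · refine ⟨0, 0, ?_, ?_, rfl⟩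
    · rw [ht h, map_zero, mul_zero, TensorProduct.zero_tmul]; rfl
    · rw [ht h, map_zero, map_zero, zero_mul, TensorProduct.tmul_zero]; rfl

lemma matMul_intw (hV : V.IsCompatible α) {d d' : Fin n → Γ} {M M' : Matrix (Fin n) (Fin n) A}
    (hM : ∀ i j, M i j ∈ V.gr (d i) (d j)) (hM' : ∀ i j, M' i j ∈ V.gr (d' i) (d' j))
    {T : Matrix (Fin n) (Fin n) B} (hT : IsSupported d' d T)
    (h : (twist α d' T).map V.r * M = M' * T.map V.s) :
    (twist α d' T).map (data V V).r * (tensorΓ.matMul hM).map (proj V V) =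
      (tensorΓ.matMul hM').map (proj V V) * T.map (data V V).s := by
  have h' : ∀ i j, ∑ k, V.r (twist α d' T i k) * M k j = ∑ k, M' i k * V.s (T k j) := fun i j => by
    have h1 := congrFun (congrFun h i) j
    rwa [mul_apply, mul_apply] at h1
  choose w w' hw hw' hww using fun i k a j : Fin n =>
    exists_proj_eq hV (hM' i k) (hM a j) (t := T k a) (hT k a)
  ext i j
  rw [mul_apply, mul_apply]
  have e1 : ∑ k, (tensorΓ.inlHom V.r V.r_mem (twist α d' T i k) : tensorΓ V V) *
      tensorΓ.matMul hM k j = ∑ a, ∑ k, w i k a j := by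
    refine Subtype.ext ?_
    refine (map_sum (tensorΓ V V).subtype _ _).trans (Eq.trans ?_
      (map_sum (tensorΓ V V).subtype _ _).symm)
    have f1 : ∀ k, (tensorΓ V V).subtype
        ((tensorΓ.inlHom V.r V.r_mem (twist α d' T i k) : tensorΓ V V) * tensorΓ.matMul hM k j) =
        ∑ a, (V.r (twist α d' T i k) * M k a) ⊗ₜ[ℂ] M a j := fun k => by
      refine (map_mul (tensorΓ V V).subtype _ _).trans ?_
      refine (congrArg₂ (· * ·) (rfl : _ = V.r (twist α d' T i k) ⊗ₜ[ℂ] (1 : A))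
        (tensorΓ.coe_matMul hM k j)).trans ?_
      rw [Finset.mul_sum]
      refine Finset.sum_congr rfl fun a _ => ?_
      rw [Algebra.TensorProduct.tmul_mul_tmul, one_mul]
    rw [Finset.sum_congr rfl fun k _ => f1 k, Finset.sum_comm]
    refine Finset.sum_congr rfl fun a _ => ?_
    rw [← TensorProduct.sum_tmul, h', TensorProduct.sum_tmul]
    refine Eq.trans ?_ (map_sum (tensorΓ V V).subtype _ _).symm
    exact Finset.sum_congr rfl fun k _ => (hw i k a j).symm
  have e2 : ∑ a, tensorΓ.matMul hM' i a * (tensorΓ.inrHom V.s V.s_mem (T a j) : tensorΓ V V) =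
      ∑ a, ∑ k, w' i k a j := by
    refine Subtype.ext ?_
    refine (map_sum (tensorΓ V V).subtype _ _).trans (Eq.trans ?_
      (map_sum (tensorΓ V V).subtype _ _).symm)
    have f1 : ∀ a, (tensorΓ V V).subtype
        (tensorΓ.matMul hM' i a * (tensorΓ.inrHom V.s V.s_mem (T a j) : tensorΓ V V)) =
        ∑ k, M' i k ⊗ₜ[ℂ] (M' k a * V.s (T a j)) := fun a => by
      refine (map_mul (tensorΓ V V).subtype _ _).trans ?_
      refine (congrArg₂ (· * ·) (tensorΓ.coe_matMul hM' i a)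
        (rfl : _ = (1 : A) ⊗ₜ[ℂ] V.s (T a j))).trans ?_
      rw [Finset.sum_mul]
      refine Finset.sum_congr rfl fun k _ => ?_
      rw [Algebra.TensorProduct.tmul_mul_tmul, mul_one]
    rw [Finset.sum_congr rfl fun a _ => f1 a, Finset.sum_comm]
    have f2 : ∀ k, ∑ a, M' i k ⊗ₜ[ℂ] (M' k a * V.s (T a j)) =
        ∑ a, M' i k ⊗ₜ[ℂ] (V.r (twist α d' T k a) * M a j) := fun k => by
      rw [← TensorProduct.tmul_sum, ← h', TensorProduct.tmul_sum]
    rw [Finset.sum_congr rfl fun k _ => f2 k, Finset.sum_comm]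
    refine Finset.sum_congr rfl fun a _ => ?_
    refine Eq.trans ?_ (map_sum (tensorΓ V V).subtype _ _).symm
    exact Finset.sum_congr rfl fun k _ => (hw' i k a j).symm
  have e3 := congrArg (proj V V) e1
  have e4 := congrArg (proj V V) e2
  rw [map_sum, map_sum] at e3 e4
  refine Eq.trans ?_ (e3.trans (Eq.trans ?_ (e4.symm.trans ?_)))
  · exact Finset.sum_congr rfl fun k _ => (map_mul (proj V V) _ _).symm
  · refine Finset.sum_congr rfl fun a _ => ?_
    rw [map_sum, map_sum]
    exact Finset.sum_congr rfl fun k _ => hww i k a j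
  · exact Finset.sum_congr rfl fun k _ => map_mul (proj V V) _ _

/-- A system of matrices of homogeneous elements of `A` gives a system in the fiber product. -/
lemma isSystem (hV : V.IsCompatible α) (hP : P.IsRegular)
    (hX : ∀ o i j, X o i j ∈ V.gr (P.d o i) (P.d o j))
    (h : IsSystem α P (V.r : B →ₐ[ℂ] A) (V.s : B →ₐ[ℂ] A) X) :
    IsSystem α P ((data V V).r : B →ₐ[ℂ] FiberProd V V) ((data V V).s : B →ₐ[ℂ] FiberProd V V)
      fun o => (tensorΓ.matMul (hX o)).map (proj V V) where
  commute b c := by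
    have h1 := tmul_mul_tmul hV hV (V.r_mem b) (tensorΓ.one_mem V) (tensorΓ.one_mem V) (V.s_mem c)
    have h2 := tmul_mul_tmul hV hV (tensorΓ.one_mem V) (V.s_mem c) (V.r_mem b) (tensorΓ.one_mem V)
    exact h1.trans ((tmul_eq_of_eq _ _ _ _ (by rw [mul_one, one_mul])
      (by rw [mul_one, one_mul])).trans h2.symm)
  typed o i j := by
    have h1 : ((tensorΓ.matMul (hX o)).map (proj V V)) i j ∈
        (data V V).gr (P.d o i) (P.d o j) := by
      refine (congrArg (· ∈ (data V V).gr (P.d o i) (P.d o j))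
        (map_sum (proj V V) (fun k => tensorΓ.tmul (hX o i k) (hX o k j)) Finset.univ)).mpr ?_
      exact Submodule.sum_mem _ fun k _ => tmul_mem (hX o i k) (hX o k j)
    exact ⟨fun b => (isCompatible hV hV).mul_r b h1, fun b => (isCompatible hV hV).mul_s b h1⟩
  pair_mul hp := by
    have h1 := tensorΓ.matMul_mul_transpose (hX _) (hX _) (h.pair_mul hp)
    have h2 := congrArg (fun M : Matrix (Fin n) (Fin n) (tensorΓ V V) =>
      M.map (proj V V : tensorΓ V V →ₐ[ℂ] FiberProd V V)) h1
    rw [map_algHom_mul, map_algHom_one] at h2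
    exact h2
  mul_pair hp := by
    have h1 := tensorΓ.transpose_matMul_mul (hX _) (hX _) (h.mul_pair hp)
    have h2 := congrArg (fun M : Matrix (Fin n) (Fin n) (tensorΓ V V) =>
      M.map (proj V V : tensorΓ V V →ₐ[ℂ] FiberProd V V)) h1
    rw [map_algHom_mul, map_algHom_one] at h2
    exact h2
  intw hT := matMul_intw hV (hX _) (hX _) (hP.supp hT) (h.intw hT)

end FiberProd

end

/-- The diagonal matrices of degrees form a system in the crossed product. -/
lemma crossedData_isSystem {P : MatrixPresentation B Γ n} (hP : P.IsRegular) :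
    IsSystem α P ((crossedData α).r : B →ₐ[ℂ] CrossedProduct α)
      ((crossedData α).s : B →ₐ[ℂ] CrossedProduct α)
      fun o => diagonal fun i => CrossedProduct.single (P.d o i) 1 where
  commute b c := (crossedAlg α).isBGAlg.commute b c
  typed o i j := by
    have h1 : (diagonal fun i => CrossedProduct.single (P.d o i) 1 : Matrix (Fin n) (Fin n)
        (CrossedProduct α)) i j ∈ (crossedData α).gr (P.d o i) (P.d o j) := by
      by_cases hij : i = j
      · rw [hij, diagonal_apply_eq]; exact single_mem_crossedData α _ _
      · rw [diagonal_apply_ne _ hij]; exact Submodule.zero_mem _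
    exact ⟨fun b => crossedData_isCompatible.mul_r b h1,
      fun b => crossedData_isCompatible.mul_s b h1⟩
  pair_mul hp := by
    rw [diagonal_transpose, hP.pair_d hp]
    refine (diagonal_mul_diagonal _ _).trans (Eq.trans (congrArg diagonal (funext fun i => ?_))
      diagonal_one)
    rw [CrossedProduct.single_mul_single, Pi.inv_apply, mul_inv_cancel, map_one, mul_one]
    rfl
  mul_pair hp := by
    rw [diagonal_transpose, hP.pair_d hp]
    refine (diagonal_mul_diagonal _ _).trans (Eq.trans (congrArg diagonal (funext fun i => ?_))
      diagonal_one)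
    rw [CrossedProduct.single_mul_single, Pi.inv_apply, inv_mul_cancel, map_one, mul_one]
    rfl
  intw {o o' T} hT := by
    have hs := hP.supp hT
    ext1 i j
    refine (mul_diagonal _ _ i j).trans (Eq.trans ?_ (diagonal_mul _ _ i j).symm)
    show CrossedProduct.single 1 (twist α (P.d o') T i j) * CrossedProduct.single (P.d o j) 1 =
      CrossedProduct.single (P.d o' i) 1 * CrossedProduct.single 1 (T i j)
    rw [CrossedProduct.single_mul_single, CrossedProduct.single_mul_single, one_mul, mul_one,
      map_one, mul_one, one_mul, twist_apply]
    by_cases h : P.d o' i = P.d o j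
    · rw [h]
    · rw [hs i j h, map_zero, CrossedProduct.single_zero, CrossedProduct.single_zero]

end FiberSystems

/-! ### The Hopf structure of a universal algebra -/

section PresentedHopf

open Matrix

variable {B Γ : Type u} [CommCStarAlgebra B] [Group Γ] {α : Γ →* (B ≃⋆ₐ[ℂ] B)} {n : ℕ}
  {A C D : Type u} [Ring A] [StarRing A] [Algebra ℂ A] [StarModule ℂ A]
  [Ring C] [StarRing C] [Algebra ℂ C] [StarModule ℂ C]
  [Ring D] [StarRing D] [Algebra ℂ D] [StarModule ℂ D]

namespace FiberProd

section

variable {V : BGStarData B Γ A} {W : BGStarData B Γ C} {V' : BGStarData B Γ D}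

lemma one_eq_tmul : (1 : FiberProd V W) = tmul (tensorΓ.one_mem V) (tensorΓ.one_mem W) :=
  congrArg (proj V W) (Subtype.ext Algebra.TensorProduct.one_def)

lemma tmul_sum_left {ι : Type*} (t : Finset ι) {γ γ' γ'' : Γ} {a : ι → A} {c : C}
    (ha : ∀ k, a k ∈ V.gr γ γ') (hc : c ∈ W.gr γ' γ'') {x : A} (hx : x ∈ V.gr γ γ')
    (h : x = ∑ k ∈ t, a k) : tmul hx hc = ∑ k ∈ t, tmul (ha k) hc := by
  refine (congrArg (proj V W) (?_ : _ = ∑ k ∈ t, tensorΓ.tmul (ha k) hc)).trans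
    (map_sum (proj V W) _ _)
  refine Subtype.ext (Eq.trans ?_ (map_sum (tensorΓ V W).subtype _ _).symm)
  refine (congrArg (· ⊗ₜ[ℂ] c) h).trans ?_
  exact TensorProduct.sum_tmul _ _ _

lemma tmul_sum_right {ι : Type*} (t : Finset ι) {γ γ' γ'' : Γ} {a : A} {c : ι → C}
    (ha : a ∈ V.gr γ γ') (hc : ∀ k, c k ∈ W.gr γ' γ'') {x : C} (hx : x ∈ W.gr γ' γ'')
    (h : x = ∑ k ∈ t, c k) : tmul ha hx = ∑ k ∈ t, tmul ha (hc k) := by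
  refine (congrArg (proj V W) (?_ : _ = ∑ k ∈ t, tensorΓ.tmul ha (hc k))).trans
    (map_sum (proj V W) _ _)
  refine Subtype.ext (Eq.trans ?_ (map_sum (tensorΓ V W).subtype _ _).symm)
  refine (congrArg (a ⊗ₜ[ℂ] ·) h).trans ?_
  exact TensorProduct.tmul_sum _ _ _

end

variable {A' C' : Type u} [Ring A'] [StarRing A'] [Algebra ℂ A'] [StarModule ℂ A']
  [Ring C'] [StarRing C'] [Algebra ℂ C'] [StarModule ℂ C']
  {V : BGStarData B Γ A} {W : BGStarData B Γ C} {V' : BGStarData B Γ A'} {W' : BGStarData B Γ C'}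

lemma map_r {f : A →⋆ₐ[ℂ] A'} {g : C →⋆ₐ[ℂ] C'} (hf : IsBGStarHom V V' f)
    (hg : IsBGStarHom W W' g) (b : B) : map hf hg ((data V W).r b) = (data V' W').r b :=
  (map_tmul hf hg (V.r_mem b) (tensorΓ.one_mem W)).trans
    (tmul_eq_of_eq _ _ (V'.r_mem b) (tensorΓ.one_mem W') (hf.map_r b) (map_one g))

lemma map_s {f : A →⋆ₐ[ℂ] A'} {g : C →⋆ₐ[ℂ] C'} (hf : IsBGStarHom V V' f)
    (hg : IsBGStarHom W W' g) (b : B) : map hf hg ((data V W).s b) = (data V' W').s b :=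
  (map_tmul hf hg (tensorΓ.one_mem V) (W.s_mem b)).trans
    (tmul_eq_of_eq _ _ (tensorΓ.one_mem V') (W'.s_mem b) (map_one f) (hg.map_s b))

end FiberProd

/-- `A` is the universal `(B, Γ)`-`*`-algebra of a presentation, where the entries of `X_u` are the
adjoints of the entries of `X_v`. -/
structure IsPresented (P : MatrixPresentation B Γ n) (V : BGStarAlg α A)
    (X : Idx.{u} → Matrix (Fin n) (Fin n) A) : Prop where
  univ : IsUniversalAlg α P (V.r : B →ₐ[ℂ] A) (V.s : B →ₐ[ℂ] A) X
  mem : ∀ o i j, X o i j ∈ V.gr (P.d o i) (P.d o j)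
  star_v : ∀ i j, star (X .v i j) = X .u i j

namespace IsPresented

variable {P : MatrixPresentation B Γ n} {V : BGStarAlg α A}
  {X : Idx.{u} → Matrix (Fin n) (Fin n) A}

lemma graded_induction (h : IsPresented P V X) (hP : P.IsRegular)
    (Q : ∀ γ γ' : Γ, Submodule ℂ (V.gr γ γ'))
    (hmul : ∀ {γ γ' δ δ' : Γ} {a b : A} (ha : a ∈ V.gr γ γ') (hb : b ∈ V.gr δ δ'),
      ⟨a, ha⟩ ∈ Q γ γ' → ⟨b, hb⟩ ∈ Q δ δ' →
        ⟨a * b, V.isBGAlg.mul_mem ha hb⟩ ∈ Q (γ * δ) (γ' * δ'))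
    (hr : ∀ b, ⟨V.r b, V.r_mem b⟩ ∈ Q 1 1) (hs : ∀ b, ⟨V.s b, V.s_mem b⟩ ∈ Q 1 1)
    (hX : ∀ o i j, ⟨X o i j, h.mem o i j⟩ ∈ Q (P.d o i) (P.d o j)) {γ γ' : Γ} {a : A}
    (ha : a ∈ V.gr γ γ') : ⟨a, ha⟩ ∈ Q γ γ' := by
  have h1 := h.univ.graded_induction hP V.isBGAlg.indep
    (fun γ γ' => (Q γ γ').map (V.gr γ γ').subtype) (fun γ γ' => Submodule.map_subtype_le _ _) ?_
    (fun b => ⟨_, hr b, rfl⟩) (fun b => ⟨_, hs b, rfl⟩) (fun i j => ⟨_, hX .v i j, rfl⟩)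
    (fun i j => ⟨_, hX .u i j, rfl⟩) γ γ' ha
  · obtain ⟨x, hx, hxa⟩ := h1
    have h2 : x = ⟨a, ha⟩ := Subtype.ext hxa
    rwa [← h2]
  · rintro γ γ' δ δ' _ _ ⟨⟨a, ha⟩, ha', rfl⟩ ⟨⟨b, hb⟩, hb', rfl⟩
    exact ⟨_, hmul ha hb ha' hb', rfl⟩

lemma isBGStarHom (h : IsPresented P V X) (hP : P.IsRegular) {W : BGStarData B Γ C}
    (hW : W.IsCompatible α) {f : A →⋆ₐ[ℂ] C} (hr : ∀ b, f (V.r b) = W.r b)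
    (hs : ∀ b, f (V.s b) = W.s b) (hX : ∀ o i j, f (X o i j) ∈ W.gr (P.d o i) (P.d o j)) :
    IsBGStarHom V.toBGStarData W f where
  map_gr {γ γ' a} ha := by
    refine h.graded_induction hP
      (fun γ γ' => (W.gr γ γ').comap (f.toAlgHom.toLinearMap.comp (V.gr γ γ').subtype))
      (fun {γ γ' δ δ' a b} ha hb ha' hb' => ?_) (fun b => ?_) (fun b => ?_) hX ha
    · show f (a * b) ∈ W.gr (γ * δ) (γ' * δ')
      rw [map_mul]
      exact hW.mul_mem ha' hb'
    · show f (V.r b) ∈ W.gr 1 1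
      rw [hr]
      exact W.r_mem b
    · show f (V.s b) ∈ W.gr 1 1
      rw [hs]
      exact W.s_mem b
  map_r := hr
  map_s := hs

/-- A system in a `*`-algebra whose matrices `X_v` and `X_u` are adjoint to each other gives a
`*`-homomorphism. -/
lemma exists_starHom (h : IsPresented P V X) (hP : P.IsRegular) {r s : B →⋆ₐ[ℂ] C}
    {Y : Idx.{u} → Matrix (Fin n) (Fin n) C}
    (hY : IsSystem α P (r : B →ₐ[ℂ] C) (s : B →ₐ[ℂ] C) Y)
    (hYs : ∀ i j, Y .u i j = star (Y .v i j)) :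
    ∃ f : A →⋆ₐ[ℂ] C, (∀ b, f (V.r b) = r b) ∧ (∀ b, f (V.s b) = s b) ∧
      ∀ o i j, f (X o i j) = Y o i j := by
  obtain ⟨f, hr, hs, hX⟩ := h.univ.exists_hom _ _ _ _ hY
  replace hr : ∀ b, f (V.r b) = r b := hr
  replace hs : ∀ b, f (V.s b) = s b := hs
  suffices h1 : ∀ a, f (star a) = star (f a) from ⟨{ f with map_star' := h1 }, hr, hs, hX⟩
  refine h.univ.map_star_of hP f (fun b => ?_) (fun b => ?_) h.star_v fun i j => ?_
  · refine (congrArg f (map_star V.r b).symm).trans ((hr _).trans ((map_star r b).trans ?_))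
    exact congrArg star (hr b).symm
  · refine (congrArg f (map_star V.s b).symm).trans ((hs _).trans ((map_star s b).trans ?_))
    exact congrArg star (hs b).symm
  · rw [hX, hX, hYs]

lemma exists_comul (h : IsPresented P V X) (hP : P.IsRegular) :
    ∃ Δ : A →⋆ₐ[ℂ] FiberProd V.toBGStarData V.toBGStarData,
      IsBGStarHom V.toBGStarData (FiberProd.data V.toBGStarData V.toBGStarData) Δ ∧
      ∀ o i j, Δ (X o i j) = ∑ k, FiberProd.tmul (h.mem o i k) (h.mem o k j) := by
  have hV := V.isCompatible
  have key : ∀ o i j, ((tensorΓ.matMul (h.mem o)).map (FiberProd.proj _ _)) i j =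
      ∑ k, FiberProd.tmul (h.mem o i k) (h.mem o k j) := fun o i j =>
    map_sum (FiberProd.proj V.toBGStarData V.toBGStarData)
      (fun k => tensorΓ.tmul (h.mem o i k) (h.mem o k j)) Finset.univ
  obtain ⟨Δ, hr, hs, hX⟩ := h.exists_starHom hP (FiberProd.isSystem hV hP h.mem h.univ.sys)
    fun i j => by
      refine (key .u i j).trans (Eq.trans ?_ (congrArg star (key .v i j)).symm)
      rw [star_sum]
      refine Finset.sum_congr rfl fun k _ => ?_
      rw [FiberProd.star_tmul hV hV]
      exact FiberProd.tmul_eq_of_eq _ _ _ _ (h.star_v i k).symm (h.star_v k j).symm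
  have hX' : ∀ o i j, Δ (X o i j) = ∑ k, FiberProd.tmul (h.mem o i k) (h.mem o k j) :=
    fun o i j => (hX o i j).trans (key o i j)
  refine ⟨Δ, h.isBGStarHom hP (FiberProd.isCompatible hV hV) hr hs fun o i j => ?_, hX'⟩
  rw [hX']
  exact Submodule.sum_mem _ fun k _ => FiberProd.tmul_mem _ _

lemma exists_counit (h : IsPresented P V X) (hP : P.IsRegular) (hd : P.d .u = (P.d .v)⁻¹) :
    ∃ ε : A →⋆ₐ[ℂ] CrossedProduct α, IsBGStarHom V.toBGStarData (crossedData α) ε ∧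
      ∀ o i j, ε (X o i j) = if i = j then CrossedProduct.single (P.d o i) 1 else 0 := by
  have key : ∀ o i j, (diagonal fun i => CrossedProduct.single (P.d o i) 1 : Matrix (Fin n) (Fin n)
      (CrossedProduct α)) i j = if i = j then CrossedProduct.single (P.d o i) 1 else 0 :=
    fun o i j => diagonal_apply _ i j
  obtain ⟨ε, hr, hs, hX⟩ := h.exists_starHom hP (crossedData_isSystem hP) fun i j => by
    rw [key, key]
    by_cases hij : i = j
    · rw [if_pos hij, if_pos hij, CrossedProduct.star_single, hd, star_one, map_one]
      rfl
    · rw [if_neg hij, if_neg hij, star_zero]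
  have hX' := fun o i j => (hX o i j).trans (key o i j)
  refine ⟨ε, h.isBGStarHom hP crossedData_isCompatible hr hs fun o i j => ?_, hX'⟩
  rw [hX']
  by_cases hij : i = j
  · rw [if_pos hij, hij]
    exact single_mem_crossedData α _ _
  · rw [if_neg hij]
    exact Submodule.zero_mem _

/-- The inverses of the matrices of a system have homogeneous entries. -/
lemma inv_mem (h : IsPresented P V X) (hP : P.IsRegular)
    {W : Idx.{u} → Matrix (Fin n) (Fin n) A} (h1 : ∀ o, X o * W o = 1) (h2 : ∀ o, W o * X o = 1)
    (o : Idx) (i j : Fin n) : W o i j ∈ V.gr (P.d o j)⁻¹ (P.d o i)⁻¹ := by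
  have hpair : ∀ {o p}, P.pairs o p → ∀ i j, W o i j ∈ V.gr (P.d o j)⁻¹ (P.d o i)⁻¹ := by
    intro o p hp i j
    rw [left_inv_eq_right_inv (h2 o) (h.univ.sys.pair_mul hp)]
    have h3 := h.mem p j i
    rwa [hP.pair_d hp] at h3
  have hintw : ∀ {o T}, T ∈ P.intw o .v → IsUnit T →
      ∀ i j, W o i j ∈ V.gr (P.d o j)⁻¹ (P.d o i)⁻¹ := by
    intro o T hT hTu i j
    obtain ⟨T', e1, e2⟩ := isUnit_iff_exists.1 hTu
    obtain ⟨R, f1, f2, -, hX⟩ := h.univ.sys.eq_conj hP hT hTu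
    let r : B →ₐ[ℂ] A := V.r
    let s : B →ₐ[ℂ] A := V.s
    have h3 : W o = T'.map s * W .v * (twist α (P.d .v) T).map r := by
      refine left_inv_eq_right_inv (h2 o) ?_
      have g1 : R.map r * (twist α (P.d .v) T).map r = 1 := by
        rw [← map_algHom_mul, f1, map_algHom_one]
      have g2 : T.map s * T'.map s = 1 := by rw [← map_algHom_mul, e1, map_algHom_one]
      rw [hX]
      calc R.map r * X .v * T.map s * (T'.map s * W .v * (twist α (P.d .v) T).map r)
          = R.map r * (X .v * (T.map s * T'.map s) * W .v) * (twist α (P.d .v) T).map r := by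
            simp only [mul_assoc]
        _ = 1 := by rw [g2, mul_one, h1, mul_one, g1]
    rw [h3]
    refine conj_mem (r := s) (s := r) (gr := fun γ γ' => V.gr γ'⁻¹ γ⁻¹) (d := P.d .v) (d' := P.d .v)
      (e := P.d o) (e' := P.d o) (fun {γ γ' x} b c hx => ?_)
      (hpair hP.pair_v.choose_spec) ((hP.supp hT).inverse e1 e2) ((hP.supp hT).twist _) i j
    have h4 := V.isBGAlg.mul_mem (V.isBGAlg.mul_mem (V.isBGAlg.s_mem b) hx) (V.isBGAlg.r_mem c)
    rwa [one_mul, one_mul, mul_one, mul_one] at h4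
  cases o with
  | v => exact hpair hP.pair_v.choose_spec i j
  | u =>
    rcases hP.inv_u with ⟨p, hp⟩ | ⟨T, hT, hu⟩
    · exact hpair hp i j
    · exact hintw hT hu i j
  | z =>
    obtain ⟨T, hT, hu⟩ := hP.inv_z
    exact hintw hT hu i j

lemma exists_antipode (h : IsPresented P V X) (hP : P.IsRegular) :
    ∃ S : A →ₗ[ℂ] A, S 1 = 1 ∧ (∀ a b, S (a * b) = S b * S a) ∧
      (∀ {γ γ' : Γ} {a : A}, a ∈ V.gr γ γ' → S a ∈ V.gr γ'⁻¹ γ⁻¹) ∧ (∀ b, S (V.r b) = V.s b) ∧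
      (∀ b, S (V.s b) = V.r b) ∧ ∀ o, X o * (X o).map S = 1 ∧ (X o).map S * X o = 1 := by
  choose W h1 h2 using fun o => isUnit_iff_exists.1 (h.univ.sys.isUnit hP o)
  obtain ⟨σ, hr, hs, hX⟩ := h.univ.exists_hom _ _ _ _ (h.univ.sys.op hP h1 h2)
  let S : A →ₗ[ℂ] A := (MulOpposite.opLinearEquiv ℂ).symm.toLinearMap.comp σ.toLinearMap
  have S_one : S 1 = 1 := congrArg MulOpposite.unop (map_one σ)
  have S_mul : ∀ a b, S (a * b) = S b * S a := fun a b => congrArg MulOpposite.unop (map_mul σ a b)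
  have S_r : ∀ b, S (V.r b) = V.s b := fun b => congrArg MulOpposite.unop (hr b)
  have S_s : ∀ b, S (V.s b) = V.r b := fun b => congrArg MulOpposite.unop (hs b)
  have S_X : ∀ o i j, S (X o i j) = W o i j := fun o i j => congrArg MulOpposite.unop (hX o i j)
  refine ⟨S, S_one, S_mul, fun {γ γ' a} ha => ?_, S_r, S_s, fun o => ?_⟩
  · refine h.graded_induction hP
      (fun γ γ' => (V.gr γ'⁻¹ γ⁻¹).comap (S.comp (V.gr γ γ').subtype))
      (fun {γ γ' δ δ' a b} ha hb ha' hb' => ?_) (fun b => ?_) (fun b => ?_) (fun o i j => ?_) ha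
    · show S (a * b) ∈ V.gr (γ' * δ')⁻¹ (γ * δ)⁻¹
      rw [S_mul, _root_.mul_inv_rev, _root_.mul_inv_rev]
      exact V.isBGAlg.mul_mem hb' ha'
    · show S (V.r b) ∈ V.gr 1⁻¹ 1⁻¹
      rw [S_r, inv_one]
      exact V.s_mem b
    · show S (V.s b) ∈ V.gr 1⁻¹ 1⁻¹
      rw [S_s, inv_one]
      exact V.r_mem b
    · show S (X o i j) ∈ V.gr (P.d o j)⁻¹ (P.d o i)⁻¹
      rw [S_X]
      exact h.inv_mem hP h1 h2 o i j
  · have h3 : (X o).map S = W o := by ext i j; exact S_X o i j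
    rw [h3]
    exact ⟨h1 o, h2 o⟩

end IsPresented

end PresentedHopf

/-! ### The axioms of a Hopf `*`-algebroid for universal algebras -/

section PresentedAxioms

open Matrix

variable {B Γ : Type u} [CommCStarAlgebra B] [Group Γ] {α : Γ →* (B ≃⋆ₐ[ℂ] B)} {n : ℕ}
  {A : Type u} [Ring A] [StarRing A] [Algebra ℂ A] [StarModule ℂ A]
  {P : MatrixPresentation B Γ n} {V : BGStarAlg α A} {X : Idx.{u} → Matrix (Fin n) (Fin n) A}

/-- `Δ` is given by the comultiplication of matrices. -/
structure IsComul (h : IsPresented P V X)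
    (Δ : A →⋆ₐ[ℂ] FiberProd V.toBGStarData V.toBGStarData) : Prop where
  hom : IsBGStarHom V.toBGStarData (FiberProd.data V.toBGStarData V.toBGStarData) Δ
  eq : ∀ o i j, Δ (X o i j) = ∑ k, FiberProd.tmul (h.mem o i k) (h.mem o k j)

/-- `ε` is given by the diagonal matrices of degrees. -/
structure IsMatrixCounit (P : MatrixPresentation B Γ n) (V : BGStarAlg α A)
    (X : Idx.{u} → Matrix (Fin n) (Fin n) A) (ε : A →⋆ₐ[ℂ] CrossedProduct α) : Prop where
  hom : IsBGStarHom V.toBGStarData (crossedData α) ε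
  eq : ∀ o i j, ε (X o i j) = if i = j then CrossedProduct.single (P.d o i) 1 else 0

namespace IsPresented

lemma starHom_ext (h : IsPresented P V X) (hP : P.IsRegular) {D : Type*} [Ring D] [StarRing D]
    [Algebra ℂ D] {f f' : A →⋆ₐ[ℂ] D} (hr : ∀ b, f (V.r b) = f' (V.r b))
    (hs : ∀ b, f (V.s b) = f' (V.s b)) (hX : ∀ i j, f (X .v i j) = f' (X .v i j)) : f = f' := by
  have h1 := h.univ.hom_ext hP (f := (f : A →ₐ[ℂ] D)) (f' := (f' : A →ₐ[ℂ] D)) hr hs hX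
    fun i j => by
      show f (X .u i j) = f' (X .u i j)
      rw [← h.star_v, map_star, map_star, hX]
  ext a
  exact AlgHom.congr_fun h1 a

lemma coassoc (h : IsPresented P V X) (hP : P.IsRegular)
    {Δ : A →⋆ₐ[ℂ] FiberProd V.toBGStarData V.toBGStarData} (hΔ : IsComul h Δ) :
    ∃ φ : FiberProd (FiberProd.data V.toBGStarData V.toBGStarData) V.toBGStarData ≃⋆ₐ[ℂ]
      FiberProd V.toBGStarData (FiberProd.data V.toBGStarData V.toBGStarData),
    (∀ {γ₀ γ₁ γ₂ γ₃ : Γ} {a c d : A} (ha : a ∈ V.gr γ₀ γ₁) (hc : c ∈ V.gr γ₁ γ₂)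
      (hd : d ∈ V.gr γ₂ γ₃), φ (FiberProd.tmul (FiberProd.tmul_mem ha hc) hd) =
        FiberProd.tmul ha (FiberProd.tmul_mem hc hd)) ∧
    ∀ a, φ (FiberProd.map hΔ.hom (IsBGStarHom.id _) (Δ a)) =
      FiberProd.map (IsBGStarHom.id _) hΔ.hom (Δ a) := by
  have hV := V.isCompatible
  obtain ⟨φ, hφ⟩ := FiberProd.exists_assoc hV hV hV V.isGraded V.isGraded V.isGraded
  refine ⟨φ, hφ, fun a => ?_⟩
  let φ' : FiberProd (FiberProd.data V.toBGStarData V.toBGStarData) V.toBGStarData →⋆ₐ[ℂ]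
      FiberProd V.toBGStarData (FiberProd.data V.toBGStarData V.toBGStarData) := φ
  have h1 : (φ'.comp (FiberProd.map hΔ.hom (IsBGStarHom.id _))).comp Δ =
      (FiberProd.map (IsBGStarHom.id _) hΔ.hom).comp Δ := by
    refine h.starHom_ext hP (fun b => ?_) (fun b => ?_) fun i j => ?_
    · show φ (FiberProd.map hΔ.hom (IsBGStarHom.id _) (Δ (V.r b))) =
        FiberProd.map (IsBGStarHom.id _) hΔ.hom (Δ (V.r b))
      rw [hΔ.hom.map_r, FiberProd.map_r, FiberProd.map_r]
      refine (hφ (V.r_mem b) (tensorΓ.one_mem _) (tensorΓ.one_mem _)).trans ?_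
      exact FiberProd.tmul_eq_of_eq _ _ (V.r_mem b) (tensorΓ.one_mem _) rfl
        FiberProd.one_eq_tmul.symm
    · show φ (FiberProd.map hΔ.hom (IsBGStarHom.id _) (Δ (V.s b))) =
        FiberProd.map (IsBGStarHom.id _) hΔ.hom (Δ (V.s b))
      rw [hΔ.hom.map_s, FiberProd.map_s, FiberProd.map_s]
      refine Eq.trans ?_ (hφ (tensorΓ.one_mem _) (tensorΓ.one_mem _) (V.s_mem b))
      exact congrArg φ (FiberProd.tmul_eq_of_eq (tensorΓ.one_mem _) (V.s_mem b) _ _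
        FiberProd.one_eq_tmul rfl)
    · show φ (FiberProd.map hΔ.hom (IsBGStarHom.id _) (Δ (X .v i j))) =
        FiberProd.map (IsBGStarHom.id _) hΔ.hom (Δ (X .v i j))
      have e1 : ∀ k, φ (FiberProd.map hΔ.hom (IsBGStarHom.id _)
          (FiberProd.tmul (h.mem .v i k) (h.mem .v k j))) = ∑ l, FiberProd.tmul (h.mem .v i l)
            (FiberProd.tmul_mem (h.mem .v l k) (h.mem .v k j)) := fun k => by
        rw [FiberProd.map_tmul]
        refine (congrArg φ (FiberProd.tmul_sum_left Finset.univ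
          (fun l => FiberProd.tmul_mem (h.mem .v i l) (h.mem .v l k)) _ _ (hΔ.eq .v i k))).trans ?_
        rw [map_sum]
        exact Finset.sum_congr rfl fun l _ => hφ _ _ _
      have e2 : ∀ l, FiberProd.map (IsBGStarHom.id _) hΔ.hom
          (FiberProd.tmul (h.mem .v i l) (h.mem .v l j)) = ∑ k, FiberProd.tmul (h.mem .v i l)
            (FiberProd.tmul_mem (h.mem .v l k) (h.mem .v k j)) := fun l => by
        rw [FiberProd.map_tmul]
        exact FiberProd.tmul_sum_right Finset.univ _
          (fun k => FiberProd.tmul_mem (h.mem .v l k) (h.mem .v k j)) _ (hΔ.eq .v l j)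
      rw [hΔ.eq, map_sum, map_sum, map_sum, Finset.sum_congr rfl fun k _ => e1 k,
        Finset.sum_congr rfl fun k _ => e2 k, Finset.sum_comm]
  exact DFunLike.congr_fun h1 a

lemma counit_left (h : IsPresented P V X) (hP : P.IsRegular)
    {Δ : A →⋆ₐ[ℂ] FiberProd V.toBGStarData V.toBGStarData} (hΔ : IsComul h Δ)
    {ε : A →⋆ₐ[ℂ] CrossedProduct α} (hε : IsMatrixCounit P V X ε) {γ γ' : Γ} {a : A}
    (ha : a ∈ V.gr γ γ') : FiberProd.map hε.hom (IsBGStarHom.id _) (Δ a) =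
      FiberProd.tmul (single_mem_crossedData α γ 1) ha := by
  have hV := V.isCompatible
  have hC := crossedData_isCompatible (α := α)
  refine h.graded_induction hP (fun γ γ' =>
    { carrier := {x | FiberProd.map hε.hom (IsBGStarHom.id _) (Δ (x : A)) =
        FiberProd.tmul (single_mem_crossedData α γ 1) x.2}
      add_mem' := fun {x y} hx hy => by
        refine (congrArg _ (map_add Δ (x : A) y)).trans ((map_add _ _ _).trans ?_)
        exact (congrArg₂ (· + ·) hx hy).trans (FiberProd.tmul_add_right _ x.2 y.2).symm
      zero_mem' := by
        refine (congrArg _ (map_zero Δ)).trans ((map_zero _).trans ?_)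
        exact (FiberProd.tmul_zero_right _ _).symm
      smul_mem' := fun z x hx => by
        refine (congrArg _ (map_smul Δ z (x : A))).trans ((map_smul _ _ _).trans ?_)
        exact (congrArg (z • ·) hx).trans (FiberProd.tmul_smul_right z _ x.2).symm })
    (fun {γ γ' δ δ' a b} ha hb ha' hb' => ?_) (fun b => ?_) (fun b => ?_) (fun o i j => ?_) ha
  · refine (congrArg _ (map_mul Δ a b)).trans ((map_mul _ _ _).trans
      ((congrArg₂ (· * ·) ha' hb').trans ((FiberProd.tmul_mul_tmul hC hV _ _ _ _).trans ?_)))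
    refine FiberProd.tmul_eq_of_eq _ _ _ _ ?_ rfl
    rw [CrossedProduct.single_mul_single, map_one, mul_one]
  · refine (congrArg _ (hΔ.hom.map_r b)).trans ((FiberProd.map_r _ _ b).trans ?_)
    have h1 := FiberProd.tmul_balanced (tensorΓ.one_mem (crossedData α)) (tensorΓ.one_mem
      V.toBGStarData) (FiberProd.s_mul_mem hC (tensorΓ.one_mem _) b)
      (FiberProd.r_mul_mem hV (tensorΓ.one_mem _) b)
    refine (FiberProd.tmul_eq_of_eq ((crossedData α).r_mem b) (tensorΓ.one_mem _) _ _ ?_ rfl).trans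
      (h1.trans
      (FiberProd.tmul_eq_of_eq _ _ _ _ rfl (mul_one _)))
    exact (mul_one _).symm
  · exact (congrArg _ (hΔ.hom.map_s b)).trans (FiberProd.map_s _ _ b)
  · refine (congrArg _ (hΔ.eq o i j)).trans ((map_sum (FiberProd.map hε.hom
      (IsBGStarHom.id V.toBGStarData)) _ _).trans ?_)
    refine (Finset.sum_eq_single i (fun k _ hk => ?_) fun hi => absurd (Finset.mem_univ i) hi).trans
      ?_
    · have h1 : ε (X o i k) = 0 := by rw [hε.eq, if_neg (Ne.symm hk)]
      have h2 := hε.hom.map_gr (h.mem o i k)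
      rw [h1] at h2
      exact (FiberProd.tmul_eq_of_eq (hε.hom.map_gr (h.mem o i k)) (h.mem o k j) h2 (h.mem o k j) h1
        rfl).trans (FiberProd.tmul_zero_left _ _)
    · exact FiberProd.tmul_eq_of_eq (hε.hom.map_gr (h.mem o i i)) (h.mem o i j) _ _
        ((hε.eq o i i).trans (if_pos rfl)) rfl

lemma counit_right (h : IsPresented P V X) (hP : P.IsRegular)
    {Δ : A →⋆ₐ[ℂ] FiberProd V.toBGStarData V.toBGStarData} (hΔ : IsComul h Δ)
    {ε : A →⋆ₐ[ℂ] CrossedProduct α} (hε : IsMatrixCounit P V X ε) {γ γ' : Γ} {a : A}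
    (ha : a ∈ V.gr γ γ') : FiberProd.map (IsBGStarHom.id _) hε.hom (Δ a) =
      FiberProd.tmul ha (single_mem_crossedData α γ' 1) := by
  have hV := V.isCompatible
  have hC := crossedData_isCompatible (α := α)
  refine h.graded_induction hP (fun γ γ' =>
    { carrier := {x | FiberProd.map (IsBGStarHom.id _) hε.hom (Δ (x : A)) =
        FiberProd.tmul x.2 (single_mem_crossedData α γ' 1)}
      add_mem' := fun {x y} hx hy => by
        refine (congrArg _ (map_add Δ (x : A) y)).trans ((map_add _ _ _).trans ?_)
        exact (congrArg₂ (· + ·) hx hy).trans (FiberProd.tmul_add_left x.2 y.2 _).symm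
      zero_mem' := by
        refine (congrArg _ (map_zero Δ)).trans ((map_zero _).trans ?_)
        exact (FiberProd.tmul_zero_left _ _).symm
      smul_mem' := fun z x hx => by
        refine (congrArg _ (map_smul Δ z (x : A))).trans ((map_smul _ _ _).trans ?_)
        exact (congrArg (z • ·) hx).trans (FiberProd.tmul_smul_left z x.2 _).symm })
    (fun {γ γ' δ δ' a b} ha hb ha' hb' => ?_) (fun b => ?_) (fun b => ?_) (fun o i j => ?_) ha
  · refine (congrArg _ (map_mul Δ a b)).trans ((map_mul _ _ _).trans
      ((congrArg₂ (· * ·) ha' hb').trans ((FiberProd.tmul_mul_tmul hV hC _ _ _ _).trans ?_)))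
    refine FiberProd.tmul_eq_of_eq _ _ _ _ rfl ?_
    rw [CrossedProduct.single_mul_single, map_one, mul_one]
  · exact (congrArg _ (hΔ.hom.map_r b)).trans (FiberProd.map_r _ _ b)
  · refine (congrArg _ (hΔ.hom.map_s b)).trans ((FiberProd.map_s _ _ b).trans ?_)
    have h1 := FiberProd.tmul_balanced (tensorΓ.one_mem V.toBGStarData) (tensorΓ.one_mem
      (crossedData α)) (FiberProd.s_mul_mem hV (tensorΓ.one_mem _) b)
      (FiberProd.r_mul_mem hC (tensorΓ.one_mem _) b)
    refine (FiberProd.tmul_eq_of_eq (tensorΓ.one_mem _) ((crossedData α).s_mem b) _ _ rfl ?_).trans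
      (h1.symm.trans
      (FiberProd.tmul_eq_of_eq _ _ _ _ (mul_one _) rfl))
    exact (mul_one _).symm
  · refine (congrArg _ (hΔ.eq o i j)).trans ((map_sum (FiberProd.map
      (IsBGStarHom.id V.toBGStarData) hε.hom) _ _).trans ?_)
    refine (Finset.sum_eq_single j (fun k _ hk => ?_) fun hi => absurd (Finset.mem_univ j) hi).trans
      ?_
    · have h1 : ε (X o k j) = 0 := by rw [hε.eq, if_neg hk]
      have h2 := hε.hom.map_gr (h.mem o k j)
      rw [h1] at h2
      exact (FiberProd.tmul_eq_of_eq (h.mem o i k) (hε.hom.map_gr (h.mem o k j)) (h.mem o i k) h2 rfl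
        h1).trans (FiberProd.tmul_zero_right _ _)
    · exact FiberProd.tmul_eq_of_eq (h.mem o i j) (hε.hom.map_gr (h.mem o j j)) _ _ rfl
        ((hε.eq o j j).trans (if_pos rfl))

/-- The algebraic properties of an antipode. -/
structure IsAntipode (V : BGStarAlg α A) (X : Idx.{u} → Matrix (Fin n) (Fin n) A)
    (S : A →ₗ[ℂ] A) : Prop where
  one : S 1 = 1
  mul : ∀ a b, S (a * b) = S b * S a
  gr : ∀ {γ γ' : Γ} {a : A}, a ∈ V.gr γ γ' → S a ∈ V.gr γ'⁻¹ γ⁻¹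
  map_r : ∀ b, S (V.r b) = V.s b
  map_s : ∀ b, S (V.s b) = V.r b
  inv : ∀ o, X o * (X o).map S = 1 ∧ (X o).map S * X o = 1

/-- The linear map `μ : x ⊗̃ y ↦ S(x) y` satisfies `μ ∘ Δ = š ∘ ε`. This property of `a` is
multiplicative, because `μ(Δ(a) w) = s(t) μ(w)` if `μ(Δ(a))` is of the form `s(b)`. -/
lemma exists_antipode_left (h : IsPresented P V X) (hP : P.IsRegular)
    {Δ : A →⋆ₐ[ℂ] FiberProd V.toBGStarData V.toBGStarData} (hΔ : IsComul h Δ)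
    {ε : A →⋆ₐ[ℂ] CrossedProduct α} (hε : IsMatrixCounit P V X ε) {S : A →ₗ[ℂ] A}
    (hS : IsAntipode V X S) : ∃ μ : FiberProd V.toBGStarData V.toBGStarData →ₗ[ℂ] A,
      (∀ {γ γ' γ'' : Γ} {a c : A} (ha : a ∈ V.gr γ γ') (hc : c ∈ V.gr γ' γ''),
        μ (FiberProd.tmul ha hc) = S a * c) ∧ ∀ a, μ (Δ a) = sCheckLin V (ε a) := by
  have hV := V.isCompatible
  obtain ⟨μ, hμ⟩ := FiberProd.exists_liftLinear hV hV ((LinearMap.mul ℂ A).comp S)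
    fun {γ γ' γ'' a c} ha hc b => by
      show S (V.s b * a) * c = S a * (V.r b * c)
      rw [hS.mul, hS.map_s, mul_assoc]
  replace hμ : ∀ {γ γ' γ'' : Γ} {a c : A} (ha : a ∈ V.gr γ γ') (hc : c ∈ V.gr γ' γ''),
    μ (FiberProd.tmul ha hc) = S a * c := hμ
  have mul_tmul : ∀ {γ γ' γ'' : Γ} {a c : A} (ha : a ∈ V.gr γ γ') (hc : c ∈ V.gr γ' γ'') (w),
      μ (w * FiberProd.tmul ha hc) = S a * μ w * c := by
    intro γ γ' γ'' a c ha hc w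
    induction w using FiberProd.induction hV hV with
    | h0 => rw [zero_mul, map_zero, mul_zero, zero_mul]
    | hadd x y hx hy => rw [add_mul, map_add, map_add, hx, hy, mul_add, add_mul]
    | hsmul z x hx => rw [smul_mul_assoc, map_smul, map_smul, hx, mul_smul_comm, smul_mul_assoc]
    | h ha' hc' =>
      rw [FiberProd.tmul_mul_tmul hV hV, hμ, hμ, hS.mul]
      simp only [mul_assoc]
  have key : ∀ {w : FiberProd V.toBGStarData V.toBGStarData} {t : B}, μ w = V.s t →
      ∀ {γ γ' : Γ} {y}, y ∈ (FiberProd.data V.toBGStarData V.toBGStarData).gr γ γ' →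
        μ (w * y) = V.s (α γ⁻¹ t) * μ y := by
    intro w t hw γ γ' y hy
    induction hy using Submodule.span_induction with
    | zero => rw [mul_zero, map_zero, mul_zero]
    | add x y _ _ hx hy => rw [mul_add, map_add, map_add, hx, hy, mul_add]
    | smul z x _ hx => rw [mul_smul_comm, map_smul, map_smul, hx, mul_smul_comm]
    | mem y hy =>
      obtain ⟨_, a, c, ha, hc, rfl⟩ := hy
      rw [mul_tmul, hw, hμ, hV.mul_s t (hS.gr ha), mul_assoc]
  have hhom : ∀ {γ γ' : Γ} {a : A}, a ∈ V.gr γ γ' → μ (Δ a) = sCheckLin V (ε a) := by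
    intro γ γ' a ha
    refine h.graded_induction hP (fun γ γ' => LinearMap.eqLocus
      ((μ.comp Δ.toAlgHom.toLinearMap).comp (V.gr γ γ').subtype)
      (((sCheckLin V).comp ε.toAlgHom.toLinearMap).comp (V.gr γ γ').subtype))
      (fun {γ γ' δ δ' a b} ha hb ha' hb' => ?_) (fun b => ?_) (fun b => ?_) (fun o i j => ?_) ha
    · replace ha' : μ (Δ a) = sCheckLin V (ε a) := ha'
      replace hb' : μ (Δ b) = sCheckLin V (ε b) := hb'
      show μ (Δ (a * b)) = sCheckLin V (ε (a * b))
      obtain ⟨c, hc, -⟩ := hε.hom.map_gr ha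
      obtain ⟨c', hc', -⟩ := hε.hom.map_gr hb
      rw [hc, sCheckLin_single] at ha'
      rw [hc', sCheckLin_single] at hb'
      rw [map_mul Δ, map_mul ε, key ha' (hΔ.hom.map_gr hb), hb', hc, hc',
        CrossedProduct.single_mul_single, sCheckLin_single, ← map_mul, _root_.mul_inv_rev, map_mul,
        map_mul, map_mul]
      have hα : ∀ x, α (δ⁻¹ * γ⁻¹) x = α δ⁻¹ (α γ⁻¹ x) := fun x => by rw [map_mul]; rfl
      rw [hα, hα, inv_apply_map]
    · show μ (Δ (V.r b)) = sCheckLin V (ε (V.r b))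
      rw [hΔ.hom.map_r, hε.hom.map_r]
      refine (hμ (V.r_mem b) (tensorΓ.one_mem _)).trans ?_
      refine Eq.trans ?_ (sCheckLin_single V 1 b).symm
      rw [hS.map_r, mul_one, inv_one, map_one]
      rfl
    · show μ (Δ (V.s b)) = sCheckLin V (ε (V.s b))
      rw [hΔ.hom.map_s, hε.hom.map_s]
      refine (hμ (tensorΓ.one_mem _) (V.s_mem b)).trans ?_
      refine Eq.trans ?_ (sCheckLin_single V 1 b).symm
      rw [hS.one, one_mul, inv_one, map_one]
      rfl
    · show μ (Δ (X o i j)) = sCheckLin V (ε (X o i j))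
      have h1 := congrFun (congrFun (hS.inv o).2 i) j
      rw [mul_apply] at h1
      rw [hΔ.eq, map_sum, hε.eq, Finset.sum_congr rfl fun k _ => hμ (h.mem o i k) (h.mem o k j)]
      refine h1.trans ?_
      by_cases hij : i = j
      · rw [if_pos hij, hij, one_apply_eq, sCheckLin_single, map_one, map_one]
      · rw [if_neg hij, one_apply_ne hij, map_zero]
  refine ⟨μ, hμ, fun a => ?_⟩
  have h1 := V.isGraded.linearMap_ext (f := μ.comp Δ.toAlgHom.toLinearMap)
    (f' := (sCheckLin V).comp ε.toAlgHom.toLinearMap) hhom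
  exact LinearMap.congr_fun h1 a

lemma exists_antipode_right (h : IsPresented P V X) (hP : P.IsRegular)
    {Δ : A →⋆ₐ[ℂ] FiberProd V.toBGStarData V.toBGStarData} (hΔ : IsComul h Δ)
    {ε : A →⋆ₐ[ℂ] CrossedProduct α} (hε : IsMatrixCounit P V X ε) {S : A →ₗ[ℂ] A}
    (hS : IsAntipode V X S) : ∃ μ : FiberProd V.toBGStarData V.toBGStarData →ₗ[ℂ] A,
      (∀ {γ γ' γ'' : Γ} {a c : A} (ha : a ∈ V.gr γ γ') (hc : c ∈ V.gr γ' γ''),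
        μ (FiberProd.tmul ha hc) = a * S c) ∧ ∀ a, μ (Δ a) = rHatLin V (ε a) := by
  have hV := V.isCompatible
  obtain ⟨μ, hμ⟩ := FiberProd.exists_liftLinear hV hV ((LinearMap.mul ℂ A).compl₂ S)
    fun {γ γ' γ'' a c} ha hc b => by
      show V.s b * a * S c = a * S (V.r b * c)
      have h1 := hV.mul_s b (hV.mul_mem ha (hS.gr hc))
      rw [mul_inv_cancel, map_one] at h1
      rw [hS.mul, hS.map_r, mul_assoc, ← mul_assoc a]
      exact h1.symm
  replace hμ : ∀ {γ γ' γ'' : Γ} {a c : A} (ha : a ∈ V.gr γ γ') (hc : c ∈ V.gr γ' γ''),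
    μ (FiberProd.tmul ha hc) = a * S c := hμ
  have tmul_mul : ∀ {γ γ' γ'' : Γ} {a c : A} (ha : a ∈ V.gr γ γ') (hc : c ∈ V.gr γ' γ'') (w),
      μ (FiberProd.tmul ha hc * w) = a * μ w * S c := by
    intro γ γ' γ'' a c ha hc w
    induction w using FiberProd.induction hV hV with
    | h0 => rw [mul_zero, map_zero, mul_zero, zero_mul]
    | hadd x y hx hy => rw [mul_add, map_add, map_add, hx, hy, mul_add, add_mul]
    | hsmul z x hx => rw [mul_smul_comm, map_smul, map_smul, hx, mul_smul_comm, smul_mul_assoc]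
    | h ha' hc' =>
      rw [FiberProd.tmul_mul_tmul hV hV, hμ, hμ, hS.mul]
      simp only [mul_assoc]
  have key : ∀ {w : FiberProd V.toBGStarData V.toBGStarData} {t : B}, μ w = V.r t →
      ∀ {γ γ' : Γ} {y}, y ∈ (FiberProd.data V.toBGStarData V.toBGStarData).gr γ γ' →
        μ (y * w) = V.r (α γ t) * μ y := by
    intro w t hw γ γ' y hy
    induction hy using Submodule.span_induction with
    | zero => rw [zero_mul, map_zero, mul_zero]
    | add x y _ _ hx hy => rw [add_mul, map_add, map_add, hx, hy, mul_add]
    | smul z x _ hx => rw [smul_mul_assoc, map_smul, map_smul, hx, mul_smul_comm]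
    | mem y hy =>
      obtain ⟨_, a, c, ha, hc, rfl⟩ := hy
      rw [tmul_mul, hw, hμ, hV.mul_r t ha, mul_assoc]
  have hhom : ∀ {γ γ' : Γ} {a : A}, a ∈ V.gr γ γ' → μ (Δ a) = rHatLin V (ε a) := by
    intro γ γ' a ha
    refine h.graded_induction hP (fun γ γ' => LinearMap.eqLocus
      ((μ.comp Δ.toAlgHom.toLinearMap).comp (V.gr γ γ').subtype)
      (((rHatLin V).comp ε.toAlgHom.toLinearMap).comp (V.gr γ γ').subtype))
      (fun {γ γ' δ δ' a b} ha hb ha' hb' => ?_) (fun b => ?_) (fun b => ?_) (fun o i j => ?_) ha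
    · replace ha' : μ (Δ a) = rHatLin V (ε a) := ha'
      replace hb' : μ (Δ b) = rHatLin V (ε b) := hb'
      show μ (Δ (a * b)) = rHatLin V (ε (a * b))
      obtain ⟨c, hc, -⟩ := hε.hom.map_gr ha
      obtain ⟨c', hc', -⟩ := hε.hom.map_gr hb
      rw [hc, rHatLin_single] at ha'
      rw [hc', rHatLin_single] at hb'
      rw [map_mul Δ, map_mul ε, key hb' (hΔ.hom.map_gr ha), ha', hc, hc',
        CrossedProduct.single_mul_single, rHatLin_single, ← map_mul, mul_comm]
    · show μ (Δ (V.r b)) = rHatLin V (ε (V.r b))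
      rw [hΔ.hom.map_r, hε.hom.map_r]
      refine (hμ (V.r_mem b) (tensorΓ.one_mem _)).trans ?_
      refine Eq.trans ?_ (rHatLin_single V 1 b).symm
      rw [hS.one, mul_one]
    · show μ (Δ (V.s b)) = rHatLin V (ε (V.s b))
      rw [hΔ.hom.map_s, hε.hom.map_s]
      refine (hμ (tensorΓ.one_mem _) (V.s_mem b)).trans ?_
      refine Eq.trans ?_ (rHatLin_single V 1 b).symm
      rw [hS.map_s, one_mul]
    · show μ (Δ (X o i j)) = rHatLin V (ε (X o i j))
      have h1 := congrFun (congrFun (hS.inv o).1 i) j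
      rw [mul_apply] at h1
      rw [hΔ.eq, map_sum, hε.eq, Finset.sum_congr rfl fun k _ => hμ (h.mem o i k) (h.mem o k j)]
      refine h1.trans ?_
      by_cases hij : i = j
      · rw [if_pos hij, hij, one_apply_eq, rHatLin_single, map_one]
      · rw [if_neg hij, one_apply_ne hij, map_zero]
  refine ⟨μ, hμ, fun a => ?_⟩
  have h1 := V.isGraded.linearMap_ext (f := μ.comp Δ.toAlgHom.toLinearMap)
    (f' := (rHatLin V).comp ε.toAlgHom.toLinearMap) hhom
  exact LinearMap.congr_fun h1 a

/-- The universal `(B, Γ)`-`*`-algebra of a presentation is a Hopf `*`-algebroid with matrix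
corepresentation `X_v`. -/
theorem exists_hopf (h : IsPresented P V X) (hP : P.IsRegular) (hd : P.d .u = (P.d .v)⁻¹) :
    ∃ H : HopfStarAlgebroid V, IsMatrixCorep H (h.mem .v) := by
  obtain ⟨Δ, hΔ1, hΔ2⟩ := h.exists_comul hP
  obtain ⟨ε, hε1, hε2⟩ := h.exists_counit hP hd
  obtain ⟨S, S1, S2, S3, S4, S5, S6⟩ := h.exists_antipode hP
  have hΔ : IsComul h Δ := ⟨hΔ1, hΔ2⟩
  have hε : IsMatrixCounit P V X ε := ⟨hε1, hε2⟩
  have hS : IsAntipode V X S := ⟨S1, S2, S3, S4, S5, S6⟩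
  obtain ⟨μ, hμ, hμΔ⟩ := h.exists_antipode_left hP hΔ hε hS
  obtain ⟨μ', hμ', hμΔ'⟩ := h.exists_antipode_right hP hΔ hε hS
  refine ⟨{
    Δ := Δ
    ε := ε
    S := S
    Δ_hom := hΔ.hom
    ε_hom := hε.hom
    S_one := S1
    S_mul := S2
    S_gr := S3
    S_r := S4
    S_s := S5
    coassoc := h.coassoc hP hΔ
    counit_left := h.counit_left hP hΔ hε
    counit_right := h.counit_right hP hΔ hε
    antipode_left := fun a m γ γ' γ'' x y hx hy e => ?_
    antipode_right := fun a m γ γ' γ'' x y hx hy e => ?_ }, ?_⟩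
  · refine Eq.trans ?_ (hμΔ a)
    rw [e, map_sum]
    exact Finset.sum_congr rfl fun i _ => (hμ (hx i) (hy i)).symm
  · refine Eq.trans ?_ (hμΔ' a)
    rw [e, map_sum]
    exact Finset.sum_congr rfl fun i _ => (hμ' (hx i) (hy i)).symm
  · exact ⟨hΔ2 .v, hε2 .v, (S6 .v).1, (S6 .v).2⟩

end IsPresented

end PresentedAxioms

/-! ### The unitary and the orthogonal presentation -/

section Presentations

open Matrix

variable {B Γ : Type u} [CommCStarAlgebra B] [Group Γ] {α : Γ →* (B ≃⋆ₐ[ℂ] B)} {n : ℕ}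
  {g : Fin n → Γ} {F G : Matrix (Fin n) (Fin n) B}

lemma IsEven.isSupported (h : IsEven α g F) : IsSupported g g F := fun i j hij =>
  (nabla_mul_nabla_eq h.choose_spec).2 i j fun h' => hij (mul_inv_eq_one.1 h')

lemma IsOdd.isSupported (h : IsOdd α g F) : IsSupported g g⁻¹ F := fun i j hij =>
  (nabla_mul_nabla_eq h.choose_spec).2 i j fun h' => hij (eq_inv_of_mul_eq_one_left h')

lemma IsSupported.inv_left (h : IsSupported g g⁻¹ F) : IsSupported g⁻¹ g F := by
  have h1 := h.inv_inv
  rwa [_root_.inv_inv] at h1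

lemma IsSupported.mul {d d' d'' : Fin n → Γ} (hF : IsSupported d d' F) (hG : IsSupported d' d'' G) :
    IsSupported d d'' (F * G) := fun i j hij => by
  rw [mul_apply]
  refine Finset.sum_eq_zero fun k _ => ?_
  by_cases h : d i = d' k
  · rw [hG k j fun h' => hij (h.trans h'), mul_zero]
  · rw [hF i k h, zero_mul]

/-- The family with the members `v`, `u` and `z`. -/
def Idx.family {D : Type u} (v u z : D) : Idx.{u} → D
  | .v => v
  | .u => u
  | .z => z

/-- The presentation where `u` is inverse to the transpose of `v`, where `z` is inverse to the
transpose of `u`, and where `F` intertwines `z` and `v`. -/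
def unitaryPres (g : Fin n → Γ) (F : Matrix (Fin n) (Fin n) B) : MatrixPresentation B Γ n where
  d := Idx.family g g⁻¹ g
  pairs o p := (o = .v ∧ p = .u) ∨ (o = .u ∧ p = .z)
  intw o o' := {T | o = .z ∧ o' = .v ∧ T = F}

variable (α) in
/-- The presentation where `z` is inverse to the transpose of `v`, where `F` intertwines `z` and `v`,
where `G` intertwines `u` and `v`, and where `Q = G (∇ Ḡ ∇)` intertwines `v` with itself. -/
def orthogonalPres (g : Fin n → Γ) (F G : Matrix (Fin n) (Fin n) B) : MatrixPresentation B Γ n where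
  d := Idx.family g g⁻¹ g⁻¹
  pairs o p := o = .v ∧ p = .z
  intw o o' := {T | (o = .z ∧ o' = .v ∧ T = F) ∨ (o = .u ∧ o' = .v ∧ T = G) ∨
    (o = .v ∧ o' = .v ∧ T = G * twist α g (G.map star))}

lemma unitaryPres_isRegular (hF : IsUnit F) (h : IsSupported g g F) :
    (unitaryPres g F).IsRegular where
  pair_d := by
    rintro _ _ (⟨rfl, rfl⟩ | ⟨rfl, rfl⟩)
    · rfl
    · exact (inv_inv g).symm
  supp := by
    rintro _ _ _ ⟨rfl, rfl, rfl⟩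
    exact h
  pair_v := ⟨.u, Or.inl ⟨rfl, rfl⟩⟩
  inv_u := Or.inl ⟨.z, Or.inr ⟨rfl, rfl⟩⟩
  inv_z := ⟨F, ⟨rfl, rfl, rfl⟩, hF⟩

lemma orthogonalPres_isRegular (hF : IsUnit F) (hG : IsUnit G) (hF' : IsSupported g g⁻¹ F)
    (hG' : IsSupported g g⁻¹ G) : (orthogonalPres α g F G).IsRegular where
  pair_d := by
    rintro _ _ ⟨rfl, rfl⟩
    rfl
  supp := by
    rintro _ _ _ (⟨rfl, rfl, rfl⟩ | ⟨rfl, rfl, rfl⟩ | ⟨rfl, rfl, rfl⟩)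
    · exact hF'
    · exact hG'
    · exact hG'.mul (hG'.inv_left.map_star.twist g)
  pair_v := ⟨.z, rfl, rfl⟩
  inv_u := Or.inr ⟨G, Or.inr (Or.inl ⟨rfl, rfl, rfl⟩), hG⟩
  inv_z := ⟨F, Or.inl ⟨rfl, rfl, rfl⟩, hF⟩

section Systems

variable {D : Type u} [Ring D] [Algebra ℂ D] {r s : B →ₐ[ℂ] D} {v u z : Matrix (Fin n) (Fin n) D}

lemma isSystem_unitaryPres (hc : ∀ b c, Commute (r b) (s c))
    (hv : ∀ i j, v i j ∈ typed α r s (g i) (g j))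
    (hu : ∀ i j, u i j ∈ typed α r s (g i)⁻¹ (g j)⁻¹) (h1 : v * uᵀ = 1) (h2 : uᵀ * v = 1)
    (h3 : u * zᵀ = 1) (h4 : zᵀ * u = 1) (h5 : (twist α g F).map r * z = v * F.map s) :
    IsSystem α (unitaryPres g F) r s (Idx.family v u z) where
  commute := hc
  typed o i j := by
    cases o with
    | v => exact hv i j
    | u => exact hu i j
    | z =>
      have h6 := inv_mem_typed (d := g⁻¹) hu h3 h4 j i
      rwa [Pi.inv_apply, Pi.inv_apply, inv_inv, inv_inv] at h6
  pair_mul := by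
    rintro _ _ (⟨rfl, rfl⟩ | ⟨rfl, rfl⟩)
    exacts [h1, h3]
  mul_pair := by
    rintro _ _ (⟨rfl, rfl⟩ | ⟨rfl, rfl⟩)
    exacts [h2, h4]
  intw := by
    rintro _ _ _ ⟨rfl, rfl, rfl⟩
    exact h5

lemma isSystem_orthogonalPres (hc : ∀ b c, Commute (r b) (s c))
    (hv : ∀ i j, v i j ∈ typed α r s (g i) (g j))
    (hu : ∀ i j, u i j ∈ typed α r s (g i)⁻¹ (g j)⁻¹) (h1 : v * zᵀ = 1) (h2 : zᵀ * v = 1)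
    (h3 : (twist α g F).map r * z = v * F.map s) (h4 : (twist α g G).map r * u = v * G.map s)
    (h5 : (twist α g (G * twist α g (G.map star))).map r * v =
      v * (G * twist α g (G.map star)).map s) :
    IsSystem α (orthogonalPres α g F G) r s (Idx.family v u z) where
  commute := hc
  typed o i j := by
    cases o with
    | v => exact hv i j
    | u => exact hu i j
    | z => exact inv_mem_typed hv h1 h2 j i
  pair_mul := by
    rintro _ _ ⟨rfl, rfl⟩
    exact h1
  mul_pair := by
    rintro _ _ ⟨rfl, rfl⟩
    exact h2
  intw := by
    rintro _ _ _ (⟨rfl, rfl, rfl⟩ | ⟨rfl, rfl, rfl⟩ | ⟨rfl, rfl, rfl⟩)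
    exacts [h3, h4, h5]

lemma unitaryPres_d_v : (unitaryPres g F).d .v = g := rfl

lemma orthogonalPres_d_v : (orthogonalPres α g F G).d .v = g := rfl

namespace IsSystem

variable {X : Idx.{u} → Matrix (Fin n) (Fin n) D}

lemma unitary_rel (h : IsSystem α (unitaryPres g F) r s X) :
    (twist α g F).map r * X .z = X .v * F.map s := by
  have h1 := h.intw (o := .z) (o' := .v) (T := F) ⟨rfl, rfl, rfl⟩
  rwa [unitaryPres_d_v] at h1

lemma orthogonal_rel (h : IsSystem α (orthogonalPres α g F G) r s X) :
    (twist α g F).map r * X .z = X .v * F.map s ∧ (twist α g G).map r * X .u = X .v * G.map s ∧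
      (twist α g (G * twist α g (G.map star))).map r * X .v =
        X .v * (G * twist α g (G.map star)).map s := by
  have h1 := h.intw (o := .z) (o' := .v) (T := F) (Or.inl ⟨rfl, rfl, rfl⟩)
  have h2 := h.intw (o := .u) (o' := .v) (T := G) (Or.inr (Or.inl ⟨rfl, rfl, rfl⟩))
  have h3 := h.intw (o := .v) (o' := .v) (T := G * twist α g (G.map star))
    (Or.inr (Or.inr ⟨rfl, rfl, rfl⟩))
  rw [orthogonalPres_d_v] at h1 h2 h3
  exact ⟨h1, h2, h3⟩

end IsSystem

/-- The transpose of an intertwining relation. -/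
lemma transpose_intw {d d' : Fin n → Γ} {T : Matrix (Fin n) (Fin n) B}
    (hv : ∀ i j, v i j ∈ typed α r s (d' i) (d' j)) (hz : ∀ i j, z i j ∈ typed α r s (d i) (d j))
    (hT : IsSupported d' d T) (h : (twist α d' T).map r * z = v * T.map s) :
    zᵀ * Tᵀ.map r = (twist α d' T)ᵀ.map s * vᵀ := by
  rw [← transpose_r_mul hz hT, h, transpose_mul_s hv]

end Systems

lemma twist_map_star (g : Fin n → Γ) (T : Matrix (Fin n) (Fin n) B) :
    (twist α g T).map star = twist α g (T.map star) := by
  ext i j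
  exact (map_star (α (g i)) _).symm

/-- `∇ Q ∇⁻¹ = (∇ G ∇) Ḡ`. -/
lemma twist_Q (hG : IsSupported g g⁻¹ G) :
    twist α g (G * twist α g (G.map star)) = twist α g G * G.map star := by
  rw [hG.twist_mul, twist_inv_twist]

lemma twist_transpose {d d' : Fin n → Γ} {T : Matrix (Fin n) (Fin n) B} (hT : IsSupported d' d T) :
    twist α d Tᵀ = (twist α d' T)ᵀ := by
  ext i j
  exact (hT.twist_apply_right j i).symm

/-- The relation `G F⋆ = F G⋆` is inherited by `∇ F ∇` and `∇ G ∇`. -/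
lemma twist_mul_conjTranspose (hF : IsSupported g g⁻¹ F) (hG : IsSupported g g⁻¹ G) :
    twist α g (G * Fᴴ) = twist α g G * (twist α g F)ᴴ := by
  rw [hG.twist_mul]
  congr 1
  ext i j
  show α (g i)⁻¹ (star (F j i)) = star (twist α g F j i)
  rw [hF.twist_apply_right]
  exact map_star (α (g i)⁻¹) _

/-- In a system for the orthogonal presentation, `r_n(Ḡ) v = u s_n(∇ Ḡ ∇)`. -/
lemma map_star_mul_eq {D : Type u} [Ring D] [Algebra ℂ D] {r s : B →ₐ[ℂ] D}
    {v u : Matrix (Fin n) (Fin n) D} (hG : IsUnit G) (hG' : IsSupported g g⁻¹ G)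
    (h4 : (twist α g G).map r * u = v * G.map s)
    (h5 : (twist α g (G * twist α g (G.map star))).map r * v =
      v * (G * twist α g (G.map star)).map s) :
    (G.map star).map r * v = u * (twist α g (G.map star)).map s := by
  refine (isUnit_map r (hG'.isUnit (α := α) hG)).mul_left_cancel ?_
  rw [← mul_assoc, ← map_algHom_mul, ← twist_Q hG', h5, map_algHom_mul, ← mul_assoc, ← mul_assoc, h4]

end Presentations

/-! ### The involutions of the free algebras -/

section Involutions

open Matrix

variable {B Γ : Type u} [CommCStarAlgebra B] [Group Γ] {α : Γ →* (B ≃⋆ₐ[ℂ] B)} {n : ℕ}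
  {g : Fin n → Γ} {F G : Matrix (Fin n) (Fin n) B}

lemma inverse_of_intw {D : Type u} [Ring D] {a a' p p' q w : Matrix (Fin n) (Fin n) D}
    (h1 : a * a' = 1) (h2 : a' * a = 1)
    (h3 : p * p' = 1) (h4 : p' * p = 1) (hq : IsUnit q) (h : a * p = q * w) :
    w * (p' * a' * q) = 1 ∧ p' * a' * q * w = 1 := by
  constructor
  · refine hq.mul_left_cancel ?_
    calc q * (w * (p' * a' * q)) = (q * w) * p' * a' * q := by simp only [mul_assoc]
      _ = a * (p * p') * a' * q := by rw [← h]; simp only [mul_assoc]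
      _ = q * 1 := by rw [h3, mul_one, h1, one_mul, mul_one]
  · calc p' * a' * q * w = p' * a' * (a * p) := by rw [h, mul_assoc]
      _ = p' * (a' * a) * p := by simp only [mul_assoc]
      _ = 1 := by rw [h2, mul_one, h4]

lemma conj_mem_typed {D : Type u} [Ring D] [Algebra ℂ D] {r s : B →ₐ[ℂ] D}
    (hc : ∀ b c, Commute (r b) (s c)) {d d' e e' : Fin n → Γ} {M : Matrix (Fin n) (Fin n) D}
    (hM : ∀ i j, M i j ∈ typed α r s (d i) (d' j)) {R T : Matrix (Fin n) (Fin n) B}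
    (hR : IsSupported e d R) (hT : IsSupported d' e' T) (i j : Fin n) :
    (R.map r * M * T.map s) i j ∈ typed α r s (e i) (e' j) := by
  have key : ∀ {γ γ' : Γ} {x : D} (b c : B), x ∈ typed α r s γ γ' →
      r b * x * s c ∈ typed α r s γ γ' := fun {γ γ' x} b c hx => by
    have hr : r b ∈ typed α r s 1 1 :=
      ⟨fun b' => by rw [map_one, ← map_mul, mul_comm, map_mul]; rfl,
        fun c' => by rw [map_one]; exact hc b c'⟩
    have hs : s c ∈ typed α r s 1 1 :=
      ⟨fun b' => by rw [map_one]; exact (hc b' c).symm,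
        fun c' => by rw [map_one, ← map_mul, mul_comm, map_mul]; rfl⟩
    have h := mul_mem_typed (mul_mem_typed hr hx) hs
    rwa [one_mul, one_mul, mul_one, mul_one] at h
  exact conj_mem (gr := fun γ γ' => typed α r s γ γ') key hM hR hT i j

/-- The matrices of adjoints of a system for the unitary presentation: they are `u`, `v` and the
inverse of the transpose of `v`, which is conjugate to `u`. The relation of `F` for these matrices
holds because `F` is hermitian. -/
lemma exists_conj_unitary (hF : IsUnit F) (hF' : IsSupported g g F) (hFs : Fᴴ = F) {D : Type u}
    [Ring D] [Algebra ℂ D] {r s : B →ₐ[ℂ] D} {X : Idx.{u} → Matrix (Fin n) (Fin n) D}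
    (h : IsSystem α (unitaryPres g F) r s X) :
    ∃ Z : Idx.{u} → Matrix (Fin n) (Fin n) D, IsSystem α (unitaryPres g F) (ConjOp.starLift r)
      (ConjOp.starLift s) (fun o => (Z o).map ConjOp.mk) ∧ Z .v = X .u ∧ Z .u = X .v := by
  have hbar : F.map star = Fᵀ := by rw [← congrArg transpose hFs]; rfl
  have hbar' : (twist α g F).map star = (twist α g F)ᵀ := by
    rw [twist_map_star, hbar, twist_transpose hF']
  obtain ⟨E, hE, hE'⟩ := isUnit_iff_exists.1 ((isUnit_transpose F).2 hF)
  have hr : Fᵀ.map r * E.map r = 1 := by rw [← map_algHom_mul, hE, map_algHom_one]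
  have hr' : E.map r * Fᵀ.map r = 1 := by rw [← map_algHom_mul, hE', map_algHom_one]
  -- `y` is the inverse of the transpose of `v`
  let y := E.map r * X .u * (twist α g F)ᵀ.map s
  have hvu : (unitaryPres g F).pairs .v .u := Or.inl ⟨rfl, rfl⟩
  have huz : (unitaryPres g F).pairs .u .z := Or.inr ⟨rfl, rfl⟩
  have hy : (X .v)ᵀ * y = 1 ∧ y * (X .v)ᵀ = 1 :=
    inverse_of_intw (h.mul_pair huz) (h.pair_mul huz) hr hr'
      (isUnit_map s ((isUnit_transpose _).2 (hF'.isUnit hF)))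
      (transpose_intw (d := g) (d' := g) (h.typed .v) (h.typed .z) hF' h.unitary_rel)
  refine ⟨Idx.family (X .u) (X .v) y, ?_, rfl, rfl⟩
  refine h.conjOp (unitaryPres_isRegular hF hF') (fun o i j => ?_) ?_ ?_
  · cases o with
    | v => exact h.typed .u i j
    | u =>
      show X .v i j ∈ typed α r s (g i)⁻¹⁻¹ (g j)⁻¹⁻¹
      rw [inv_inv, inv_inv]
      exact h.typed .v i j
    | z =>
      exact conj_mem_typed h.commute (d := g⁻¹) (d' := g⁻¹) (e := g⁻¹) (e' := g⁻¹) (h.typed .u)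
        (hF'.transpose.inverse hE hE').inv_inv (hF'.twist g).transpose.inv_inv i j
  · rintro _ _ (⟨rfl, rfl⟩ | ⟨rfl, rfl⟩)
    · exact ⟨h.pair_mul hvu, h.mul_pair hvu⟩
    · exact ⟨hy.2, hy.1⟩
  · rintro _ _ T ⟨rfl, rfl, hT⟩
    rw [hT]
    show (F.map star).map r * y = X .u * ((twist α g F).map star).map s
    rw [hbar, hbar', ← mul_assoc, ← mul_assoc, hr, one_mul]

/-- The matrices of adjoints of a system for the orthogonal presentation: they are `u`, `v` and the
inverse of the transpose of `u`, which is conjugate to `v`. The relations of `F` and `Q` for these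
matrices follow from `G F⋆ = F G⋆` and from `r_n(Ḡ) v = u s_n(∇ Ḡ ∇)`. -/
lemma exists_conj_orthogonal (hF : IsUnit F) (hG : IsUnit G) (hF' : IsSupported g g⁻¹ F)
    (hG' : IsSupported g g⁻¹ G) (hFG : G * Fᴴ = F * Gᴴ) {D : Type u}
    [Ring D] [Algebra ℂ D] {r s : B →ₐ[ℂ] D} {X : Idx.{u} → Matrix (Fin n) (Fin n) D}
    (h : IsSystem α (orthogonalPres α g F G) r s X) :
    ∃ Z : Idx.{u} → Matrix (Fin n) (Fin n) D, IsSystem α (orthogonalPres α g F G)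
      (ConjOp.starLift r) (ConjOp.starLift s) (fun o => (Z o).map ConjOp.mk) ∧
      Z .v = X .u ∧ Z .u = X .v := by
  have hFG' : twist α g G * (twist α g F)ᴴ = twist α g F * (twist α g G)ᴴ := by
    rw [← twist_mul_conjTranspose hF' hG', hFG, twist_mul_conjTranspose hG' hF']
  have e1 : F.map star * Gᵀ = G.map star * Fᵀ := by
    have h1 := congrArg transpose hFG
    rwa [transpose_mul, transpose_mul] at h1
  have e2 : (twist α g G).map star * (twist α g F)ᵀ = (twist α g F).map star * (twist α g G)ᵀ := by
    have h1 := congrArg transpose hFG'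
    rw [transpose_mul, transpose_mul] at h1
    exact h1.symm
  set F₁ := twist α g F with hF₁
  set G₁ := twist α g G with hG₁
  obtain ⟨E, hE, hE'⟩ := isUnit_iff_exists.1 ((isUnit_transpose F).2 hF)
  obtain ⟨E₁, hE₁, hE₁'⟩ := isUnit_iff_exists.1 ((isUnit_transpose F₁).2 (hF'.isUnit hF))
  obtain ⟨K, hK, hK'⟩ := isUnit_iff_exists.1 ((isUnit_transpose G).2 hG)
  obtain ⟨K₁, hK₁, hK₁'⟩ := isUnit_iff_exists.1 ((isUnit_transpose G₁).2 (hG'.isUnit hG))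
  have hvz : (orthogonalPres α g F G).pairs .v .z := ⟨rfl, rfl⟩
  obtain ⟨hzv, huv, hvv⟩ := h.orthogonal_rel
  have hzT := transpose_intw (d := g⁻¹) (d' := g) (h.typed .v) (h.typed .z) hF' hzv
  have huT := transpose_intw (d := g⁻¹) (d' := g) (h.typed .v) (h.typed .u) hG' huv
  -- `y` is the inverse of the transpose of `u`
  let y := (Gᵀ * E).map r * X .v * (F₁ᵀ * K₁).map s
  have hy : (X .u)ᵀ * y = 1 ∧ y * (X .u)ᵀ = 1 := by
    refine inverse_of_intw (p := (Fᵀ * K).map r) (h.mul_pair hvz) (h.pair_mul hvz) ?_ ?_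
      (isUnit_map s (((isUnit_transpose F₁).2 (hF'.isUnit hF)).mul
        (isUnit_iff_exists.2 ⟨_, hK₁', hK₁⟩))) ?_
    · rw [← map_algHom_mul, mul_assoc, ← mul_assoc K, hK', one_mul, hE, map_algHom_one]
    · rw [← map_algHom_mul, mul_assoc, ← mul_assoc E, hE', one_mul, hK, map_algHom_one]
    · have h1 : (X .v)ᵀ = K₁.map s * ((X .u)ᵀ * Gᵀ.map r) :=
        (congrArg (K₁.map s * ·) huT).trans (by
          rw [← mul_assoc, ← map_algHom_mul]
          refine (congrArg (· * (X .v)ᵀ) (congrArg (fun M => M.map s) hK₁')).trans ?_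
          rw [map_algHom_one, one_mul]) |>.symm
      have h2 : (X .z)ᵀ * Fᵀ.map r = F₁ᵀ.map s * (K₁.map s * ((X .u)ᵀ * Gᵀ.map r)) :=
        hzT.trans (congrArg (F₁ᵀ.map s * ·) h1)
      rw [map_algHom_mul, ← mul_assoc, h2, map_algHom_mul, mul_assoc, mul_assoc, mul_assoc,
        mul_assoc, ← map_algHom_mul, hK, map_algHom_one, mul_one]
  have hQ := map_star_mul_eq hG hG' huv hvv
  refine ⟨Idx.family (X .u) (X .v) y, ?_, rfl, rfl⟩
  refine h.conjOp (orthogonalPres_isRegular hF hG hF' hG') (fun o i j => ?_) ?_ ?_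
  · cases o with
    | v => exact h.typed .u i j
    | u =>
      show X .v i j ∈ typed α r s (g i)⁻¹⁻¹ (g j)⁻¹⁻¹
      rw [inv_inv, inv_inv]
      exact h.typed .v i j
    | z =>
      show y i j ∈ typed α r s (g i)⁻¹⁻¹ (g j)⁻¹⁻¹
      rw [inv_inv, inv_inv]
      have s1 := (hG'.transpose.mul (hF'.transpose.inverse hE hE')).inv_inv
      have s2 := ((hF'.twist (α := α) g).transpose.mul
        ((hG'.twist (α := α) g).transpose.inverse hK₁ hK₁')).inv_inv
      rw [_root_.inv_inv] at s1 s2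
      exact conj_mem_typed h.commute (h.typed .v) s1 s2 i j
  · rintro _ _ ⟨rfl, rfl⟩
    exact ⟨hy.2, hy.1⟩
  · rintro _ _ T (⟨rfl, rfl, hT⟩ | ⟨rfl, rfl, hT⟩ | ⟨rfl, rfl, hT⟩) <;> rw [hT]
    · show (F.map star).map r * y = X .u * (F₁.map star).map s
      calc (F.map star).map r * y
          = (F.map star * Gᵀ * E).map r * X .v * (F₁ᵀ * K₁).map s := by
            rw [← mul_assoc, ← mul_assoc, ← map_algHom_mul, mul_assoc (F.map star)]
        _ = (G.map star).map r * X .v * (F₁ᵀ * K₁).map s := by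
            rw [e1, mul_assoc (G.map star), hE, mul_one]
        _ = X .u * (G₁.map star * F₁ᵀ * K₁).map s := by
            rw [hQ, ← twist_map_star, mul_assoc, ← map_algHom_mul, mul_assoc (G₁.map star)]
        _ = X .u * (F₁.map star).map s := by rw [e2, mul_assoc, hK₁, mul_one]
    · show (G.map star).map r * X .v = X .u * (G₁.map star).map s
      rw [hQ, ← twist_map_star]
    · show ((G * twist α g (G.map star)).map star).map r * X .u =
        X .u * ((twist α g (G * twist α g (G.map star))).map star).map s
      have hmul : ∀ M N : Matrix (Fin n) (Fin n) B, (M * N).map star = M.map star * N.map star :=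
        fun M N => Matrix.map_mul (f := starRingEnd B)
      have hss : ∀ M : Matrix (Fin n) (Fin n) B, (M.map star).map star = M := fun M => by
        ext i j
        exact star_star _
      rw [twist_Q hG', hmul, hmul, hss, ← twist_map_star, hss, map_algHom_mul, mul_assoc,
        map_algHom_mul,
        twist_map_star, ← mul_assoc (X .u), ← hQ, mul_assoc]
      exact congrArg _ huv

/-- A regular presentation whose systems have conjugate systems has a universal
`(B, Γ)`-`*`-algebra. -/
lemma exists_isPresented {P : MatrixPresentation B Γ n} (hP : P.IsRegular)
    (hd : P.d .u = (P.d .v)⁻¹)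
    (hconj : ∀ {D : Type u} [Ring D] [Algebra ℂ D] {r s : B →ₐ[ℂ] D}
      {X : Idx.{u} → Matrix (Fin n) (Fin n) D}, IsSystem α P r s X →
      ∃ Z : Idx.{u} → Matrix (Fin n) (Fin n) D, IsSystem α P (ConjOp.starLift r)
        (ConjOp.starLift s) (fun o => (Z o).map ConjOp.mk) ∧ Z .v = X .u ∧ Z .u = X .v) :
    ∃ (A : Type u) (_ : Ring A) (_ : StarRing A) (_ : Algebra ℂ A) (_ : StarModule ℂ A)
      (V : BGStarAlg α A) (X : Idx.{u} → Matrix (Fin n) (Fin n) A), IsPresented P V X := by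
  obtain ⟨A, _, _, r, s, X, h⟩ := exists_isUniversalAlg α P
  obtain ⟨Z, hZ, hv, hu⟩ := hconj h.sys
  obtain ⟨_, _, V, rfl, rfl, hX, hstar⟩ := h.exists_bgStarAlg hP hd hZ hv hu
  exact ⟨A, _, _, _, inferInstance, V, X, h, hX, hstar⟩

end Involutions

/-! ### The enveloping C⋆-algebra of a universal algebra -/

section Bounded

variable (A : Type u) [Ring A] [StarRing A] [Algebra ℂ A]

/-- The elements `a` for which `‖π a‖` is bounded independently of the representation `π`. -/
def boundedSubalgebra : Subalgebra ℂ A where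
  carrier := {a | ∃ c : ℝ, ∀ (D : Type u) [CStarAlgebra D] (π : A →⋆ₐ[ℂ] D), ‖π a‖ ≤ c}
  mul_mem' := by
    rintro a b ⟨c, hc⟩ ⟨d, hd⟩
    refine ⟨c * d, fun D _ π => ?_⟩
    rw [map_mul]
    exact (norm_mul_le _ _).trans (mul_le_mul (hc D π) (hd D π) (norm_nonneg _)
      ((norm_nonneg _).trans (hc D π)))
  add_mem' := by
    rintro a b ⟨c, hc⟩ ⟨d, hd⟩
    refine ⟨c + d, fun D _ π => ?_⟩
    rw [map_add]
    exact (norm_add_le _ _).trans (add_le_add (hc D π) (hd D π))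
  algebraMap_mem' z := by
    refine ⟨‖z‖, fun D _ π => ?_⟩
    rw [Algebra.algebraMap_eq_smul_one, map_smul, map_one, norm_smul]
    refine mul_le_of_le_one_right (norm_nonneg _) (norm_le_one_of_isometry ?_)
    rw [star_one, mul_one]

variable {A}

lemma hasEnvelopingCStar_of_bounded (h : boundedSubalgebra A = ⊤) : HasEnvelopingCStar A := by
  refine ⟨fun a => ?_⟩
  obtain ⟨c, hc⟩ := (h ▸ Algebra.mem_top : a ∈ boundedSubalgebra A)
  refine ⟨c, ?_⟩
  rintro _ ⟨D, _, π, rfl⟩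
  exact hc D π

lemma star_mem_boundedSubalgebra {a : A} (h : a ∈ boundedSubalgebra A) :
    star a ∈ boundedSubalgebra A := by
  obtain ⟨c, hc⟩ := h
  refine ⟨c, fun D _ π => ?_⟩
  rw [map_star, norm_star]
  exact hc D π

lemma map_mem_boundedSubalgebra {B : Type u} [CStarAlgebra B] (f : B →⋆ₐ[ℂ] A) (b : B) :
    f b ∈ boundedSubalgebra A :=
  ⟨‖b‖, fun _ _ π => NonUnitalStarAlgHom.norm_apply_le (π.comp f) b⟩

lemma norm_le_one_of_sum {D : Type*} [CStarAlgebra D] {ι : Type*} [Fintype ι] {x : ι → D}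
    (h : ∑ k, star (x k) * x k = 1) (k : ι) : ‖x k‖ ≤ 1 := by
  let _ := CStarAlgebra.spectralOrder D
  have _ := CStarAlgebra.spectralOrderedRing D
  have h1 := Finset.single_le_sum (fun i _ => star_mul_self_nonneg (x i)) (Finset.mem_univ k)
  rw [h] at h1
  have h2 := CStarAlgebra.norm_le_norm_of_nonneg_of_le (star_mul_self_nonneg (x k)) h1
  have h3 : ‖(1 : D)‖ ≤ 1 := norm_le_one_of_isometry (by rw [star_one, mul_one])
  rw [CStarRing.norm_star_mul_self] at h2
  nlinarith [norm_nonneg (x k)]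

open scoped Matrix in
/-- In every representation, the entries of an isometry are contractions. -/
lemma entry_mem_boundedSubalgebra {n : ℕ} {y : Matrix (Fin n) (Fin n) A} (h : yᴴ * y = 1)
    (i j : Fin n) : y i j ∈ boundedSubalgebra A := by
  refine ⟨1, fun D _ π => ?_⟩
  refine norm_le_one_of_sum (x := fun k => π (y k j)) ?_ i
  have h1 := congrArg π (congrFun (congrFun h j) j)
  rw [Matrix.mul_apply, map_sum, Matrix.one_apply_eq, map_one] at h1
  refine Eq.trans (Finset.sum_congr rfl fun k _ => ?_) h1
  rw [map_mul, Matrix.conjTranspose_apply, map_star]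

end Bounded

section PresentedEnvelope

open Matrix

variable {B Γ : Type u} [CommCStarAlgebra B] [Group Γ] {α : Γ →* (B ≃⋆ₐ[ℂ] B)} {n : ℕ}
  {P : MatrixPresentation B Γ n} {A A₀ : Type u} [Ring A] [StarRing A] [Algebra ℂ A]
  [StarModule ℂ A] [Ring A₀] [StarRing A₀] [Algebra ℂ A₀] [StarModule ℂ A₀] {V : BGStarAlg α A}
  {X : Idx.{u} → Matrix (Fin n) (Fin n) A}

namespace IsPresented

lemma hasEnvelopingCStar (h : IsPresented P V X) (hP : P.IsRegular)
    (hb : ∀ i j, X .v i j ∈ boundedSubalgebra A) : HasEnvelopingCStar A := by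
  refine hasEnvelopingCStar_of_bounded (h.univ.generates' hP _
    (map_mem_boundedSubalgebra V.r) (map_mem_boundedSubalgebra V.s) hb fun i j => ?_)
  rw [← h.star_v]
  exact star_mem_boundedSubalgebra (hb i j)

/-- Being universal is invariant under isomorphisms. -/
lemma of_equiv {V₀ : BGStarAlg α A₀} {X₀ : Idx.{u} → Matrix (Fin n) (Fin n) A₀}
    (h : IsPresented P V₀ X₀) {φ : A₀ →⋆ₐ[ℂ] A}
    (hφ : IsBGStarHom V₀.toBGStarData V.toBGStarData φ) (ψ : A →ₐ[ℂ] A₀)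
    (h1 : ∀ a, φ (ψ a) = a) (h2 : ∀ a, ψ (φ a) = a) :
    IsPresented P V fun o => (X₀ o).map φ where
  univ :=
    { sys := by
        have h3 := h.univ.sys.map (φ : A₀ →ₐ[ℂ] A)
        have hr : (φ : A₀ →ₐ[ℂ] A).comp (V₀.r : B →ₐ[ℂ] A₀) = (V.r : B →ₐ[ℂ] A) :=
          AlgHom.ext hφ.map_r
        have hs : (φ : A₀ →ₐ[ℂ] A).comp (V₀.s : B →ₐ[ℂ] A₀) = (V.s : B →ₐ[ℂ] A) :=
          AlgHom.ext hφ.map_s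
        rw [hr, hs] at h3
        exact h3
      exists_hom := fun D _ _ r s Y hY => by
        obtain ⟨f, hr, hs, hf⟩ := h.univ.exists_hom D r s Y hY
        refine ⟨f.comp ψ, fun b => ?_, fun b => ?_, fun o i j => ?_⟩
        · exact (congrArg f ((congrArg ψ (hφ.map_r b).symm).trans (h2 _))).trans (hr b)
        · exact (congrArg f ((congrArg ψ (hφ.map_s b).symm).trans (h2 _))).trans (hs b)
        · exact (congrArg f (h2 _)).trans (hf o i j)
      generates := fun N hr hs hX => by
        have h3 := h.univ.generates (N.comap (φ : A₀ →ₐ[ℂ] A))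
          (fun b => by
            show φ (V₀.r b) ∈ N
            rw [hφ.map_r]
            exact hr b)
          (fun b => by
            show φ (V₀.s b) ∈ N
            rw [hφ.map_s]
            exact hs b) hX
        rw [eq_top_iff]
        rintro a -
        have h4 : ψ a ∈ N.comap (φ : A₀ →ₐ[ℂ] A) := h3 ▸ Algebra.mem_top
        rw [← h1 a]
        exact h4 }
  mem o i j := hφ.map_gr (h.mem o i j)
  star_v i j := (map_star φ _).symm.trans (congrArg φ (h.star_v i j))

variable [HasEnvelopingCStar A]

/-- The enveloping C⋆-algebra of a universal algebra is universal for the relations `R` if the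
matrices satisfying `R` are those which belong to a system of a `*`-algebra. -/
lemma isUniversalCStar (h : IsPresented P V X) (hP : P.IsRegular)
    {R : ∀ (D : Type u) [CStarAlgebra D], (B →⋆ₐ[ℂ] D) → (B →⋆ₐ[ℂ] D) →
      Matrix (Fin n) (Fin n) D → Prop}
    (hR : R (CStarEnv A) (envData V).r (envData V).s ((X .v).map CStarEnv.of))
    (hR' : ∀ (D : Type u) [CStarAlgebra D] (r s : B →⋆ₐ[ℂ] D) (v : Matrix (Fin n) (Fin n) D),
      R D r s v → ∃ Y : Idx.{u} → Matrix (Fin n) (Fin n) D,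
        IsSystem α P (r : B →ₐ[ℂ] D) (s : B →ₐ[ℂ] D) Y ∧ (∀ i j, Y .u i j = star (Y .v i j)) ∧
          Y .v = v) :
    IsUniversalCStar R (envData V).r (envData V).s ((X .v).map CStarEnv.of) where
  rel := hR
  generates := by
    let S := StarAlgebra.adjoin ℂ (Set.range (envData V).r ∪ Set.range (envData V).s ∪
      {x | ∃ i j, x = ((X .v).map CStarEnv.of : Matrix (Fin n) (Fin n) (CStarEnv A)) i j})
    have hsub := StarAlgebra.subset_adjoin ℂ (Set.range (envData V).r ∪ Set.range (envData V).s ∪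
      {x | ∃ i j, x = ((X .v).map CStarEnv.of : Matrix (Fin n) (Fin n) (CStarEnv A)) i j})
    have hv : ∀ i j, (CStarEnv.of (X .v i j) : CStarEnv A) ∈ S := fun i j =>
      hsub (Or.inr ⟨i, j, rfl⟩)
    have h1 : S.toSubalgebra.comap (CStarEnv.of (A := A) : A →ₐ[ℂ] CStarEnv A) = ⊤ := by
      refine h.univ.generates' hP _ (fun b => hsub (Or.inl (Or.inl ⟨b, rfl⟩)))
        (fun b => hsub (Or.inl (Or.inr ⟨b, rfl⟩))) hv fun i j => ?_
      show CStarEnv.of (X .u i j) ∈ S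
      rw [← h.star_v, map_star]
      exact star_mem (hv i j)
    refine (CStarEnv.denseRange_of (A := A)).mono ?_ |>.closure_eq
    rintro _ ⟨a, rfl⟩
    exact (h1 ▸ Algebra.mem_top :
      a ∈ S.toSubalgebra.comap (CStarEnv.of (A := A) : A →ₐ[ℂ] CStarEnv A))
  universal D _ r s v hv := by
    obtain ⟨Y, hY, hYs, rfl⟩ := hR' D r s v hv
    obtain ⟨f, hr, hs, hf⟩ := h.exists_starHom hP hY hYs
    refine ⟨CStarEnv.lift f, ⟨fun b => ?_, fun b => ?_, fun i j => ?_⟩, ?_⟩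
    · exact (CStarEnv.lift_of f _).trans (hr b)
    · exact (CStarEnv.lift_of f _).trans (hs b)
    · exact (CStarEnv.lift_of f _).trans (hf .v i j)
    · rintro f' ⟨hr', hs', hf'⟩
      have h1 : f'.comp CStarEnv.of = f := by
        refine h.starHom_ext hP (fun b => ?_) (fun b => ?_) fun i j => ?_
        · exact (hr' b).trans (hr b).symm
        · exact (hs' b).trans (hs b).symm
        · exact (hf' i j).trans (hf .v i j).symm
      refine CStarEnv.hom_ext fun a => ?_
      exact (congrArg (fun f => f a) h1).trans (CStarEnv.lift_of f a).symm

/-- The Hopf structure of a universal algebra passes to its enveloping C⋆-algebra. -/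
lemma exists_compactHopf (h : IsPresented P V X) (hP : P.IsRegular) (hd : P.d .u = (P.d .v)⁻¹) :
    ∃ H : HopfStarAlgebroid V, IsMatrixCorep H (h.mem .v) ∧ ∃ K : CompactHopf α (envData V),
      K.Extends H ∧ K.IsCounit (CStarEnv.map H.ε) ∧
        IsExplicit K (CStarEnv.map H.ε) (P.d .v) ((X .v).map CStarEnv.of) := by
  obtain ⟨H, hH⟩ := h.exists_hopf hP hd
  obtain ⟨K, hK, hε⟩ := H.exists_compactHopf
  refine ⟨H, hH, K, hK, hε, fun i j => (of_mem_envData V (h.mem .v i j)).1,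
    fun i j => (of_mem_envData V (h.mem .v i j)).2, fun i j => ?_, fun i j => ?_⟩
  · obtain ⟨f, hf, hfΔ⟩ := hK
    refine (hfΔ (X .v i j)).trans ((congrArg f (hH.Δ_eq i j)).trans ((map_sum f _ _).trans ?_))
    exact Finset.sum_congr rfl fun k _ => hf (h.mem .v i k) (h.mem .v k j)
  · refine (CStarEnv.lift_of _ (X .v i j)).trans ((congrArg CStarEnv.of (hH.ε_eq i j)).trans ?_)
    by_cases hij : i = j
    · rw [if_pos hij, if_pos hij, iotaΓ_gen]
    · rw [if_neg hij, if_neg hij, map_zero]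

end IsPresented

end PresentedEnvelope

/-! ### The free unitary and the free orthogonal algebras -/

section FreeAlgebras

open Matrix

variable {B Γ : Type u} [CommCStarAlgebra B] [Group Γ] {α : Γ →* (B ≃⋆ₐ[ℂ] B)} {n : ℕ}

lemma IsBGAlg.typed_le {A : Type u} [Ring A] [Algebra ℂ A] {gr : Γ → Γ → Submodule ℂ A}
    {r s : B →ₐ[ℂ] A} (h : IsBGAlg α gr r s) (γ γ' : Γ) : gr γ γ' ≤ typed α r s γ γ' :=
  fun _ ha => ⟨fun b => h.mul_r b ha, fun b => h.mul_s b ha⟩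

lemma IsBGAlg.conj_mem {A : Type u} [Ring A] [Algebra ℂ A] {gr : Γ → Γ → Submodule ℂ A}
    {r s : B →ₐ[ℂ] A} (h : IsBGAlg α gr r s) {d d' e e' : Fin n → Γ} {M : Matrix (Fin n) (Fin n) A}
    (hM : ∀ i j, M i j ∈ gr (d i) (d' j)) {R T : Matrix (Fin n) (Fin n) B}
    (hR : IsSupported e d R) (hT : IsSupported d' e' T) (i j : Fin n) :
    (R.map r * M * T.map s) i j ∈ gr (e i) (e' j) := by
  refine _root_.conj_mem (gr := gr) (fun {γ γ' x} b c hx => ?_) hM hR hT i j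
  have h1 := h.mul_mem (h.mul_mem (h.r_mem b) hx) (h.s_mem c)
  rwa [one_mul, one_mul, mul_one, mul_one] at h1

/-- A homomorphism on a universal algebra preserves the grading if it preserves the degrees of the
entries of `X_v` and `X_u`. -/
lemma IsUniversalAlg.map_gr {P : MatrixPresentation B Γ n} (hP : P.IsRegular) {A C : Type u} [Ring A]
    [Algebra ℂ A] [Ring C] [Algebra ℂ C] {r s : B →ₐ[ℂ] A} {r' s' : B →ₐ[ℂ] C}
    {X : Idx.{u} → Matrix (Fin n) (Fin n) A} (h : IsUniversalAlg α P r s X)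
    {gr : Γ → Γ → Submodule ℂ A} {gr' : Γ → Γ → Submodule ℂ C} (hA : IsBGAlg α gr r s)
    (hC : IsBGAlg α gr' r' s') (hX : ∀ o i j, X o i j ∈ gr (P.d o i) (P.d o j)) {f : A →ₐ[ℂ] C}
    (hr : ∀ b, f (r b) = r' b) (hs : ∀ b, f (s b) = s' b)
    (hv : ∀ i j, f (X .v i j) ∈ gr' (P.d .v i) (P.d .v j))
    (hu : ∀ i j, f (X .u i j) ∈ gr' (P.d .u i) (P.d .u j)) {γ γ' : Γ} {a : A}
    (ha : a ∈ gr γ γ') : f a ∈ gr' γ γ' := by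
  refine (h.graded_induction hP hA.indep
    (fun γ γ' => gr γ γ' ⊓ (gr' γ γ').comap f.toLinearMap) (fun _ _ => inf_le_left) ?_ ?_ ?_ ?_ ?_
      γ γ' ha).2
  · rintro γ γ' δ δ' a b ⟨ha, ha'⟩ ⟨hb, hb'⟩
    refine ⟨hA.mul_mem ha hb, ?_⟩
    show f (a * b) ∈ gr' (γ * δ) (γ' * δ')
    rw [map_mul]
    exact hC.mul_mem ha' hb'
  · refine fun b => ⟨hA.r_mem b, ?_⟩
    show f (r b) ∈ gr' 1 1
    rw [hr]
    exact hC.r_mem b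
  · refine fun b => ⟨hA.s_mem b, ?_⟩
    show f (s b) ∈ gr' 1 1
    rw [hs]
    exact hC.s_mem b
  · exact fun i j => ⟨hX .v i j, hv i j⟩
  · exact fun i j => ⟨hX .u i j, hu i j⟩

section Relations

variable {g : Fin n → Γ} {F G : Matrix (Fin n) (Fin n) B} {C : Type u} [Ring C] [StarRing C]
  [Algebra ℂ C] {r s : B →⋆ₐ[ℂ] C} {v : Matrix (Fin n) (Fin n) C}

lemma star_mem_typed {γ γ' : Γ} {x : C} (hx : x ∈ typed α (r : B →ₐ[ℂ] C) (s : B →ₐ[ℂ] C) γ γ') :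
    star x ∈ typed α (r : B →ₐ[ℂ] C) (s : B →ₐ[ℂ] C) γ⁻¹ γ'⁻¹ := by
  constructor
  · intro b
    show star x * r b = r (α γ⁻¹ b) * star x
    have h1 : r (star b) * x = x * r (α γ⁻¹ (star b)) := typed_mul_r hx _
    rw [map_star r, map_star (α γ⁻¹), map_star r] at h1
    have h2 := congrArg star h1
    rwa [star_mul, star_mul, star_star, star_star] at h2
  · intro b
    show star x * s b = s (α γ'⁻¹ b) * star x
    have h1 : s (star b) * x = x * s (α γ'⁻¹ (star b)) := typed_mul_s hx _
    rw [map_star s, map_star (α γ'⁻¹), map_star s] at h1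
    have h2 := congrArg star h1
    rwa [star_mul, star_mul, star_star, star_star] at h2

lemma UnitaryRel.exists_isSystem (hc : ∀ b c, Commute (r b) (s c))
    (hv : ∀ i j, v i j ∈ typed α (r : B →ₐ[ℂ] C) (s : B →ₐ[ℂ] C) (g i) (g j))
    (h : UnitaryRel α g F r s v) : ∃ Y : Idx.{u} → Matrix (Fin n) (Fin n) C,
      IsSystem α (unitaryPres g F) (r : B →ₐ[ℂ] C) (s : B →ₐ[ℂ] C) Y ∧
        (∀ i j, Y .u i j = star (Y .v i j)) ∧ Y .v = v := by
  obtain ⟨h1, h2, w, h3, h4, h5⟩ := h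
  exact ⟨Idx.family v (v.map star) wᵀ, isSystem_unitaryPres hc hv
    (fun i j => star_mem_typed (hv i j)) h1 h2 h3 h4 h5, fun _ _ => rfl, rfl⟩

lemma IsSystem.unitaryRel {Y : Idx.{u} → Matrix (Fin n) (Fin n) C}
    (h : IsSystem α (unitaryPres g F) (r : B →ₐ[ℂ] C) (s : B →ₐ[ℂ] C) Y)
    (hY : ∀ i j, Y .u i j = star (Y .v i j)) : UnitaryRel α g F r s (Y .v) := by
  have hu : Y .u = (Y .v).map star := by
    ext i j
    exact hY i j
  have h1 := h.pair_mul (o := .v) (p := .u) (Or.inl ⟨rfl, rfl⟩)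
  have h2 := h.mul_pair (o := .v) (p := .u) (Or.inl ⟨rfl, rfl⟩)
  have h3 := h.pair_mul (o := .u) (p := .z) (Or.inr ⟨rfl, rfl⟩)
  have h4 := h.mul_pair (o := .u) (p := .z) (Or.inr ⟨rfl, rfl⟩)
  rw [hu] at h1 h2 h3 h4
  exact ⟨h1, h2, (Y .z)ᵀ, h3, h4, h.unitary_rel⟩

/-- The adjoint of the relation `r_n(∇G∇) v̄ = v s_n(G)`. -/
lemma BarRel.star_rel (hG : IsSupported g g⁻¹ G)
    (hv : ∀ i j, v i j ∈ typed α (r : B →ₐ[ℂ] C) (s : B →ₐ[ℂ] C) (g i) (g j))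
    (h : BarRel α g G r s v) :
    (G.map star).map r * v = v.map star * (twist α g (G.map star)).map s := by
  ext i j
  have h1 := congrArg star (congrFun (congrFun h i) j)
  rw [mul_apply, mul_apply, star_sum, star_sum] at h1
  rw [mul_apply, mul_apply]
  refine (Finset.sum_congr rfl fun k _ => ?_).trans (h1.trans (Finset.sum_congr rfl fun k _ => ?_))
  · show r (star (G i k)) * v k j = star (r (twist α g G i k) * star (v k j))
    rw [star_mul, star_star, ← map_star r, hG.twist_apply_right]
    refine Eq.trans ?_ ((hv k j).1 _).symm
    show _ = r (α (g k) (star (α (g k)⁻¹ (G i k)))) * v k j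
    rw [← map_star (α (g k)⁻¹), map_apply_inv]
  · show star (v i k * s (G k j)) = star (v i k) * s (α (g k) (star (G k j)))
    rw [star_mul, ← map_star s]
    refine Eq.trans ?_ ((star_mem_typed (hv i k)).2 _).symm
    show _ = s (α (g k)⁻¹ (α (g k) (star (G k j)))) * star (v i k)
    rw [inv_apply_map]

lemma exists_isSystem_orthogonalPres (hG : IsSupported g g⁻¹ G) (hc : ∀ b c, Commute (r b) (s c))
    (hv : ∀ i j, v i j ∈ typed α (r : B →ₐ[ℂ] C) (s : B →ₐ[ℂ] C) (g i) (g j))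
    (h : InvTransposeRel α g F (r : B →ₐ[ℂ] C) (s : B →ₐ[ℂ] C) v) (hb : BarRel α g G r s v) :
    ∃ Y : Idx.{u} → Matrix (Fin n) (Fin n) C,
      IsSystem α (orthogonalPres α g F G) (r : B →ₐ[ℂ] C) (s : B →ₐ[ℂ] C) Y ∧
        (∀ i j, Y .u i j = star (Y .v i j)) ∧ Y .v = v := by
  obtain ⟨w, h1, h2, h3⟩ := h
  refine ⟨Idx.family v (v.map star) wᵀ, isSystem_orthogonalPres hc hv
    (fun i j => star_mem_typed (hv i j)) h1 h2 h3 hb ?_, fun _ _ => rfl, rfl⟩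
  rw [twist_Q hG, map_algHom_mul, map_algHom_mul, mul_assoc]
  refine (congrArg _ (hb.star_rel hG hv)).trans ?_
  rw [← mul_assoc, ← mul_assoc]
  exact congrArg (· * _) hb

lemma IsSystem.barRel {Y : Idx.{u} → Matrix (Fin n) (Fin n) C}
    (h : IsSystem α (orthogonalPres α g F G) (r : B →ₐ[ℂ] C) (s : B →ₐ[ℂ] C) Y)
    (hY : ∀ i j, Y .u i j = star (Y .v i j)) : BarRel α g G r s (Y .v) := by
  have hu : Y .u = (Y .v).map star := by
    ext i j
    exact hY i j
  have h1 := h.orthogonal_rel.2.1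
  rw [hu] at h1
  exact h1

lemma IsSystem.invTransposeRel {D : Type u} [Ring D] [Algebra ℂ D] {r s : B →ₐ[ℂ] D}
    {Y : Idx.{u} → Matrix (Fin n) (Fin n) D} (h : IsSystem α (orthogonalPres α g F G) r s Y) :
    InvTransposeRel α g F r s (Y .v) :=
  ⟨(Y .z)ᵀ, h.pair_mul (o := .v) (p := .z) ⟨rfl, rfl⟩, h.mul_pair (o := .v) (p := .z) ⟨rfl, rfl⟩,
    h.orthogonal_rel.1⟩

end Relations

variable {g : Fin n → Γ} {F G : Matrix (Fin n) (Fin n) B} {A : Type u} [Ring A] [StarRing A]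
  [Algebra ℂ A] [StarModule ℂ A] {V : BGStarAlg α A} {X : Idx.{u} → Matrix (Fin n) (Fin n) A}

lemma IsPresented.isFreeUnitary (hF : IsUnit F) (hF' : IsSupported g g F)
    (h : IsPresented (unitaryPres g F) V X) : IsFreeUnitary α g F V (X .v) where
  v_mem := h.mem .v
  rel := h.univ.sys.unitaryRel fun i j => (h.star_v i j).symm
  universal C _ _ _ _ W w hw hrel := by
    have hP := unitaryPres_isRegular hF hF'
    obtain ⟨Y, hY, hYs, rfl⟩ := hrel.exists_isSystem W.isBGAlg.commute
      fun i j => W.isBGAlg.typed_le _ _ (hw i j)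
    obtain ⟨f, hr, hs, hf⟩ := h.exists_starHom hP hY hYs
    refine ⟨f, ⟨⟨fun ha => ?_, hr, hs⟩, hf .v⟩, ?_⟩
    · refine h.univ.map_gr hP (f := (f : A →ₐ[ℂ] C)) V.isBGAlg W.isBGAlg h.mem hr hs
        (fun i j => ?_) (fun i j => ?_) ha
      · show f (X .v i j) ∈ W.gr (g i) (g j)
        rw [hf]
        exact hw i j
      · show f (X .u i j) ∈ W.gr (g i)⁻¹ (g j)⁻¹
        rw [hf, hYs]
        exact W.star_mem (hw i j)
    · rintro f' ⟨hf1, hf2⟩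
      exact h.starHom_ext hP (fun b => (hf1.map_r b).trans (hr b).symm)
        (fun b => (hf1.map_s b).trans (hs b).symm) fun i j => (hf2 i j).trans (hf .v i j).symm

lemma IsPresented.isFreeOrthogonal (hF : IsUnit F) (hG : IsUnit G) (hF' : IsSupported g g⁻¹ F)
    (hG' : IsSupported g g⁻¹ G) (h : IsPresented (orthogonalPres α g F G) V X) :
    IsFreeOrthogonal α g F G V (X .v) where
  v_mem := h.mem .v
  rel_F := h.univ.sys.invTransposeRel
  rel_Q := h.univ.sys.orthogonal_rel.2.2
  rel_G := h.univ.sys.barRel fun i j => (h.star_v i j).symm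
  universal C _ _ W w hw hrel hQ := by
    have hP := orthogonalPres_isRegular (α := α) hF hG hF' hG'
    obtain ⟨w', h1, h2, h3⟩ := hrel
    obtain ⟨K, hK, hK'⟩ := isUnit_iff_exists.1 (hG'.isUnit (α := α) hG)
    have hu : ∀ i j, (K.map W.r * w * G.map W.s) i j ∈ W.gr (g i)⁻¹ (g j)⁻¹ :=
      W.isBGAlg.conj_mem (e := g⁻¹) (e' := g⁻¹) hw ((hG'.twist g).inverse hK hK') hG'
    have hY := isSystem_orthogonalPres (z := w'ᵀ) W.isBGAlg.commute
      (fun i j => W.isBGAlg.typed_le _ _ (hw i j)) (fun i j => W.isBGAlg.typed_le _ _ (hu i j))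
      h1 h2 h3 (by rw [← mul_assoc, ← mul_assoc, ← map_algHom_mul, hK, map_algHom_one, one_mul]) hQ
    obtain ⟨f, hr, hs, hf⟩ := h.univ.exists_hom _ _ _ _ hY
    refine ⟨f, ⟨⟨fun ha => ?_, hr, hs⟩, hf .v⟩, ?_⟩
    · refine h.univ.map_gr hP V.isBGAlg W.isBGAlg h.mem hr hs (fun i j => ?_) (fun i j => ?_) ha
      · rw [hf]
        exact hw i j
      · rw [hf]
        exact hu i j
    · rintro f' ⟨hf1, hf2⟩
      have e1 : ∀ b, f' (V.r b) = f (V.r b) := fun b => (hf1.map_r b).trans (hr b).symm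
      have e2 : ∀ b, f' (V.s b) = f (V.s b) := fun b => (hf1.map_s b).trans (hs b).symm
      have e3 : ∀ i j, f' (X .v i j) = f (X .v i j) := fun i j => (hf2 i j).trans (hf .v i j).symm
      refine h.univ.hom_ext hP e1 e2 e3 fun i j => ?_
      obtain ⟨R, -, -, -, hX⟩ := h.univ.sys.eq_conj hP (o := .u) (T := G)
        (Or.inr (Or.inl ⟨rfl, rfl, rfl⟩)) hG
      have h4 : X .u i j ∈ AlgHom.equalizer f' f := by
        rw [hX]
        exact conj_mem_subalgebra _ e1 e2 e3 R G i j
      exact h4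

/-- Universality determines the free unitary algebra up to isomorphism, so that it is universal for
the full system of relations, which does not refer to adjoints. -/
lemma IsFreeUnitary.exists_isPresented (hF : IsUnit F) (hF' : IsSupported g g F) (hFs : Fᴴ = F)
    {v : Matrix (Fin n) (Fin n) A} (hv : IsFreeUnitary α g F V v) :
    ∃ X : Idx.{u} → Matrix (Fin n) (Fin n) A, IsPresented (unitaryPres g F) V X ∧ X .v = v := by
  obtain ⟨A₀, _, _, _, _, V₀, X₀, h⟩ := _root_.exists_isPresented (unitaryPres_isRegular hF hF') rfl
    (exists_conj_unitary (α := α) hF hF' hFs)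
  have h₀ := h.isFreeUnitary hF hF'
  obtain ⟨φ, ⟨hφ, hφv⟩, -⟩ := h₀.universal A V v hv.v_mem hv.rel
  obtain ⟨ψ, ⟨hψ, hψv⟩, -⟩ := hv.universal A₀ V₀ (X₀ .v) h₀.v_mem h₀.rel
  have e1 : φ.comp ψ = StarAlgHom.id ℂ A := (hv.universal A V v hv.v_mem hv.rel).unique
    ⟨⟨fun ha => hφ.map_gr (hψ.map_gr ha), fun b => (congrArg φ (hψ.map_r b)).trans (hφ.map_r b),
      fun b => (congrArg φ (hψ.map_s b)).trans (hφ.map_s b)⟩,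
      fun i j => (congrArg φ (hψv i j)).trans (hφv i j)⟩ ⟨IsBGStarHom.id _, fun _ _ => rfl⟩
  have e2 : ψ.comp φ = StarAlgHom.id ℂ A₀ := (h₀.universal A₀ V₀ (X₀ .v) h₀.v_mem h₀.rel).unique
    ⟨⟨fun ha => hψ.map_gr (hφ.map_gr ha), fun b => (congrArg ψ (hφ.map_r b)).trans (hψ.map_r b),
      fun b => (congrArg ψ (hφ.map_s b)).trans (hψ.map_s b)⟩,
      fun i j => (congrArg ψ (hφv i j)).trans (hψv i j)⟩ ⟨IsBGStarHom.id _, fun _ _ => rfl⟩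
  refine ⟨_, h.of_equiv hφ (ψ : A →ₐ[ℂ] A₀) (DFunLike.congr_fun e1) (DFunLike.congr_fun e2), ?_⟩
  ext i j
  exact hφv i j

/-- Universality determines the free orthogonal algebra up to isomorphism, so that it is universal
for the full system of relations. -/
lemma IsFreeOrthogonal.exists_isPresented (hF : IsUnit F) (hG : IsUnit G)
    (hF' : IsSupported g g⁻¹ F) (hG' : IsSupported g g⁻¹ G) (hFG : G * Fᴴ = F * Gᴴ)
    {v : Matrix (Fin n) (Fin n) A} (hv : IsFreeOrthogonal α g F G V v) :
    ∃ X : Idx.{u} → Matrix (Fin n) (Fin n) A,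
      IsPresented (orthogonalPres α g F G) V X ∧ X .v = v := by
  have hP := orthogonalPres_isRegular (α := α) hF hG hF' hG'
  obtain ⟨A₀, _, _, _, _, V₀, X₀, h⟩ := _root_.exists_isPresented hP rfl
    (exists_conj_orthogonal hF hG hF' hG' hFG)
  have h₀ := h.isFreeOrthogonal hF hG hF' hG'
  obtain ⟨Y, hY, hYs, hYv⟩ := exists_isSystem_orthogonalPres hG' V.isBGAlg.commute
    (fun i j => V.isBGAlg.typed_le _ _ (hv.v_mem i j)) hv.rel_F hv.rel_G
  obtain ⟨φ, hr, hs, hφX⟩ := h.exists_starHom hP hY hYs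
  have hφv : ∀ i j, φ (X₀ .v i j) = v i j := fun i j => by rw [hφX, hYv]
  have hφ : IsBGStarHom V₀.toBGStarData V.toBGStarData φ := by
    refine ⟨fun ha => ?_, hr, hs⟩
    refine h.univ.map_gr hP (f := (φ : A₀ →ₐ[ℂ] A)) V₀.isBGAlg V.isBGAlg h.mem hr hs
      (fun i j => ?_) (fun i j => ?_) ha
    · show φ (X₀ .v i j) ∈ V.gr (g i) (g j)
      rw [hφv]
      exact hv.v_mem i j
    · show φ (X₀ .u i j) ∈ V.gr (g i)⁻¹ (g j)⁻¹
      rw [hφX, hYs, hYv]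
      exact V.star_mem (hv.v_mem i j)
  obtain ⟨ψ, ⟨hψ, hψv⟩, -⟩ := hv.universal A₀ V₀.toBGAlg (X₀ .v) h₀.v_mem h₀.rel_F h₀.rel_Q
  have e1 : (φ : A₀ →ₐ[ℂ] A).comp ψ = AlgHom.id ℂ A :=
    (hv.universal A V.toBGAlg v hv.v_mem hv.rel_F hv.rel_Q).unique
      ⟨⟨fun ha => hφ.map_gr (hψ.map_gr ha), fun b => (congrArg φ (hψ.map_r b)).trans (hφ.map_r b),
        fun b => (congrArg φ (hψ.map_s b)).trans (hφ.map_s b)⟩,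
        fun i j => (congrArg φ (hψv i j)).trans (hφv i j)⟩
      ⟨⟨fun ha => ha, fun _ => rfl, fun _ => rfl⟩, fun _ _ => rfl⟩
  have e2 : ψ.comp (φ : A₀ →ₐ[ℂ] A) = AlgHom.id ℂ A₀ :=
    (h₀.universal A₀ V₀.toBGAlg (X₀ .v) h₀.v_mem h₀.rel_F h₀.rel_Q).unique
      ⟨⟨fun ha => hψ.map_gr (hφ.map_gr ha), fun b => (congrArg ψ (hφ.map_r b)).trans (hψ.map_r b),
        fun b => (congrArg ψ (hφ.map_s b)).trans (hψ.map_s b)⟩,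
        fun i j => (congrArg ψ (hφv i j)).trans (hψv i j)⟩
      ⟨⟨fun ha => ha, fun _ => rfl, fun _ => rfl⟩, fun _ _ => rfl⟩
  refine ⟨_, h.of_equiv hφ ψ (DFunLike.congr_fun e1) (DFunLike.congr_fun e2), ?_⟩
  ext i j
  exact hφv i j

end FreeAlgebras

/-! ### Boundedness of the generators -/

section Orthogonal

open Matrix

variable {B Γ : Type u} [CommCStarAlgebra B] [Group Γ] {α : Γ →* (B ≃⋆ₐ[ℂ] B)} {n : ℕ}
  {g : Fin n → Γ} {F G M N : Matrix (Fin n) (Fin n) B} {A : Type u} [Ring A] [StarRing A]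
  [Algebra ℂ A]

/-- The adjoints of the entries of a conjugated matrix. -/
lemma map_star_conj {r s : B →⋆ₐ[ℂ] A} {v : Matrix (Fin n) (Fin n) A}
    (hc : ∀ b c, Commute (r b) (s c))
    (hv : ∀ i j, v i j ∈ typed α (r : B →ₐ[ℂ] A) (s : B →ₐ[ℂ] A) (g i) (g j))
    {R : Matrix (Fin n) (Fin n) B} (hR : IsSupported g g R) (T : Matrix (Fin n) (Fin n) B) :
    (R.map r * v * T.map s).map star =
      ((twist α g⁻¹ R).map star).map r * v.map star * ((twist α g T).map star).map s := by
  ext i j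
  rw [map_apply, mul_apply, mul_apply, star_sum]
  refine Finset.sum_congr rfl fun l _ => ?_
  rw [mul_apply, mul_apply, Finset.sum_mul, Finset.sum_mul, star_sum]
  refine Finset.sum_congr rfl fun k _ => ?_
  have hk := star_mem_typed (hv k l)
  have h1 : star (v k l) * r (star (R i k)) = r (star (twist α g⁻¹ R i k)) * star (v k l) := by
    rw [hR.inv_inv.twist_apply_right]
    refine (hk.1 (star (R i k))).trans ?_
    show r (α (g k)⁻¹ (star (R i k))) * _ = r (star (α (g k)⁻¹ (R i k))) * _
    rw [map_star (α (g k)⁻¹)]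
  have h2 : s (star (T l j)) * star (v k l) = star (v k l) * s (star (twist α g T l j)) := by
    refine (typed_mul_s hk _).trans ?_
    show star (v k l) * s (α (g l)⁻¹⁻¹ (star (T l j))) = star (v k l) * s (star (α (g l) (T l j)))
    rw [inv_inv, map_star (α (g l))]
  show star (r (R i k) * v k l * s (T l j)) =
    r (star (twist α g⁻¹ R i k)) * star (v k l) * s (star (twist α g T l j))
  rw [star_mul, star_mul, ← map_star s, ← map_star r, h1, ← mul_assoc, (hc _ _).symm.eq, mul_assoc,
    h2, mul_assoc]

/-- If `G⁻¹ F = c M̄ M⊤` with `c ≠ 0`, then `v` is conjugate to the unitary matrix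
`r_n(M⁻¹) v s_n(∇⁻¹ M ∇)`. -/
lemma exists_unitary_conj {r s : B →⋆ₐ[ℂ] A} {v w : Matrix (Fin n) (Fin n) A}
    (hc : ∀ b c, Commute (r b) (s c))
    (hv : ∀ i j, v i j ∈ typed α (r : B →ₐ[ℂ] A) (s : B →ₐ[ℂ] A) (g i) (g j)) (hG : IsUnit G)
    (hG' : IsSupported g g⁻¹ G) (hM : IsUnit M) (hM' : IsSupported g g M) {c : ℂ} (hc0 : c ≠ 0)
    (hF : F = c • (G * (M.map star * Mᵀ))) (h1 : v * w = 1) (h2 : w * v = 1)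
    (h3 : (twist α g F).map r * wᵀ = v * F.map s)
    (h4 : (twist α g G).map r * v.map star = v * G.map s) :
    ∃ (y : Matrix (Fin n) (Fin n) A) (R T : Matrix (Fin n) (Fin n) B), yᴴ * y = 1 ∧
      v = R.map r * y * T.map s := by
  let r₁ : B →ₐ[ℂ] A := r
  let s₁ : B →ₐ[ℂ] A := s
  have hr : ∀ M N : Matrix (Fin n) (Fin n) B, (M * N).map r = M.map r * N.map r :=
    map_algHom_mul r₁
  have hs : ∀ M N : Matrix (Fin n) (Fin n) B, (M * N).map s = M.map s * N.map s :=
    map_algHom_mul s₁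
  have hr1 : (1 : Matrix (Fin n) (Fin n) B).map r = 1 := map_algHom_one r₁
  have hs1 : (1 : Matrix (Fin n) (Fin n) B).map s = 1 := map_algHom_one s₁
  obtain ⟨K, hK, hK'⟩ := isUnit_iff_exists.1 hM
  have hKg : IsSupported g g K := hM'.inverse hK hK'
  obtain ⟨hN, hN'⟩ := hM'.inv_inv.isUnit_twist (α := α) hK hK'
  let N := twist α g⁻¹ M
  let L := twist α g⁻¹ K
  have hbar : ∀ {M N : Matrix (Fin n) (Fin n) B}, M * N = 1 → M.map star * N.map star = 1 :=
    fun {M N} h => by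
      refine (Matrix.map_mul (f := starRingEnd B)).symm.trans ?_
      rw [h]
      exact Matrix.map_one (starRingEnd B) (map_zero _) (map_one _)
  have hNg : IsSupported g g N := hM'.twist _
  have hMN : twist α g N = M := by
    have h5 := twist_inv_twist (α := α) g⁻¹ M
    rwa [_root_.inv_inv] at h5
  let y := K.map r * v * N.map s
  have hy : ∀ i j, y i j ∈ typed α r₁ s₁ (g i) (g j) := conj_mem_typed hc hv hKg hNg
  have hystar : y.map star = (L.map star).map r * v.map star * (M.map star).map s := by
    have h5 := map_star_conj hc hv hKg N
    rw [hMN] at h5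
    exact h5
  have hF' : twist α g F = c • (twist α g G * (N.map star * Nᵀ)) := by
    have h5 : twist α g F = c • twist α g (G * (M.map star * Mᵀ)) := by
      rw [hF]
      ext i j
      exact map_smul (α (g i)) c _
    rw [h5, hG'.twist_mul, (hM'.inv_inv.map_star).twist_mul, ← twist_map_star,
      twist_transpose hM'.inv_inv]
  have hsmul : ∀ (f : B →ₐ[ℂ] A) (T : Matrix (Fin n) (Fin n) B), (c • T).map f = c • T.map f :=
    fun f T => by
      ext i j
      exact map_smul f c _
  have e1 : (N.map star * Nᵀ).map r * wᵀ = v.map star * (M.map star * Mᵀ).map s := by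
    have h5 : c • ((twist α g G).map r * ((N.map star * Nᵀ).map r * wᵀ)) =
        c • ((twist α g G).map r * (v.map star * (M.map star * Mᵀ).map s)) := by
      rw [← mul_assoc, ← mul_assoc, h4, ← hr, mul_assoc, ← hs, ← smul_mul_assoc, ← mul_smul_comm]
      refine (congrArg (· * wᵀ) ((hsmul r₁ _).symm.trans (congrArg (fun T => T.map r) hF'.symm))).trans
        (h3.trans (congrArg (v * ·) ?_))
      exact (congrArg (fun T => T.map s) hF).trans (hsmul s₁ _)
    have h6 := congrArg (c⁻¹ • ·) h5
    rw [inv_smul_smul₀ hc0, inv_smul_smul₀ hc0] at h6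
    exact (isUnit_map r₁ (hG'.isUnit (α := α) hG)).mul_left_cancel h6
  have e2 : Nᵀ.map r * wᵀ = y.map star * Mᵀ.map s := by
    calc Nᵀ.map r * wᵀ = (L.map star).map r * ((N.map star * Nᵀ).map r * wᵀ) := by
          rw [hr, mul_assoc, ← mul_assoc, ← hr, hbar hN', hr1, one_mul]
      _ = y.map star * Mᵀ.map s := by rw [e1, hystar, hs]; simp only [mul_assoc]
  have e3 : w * M.map r = N.map s * yᴴ := by
    have h5 : ((twist α g⁻¹ Mᵀ).map r₁ * wᵀ)ᵀ = wᵀᵀ * Mᵀᵀ.map r₁ :=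
      transpose_r_mul (d := g⁻¹) (fun i j => inv_mem_typed hv h1 h2 j i) hM'.transpose.inv_inv
    have h6 : (y.map star * Mᵀ.map s₁)ᵀ = (twist α g⁻¹ Mᵀ)ᵀ.map s₁ * (y.map star)ᵀ :=
      transpose_mul_s (d := g⁻¹) (fun i j => star_mem_typed (hy i j)) Mᵀ
    rw [twist_transpose hM'.inv_inv] at h5 h6
    exact h5.symm.trans ((congrArg transpose e2).trans h6)
  refine ⟨y, M, L, ?_, ?_⟩
  · refine (isUnit_map s₁ (isUnit_iff_exists.2 ⟨L, hN, hN'⟩)).mul_left_cancel ?_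
    show N.map s * (yᴴ * y) = N.map s * 1
    rw [← mul_assoc, ← e3, mul_one]
    calc w * M.map r * (K.map r * v * N.map s) = w * (M.map r * K.map r) * v * N.map s := by
          simp only [mul_assoc]
      _ = N.map s := by rw [← hr, hK, hr1, mul_one, h2, one_mul]
  · calc v = (M.map r * K.map r) * v * (N.map s * L.map s) := by
          rw [← hr, hK, hr1, one_mul, ← hs, hN, hs1, mul_one]
      _ = M.map r * y * L.map s := by simp only [y, mul_assoc]

lemma IsFreeOrthogonal.mem_boundedSubalgebra [StarModule ℂ A] {V : BGStarAlg α A}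
    {v : Matrix (Fin n) (Fin n) A} (hv : IsFreeOrthogonal α g F G V v) (hF : IsUnit F)
    (hG : IsUnit G) (hG' : IsSupported g g⁻¹ G) (hM : IsUnit M) (hM' : IsSupported g g M) {c : ℂ}
    (h : G⁻¹ * F = c • (M.map star * Mᵀ)) (i j : Fin n) : v i j ∈ boundedSubalgebra A := by
  have h1 : F = c • (G * (M.map star * Mᵀ)) := by
    rw [← Matrix.mul_smul, ← h,
      Matrix.mul_nonsing_inv_cancel_left _ _ ((Matrix.isUnit_iff_isUnit_det G).1 hG)]
  by_cases hc : c = 0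
  · -- if `c = 0`, then `F = 0` is invertible, so that all matrices over `A` vanish
    rw [hc, zero_smul] at h1
    rw [h1, isUnit_zero_iff] at hF
    have h2 := congrArg (fun T => T.map (V.r : B →ₐ[ℂ] A)) hF
    rw [map_algHom_one, Matrix.map_zero _ (map_zero _)] at h2
    rw [← mul_one v, ← h2, mul_zero]
    exact zero_mem _
  · obtain ⟨w, h2, h3, h4⟩ := hv.rel_F
    obtain ⟨y, R, T, hy, hyv⟩ := exists_unitary_conj V.isBGAlg.commute
      (fun i j => V.isBGAlg.typed_le _ _ (hv.v_mem i j)) hG hG' hM hM' hc h1 h2 h3 h4 hv.rel_G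
    rw [hyv]
    exact conj_mem_subalgebra (r := (V.r : B →ₐ[ℂ] A)) (s := (V.s : B →ₐ[ℂ] A)) _
      (map_mem_boundedSubalgebra V.r) (map_mem_boundedSubalgebra V.s)
      (entry_mem_boundedSubalgebra hy) R T i j

end Orthogonal

/-! ### The structure of the free dynamical quantum groups -/

section Main

open Matrix

variable {B Γ : Type u} [CommCStarAlgebra B] [Group Γ] {α : Γ →* (B ≃⋆ₐ[ℂ] B)} {n : ℕ}
  {g : Fin n → Γ} {F G : Matrix (Fin n) (Fin n) B} {A : Type u} [Ring A] [StarRing A]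
  [Algebra ℂ A] [StarModule ℂ A] {V : BGStarAlg α A} {v : Matrix (Fin n) (Fin n) A}

lemma IsPresented.isSystem_env [HasEnvelopingCStar A] {P : MatrixPresentation B Γ n}
    {X : Idx.{u} → Matrix (Fin n) (Fin n) A} (h : IsPresented P V X) :
    IsSystem α P ((envData V).r : B →ₐ[ℂ] CStarEnv A) ((envData V).s : B →ₐ[ℂ] CStarEnv A)
      (fun o => (X o).map (CStarEnv.of (A := A))) ∧
      ∀ i j, CStarEnv.of (X .u i j) = star (CStarEnv.of (X .v i j)) :=
  ⟨h.univ.sys.map ((CStarEnv.of (A := A) : A →⋆ₐ[ℂ] CStarEnv A) : A →ₐ[ℂ] CStarEnv A), fun i j =>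
    (congrArg CStarEnv.of (h.star_v i j).symm).trans (map_star CStarEnv.of _)⟩

theorem IsFreeUnitary.exists_compactHopf (hF : IsUnit F) (hFs : Fᴴ = F) (hF' : IsSupported g g F)
    (hv : IsFreeUnitary α g F V v) :
    ∃ _ : HasEnvelopingCStar A,
      IsUniversalCStar (UnitaryPresentation α g F) (envData V).r (envData V).s
        (v.map CStarEnv.of) ∧
      ∃ H : HopfStarAlgebroid V, IsMatrixCorep H hv.v_mem ∧
        ∃ K : CompactHopf α (envData V), K.Extends H ∧ K.IsCounit (CStarEnv.map H.ε) ∧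
          IsExplicit K (CStarEnv.map H.ε) g (v.map CStarEnv.of) := by
  have hP := unitaryPres_isRegular hF hF'
  obtain ⟨X, h, hX⟩ := hv.exists_isPresented hF hF' hFs
  subst hX
  have hA := h.hasEnvelopingCStar hP (entry_mem_boundedSubalgebra hv.rel.2.1)
  obtain ⟨hsys, hstar⟩ := h.isSystem_env
  refine ⟨hA, h.isUniversalCStar hP ⟨?_, ?_⟩ fun D _ r s v' hv' =>
    hv'.2.exists_isSystem hv'.1.commute fun i j => ⟨hv'.1.mul_r i j, hv'.1.mul_s i j⟩,
    h.exists_compactHopf hP rfl⟩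
  · exact ⟨hsys.commute, fun i j => (hsys.typed .v i j).1, fun i j => (hsys.typed .v i j).2⟩
  · exact hsys.unitaryRel hstar

theorem IsFreeOrthogonal.exists_compactHopf (hF : IsUnit F) (hG : IsUnit G)
    (hF' : IsSupported g g⁻¹ F) (hG' : IsSupported g g⁻¹ G) (hFG : G * Fᴴ = F * Gᴴ)
    (hM : ∃ (c : ℂ) (M : Matrix (Fin n) (Fin n) B), IsUnit M ∧ IsEven α g M ∧
      G⁻¹ * F = c • (M.map star * M.transpose)) (hv : IsFreeOrthogonal α g F G V v) :
    ∃ _ : HasEnvelopingCStar A,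
      IsUniversalCStar (OrthogonalPresentation α g F G) (envData V).r (envData V).s
        (v.map CStarEnv.of) ∧
      ∃ H : HopfStarAlgebroid V, IsMatrixCorep H hv.v_mem ∧
        ∃ K : CompactHopf α (envData V), K.Extends H ∧ K.IsCounit (CStarEnv.map H.ε) ∧
          IsExplicit K (CStarEnv.map H.ε) g (v.map CStarEnv.of) := by
  have hP := orthogonalPres_isRegular (α := α) hF hG hF' hG'
  obtain ⟨X, h, hX⟩ := hv.exists_isPresented hF hG hF' hG' hFG
  subst hX
  obtain ⟨c, M, hMu, hMe, hGF⟩ := hM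
  have hA := h.hasEnvelopingCStar hP
    (hv.mem_boundedSubalgebra hF hG hG' hMu hMe.isSupported hGF)
  obtain ⟨hsys, hstar⟩ := h.isSystem_env
  refine ⟨hA, h.isUniversalCStar hP ⟨?_, ?_, ?_⟩ fun D _ r s v' hv' =>
    exists_isSystem_orthogonalPres hG' hv'.1.commute
      (fun i j => ⟨hv'.1.mul_r i j, hv'.1.mul_s i j⟩) hv'.2.1 hv'.2.2,
    h.exists_compactHopf hP rfl⟩
  · exact ⟨hsys.commute, fun i j => (hsys.typed .v i j).1, fun i j => (hsys.typed .v i j).2⟩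
  · exact hsys.invTransposeRel
  · exact hsys.barRel hstar

end Main

end

theorem mainTheorem10 {B Γ : Type u} [CommCStarAlgebra B] [Group Γ] (α : Γ →* (B ≃⋆ₐ[ℂ] B)) :
    (∀ (A : Type u) [Ring A] [StarRing A] [Algebra ℂ A] [StarModule ℂ A] [HasEnvelopingCStar A]
      (V : BGStarAlg α A) (H : HopfStarAlgebroid V),
      ∃ K : CompactHopf α (envData V), K.Extends H ∧ K.IsCounit (CStarEnv.map H.ε)) ∧
    (∀ (n : ℕ) (g : Fin n → Γ) (F : Matrix (Fin n) (Fin n) B), IsUnit F → F.conjTranspose = F →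
      IsEven α g F →
      (∃ (A : Type u) (_ : Ring A) (_ : StarRing A) (_ : Algebra ℂ A) (_ : StarModule ℂ A)
        (V : BGStarAlg α A) (v : Matrix (Fin n) (Fin n) A), IsFreeUnitary α g F V v) ∧
      ∀ (A : Type u) [Ring A] [StarRing A] [Algebra ℂ A] [StarModule ℂ A] (V : BGStarAlg α A)
        (v : Matrix (Fin n) (Fin n) A) (hv : IsFreeUnitary α g F V v),
        ∃ _ : HasEnvelopingCStar A,
          IsUniversalCStar (UnitaryPresentation α g F) (envData V).r (envData V).s
            (v.map CStarEnv.of) ∧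
          ∃ H : HopfStarAlgebroid V, IsMatrixCorep H hv.v_mem ∧
            ∃ K : CompactHopf α (envData V), K.Extends H ∧ K.IsCounit (CStarEnv.map H.ε) ∧
              IsExplicit K (CStarEnv.map H.ε) g (v.map CStarEnv.of)) ∧
    (∀ (n : ℕ) (g : Fin n → Γ) (F G : Matrix (Fin n) (Fin n) B), IsUnit F → IsUnit G →
      IsOdd α g F → IsOdd α g G → G * F.conjTranspose = F * G.conjTranspose →
      (∃ (c : ℂ) (M : Matrix (Fin n) (Fin n) B), IsUnit M ∧ IsEven α g M ∧
        G⁻¹ * F = c • (M.map star * M.transpose)) →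
      (∃ (A : Type u) (_ : Ring A) (_ : StarRing A) (_ : Algebra ℂ A) (_ : StarModule ℂ A)
        (V : BGStarAlg α A) (v : Matrix (Fin n) (Fin n) A), IsFreeOrthogonal α g F G V v) ∧
      ∀ (A : Type u) [Ring A] [StarRing A] [Algebra ℂ A] [StarModule ℂ A] (V : BGStarAlg α A)
        (v : Matrix (Fin n) (Fin n) A) (hv : IsFreeOrthogonal α g F G V v),
        ∃ _ : HasEnvelopingCStar A,
          IsUniversalCStar (OrthogonalPresentation α g F G) (envData V).r (envData V).s
            (v.map CStarEnv.of) ∧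
          ∃ H : HopfStarAlgebroid V, IsMatrixCorep H hv.v_mem ∧
            ∃ K : CompactHopf α (envData V), K.Extends H ∧ K.IsCounit (CStarEnv.map H.ε) ∧
              IsExplicit K (CStarEnv.map H.ε) g (v.map CStarEnv.of)) := by
  refine ⟨fun A _ _ _ _ _ V H => H.exists_compactHopf, fun n g F hF hFs hFe => ⟨?_, ?_⟩,
    fun n g F G hF hG hFo hGo hFG hM => ⟨?_, ?_⟩⟩
  · obtain ⟨A, _, _, _, _, V, X, h⟩ := exists_isPresented (unitaryPres_isRegular hF hFe.isSupported)
      rfl (exists_conj_unitary (α := α) hF hFe.isSupported hFs)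
    exact ⟨A, _, _, _, inferInstance, V, X .v, h.isFreeUnitary hF hFe.isSupported⟩
  · exact fun A _ _ _ _ V v hv => hv.exists_compactHopf hF hFs hFe.isSupported
  · obtain ⟨A, _, _, _, _, V, X, h⟩ := exists_isPresented
      (orthogonalPres_isRegular hF hG hFo.isSupported hGo.isSupported) rfl
      (exists_conj_orthogonal (α := α) hF hG hFo.isSupported hGo.isSupported hFG)
    exact ⟨A, _, _, _, inferInstance, V, X .v,
      h.isFreeOrthogonal hF hG hFo.isSupported hGo.isSupported⟩
  · exact fun A _ _ _ _ V v hv =>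
      hv.exists_compactHopf hF hG hFo.isSupported hGo.isSupported hFG hM
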